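/- Graphs are finite, simple and undirected, and the spectrum of a graph is the multiset of eigenvalues of its adjacency matrix (with multiplicities). Let $\mathcal H'$ be the set of graphs without isolated vertices for which all but at most two adjacency eigenvalues (counted with multiplicity) are equal to $-2$ or $0$. Let $CP(k)=K_{2,\ldots,2}$ ($k$ classes) be the cocktail party graph with adjacency matrix $C(k)$, let $G+G'$ denote disjoint union, let $J$ and $O$ denote all-ones and all-zeros matrices, $I_m$ the identity matrix of order $m$, and $\mathbf 1$ an all-ones column vector. Define the following graphs, some by their adjacency matrices: - $G_0(\ell,m)=K_{\ell,m}$ ($\ell\ge m\ge 1$); $G_3=2K_{1,4}$; $G_4(k)=K_{1,4}+CP(k)$ ($k\geq 2$); $G_5(k,\ell)=CP(k)+CP(\ell)$ ($k\ge\ell\ge2$); - $G_6(m)=\begin{bmatrix}J-I_m&I_m\\ I_m&J-I_m\end{bmatrix}$ ($m\ge3$); - $G_8(k,\ell)=\begin{bmatrix}C(k)&O&\mathbf 1\\ O&C(\ell)&\mathbf 1\\ \mathbf 1^\top&\mathbf 1^\top&0\end{bmatrix}$ ($k\ge\ell\ge1$, $k\ge2$); - $G_9(k)=\begin{bmatrix}O&O&J&J\\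 O&J-I_3&J-I_3&O\\ J&J-I_3&J-I_3&J\\ J&O&J&C(k)\end{bmatrix}$ ($k\ge0$), with blocks of sizes $2,3,3,2k$; - $G_{11}=\begin{bmatrix}0&0&0&0&0&1&1&0&0\\0&0&0&0&0&1&1&0&0\\0&0&0&0&0&0&0&1&1\\0&0&0&0&0&0&0&1&1\\0&0&0&0&0&1&1&1&1\\1&1&0&0&1&0&1&0&1\\1&1&0&0&1&1&0&1&0\\0&0&1&1&1&0&1&0&1\\0&0&1&1&1&1&0&1&0\end{bmatrix}$, $\quad G_{12}=\begin{bmatrix}0&0&0&0&0&0&1&0\\0&0&0&0&0&0&1&0\\0&0&0&0&0&0&0&1\\0&0&0&0&0&0&0&1\\0&0&0&0&0&0&1&1\\0&0&0&0&0&0&1&1\\1&1&0&0&1&1&0&1\\0&0&1&1&1&1&1&0\end{bmatrix}$. **Theorem.** Two nonisomorphic graphs $G,G'\in\mathcal H'$ have equal nonzero parts of the spectrum (as multisets) if and only if, up to isomorphism, one of the following holds: - $G=G_0(\ell,m)$ and $G'=G_0(\ell',m')$, where $\ell\ge m\ge 1$, $\ell'\ge m'\ge 1$ and $\ell m=\ell'm'$;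 - $G,G'\in\{G_4(k),\,G_5(k,2)\}$ for some $k\ge2$; - $G,G'\in\{G_5(k+1,k),\,G_6(2k),\,G_8(k,k)\}$ for some $k\ge2$; - $G,G'\in\{G_6(3),\,G_{12}\}$; - $G,G'\in\{G_4(4),\,G_5(4,2),\,G_9(1)\}$; - $G,G'\in\{G_4(3),\,G_5(3,2),\,G_6(4),\,G_8(2,2),\,G_{11}\}$; - $G,G'\in\{G_3,\,G_4(2),\,G_5(2,2)\}$. -/

import Mathlib

/-- The adjacency spectrum of a finite simple graph: the multiset of the (real) eigenvalues of its
adjacency matrix, i.e. of the roots of the characteristic polynomial with multiplicity. -/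
noncomputable def adjSpectrum {V : Type*} [Fintype V] [DecidableEq V]
    (G : SimpleGraph V) [DecidableRel G.Adj] : Multiset ℝ :=
  (G.adjMatrix ℝ).charpoly.roots

/-- The nonzero part of the adjacency spectrum, with multiplicities. -/
noncomputable def nonzeroSpectrum {V : Type*} [Fintype V] [DecidableEq V]
    (G : SimpleGraph V) [DecidableRel G.Adj] : Multiset ℝ :=
  (adjSpectrum G).filter (fun x => x ≠ 0)

/-- The class `𝓗`: all but at most two eigenvalues (counted with multiplicity) of the adjacency
matrix are equal to `-2` or `0`. -/
def IsInH {V : Type*} [Fintype V] [DecidableEq V]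
    (G : SimpleGraph V) [DecidableRel G.Adj] : Prop :=
  ((adjSpectrum G).filter (fun x => x ≠ -2 ∧ x ≠ 0)).card ≤ 2

/-- The class `𝓗'`: the graphs in `𝓗` without isolated vertices. -/
def IsInH' {V : Type*} [Fintype V] [DecidableEq V]
    (G : SimpleGraph V) [DecidableRel G.Adj] : Prop :=
  IsInH G ∧ ∀ v, ¬ G.IsIsolated v

/-- `G` and `H` are isomorphic graphs. -/
def IsIsoTo {V W : Type*} (G : SimpleGraph V) (H : SimpleGraph W) : Prop :=
  Nonempty (G ≃g H)

/-- `G₀(ℓ, m)` is the complete bipartite graph `K_{ℓ,m}`. -/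
def graph0 (l m : ℕ) : SimpleGraph (Fin l ⊕ Fin m) :=
  completeBipartiteGraph (Fin l) (Fin m)

/-- The cocktail party graph `CP(k) = K_{2,…,2}` with `k` classes. -/
def cocktailParty (k : ℕ) : SimpleGraph (Fin k × Fin 2) :=
  SimpleGraph.completeEquipartiteGraph k 2

/-- `G₃ = 2 K_{1,4}`. -/
def graph3 : SimpleGraph ((Fin 1 ⊕ Fin 4) ⊕ (Fin 1 ⊕ Fin 4)) :=
  SimpleGraph.sum (graph0 1 4) (graph0 1 4)

/-- `G₄(k) = K_{1,4} + CP(k)`. -/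
def graph4 (k : ℕ) : SimpleGraph ((Fin 1 ⊕ Fin 4) ⊕ (Fin k × Fin 2)) :=
  SimpleGraph.sum (graph0 1 4) (cocktailParty k)

/-- `G₅(k, ℓ) = CP(k) + CP(ℓ)`. -/
def graph5 (k l : ℕ) : SimpleGraph ((Fin k × Fin 2) ⊕ (Fin l × Fin 2)) :=
  SimpleGraph.sum (cocktailParty k) (cocktailParty l)

/-- `G₆(m)`, with adjacency matrix `[J - I, I; I, J - I]` (blocks of order `m`): the first
component of a vertex is its block, the second its position in the block. -/
def graph6 (m : ℕ) : SimpleGraph (Fin 2 × Fin m) where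
  Adj x y := (x.1 = y.1 ∧ x.2 ≠ y.2) ∨ (x.1 ≠ y.1 ∧ x.2 = y.2)
  symm := ⟨fun x y h => by
    rcases h with ⟨h1, h2⟩ | ⟨h1, h2⟩
    · exact Or.inl ⟨h1.symm, h2.symm⟩
    · exact Or.inr ⟨h1.symm, h2.symm⟩⟩
  loopless := ⟨fun x h => by
    rcases h with ⟨_, h2⟩ | ⟨h1, _⟩
    · exact h2 rfl
    · exact h1 rfl⟩

/-- `G₈(k, ℓ)`: the disjoint union `CP(k) + CP(ℓ)` together with one further vertex that is
adjacent to all other vertices. -/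
def graph8 (k l : ℕ) : SimpleGraph (((Fin k × Fin 2) ⊕ (Fin l × Fin 2)) ⊕ Fin 1) :=
  SimpleGraph.sum (graph5 k l) (⊥ : SimpleGraph (Fin 1)) ⊔ completeBipartiteGraph _ (Fin 1)

/-- The vertices of `G₉(k)`, in four blocks of sizes `2`, `3`, `3`, `2k`. -/
inductive Vert9 (k : ℕ) : Type
  | a (i : Fin 2)
  | b (i : Fin 3)
  | c (i : Fin 3)
  | d (i : Fin k × Fin 2)

/-- The adjacency relation of `G₉(k)`, given by the block matrix
`[O, O, J, J; O, J - I, J - I, O; J, J - I, J - I, J; J, O, J, C(k)]`, where `C(k)` is the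
adjacency matrix of `CP(k)`. -/
def adj9 (k : ℕ) : Vert9 k → Vert9 k → Prop
  | .a _, .a _ => False
  | .a _, .b _ => False
  | .a _, .c _ => True
  | .a _, .d _ => True
  | .b _, .a _ => False
  | .b i, .b j => i ≠ j
  | .b i, .c j => i ≠ j
  | .b _, .d _ => False
  | .c _, .a _ => True
  | .c i, .b j => i ≠ j
  | .c i, .c j => i ≠ j
  | .c _, .d _ => True
  | .d _, .a _ => True
  | .d _, .b _ => False
  | .d _, .c _ => True
  | .d i, .d j => (cocktailParty k).Adj i j

/-- The graph `G₉(k)`. -/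
def graph9 (k : ℕ) : SimpleGraph (Vert9 k) where
  Adj := adj9 k
  symm := ⟨fun x y h => by
    cases x <;> cases y <;> first
      | exact h
      | exact Ne.symm h⟩
  loopless := ⟨fun x h => by
    cases x <;> first
      | exact h
      | exact h rfl⟩

/-- The adjacency matrix of `G₁₁`. -/
def matrix11 : Matrix (Fin 9) (Fin 9) ℕ :=
  !![0, 0, 0, 0, 0, 1, 1, 0, 0;
     0, 0, 0, 0, 0, 1, 1, 0, 0;
     0, 0, 0, 0, 0, 0, 0, 1, 1;
     0, 0, 0, 0, 0, 0, 0, 1, 1;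
     0, 0, 0, 0, 0, 1, 1, 1, 1;
     1, 1, 0, 0, 1, 0, 1, 0, 1;
     1, 1, 0, 0, 1, 1, 0, 1, 0;
     0, 0, 1, 1, 1, 0, 1, 0, 1;
     0, 0, 1, 1, 1, 1, 0, 1, 0]

/-- The graph `G₁₁`. -/
def graph11 : SimpleGraph (Fin 9) where
  Adj i j := matrix11 i j = 1
  symm := ⟨fun i j h => by
    have hs : matrix11.transpose = matrix11 := by decide
    rw [← hs]
    exact h⟩
  loopless := ⟨fun i h => by
    have hd : ∀ i, matrix11 i i = 0 := by decide
    rw [hd i] at h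
    exact absurd h (by norm_num)⟩

/-- The adjacency matrix of `G₁₂`. -/
def matrix12 : Matrix (Fin 8) (Fin 8) ℕ :=
  !![0, 0, 0, 0, 0, 0, 1, 0;
     0, 0, 0, 0, 0, 0, 1, 0;
     0, 0, 0, 0, 0, 0, 0, 1;
     0, 0, 0, 0, 0, 0, 0, 1;
     0, 0, 0, 0, 0, 0, 1, 1;
     0, 0, 0, 0, 0, 0, 1, 1;
     1, 1, 0, 0, 1, 1, 0, 1;
     0, 0, 1, 1, 1, 1, 1, 0]

/-- The graph `G₁₂`. -/
def graph12 : SimpleGraph (Fin 8) where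
  Adj i j := matrix12 i j = 1
  symm := ⟨fun i j h => by
    have hs : matrix12.transpose = matrix12 := by decide
    rw [← hs]
    exact h⟩
  loopless := ⟨fun i h => by
    have hd : ∀ i, matrix12 i i = 0 := by decide
    rw [hd i] at h
    exact absurd h (by norm_num)⟩

/-! Let `A` be the adjacency matrix. The polynomial `t² + 2t` vanishes at `0` and `-2`, so `A² + 2A`
has rank at most two: only the exceptional eigenvalues, those different from `-2` and `0`,
contribute to it. Since `A` has trace zero, the sum of the exceptional eigenvalues is twice the
multiplicity of `-2`. Hence they determine the nonzero spectrum (`nonzeroSpectrum_eq_iff`), and they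
are themselves determined by their sum and product (`IsInH.exceptional_eq_iff`). The theorem
therefore amounts to a classification of `𝓗'` followed by a comparison of pairs of numbers.

Suppose that some exceptional eigenvalue is negative. Trace zero forces the other one to be
positive, so `A` has exactly one positive eigenvalue, and a graph of this kind without isolated
vertices is complete multipartite (`adj_or_of_bound`). The vanishing of the 3×3 minors of `A² + 2A`
then leaves complete bipartite graphs, joins of a coclique with a cocktail party graph, and
`K_{1,1,3}` (`IsMultipartite.classification`).

Otherwise `A + 2I` and `A² + 2A` are positive semidefinite, and `A² + 2A` is the Gram matrix of
vectors in the plane. As `A² + 2A + I = (A + I)²`, inner products count the common elements of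
closed neighbourhoods, and squared lengths are degrees (`IsGram`). Two principles carry the
classification `IsGram.classification`. The symmetric difference of two closed neighbourhoods has
two elements more than the squared distance of the vectors, so that vertices with equal vectors
differ by a swap of one vertex for another with an equal vector (`IsGram.exists_swap`). A null
vector of `A + 2I` on a small induced subgraph, such as a four-cycle or `K_{1,4}`, is a null vector
globally and restricts all other vertices (`IsGram.null_vector`).

Vectors on a single line come from `K_{1,4}` or a cocktail party graph, and a disconnected graph
consists of two such pieces on orthogonal lines. In the remaining connected graphs parallel vectors
are equal. If two closed neighbourhoods are disjoint, their vertices give an orthogonal basis in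
which all coordinates are counts, and divisibility leaves finitely many graphs
(`IsOpposite.classification`). If any two closed neighbourhoods meet, all angles are acute and the
vectors are ordered by direction; a vertex strictly between two others is adjacent to one of them.
Nonadjacent vertices with equal vectors then lead to `G₈` and `G₉` (`IsTwin.classification`), and
without them the graph is covered by two cliques (`IsTwoClique.classification`), which leads to
`G₆`. Three sporadic graphs of the shape `kappaTail` appear along the way.

All these graphs are blow-ups of small patterns, so their exceptional eigenvalues come from a small
quotient matrix. When there are two positive ones they are `M ± √N` with `N = d² + r` and `r ≤ 3`;
such representations rarely coincide, which yields the finite list of coincidences and families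
(`HasEntry.isIsoTo_or`). -/

set_option linter.unusedSectionVars false
set_option linter.unusedDecidableInType false
open Finset

/-! ### Plane vectors attached to vertices, and the swap principle -/

section GramGraphs

open scoped Classical

variable {V : Type*} [Fintype V]

/-- The closed neighbourhood of a vertex. -/
noncomputable def closedNbhd (G : SimpleGraph V) (v : V) : Finset V :=
  univ.filter fun w => w = v ∨ G.Adj v w

/-- The entries of `A + I`, where `A` is the adjacency matrix. -/
noncomputable def closedInd (G : SimpleGraph V) (v w : V) : ℝ :=
  if w ∈ closedNbhd G v then 1 else 0

/-- The vectors `(x v, y v)` of the plane have Gram matrix `A² + 2A`, and `A + 2I` is positive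
semidefinite, where `A` is the adjacency matrix of `G`. -/
structure IsGram (G : SimpleGraph V) (x y : V → ℝ) : Prop where
  self : ∀ v, x v * x v + y v * y v + 1 = (closedNbhd G v).card
  inter : ∀ v w, v ≠ w → x v * x w + y v * y w = (closedNbhd G v ∩ closedNbhd G w).card
  psd : ∀ f : V → ℝ, 0 ≤ ∑ v, f v * (f v + ∑ w, closedInd G v w * f w)

/-- Two vertices are represented by the same vector. -/
def SameVec (x y : V → ℝ) (v w : V) : Prop := x v = x w ∧ y v = y w

variable {G : SimpleGraph V} {x y : V → ℝ}

lemma SameVec.symm {v w : V} (h : SameVec x y v w) : SameVec x y w v := ⟨h.1.symm, h.2.symm⟩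

lemma SameVec.trans {u v w : V} (h : SameVec x y u v) (h' : SameVec x y v w) :
    SameVec x y u w := ⟨h.1.trans h'.1, h.2.trans h'.2⟩

@[simp] lemma mem_closedNbhd {v w : V} : w ∈ closedNbhd G v ↔ w = v ∨ G.Adj v w := by
  simp [closedNbhd]

lemma self_mem_closedNbhd (v : V) : v ∈ closedNbhd G v := by simp

lemma mem_closedNbhd_comm {v w : V} : w ∈ closedNbhd G v ↔ v ∈ closedNbhd G w := by
  simp [G.adj_comm v w, eq_comm]

lemma closedInd_comm (v w : V) : closedInd G v w = closedInd G w v := by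
  unfold closedInd; simp only [mem_closedNbhd_comm (v := v) (w := w)]

lemma closedInd_self (v : V) : closedInd G v v = 1 := by simp [closedInd]

lemma closedInd_of_adj {v w : V} (h : G.Adj v w) : closedInd G v w = 1 := by simp [closedInd, h]

lemma closedInd_of_not_adj {v w : V} (hvw : v ≠ w) (h : ¬ G.Adj v w) : closedInd G v w = 0 := by
  simp [closedInd, h, hvw.symm]

lemma sum_closedInd_mul (v w : V) :
    ∑ z, closedInd G v z * closedInd G w z = (closedNbhd G v ∩ closedNbhd G w).card := by
  simp only [closedInd, ← ite_and, mul_ite, mul_one, mul_zero]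
  rw [sum_boole]
  congr 2
  ext z
  simp [and_comm]

namespace IsGram

lemma sum_closedInd_mul (h : IsGram G x y) (v w : V) :
    ∑ z, closedInd G v z * closedInd G w z
      = x v * x w + y v * y w + if v = w then 1 else 0 := by
  rw [_root_.sum_closedInd_mul]
  split_ifs with hvw
  · subst hvw
    rw [inter_self, h.self]
  · rw [h.inter v w hvw, add_zero]

/-- Expand the squared distance: each squared length is one less than the size of the closed
neighbourhood, which accounts for the summand `2`. Closeness of vectors thus measures closeness of
closed neighbourhoods. -/
lemma card_sdiff_add (h : IsGram G x y) {v w : V} (hvw : v ≠ w) :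
    ((closedNbhd G v \ closedNbhd G w).card + (closedNbhd G w \ closedNbhd G v).card : ℝ)
      = 2 + ((x v - x w) ^ 2 + (y v - y w) ^ 2) := by
  have h1 := card_sdiff_add_card_inter (closedNbhd G v) (closedNbhd G w)
  have h2 := card_sdiff_add_card_inter (closedNbhd G w) (closedNbhd G v)
  rw [inter_comm] at h2
  have h3 := h.inter v w hvw
  have h4 := h.self v
  have h5 := h.self w
  rw [← h1] at h4
  rw [← h2] at h5
  push_cast at h4 h5
  nlinarith

lemma card_closedNbhd_eq_of_same (h : IsGram G x y) {v w : V} (hs : SameVec x y v w) :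
    (closedNbhd G v).card = (closedNbhd G w).card := by
  have h1 := h.self v
  rw [hs.1, hs.2, h.self w] at h1
  exact_mod_cast h1.symm

/-- Vertices with close closed neighbourhoods are represented by the same vector. -/
lemma same_of_card_le (h : IsGram G x y) {v w : V}
    (hc : (closedNbhd G v \ closedNbhd G w).card + (closedNbhd G w \ closedNbhd G v).card ≤ 2) :
    SameVec x y v w := by
  by_cases hvw : v = w
  · subst hvw; exact ⟨rfl, rfl⟩
  have h1 := h.card_sdiff_add hvw
  have h2 : ((closedNbhd G v \ closedNbhd G w).card
      + (closedNbhd G w \ closedNbhd G v).card : ℝ) ≤ 2 := by exact_mod_cast hc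
  have h3 : (x v - x w) ^ 2 = 0 := by nlinarith [sq_nonneg (x v - x w), sq_nonneg (y v - y w)]
  have h4 : (y v - y w) ^ 2 = 0 := by nlinarith [sq_nonneg (x v - x w), sq_nonneg (y v - y w)]
  exact ⟨by nlinarith [pow_eq_zero_iff (two_ne_zero) |>.1 h3],
    by nlinarith [pow_eq_zero_iff (two_ne_zero) |>.1 h4]⟩

lemma two_le_card_sdiff_add (h : IsGram G x y) {v w : V} (hvw : v ≠ w) :
    2 ≤ (closedNbhd G v \ closedNbhd G w).card + (closedNbhd G w \ closedNbhd G v).card := by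
  have h1 := h.card_sdiff_add hvw
  have : (2 : ℝ) ≤ ((closedNbhd G v \ closedNbhd G w).card
      + (closedNbhd G w \ closedNbhd G v).card : ℕ) := by
    push_cast
    nlinarith [sq_nonneg (x v - x w), sq_nonneg (y v - y w)]
  exact_mod_cast this

lemma closedNbhd_injective (h : IsGram G x y) : Function.Injective (closedNbhd G) := by
  intro v w hvw
  by_contra hne
  have := h.two_le_card_sdiff_add hne
  simp [hvw] at this

lemma three_le_card_sdiff_add (h : IsGram G x y) {v w : V} (hvw : ¬ SameVec x y v w) :
    3 ≤ (closedNbhd G v \ closedNbhd G w).card + (closedNbhd G w \ closedNbhd G v).card := by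
  by_contra hc
  exact hvw (h.same_of_card_le (by omega))

/-- The Gram matrix is `(A + I)² - I`, which commutes with `A + I`. -/
lemma sum_closedInd_ip (h : IsGram G x y) (v k : V) :
    ∑ z, closedInd G v z * (x z * x k + y z * y k)
      = ∑ z, closedInd G k z * (x v * x z + y v * y z) := by
  have e1 : ∀ z, x z * x k + y z * y k
      = ∑ m, closedInd G z m * closedInd G k m - if z = k then 1 else 0 := fun z => by
    rw [h.sum_closedInd_mul]; ring
  have e2 : ∀ z, x v * x z + y v * y z
      = ∑ m, closedInd G v m * closedInd G z m - if v = z then 1 else 0 := fun z => by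
    rw [h.sum_closedInd_mul]; ring
  simp_rw [e1, e2, mul_sub, sum_sub_distrib, mul_sum]
  congr 1
  · rw [sum_comm]
    refine sum_congr rfl fun m _ => sum_congr rfl fun z _ => ?_
    rw [closedInd_comm z m]; ring
  · simp [closedInd_comm v k]

/-- Equal vectors have equal neighbourhood sums. -/
lemma sum_closedInd_eq_of_same (h : IsGram G x y) {v w : V} (hs : SameVec x y v w) :
    ∑ z, (closedInd G v z - closedInd G w z) * x z = 0 ∧
      ∑ z, (closedInd G v z - closedInd G w z) * y z = 0 := by
  set X := ∑ z, (closedInd G v z - closedInd G w z) * x z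
  set Y := ∑ z, (closedInd G v z - closedInd G w z) * y z
  -- By the commutation of `A + I` with the Gram matrix, the vector `(X, Y)` is orthogonal to all
  -- vertex vectors.
  have key : ∀ k, X * x k + Y * y k = 0 := by
    intro k
    have h1 := h.sum_closedInd_ip v k
    have h2 := h.sum_closedInd_ip w k
    rw [hs.1, hs.2, ← h2] at h1
    rw [← sub_eq_zero, ← sum_sub_distrib] at h1
    rw [← h1, Finset.sum_mul, Finset.sum_mul, ← sum_add_distrib]
    exact sum_congr rfl fun z _ => by ring
  -- Being a combination of vertex vectors, `(X, Y)` is also orthogonal to itself.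
  have hXY : X * X + Y * Y = 0 := by
    calc X * X + Y * Y
        = ∑ z, (closedInd G v z - closedInd G w z) * (X * x z + Y * y z) := by
          conv_lhs => rw [show X * X = X * ∑ z, (closedInd G v z - closedInd G w z) * x z from rfl,
            show Y * Y = Y * ∑ z, (closedInd G v z - closedInd G w z) * y z from rfl]
          rw [mul_sum, mul_sum, ← sum_add_distrib]
          exact sum_congr rfl fun z _ => by ring
      _ = 0 := by simp [key]
  constructor <;> nlinarith [mul_self_nonneg X, mul_self_nonneg Y]

/-- The closed neighbourhoods of two vertices with the same vector differ by exchanging two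
vertices with the same vector. -/
lemma exists_swap (h : IsGram G x y) {v w : V} (hvw : v ≠ w) (hs : SameVec x y v w) :
    ∃ a b, closedNbhd G v \ closedNbhd G w = {a} ∧ closedNbhd G w \ closedNbhd G v = {b} ∧
      SameVec x y a b := by
  have h1 := h.card_sdiff_add hvw
  have h2 : (closedNbhd G v \ closedNbhd G w).card = (closedNbhd G w \ closedNbhd G v).card := by
    have e1 := card_sdiff_add_card_inter (closedNbhd G v) (closedNbhd G w)
    have e2 := card_sdiff_add_card_inter (closedNbhd G w) (closedNbhd G v)
    have e3 := h.card_closedNbhd_eq_of_same hs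
    rw [inter_comm] at e2
    omega
  -- The distance is zero, so the symmetric difference has exactly two elements; they are evenly
  -- split because the two neighbourhoods have the same size.
  have h3 : (closedNbhd G w \ closedNbhd G v).card = 1 := by
    rw [h2, hs.1, hs.2] at h1
    have : ((closedNbhd G w \ closedNbhd G v).card : ℝ) = 1 := by linarith
    exact_mod_cast this
  obtain ⟨b, hb⟩ := card_eq_one.1 h3
  obtain ⟨a, ha⟩ := card_eq_one.1 (h2.trans h3)
  refine ⟨a, b, ha, hb, ?_⟩
  have ha' : a ∈ closedNbhd G v \ closedNbhd G w := by simp [ha]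
  have hb' : b ∈ closedNbhd G w \ closedNbhd G v := by simp [hb]
  rw [mem_sdiff] at ha' hb'
  have hab : a ≠ b := by rintro rfl; exact ha'.2 hb'.1
  -- The two rows of `A + I` differ only at `a` and `b`, so equality of the neighbourhood sums reads
  -- as equality of the vectors of `a` and `b`.
  have ind : ∀ z, closedInd G v z - closedInd G w z
      = (if z = a then 1 else 0) - (if z = b then 1 else 0) := by
    intro z
    have e1 : z ∈ closedNbhd G v \ closedNbhd G w ↔ z = a := by simp [ha]
    have e2 : z ∈ closedNbhd G w \ closedNbhd G v ↔ z = b := by simp [hb]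
    rw [mem_sdiff] at e1 e2
    unfold closedInd
    by_cases hv : z ∈ closedNbhd G v <;> by_cases hw : z ∈ closedNbhd G w <;>
      simp_all
  obtain ⟨hX, hY⟩ := h.sum_closedInd_eq_of_same hs
  simp_rw [ind, sub_mul, sum_sub_distrib] at hX hY
  simp at hX hY
  exact ⟨by linarith, by linarith⟩

/-- Nonadjacent vertices with the same vector are twins. -/
lemma adj_iff_of_twin (h : IsGram G x y) {v w : V} (hvw : v ≠ w) (hs : SameVec x y v w)
    (hn : ¬ G.Adj v w) (z : V) : G.Adj v z ↔ G.Adj w z := by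
  obtain ⟨a, b, ha, hb, -⟩ := h.exists_swap hvw hs
  -- By nonadjacency the exchanged vertices are `v` and `w` themselves, so nothing else
  -- distinguishes their neighbourhoods.
  have hv : v ∈ closedNbhd G v \ closedNbhd G w := by
    simp [hvw, G.adj_comm w v, hn]
  have hw : w ∈ closedNbhd G w \ closedNbhd G v := by
    simp [hvw.symm, hn]
  have e1 : z ∈ closedNbhd G v \ closedNbhd G w ↔ z = v := by
    rw [ha, mem_singleton] at hv; rw [ha, mem_singleton, hv]
  have e2 : z ∈ closedNbhd G w \ closedNbhd G v ↔ z = w := by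
    rw [hb, mem_singleton] at hw; rw [hb, mem_singleton, hw]
  simp only [mem_sdiff, mem_closedNbhd, not_or] at e1 e2
  constructor
  · intro hvz
    by_contra hwz
    have hz : z ≠ w := by rintro rfl; exact hn hvz
    exact hvz.ne (e1.1 ⟨Or.inr hvz, hz, hwz⟩).symm
  · intro hwz
    by_contra hvz
    have hz : z ≠ v := by rintro rfl; exact hn hwz.symm
    exact hwz.ne (e2.1 ⟨Or.inr hwz, hz, hvz⟩).symm

/-- The vector `e_j - α e_i - β e_k` is annihilated by the Gram matrix, so `(A + I)²`, which is that
matrix plus `I`, takes on it the value of its squared length. -/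
lemma sum_sq_three (h : IsGram G x y) {i j k : V} (hij : i ≠ j) (hjk : j ≠ k) (hik : i ≠ k)
    (α β : ℝ) (hx : x j = α * x i + β * x k) (hy : y j = α * y i + β * y k) :
    ∑ z, (closedInd G j z - α * closedInd G i z - β * closedInd G k z) ^ 2
      = 1 + α ^ 2 + β ^ 2 := by
  have e : ∀ z, (closedInd G j z - α * closedInd G i z - β * closedInd G k z) ^ 2
      = closedInd G j z * closedInd G j z + α ^ 2 * (closedInd G i z * closedInd G i z)
        + β ^ 2 * (closedInd G k z * closedInd G k z)
        - 2 * α * (closedInd G j z * closedInd G i z)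
        - 2 * β * (closedInd G j z * closedInd G k z)
        + 2 * α * β * (closedInd G i z * closedInd G k z) := fun z => by ring
  simp_rw [e, sum_add_distrib, sum_sub_distrib, sum_add_distrib, ← mul_sum, h.sum_closedInd_mul]
  simp only [if_true, hij.symm, hjk, hik, if_false]
  rw [hx, hy]
  ring

/-- A null vector of the positive semidefinite form of `A + 2I` lies in its kernel. -/
lemma null_vector (h : IsGram G x y) (f : V → ℝ)
    (hf : ∑ v, f v * (f v + ∑ w, closedInd G v w * f w) ≤ 0) (v : V) :
    f v + ∑ w, closedInd G v w * f w = 0 := by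
  set L : V → ℝ := fun v => f v + ∑ w, closedInd G v w * f w with hL
  -- The form at `f - τ e_v` is at most `-2τ L v + 2τ²`, as the form of `A + 2I` at `e_v` is `2`.
  -- This choice of `τ` minimises the bound, which becomes `-(L v)² / 2`.
  set τ := L v / 2 with hτ
  have h1 := h.psd (fun z => f z - τ * if z = v then 1 else 0)
  have h2 : ∀ z, (f z - τ * if z = v then 1 else 0)
      + ∑ w, closedInd G z w * (f w - τ * if w = v then 1 else 0)
      = L z - τ * ((if z = v then 1 else 0) + closedInd G z v) := by
    intro z
    simp only [mul_sub, sum_sub_distrib, hL]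
    have : ∑ w, closedInd G z w * (τ * if w = v then 1 else 0) = τ * closedInd G z v := by
      simp [mul_comm]
    rw [this]; ring
  simp_rw [h2] at h1
  have h3 : ∑ z, (f z - τ * if z = v then 1 else 0)
        * (L z - τ * ((if z = v then 1 else 0) + closedInd G z v))
      = ∑ z, f z * L z - 2 * τ * L v + 2 * τ ^ 2 := by
    have e : ∀ z, (f z - τ * if z = v then 1 else 0)
        * (L z - τ * ((if z = v then 1 else 0) + closedInd G z v))
        = f z * L z - τ * (if z = v then L z + f z - τ * (1 + closedInd G z v) else 0)
          - τ * (closedInd G v z * f z) := by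
      intro z
      rw [closedInd_comm v z]
      split_ifs <;> ring
    simp_rw [e, sum_sub_distrib, ← mul_sum]
    simp only [sum_ite_eq', mem_univ, if_true, closedInd_self]
    have : ∑ w, closedInd G v w * f w = L v - f v := by simp [hL]
    rw [this]; ring
  rw [h3] at h1
  have h4 : L v ^ 2 ≤ 0 := by rw [hτ] at h1; nlinarith
  exact pow_eq_zero_iff (two_ne_zero) |>.1 (le_antisymm h4 (sq_nonneg _))

end IsGram

end GramGraphs

/-! ### Null vectors of small subgraphs, parallel vectors and intermediate vectors -/

section GramGraphs2
open scoped Classical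
variable {V : Type*} [Fintype V] {G : SimpleGraph V} {x y : V → ℝ}

/-- In the plane, the coordinates with respect to two orthogonal vectors determine the inner
product. -/
lemma plane_parseval {a b c d e f g h : ℝ} (ho : a * c + b * d = 0) (h0 : a * a + b * b ≠ 0) :
    (c * c + d * d) * (e * a + f * b) * (g * a + h * b)
      + (a * a + b * b) * (e * c + f * d) * (g * c + h * d)
      = (a * a + b * b) * (c * c + d * d) * (e * g + f * h) := by
  obtain ⟨l, hc, hd⟩ : ∃ l, c = -l * b ∧ d = l * a := by
    refine ⟨(a * d - b * c) / (a * a + b * b), ?_, ?_⟩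
    · rw [neg_mul, div_mul_eq_mul_div, ← neg_div, eq_div_iff h0]; linear_combination a * ho
    · rw [div_mul_eq_mul_div, eq_div_iff h0]; linear_combination b * ho
  subst hc hd
  ring

namespace IsGram

/-- The alternating vector of an induced four-cycle is an eigenvector of the cycle for `-2`, so it
is null for `A + 2I`. The conclusion is the kernel equation at a vertex off the cycle. -/
lemma four_cycle (h : IsGram G x y) {t t' w w' : V} (htt : t ≠ t') (htn : ¬ G.Adj t t')
    (hww : w ≠ w') (hwn : ¬ G.Adj w w') (h1 : G.Adj t w) (h2 : G.Adj t w') (h3 : G.Adj t' w)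
    (h4 : G.Adj t' w') {z : V} (zt : z ≠ t) (zt' : z ≠ t') (zw : z ≠ w) (zw' : z ≠ w') :
    closedInd G z t + closedInd G z t' = closedInd G z w + closedInd G z w' := by
  set f : V → ℝ := fun v => (if v = t then 1 else 0) + (if v = t' then 1 else 0)
    - (if v = w then 1 else 0) - (if v = w' then 1 else 0) with hf
  have hL : ∀ v, ∑ u, closedInd G v u * f u
      = closedInd G v t + closedInd G v t' - closedInd G v w - closedInd G v w' := by
    intro v
    simp [hf, mul_add, mul_sub, sum_add_distrib, sum_sub_distrib]
  have hs : ∀ g : V → ℝ, ∑ v, f v * g v = g t + g t' - g w - g w' := by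
    intro g
    simp [hf, add_mul, sub_mul, sum_add_distrib, sum_sub_distrib]
  have n1 := h1.ne; have n2 := h2.ne; have n3 := h3.ne; have n4 := h4.ne
  have := h.null_vector f (by
    simp_rw [hL]
    rw [hs]
    simp [hf, closedInd, h1, h2, h3, h4, h1.symm, h2.symm, h3.symm, h4.symm, htn, hwn,
      G.adj_comm t' t, G.adj_comm w' w, htt, htt.symm, hww, hww.symm, n1, n2, n3, n4, n1.symm,
      n2.symm, n3.symm, n4.symm]) z
  rw [hL] at this
  simp only [hf, zt, zt', zw, zw', if_false] at this
  linarith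

/-- Three pairwise nonadjacent vertices joined to both ends of an edge. -/
lemma coclique_join_edge (h : IsGram G x y) {a b c v w : V} (hab : a ≠ b) (hac : a ≠ c)
    (hbc : b ≠ c) (nab : ¬ G.Adj a b) (nac : ¬ G.Adj a c) (nbc : ¬ G.Adj b c) (hvw : G.Adj v w)
    (av : G.Adj a v) (bv : G.Adj b v) (cv : G.Adj c v) (aw : G.Adj a w) (bw : G.Adj b w)
    (cw : G.Adj c w) {z : V} (za : z ≠ a) (zb : z ≠ b) (zc : z ≠ c) (zv : z ≠ v) (zw : z ≠ w) :
    closedInd G z a + closedInd G z b + closedInd G z c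
      = closedInd G z v + closedInd G z w := by
  -- Weight `1` on the coclique and `-1` on the ends of the edge: the form of `A + 2I` takes the
  -- value `10 - 12 + 2 = 0`.
  set f : V → ℝ := fun u => (if u = a then 1 else 0) + (if u = b then 1 else 0)
    + (if u = c then 1 else 0) - (if u = v then 1 else 0) - (if u = w then 1 else 0) with hf
  have hL : ∀ u, ∑ k, closedInd G u k * f k = closedInd G u a + closedInd G u b
      + closedInd G u c - closedInd G u v - closedInd G u w := by
    intro u
    simp [hf, mul_add, mul_sub, sum_add_distrib, sum_sub_distrib]
  have hs : ∀ g : V → ℝ, ∑ u, f u * g u = g a + g b + g c - g v - g w := by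
    intro g
    simp [hf, add_mul, sub_mul, sum_add_distrib, sum_sub_distrib]
  have n1 := av.ne; have n2 := bv.ne; have n3 := cv.ne
  have n4 := aw.ne; have n5 := bw.ne; have n6 := cw.ne; have n7 := hvw.ne
  have := h.null_vector f (by
    simp_rw [hL]
    rw [hs]
    simp [hf, closedInd, av, bv, cv, aw, bw, cw, hvw, av.symm, bv.symm, cv.symm, aw.symm, bw.symm,
      cw.symm, hvw.symm, nab, nac, nbc, G.adj_comm b a, G.adj_comm c a, G.adj_comm c b,
      hab, hac, hbc, hab.symm, hac.symm, hbc.symm, n1, n2, n3, n4, n5, n6, n7, n1.symm, n2.symm,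
      n3.symm, n4.symm, n5.symm, n6.symm, n7.symm]) z
  rw [hL] at this
  simp only [hf, za, zb, zc, zv, zw, if_false] at this
  linarith

/-- A star with four pairwise nonadjacent leaves. -/
lemma four_star (h : IsGram G x y) {a b c d v : V} (hab : a ≠ b) (hac : a ≠ c) (had : a ≠ d)
    (hbc : b ≠ c) (hbd : b ≠ d) (hcd : c ≠ d) (nab : ¬ G.Adj a b) (nac : ¬ G.Adj a c)
    (nad : ¬ G.Adj a d) (nbc : ¬ G.Adj b c) (nbd : ¬ G.Adj b d) (ncd : ¬ G.Adj c d)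
    (av : G.Adj a v) (bv : G.Adj b v) (cv : G.Adj c v) (dv : G.Adj d v)
    {z : V} (za : z ≠ a) (zb : z ≠ b) (zc : z ≠ c) (zd : z ≠ d) (zv : z ≠ v) :
    closedInd G z a + closedInd G z b + closedInd G z c + closedInd G z d
      = 2 * closedInd G z v := by
  -- The eigenvector of `K_{1,4}` for `-2`: weight `1` on the leaves and `-2` at the centre.
  set f : V → ℝ := fun u => (if u = a then 1 else 0) + (if u = b then 1 else 0)
    + (if u = c then 1 else 0) + (if u = d then 1 else 0) - 2 * (if u = v then 1 else 0) with hf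
  have hL : ∀ u, ∑ k, closedInd G u k * f k = closedInd G u a + closedInd G u b
      + closedInd G u c + closedInd G u d - 2 * closedInd G u v := by
    intro u
    simp [hf, mul_add, mul_sub, sum_add_distrib, sum_sub_distrib, mul_comm]
  have hs : ∀ g : V → ℝ, ∑ u, f u * g u = g a + g b + g c + g d - 2 * g v := by
    intro g
    simp [hf, add_mul, sub_mul, sum_add_distrib, sum_sub_distrib]
  have n1 := av.ne; have n2 := bv.ne; have n3 := cv.ne; have n4 := dv.ne
  have := h.null_vector f (by
    simp_rw [hL]
    rw [hs]
    simp [hf, closedInd, av, bv, cv, dv, av.symm, bv.symm, cv.symm, dv.symm, nab, nac, nad, nbc,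
      nbd, ncd, G.adj_comm b a, G.adj_comm c a, G.adj_comm c b, G.adj_comm d a, G.adj_comm d b,
      G.adj_comm d c, hab, hac, had, hbc, hbd, hcd, hab.symm, hac.symm, had.symm, hbc.symm,
      hbd.symm, hcd.symm, n1, n2, n3, n4, n1.symm, n2.symm, n3.symm, n4.symm]
    norm_num) z
  rw [hL] at this
  simp only [hf, za, zb, zc, zd, zv, if_false] at this
  linarith

lemma ip_nonneg (h : IsGram G x y) (v w : V) : 0 ≤ x v * x w + y v * y w := by
  by_cases hvw : v = w
  · subst hvw; nlinarith [mul_self_nonneg (x v), mul_self_nonneg (y v)]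
  · rw [h.inter v w hvw]; positivity

lemma _root_.card_closedNbhd (v : V) : (closedNbhd G v).card = G.degree v + 1 := by
  rw [show closedNbhd G v = insert v (G.neighborFinset v) by ext z; simp]
  rw [card_insert_of_notMem (by simp), SimpleGraph.card_neighborFinset_eq_degree]

lemma self_eq_degree (h : IsGram G x y) (v : V) : x v * x v + y v * y v = G.degree v := by
  have := h.self v
  rw [card_closedNbhd] at this
  push_cast at this
  linarith

/-- Parallel, different vectors only occur for the ends of a pendant edge at a vertex of
degree `4`. -/
lemma parallel (h : IsGram G x y) (hiso : ∀ v, ¬ G.IsIsolated v) {v w : V}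
    (hp : x v * y w = x w * y v) (hs : ¬ SameVec x y v w) :
    ∃ i j, (i = v ∧ j = w ∨ i = w ∧ j = v) ∧ G.degree j = 1 ∧ G.degree i = 4 ∧ G.Adj i j := by
  have hpos : ∀ v, 0 < G.degree v := by
    intro v
    rw [SimpleGraph.degree_pos_iff_exists_adj]
    simpa [SimpleGraph.IsIsolated] using hiso v
  have hvw : v ≠ w := by rintro rfl; exact hs ⟨rfl, rfl⟩
  -- Parallel vectors of the same length with nonnegative inner product are equal.
  have hne : G.degree v ≠ G.degree w := by
    intro hd
    have h1 := h.self_eq_degree v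
    have h2 := h.self_eq_degree w
    rw [hd] at h1
    have h3 := h.ip_nonneg v w
    have h4 : (x v * x w + y v * y w) ^ 2 = (G.degree w : ℝ) ^ 2 := by
      have : (x v * x w + y v * y w) ^ 2 + (x v * y w - x w * y v) ^ 2
        = (x v * x v + y v * y v) * (x w * x w + y w * y w) := by ring
      rw [h1, h2, hp, sub_self] at this
      linarith
    have h5 : x v * x w + y v * y w = G.degree w := by
      rw [sq_eq_sq₀ h3 (by positivity)] at h4
      exact h4
    exact hs ⟨by nlinarith [sq_nonneg (x v - x w), sq_nonneg (y v - y w)],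
      by nlinarith [sq_nonneg (x v - x w), sq_nonneg (y v - y w)]⟩
  wlog hlt : G.degree w < G.degree v generalizing v w
  · obtain ⟨i, j, hij, h'⟩ := this (v := w) (w := v) hp.symm (fun hs' => hs hs'.symm) hvw.symm
      hne.symm (by omega)
    exact ⟨i, j, hij.symm, h'⟩
  refine ⟨v, w, Or.inl ⟨rfl, rfl⟩, ?_⟩
  set n := (closedNbhd G v ∩ closedNbhd G w).card with hn
  -- Equality in Cauchy–Schwarz. Together with `deg w < n ≤ deg w + 1` it gives `n = deg w + 1`, so
  -- `deg w` divides `(deg w + 1)²` and hence `1`.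
  have e1 : n ^ 2 = G.degree v * G.degree w := by
    have h1 := h.self_eq_degree v
    have h2 := h.self_eq_degree w
    have h3 := h.inter v w hvw
    have : ((n : ℝ)) ^ 2 = G.degree v * G.degree w := by
      rw [hn, ← h3, ← h1, ← h2]
      have : (x v * x w + y v * y w) ^ 2 + (x v * y w - x w * y v) ^ 2
        = (x v * x v + y v * y v) * (x w * x w + y w * y w) := by ring
      rw [hp, sub_self] at this
      linarith
    exact_mod_cast this
  have e2 : n ≤ G.degree w + 1 := by
    rw [← card_closedNbhd]; exact card_le_card inter_subset_right
  have hw := hpos w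
  have e3 : G.degree w < n := by nlinarith
  have e4 : n = G.degree w + 1 := by omega
  have e5 : G.degree w ∣ 1 := by
    have : G.degree w ∣ (G.degree w + 1) ^ 2 := by rw [← e4, e1]; exact dvd_mul_left _ _
    have h2 : (G.degree w + 1) ^ 2 = G.degree w * (G.degree w + 2) + 1 := by ring
    rw [h2] at this
    exact (Nat.dvd_add_right (dvd_mul_right _ _)).1 this
  have e6 : G.degree w = 1 := Nat.dvd_one.1 e5
  refine ⟨e6, by rw [e4, e6] at e1; omega, ?_⟩
  have e7 : closedNbhd G w ⊆ closedNbhd G v := by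
    have : closedNbhd G v ∩ closedNbhd G w = closedNbhd G w :=
      eq_of_subset_of_card_le inter_subset_right (by rw [card_closedNbhd, ← hn, e4])
    rw [← this]; exact inter_subset_left
  have := e7 (self_mem_closedNbhd w)
  rw [mem_closedNbhd] at this
  exact this.resolve_left hvw.symm

/-- If `j` lies strictly between `i` and `k` and is adjacent to neither of them, then its
neighbourhood is the disjoint union of their neighbourhoods. -/
lemma between (h : IsGram G x y) (hiso : ∀ v, ¬ G.IsIsolated v) {i j k : V} {α β : ℝ}
    (hα : 0 < α) (hβ : 0 < β) (hx : x j = α * x i + β * x k) (hy : y j = α * y i + β * y k)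
    (hij : i ≠ j) (hjk : j ≠ k) (hik : ¬ SameVec x y i k) (nij : ¬ G.Adj j i)
    (njk : ¬ G.Adj j k) :
    α = 1 ∧ β = 1 ∧ closedNbhd G i ∩ closedNbhd G k = ∅ ∧
      ∀ v, G.Adj j v ↔ G.Adj i v ∨ G.Adj k v := by
  have hik' : i ≠ k := by rintro rfl; exact hik ⟨rfl, rfl⟩
  -- The terms at `i`, `j`, `k` already exhaust the sum `1 + α² + β²`. An edge between `i` and `k`
  -- would exceed it, and all other terms vanish: away from these three vertices, row `j` of `A + I`
  -- is `α` times row `i` plus `β` times row `k`.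
  have hsum := h.sum_sq_three hij hjk hik' α β hx hy
  set F : V → ℝ := fun z => (closedInd G j z - α * closedInd G i z - β * closedInd G k z) ^ 2
  have hF : ∀ z, 0 ≤ F z := fun z => sq_nonneg _
  have cjj : closedInd G j j = 1 := closedInd_self j
  have cij : closedInd G i j = 0 := closedInd_of_not_adj hij (fun hh => nij hh.symm)
  have ckj : closedInd G k j = 0 := closedInd_of_not_adj hjk.symm (fun hh => njk hh.symm)
  have cji : closedInd G j i = 0 := closedInd_of_not_adj hij.symm nij
  have cjk : closedInd G j k = 0 := closedInd_of_not_adj hjk njk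
  have Fj : F j = 1 := by simp only [F, cjj, cij, ckj]; ring
  have Fi : F i = (α + β * closedInd G k i) ^ 2 := by
    simp only [F, cji, closedInd_self]; ring
  have Fk : F k = (α * closedInd G i k + β) ^ 2 := by
    simp only [F, cjk, closedInd_self]; ring
  have split : ∀ z, z ≠ i → z ≠ j → z ≠ k → F i + F j + F k + F z ≤ ∑ z, F z := by
    intro z zi zj zk
    calc F i + F j + F k + F z = ∑ u ∈ {i, j, k, z}, F u := by
          rw [sum_insert (by simp [hij, hik', zi.symm]), sum_insert (by simp [hjk, zj.symm]),
            sum_insert (by simp [zk.symm]), sum_singleton]; ring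
      _ ≤ ∑ z, F z := sum_le_sum_of_subset_of_nonneg (subset_univ _) (fun _ _ _ => hF _)
  have split3 : F i + F j + F k ≤ ∑ z, F z := by
    calc F i + F j + F k = ∑ u ∈ {i, j, k}, F u := by
          rw [sum_insert (by simp [hij, hik']), sum_insert (by simp [hjk]), sum_singleton]; ring
      _ ≤ ∑ z, F z := sum_le_sum_of_subset_of_nonneg (subset_univ _) (fun _ _ _ => hF _)
  have nik : ¬ G.Adj i k := by
    intro hadj
    rw [Fi, Fj, Fk, closedInd_of_adj hadj, closedInd_of_adj hadj.symm, hsum] at split3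
    nlinarith [mul_pos hα hβ]
  have cik : closedInd G i k = 0 := closedInd_of_not_adj hik' nik
  have cki : closedInd G k i = 0 := closedInd_of_not_adj hik'.symm (fun hh => nik hh.symm)
  have hzero : ∀ z, z ≠ i → z ≠ j → z ≠ k →
      closedInd G j z = α * closedInd G i z + β * closedInd G k z := by
    intro z zi zj zk
    have := split z zi zj zk
    rw [hsum, Fi, Fj, Fk, cik, cki] at this
    have hz : F z = 0 := le_antisymm (by nlinarith) (hF z)
    have := pow_eq_zero_iff (two_ne_zero) |>.1 hz
    linarith
  have hcases : ∀ v w, closedInd G v w = 0 ∨ closedInd G v w = 1 := by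
    intro v w; unfold closedInd; split_ifs <;> simp
  have adjv : ∀ v w, v ≠ w → (closedInd G v w = 1 ↔ G.Adj v w) := by
    intro v w hvw
    by_cases hh : G.Adj v w
    · simp [closedInd_of_adj hh, hh]
    · simp [closedInd_of_not_adj hvw hh, hh]
  have key : ∀ z, z ≠ i → z ≠ j → z ≠ k →
      (closedInd G i z = 1 ∨ closedInd G k z = 1) → closedInd G j z = 1 := by
    intro z zi zj zk hz
    have e := hzero z zi zj zk
    rcases hcases j z with h0 | h1
    · exfalso
      rcases hcases i z with a | a <;> rcases hcases k z with b | b <;> rw [h0, a, b] at e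
      · rw [a, b] at hz; norm_num at hz
      all_goals linarith
    · exact h1
  have hex : ∀ v, ∃ w, G.Adj v w := fun v => by simpa [SimpleGraph.IsIsolated] using hiso v
  have ne1 : ∀ v, G.Adj i v → v ≠ i ∧ v ≠ j ∧ v ≠ k := fun v hv =>
    ⟨hv.ne', fun e => nij (e ▸ hv.symm), fun e => nik (e ▸ hv)⟩
  have ne2 : ∀ v, G.Adj k v → v ≠ i ∧ v ≠ j ∧ v ≠ k := fun v hv =>
    ⟨fun e => nik (e ▸ hv.symm), fun e => njk (e ▸ hv.symm), hv.ne'⟩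
  have only1 : ∀ v, G.Adj i v → ¬ G.Adj k v → α = 1 := by
    intro v hi hk
    obtain ⟨a, b, c⟩ := ne1 v hi
    have e := hzero v a b c
    rw [key v a b c (Or.inl (closedInd_of_adj hi)), closedInd_of_adj hi,
      closedInd_of_not_adj c.symm hk] at e
    linarith
  have only2 : ∀ v, G.Adj k v → ¬ G.Adj i v → β = 1 := by
    intro v hk hi
    obtain ⟨a, b, c⟩ := ne2 v hk
    have e := hzero v a b c
    rw [key v a b c (Or.inr (closedInd_of_adj hk)), closedInd_of_adj hk,
      closedInd_of_not_adj a.symm hi] at e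
    linarith
  -- A common neighbour gives `α + β = 1`, whereas a private neighbour of `i` or `k` gives `α = 1`
  -- or `β = 1`. So `i` and `k` would have the same neighbours and therefore the same vector.
  have both : ∀ v, G.Adj i v → ¬ G.Adj k v := by
    intro v hi hk
    obtain ⟨a, b, c⟩ := ne1 v hi
    have e := hzero v a b c
    rw [key v a b c (Or.inl (closedInd_of_adj hi)), closedInd_of_adj hi, closedInd_of_adj hk] at e
    refine hik (h.same_of_card_le ?_)
    have s1 : ∀ v, G.Adj i v → G.Adj k v := fun v hv => by
      by_contra hh; have := only1 v hv hh; linarith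
    have s2 : ∀ v, G.Adj k v → G.Adj i v := fun v hv => by
      by_contra hh; have := only2 v hv hh; linarith
    have t1 : closedNbhd G i \ closedNbhd G k ⊆ {i} := by
      intro v; simp only [mem_sdiff, mem_closedNbhd, mem_singleton]
      rintro ⟨rfl | h1, h2⟩
      · rfl
      · exact absurd (Or.inr (s1 v h1)) h2
    have t2 : closedNbhd G k \ closedNbhd G i ⊆ {k} := by
      intro v; simp only [mem_sdiff, mem_closedNbhd, mem_singleton]
      rintro ⟨rfl | h1, h2⟩
      · rfl
      · exact absurd (Or.inr (s2 v h1)) h2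
    have := card_le_card t1
    have := card_le_card t2
    simp only [card_singleton] at *
    omega
  obtain ⟨a, ha⟩ := hex i
  obtain ⟨b, hb⟩ := hex k
  have hα1 := only1 a ha (both a ha)
  have hβ1 := only2 b hb (fun hh => both b hh hb)
  refine ⟨hα1, hβ1, ?_, ?_⟩
  · rw [← disjoint_iff_inter_eq_empty, disjoint_left]
    intro v hv hv'
    rw [mem_closedNbhd] at hv hv'
    rcases hv with rfl | hv <;> rcases hv' with hv' | hv'
    · exact hik' hv'
    · exact nik hv'.symm
    · rw [hv'] at hv; exact nik hv
    · exact both v hv hv'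
  · intro v
    constructor
    · intro hv
      have vj : v ≠ j := hv.ne'
      have vi : v ≠ i := fun e => nij (e ▸ hv)
      have vk : v ≠ k := fun e => njk (e ▸ hv)
      have e := hzero v vi vj vk
      rw [closedInd_of_adj hv] at e
      by_contra hcon
      push Not at hcon
      rw [closedInd_of_not_adj vi.symm hcon.1, closedInd_of_not_adj vk.symm hcon.2] at e
      linarith
    · rintro (hv | hv)
      · obtain ⟨a, b, c⟩ := ne1 v hv
        exact (adjv j v b.symm).1 (key v a b c (Or.inl (closedInd_of_adj hv)))
      · obtain ⟨a, b, c⟩ := ne2 v hv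
        exact (adjv j v b.symm).1 (key v a b c (Or.inr (closedInd_of_adj hv)))

end IsGram
end GramGraphs2

/-! ### Blow-up patterns -/

/-- The possible relations between two blocks of vertices in a blow-up pattern: no edges, all
edges, edges between vertices with the same index, edges between vertices with different
indices. -/
inductive BlockRel
  | none
  | all
  | eq
  | ne
  deriving DecidableEq

/-- Adjacency of the vertices of index `a` and `b` in two blocks related by `r`. -/
def BlockRel.Holds : BlockRel → ℕ → ℕ → Prop
  | .none, _, _ => False
  | .all, _, _ => True
  | .eq, a, b => a = b
  | .ne, a, b => a ≠ b

/-- The vertices of `G` can be written as `f i a` with `i < t` and `a < n i`, such that adjacency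
is given by the block relations `κ`. -/
def HasPattern {V : Type*} (G : SimpleGraph V) {t : ℕ} (n : Fin t → ℕ)
    (κ : Fin t → Fin t → BlockRel) : Prop :=
  ∃ f : Fin t → ℕ → V,
    (∀ i j a b, a < n i → b < n j → f i a = f j b → i = j ∧ a = b) ∧
    (∀ v, ∃ i a, a < n i ∧ f i a = v) ∧
    ∀ i j a b, a < n i → b < n j → (G.Adj (f i a) (f j b) ↔ (κ i j).Holds a b)

section Patterns

variable {V W : Type*} {G : SimpleGraph V} {H : SimpleGraph W} {t : ℕ} {n : Fin t → ℕ}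
  {κ : Fin t → Fin t → BlockRel}

lemma BlockRel.holds_comm (r : BlockRel) (a b : ℕ) : r.Holds a b ↔ r.Holds b a := by
  cases r <;> simp [BlockRel.Holds, eq_comm]

lemma HasPattern.of_lt (f : Fin t → ℕ → V) (hκ : ∀ i j, κ i j = κ j i)
    (hinj : ∀ i a b, a < n i → b < n i → f i a = f i b → a = b)
    (hdisj : ∀ i j, i < j → ∀ a b, a < n i → b < n j → f i a ≠ f j b)
    (hsurj : ∀ v, ∃ i a, a < n i ∧ f i a = v)
    (hadj : ∀ i j, i ≤ j → ∀ a b, a < n i → b < n j →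
      (G.Adj (f i a) (f j b) ↔ (κ i j).Holds a b)) : HasPattern G n κ := by
  refine ⟨f, ?_, hsurj, ?_⟩
  · intro i j a b ha hb hab
    rcases lt_trichotomy i j with h | rfl | h
    · exact absurd hab (hdisj i j h a b ha hb)
    · exact ⟨rfl, hinj i a b ha hb hab⟩
    · exact absurd hab.symm (hdisj j i h b a hb ha)
  · intro i j a b ha hb
    rcases le_total i j with h | h
    · exact hadj i j h a b ha hb
    · rw [G.adj_comm, hadj j i h b a hb ha, hκ, BlockRel.holds_comm]

lemma HasPattern.exists_equiv (h : HasPattern G n κ) :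
    ∃ e : (Σ i, Fin (n i)) ≃ V, ∀ p q,
      G.Adj (e p) (e q) ↔ (κ p.1 q.1).Holds p.2 q.2 := by
  obtain ⟨f, hinj, hsurj, hadj⟩ := h
  refine ⟨Equiv.ofBijective (fun p => f p.1 p.2) ⟨?_, ?_⟩, ?_⟩
  · rintro ⟨i, a⟩ ⟨j, b⟩ hab
    obtain ⟨rfl, hab⟩ := hinj i j a b a.2 b.2 hab
    rw [Fin.ext hab]
  · intro v
    obtain ⟨i, a, ha, rfl⟩ := hsurj v
    exact ⟨⟨i, ⟨a, ha⟩⟩, rfl⟩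
  · rintro ⟨i, a⟩ ⟨j, b⟩
    exact hadj i j a b a.2 b.2

lemma HasPattern.isIsoTo (h : HasPattern G n κ) (h' : HasPattern H n κ) : IsIsoTo G H := by
  obtain ⟨e, he⟩ := h.exists_equiv
  obtain ⟨e', he'⟩ := h'.exists_equiv
  refine ⟨⟨e.symm.trans e', ?_⟩⟩
  intro a b
  rw [Equiv.trans_apply, Equiv.trans_apply, he', ← he]
  simp

lemma HasPattern.of_iso (e : G ≃g H) (h : HasPattern H n κ) : HasPattern G n κ := by
  obtain ⟨f, hinj, hsurj, hadj⟩ := h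
  refine ⟨fun i a => e.symm (f i a), ?_, ?_, ?_⟩
  · intro i j a b ha hb hab
    exact hinj i j a b ha hb (e.symm.injective hab)
  · intro v
    obtain ⟨i, a, ha, hv⟩ := hsurj (e v)
    exact ⟨i, a, ha, by simp [hv]⟩
  · intro i j a b ha hb
    rw [← hadj i j a b ha hb, e.symm.map_adj_iff]

lemma IsIsoTo.hasPattern (h : IsIsoTo G H) (h' : HasPattern H n κ) : HasPattern G n κ :=
  h.elim fun e => h'.of_iso e

lemma Finset.exists_enum [Nonempty V] (S : Finset V) :
    ∃ f : ℕ → V, (∀ a, a < S.card → f a ∈ S) ∧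
      (∀ a b, a < S.card → b < S.card → f a = f b → a = b) ∧
      ∀ v ∈ S, ∃ a, a < S.card ∧ f a = v := by
  classical
  let e := S.equivFin
  refine ⟨fun a => if h : a < S.card then e.symm ⟨a, h⟩ else Classical.arbitrary V, ?_, ?_, ?_⟩
  · intro a ha
    simp [ha]
  · intro a b ha hb hab
    simp only [ha, hb, dif_pos] at hab
    have := e.symm.injective (Subtype.ext hab)
    simpa using this
  · intro v hv
    refine ⟨e ⟨v, hv⟩, (e ⟨v, hv⟩).2, ?_⟩
    simp

/-- A set of vertices in which nonadjacency is a perfect matching can be enumerated in pairs. -/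
lemma exists_enum_mates [Nonempty V] (S : Finset V)
    (hS : ∀ v ∈ S, ∃ v' ∈ S, v' ≠ v ∧ ∀ w ∈ S, w ≠ v → (G.Adj v w ↔ w ≠ v')) :
    ∃ (k : ℕ) (f g : ℕ → V), S.card = 2 * k ∧
      (∀ a, a < k → f a ∈ S ∧ g a ∈ S) ∧
      (∀ a b, a < k → b < k → f a = f b → a = b) ∧
      (∀ a b, a < k → b < k → g a = g b → a = b) ∧
      (∀ a b, a < k → b < k → f a ≠ g b) ∧
      (∀ v ∈ S, ∃ a, a < k ∧ (f a = v ∨ g a = v)) ∧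
      (∀ a b, a < k → b < k → (G.Adj (f a) (f b) ↔ a ≠ b)) ∧
      (∀ a b, a < k → b < k → (G.Adj (g a) (g b) ↔ a ≠ b)) ∧
      ∀ a b, a < k → b < k → (G.Adj (f a) (g b) ↔ a ≠ b) := by
  classical
  induction hn : S.card using Nat.strong_induction_on generalizing S with
  | _ m ih =>
  rcases S.eq_empty_or_nonempty with rfl | ⟨v, hv⟩
  · refine ⟨0, fun _ => Classical.arbitrary V, fun _ => Classical.arbitrary V, ?_⟩
    simp at hn
    simp [hn.symm]
  -- Being mates is a symmetric relation, so `v` and its mate can be removed together; the pair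
  -- receives the last index `k`.
  · obtain ⟨v', hv', hne, hadj⟩ := hS v hv
    have nvv' : ¬ G.Adj v v' := fun h => ((hadj v' hv' hne).1 h) rfl
    have hadj' : ∀ w ∈ S, w ≠ v' → (G.Adj v' w ↔ w ≠ v) := by
      obtain ⟨v2, hv2, hne2, hadj2⟩ := hS v' hv'
      have : v2 = v := by
        by_contra hc
        exact nvv' ((hadj2 v hv hne.symm).2 (Ne.symm hc)).symm
      rwa [this] at hadj2
    set S' := (S.erase v).erase v' with hS'
    have hmem : ∀ w, w ∈ S' ↔ w ≠ v' ∧ w ≠ v ∧ w ∈ S := by intro w; simp [hS']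
    have hcard : S'.card + 2 = S.card := by
      rw [hS', card_erase_of_mem (by simp [hne, hv']), card_erase_of_mem hv]
      have : 1 < S.card := one_lt_card.2 ⟨v, hv, v', hv', hne.symm⟩
      omega
    obtain ⟨k, f, g, hk, hfg, hf, hg, hfgne, hsur, aff, agg, afg⟩ := ih S'.card (by omega) S' (by
      intro w hw
      rw [hmem] at hw
      obtain ⟨w', hw', hwne, hwadj⟩ := hS w hw.2.2
      have h1 : w' ≠ v := by
        rintro rfl
        exact (hwadj w' hw' hwne).1 ((hadj w hw.2.2 hw.2.1).2 hw.1).symm rfl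
      have h2 : w' ≠ v' := by
        rintro rfl
        exact (hwadj w' hw' hwne).1 ((hadj' w hw.2.2 hw.1).2 hw.2.1).symm rfl
      refine ⟨w', (hmem _).2 ⟨h2, h1, hw'⟩, hwne, fun u hu hne => hwadj u ((hmem u).1 hu).2.2 hne⟩)
      rfl
    have fS : ∀ a, a < k → f a ≠ v' ∧ f a ≠ v ∧ f a ∈ S := fun a ha => (hmem _).1 (hfg a ha).1
    have gS : ∀ a, a < k → g a ≠ v' ∧ g a ≠ v ∧ g a ∈ S := fun a ha => (hmem _).1 (hfg a ha).2
    refine ⟨k + 1, fun a => if a = k then v else f a, fun a => if a = k then v' else g a,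
      by omega, ?_, ?_, ?_, ?_, ?_, ?_, ?_, ?_⟩
    · intro a ha
      by_cases hak : a = k
      · simp [hak, hv, hv']
      · simp [hak, (fS a (by omega)).2.2, (gS a (by omega)).2.2]
    · intro a b ha hb
      by_cases hak : a = k <;> by_cases hbk : b = k <;> simp only [hak, hbk, if_true, if_false]
      · simp
      · intro h; exact absurd h.symm (fS b (by omega)).2.1
      · intro h; exact absurd h (fS a (by omega)).2.1
      · exact hf a b (by omega) (by omega)
    · intro a b ha hb
      by_cases hak : a = k <;> by_cases hbk : b = k <;> simp only [hak, hbk, if_true, if_false]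
      · simp
      · intro h; exact absurd h.symm (gS b (by omega)).1
      · intro h; exact absurd h (gS a (by omega)).1
      · exact hg a b (by omega) (by omega)
    · intro a b ha hb
      by_cases hak : a = k <;> by_cases hbk : b = k <;> simp only [hak, hbk, if_true, if_false]
      · exact hne.symm
      · exact (gS b (by omega)).2.1.symm
      · exact (fS a (by omega)).1
      · exact hfgne a b (by omega) (by omega)
    · intro w hw
      by_cases h1 : w = v
      · exact ⟨k, by omega, by simp [h1]⟩
      by_cases h2 : w = v'
      · exact ⟨k, by omega, by simp [h2]⟩
      obtain ⟨a, ha, hfa⟩ := hsur w ((hmem w).2 ⟨h2, h1, hw⟩)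
      exact ⟨a, by omega, by simpa [ha.ne] using hfa⟩
    · intro a b ha hb
      by_cases hak : a = k <;> by_cases hbk : b = k <;> simp only [hak, hbk, if_true, if_false]
      · simp
      · obtain ⟨h1, h2, h3⟩ := fS b (by omega)
        simp [(hadj _ h3 h2).2 h1, Ne.symm hbk]
      · obtain ⟨h1, h2, h3⟩ := fS a (by omega)
        simp [((hadj _ h3 h2).2 h1).symm, hak]
      · exact aff a b (by omega) (by omega)
    · intro a b ha hb
      by_cases hak : a = k <;> by_cases hbk : b = k <;> simp only [hak, hbk, if_true, if_false]
      · simp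
      · obtain ⟨h1, h2, h3⟩ := gS b (by omega)
        simp [(hadj' _ h3 h1).2 h2, Ne.symm hbk]
      · obtain ⟨h1, h2, h3⟩ := gS a (by omega)
        simp [((hadj' _ h3 h1).2 h2).symm, hak]
      · exact agg a b (by omega) (by omega)
    · intro a b ha hb
      by_cases hak : a = k <;> by_cases hbk : b = k <;> simp only [hak, hbk, if_true, if_false]
      · simpa using nvv'
      · obtain ⟨h1, h2, h3⟩ := gS b (by omega)
        simp [(hadj _ h3 h2).2 h1, Ne.symm hbk]
      · obtain ⟨h1, h2, h3⟩ := fS a (by omega)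
        simp [((hadj' _ h3 h1).2 h2).symm, hak]
      · exact afg a b (by omega) (by omega)

end Patterns

/-! ### Enumerations of vertex sets -/

/-- `f 0, …, f (n - 1)` are the elements of `S`, without repetition. -/
structure IsEnum {V : Type*} (f : ℕ → V) (n : ℕ) (S : Finset V) : Prop where
  mem : ∀ a, a < n → f a ∈ S
  inj : ∀ a b, a < n → b < n → f a = f b → a = b
  surj : ∀ v ∈ S, ∃ a, a < n ∧ f a = v

section Enumerations

variable {V : Type*} {G : SimpleGraph V}

lemma IsEnum.singleton (v : V) : IsEnum (fun _ => v) 1 {v} :=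
  ⟨by simp, fun a b ha hb _ => by omega, fun w hw => ⟨0, by omega, (mem_singleton.1 hw).symm⟩⟩

lemma IsEnum.exists [Nonempty V] (S : Finset V) {n : ℕ} (hn : S.card = n) :
    ∃ f, IsEnum f n S := by
  subst hn
  obtain ⟨f, h1, h2, h3⟩ := Finset.exists_enum S
  exact ⟨f, h1, h2, h3⟩

lemma IsEnum.card [DecidableEq V] {f : ℕ → V} {n : ℕ} {S : Finset V} (h : IsEnum f n S) :
    S.card = n := by
  have : S = (range n).image f := by
    ext v
    simp only [mem_image, mem_range]
    exact ⟨h.surj v, fun ⟨a, ha, e⟩ => e ▸ h.mem a ha⟩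
  rw [this, card_image_of_injOn, card_range]
  intro a ha b hb hab
  exact h.inj a b (by simpa using ha) (by simpa using hb) hab

/-- Two sets between which a relation is a perfect matching have compatible enumerations. -/
lemma exists_matched_enum [Nonempty V] (S T : Finset V) (R : V → V → Prop)
    (h1 : ∀ v ∈ S, ∃ w ∈ T, ∀ w' ∈ T, R v w' ↔ w' = w)
    (h2 : ∀ w ∈ T, ∃ v ∈ S, ∀ v' ∈ S, R v' w ↔ v' = v) :
    ∃ f g, IsEnum f S.card S ∧ IsEnum g S.card T ∧
      ∀ a b, a < S.card → b < S.card → (R (f a) (g b) ↔ a = b) := by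
  obtain ⟨f, hf⟩ := IsEnum.exists S rfl
  choose! φ hφ hφ' using h1
  choose! ψ hψ hψ' using h2
  have hinj : ∀ a b, a < S.card → b < S.card → φ (f a) = φ (f b) → a = b := by
    intro a b ha hb hab
    refine hf.inj a b ha hb ?_
    have fa := hf.mem a ha
    have fb := hf.mem b hb
    have e1 := (hψ' _ (hφ _ fa) _ fa).1 ((hφ' _ fa _ (hφ _ fa)).2 rfl)
    have e2 := (hψ' _ (hφ _ fb) _ fb).1 ((hφ' _ fb _ (hφ _ fb)).2 rfl)
    rw [e1, e2, hab]
  refine ⟨f, φ ∘ f, hf, ⟨fun a ha => hφ _ (hf.mem a ha), hinj, ?_⟩, ?_⟩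
  · intro w hw
    obtain ⟨a, ha, e⟩ := hf.surj _ (hψ w hw)
    refine ⟨a, ha, ?_⟩
    rw [Function.comp_apply, e]
    exact ((hφ' _ (hψ w hw) _ hw).1 ((hψ' w hw _ (hψ w hw)).2 rfl)).symm
  · intro a b ha hb
    rw [Function.comp_apply, hφ' _ (hf.mem a ha) _ (hφ _ (hf.mem b hb))]
    exact ⟨fun e => (hinj b a hb ha e).symm, fun e => by rw [e]⟩

lemma HasPattern.of_enum {t : ℕ} {n : Fin t → ℕ} {κ : Fin t → Fin t → BlockRel}
    (f : Fin t → ℕ → V) (S : Fin t → Finset V) (hf : ∀ i, IsEnum (f i) (n i) (S i))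
    (hκ : ∀ i j, κ i j = κ j i) (hdisj : ∀ i j, i < j → ∀ v ∈ S i, v ∉ S j)
    (hcover : ∀ v, ∃ i, v ∈ S i)
    (hadj : ∀ i j, i ≤ j → ∀ a b, a < n i → b < n j → f i a ∈ S i → f j b ∈ S j →
      (G.Adj (f i a) (f j b) ↔ (κ i j).Holds a b)) : HasPattern G n κ := by
  refine HasPattern.of_lt f hκ (fun i => (hf i).inj) ?_ ?_ ?_
  · intro i j hij a b ha hb e
    exact hdisj i j hij _ ((hf i).mem a ha) (e ▸ (hf j).mem b hb)
  · intro v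
    obtain ⟨i, hi⟩ := hcover v
    exact ⟨i, (hf i).surj v hi⟩
  · intro i j hij a b ha hb
    exact hadj i j hij a b ha hb ((hf i).mem a ha) ((hf j).mem b hb)

end Enumerations

/-! ### Sets of vertices whose vectors lie on one line -/

section ConnectedGram
open scoped Classical
variable {V : Type*} [Fintype V] {G : SimpleGraph V} {x y : V → ℝ}

/-- Connected graphs represented in the plane, such that parallel vectors are equal. -/
structure IsConnGram (G : SimpleGraph V) (x y : V → ℝ) : Prop extends IsGram G x y where
  not_isolated : ∀ v, ¬ G.IsIsolated v
  preconnected : G.Preconnected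
  same_of_parallel : ∀ v w, x v * y w = x w * y v → SameVec x y v w

lemma closed_eq_univ (hc : G.Preconnected) (P : V → Prop) {o : V} (ho : P o)
    (hP : ∀ v w, P v → G.Adj v w → P w) (v : V) : P v := by
  obtain ⟨p⟩ := hc o v
  induction p with
  | nil => exact ho
  | cons hadj _ ih => exact ih (hP _ _ ho hadj)

namespace IsGram

lemma exists_adj (hiso : ∀ v, ¬ G.IsIsolated v) (v : V) : ∃ w, G.Adj v w := by
  simpa [SimpleGraph.IsIsolated] using hiso v

lemma degree_pos' (hiso : ∀ v, ¬ G.IsIsolated v) (v : V) : 0 < G.degree v := by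
  rw [SimpleGraph.degree_pos_iff_exists_adj]
  exact exists_adj hiso v

lemma inter_pos {v w z : V} (h1 : z ∈ closedNbhd G v) (h2 : z ∈ closedNbhd G w) :
    0 < (closedNbhd G v ∩ closedNbhd G w).card := card_pos.2 ⟨z, mem_inter.2 ⟨h1, h2⟩⟩

/-- A vertex all of whose neighbours have its vector lies in a component in which all vertices
have this vector. -/
lemma same_of_nbhd_same (h : IsGram G x y) (hc : G.Preconnected) {o : V}
    (ho : ∀ v, G.Adj o v → SameVec x y o v) (v : V) : SameVec x y o v := by
  refine closed_eq_univ hc (fun v => SameVec x y o v) ⟨rfl, rfl⟩ ?_ v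
  intro v w hv hvw
  by_cases hov : o = v
  · subst hov; exact ho w hvw
  -- A neighbour `w` of `v` outside the closed neighbourhood of `o` must be the vertex exchanged for
  -- some `a` in the latter, and `a` has the vector of `o`.
  obtain ⟨a, b, ha, hb, hab⟩ := h.exists_swap hov hv
  by_cases hw : w ∈ closedNbhd G o
  · rcases mem_closedNbhd.1 hw with rfl | hw
    · exact ⟨rfl, rfl⟩
    · exact ho w hw
  · have : w ∈ closedNbhd G v \ closedNbhd G o := by simp [hw, hvw, mem_sdiff] at *
    rw [hb, mem_singleton] at this
    subst this
    have ha' : a ∈ closedNbhd G o \ closedNbhd G v := by simp [ha]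
    rcases mem_closedNbhd.1 (mem_sdiff.1 ha').1 with rfl | ha'
    · exact hab
    · exact (ho a ha').trans hab

/-- A set of vertices that is closed under adjacency and on which the vectors are pairwise
parallel induces a cocktail party graph or a star `K_{1,4}`. -/
lemma rank_one_part (h : IsGram G x y) (hiso : ∀ v, ¬ G.IsIsolated v) (S : Finset V)
    (hcl : ∀ v ∈ S, ∀ w, G.Adj v w → w ∈ S)
    (hpar : ∀ v ∈ S, ∀ w ∈ S, x v * y w = x w * y v) :
    (∃ i ∈ S, ∃ L : Finset V, L ⊆ S ∧ L.card = 4 ∧ i ∉ L ∧ (∀ v ∈ S, v = i ∨ v ∈ L) ∧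
      (∀ v ∈ L, G.Adj i v) ∧ ∀ v ∈ L, ∀ w ∈ L, ¬ G.Adj v w) ∨
    ∀ v ∈ S, ∃ v' ∈ S, v' ≠ v ∧ ∀ w ∈ S, w ≠ v → (G.Adj v w ↔ w ≠ v') := by
  by_cases hsame : ∀ v ∈ S, ∀ w ∈ S, SameVec x y v w
  · right
    intro w hw
    obtain ⟨v, hwv⟩ := exists_adj hiso w
    have hv := hcl w hw v hwv
    -- Take any neighbour `v` of `w`. A nonneighbour of `w` is a twin of `w`, hence adjacent to `v`,
    -- hence in the difference `{a}`: so `a` is the mate of `w`.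
    obtain ⟨a, b, ha, -, -⟩ := h.exists_swap hwv.ne' (hsame v hv w hw)
    have mem : ∀ z, G.Adj v z → z ≠ w → ¬ G.Adj w z → z = a := by
      intro z hz hzw hn
      have : z ∈ closedNbhd G v \ closedNbhd G w := by simp [hz, hzw, hn]
      rwa [ha, mem_singleton] at this
    have ha' : a ∈ closedNbhd G v \ closedNbhd G w := by simp [ha]
    simp only [mem_sdiff, mem_closedNbhd, not_or] at ha'
    have hav : G.Adj v a := by
      rcases ha'.1 with rfl | h'
      · exact absurd hwv ha'.2.2
      · exact h'
    refine ⟨a, hcl v hv a hav, ha'.2.1, ?_⟩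
    intro z hz hzw
    refine ⟨fun hh e => ha'.2.2 (e ▸ hh), fun hne => ?_⟩
    by_contra hn
    refine hne (mem z ?_ hzw hn)
    exact ((h.adj_iff_of_twin hzw.symm (hsame w hw z hz) hn v).1 hwv).symm
  · left
    push Not at hsame
    obtain ⟨v, hv, w, hw, hs⟩ := hsame
    obtain ⟨i, j, hij, hj1, hi4, hadj⟩ := h.parallel hiso (hpar v hv w hw) hs
    have hi : i ∈ S := by rcases hij with ⟨rfl, -⟩ | ⟨rfl, -⟩ <;> assumption
    have hj : j ∈ S := by rcases hij with ⟨-, rfl⟩ | ⟨-, rfl⟩ <;> assumption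
    have nj : ∀ z, G.Adj j z → z = i := by
      intro z hz
      rw [← SimpleGraph.card_neighborFinset_eq_degree, card_eq_one] at hj1
      obtain ⟨u, hu⟩ := hj1
      have h1 : z ∈ G.neighborFinset j := by simpa using hz
      have h2 : i ∈ G.neighborFinset j := by simpa using hadj.symm
      rw [hu, mem_singleton] at h1 h2
      rw [h1, h2]
    -- Equality in Cauchy–Schwarz on the line. In particular the closed neighbourhood of every
    -- vertex of `S` meets that of `i`.
    have hcommon : ∀ z ∈ S, z ≠ i → ((closedNbhd G z ∩ closedNbhd G i).card : ℝ) ^ 2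
        = G.degree z * G.degree i := by
      intro z hz hzi
      rw [← h.inter z i hzi, ← h.self_eq_degree, ← h.self_eq_degree]
      have := hpar z hz i hi
      have e : (x z * x i + y z * y i) ^ 2 = (x z * x z + y z * y z) * (x i * x i + y i * y i)
        - (x z * y i - x i * y z) ^ 2 := by ring
      rw [e, this]; ring
    -- The leaf `j` has length `1`, the centre `i` has length `2`, and their inner product is `2`,
    -- so the vector of `i` is twice that of `j`. Common counts with `i` are therefore twice those
    -- with `j`, and the latter are at most `1`. A further neighbour `m` of `l` breaks this: at `l`
    -- if `m` is adjacent to `i`, since three vertices are then common, and at `m` otherwise.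
    have key : ∀ l, G.Adj i l → ∀ m, G.Adj l m → m = i := by
      intro l hil m hlm
      by_contra hmi
      have hl := hcl i hi l hil
      have hm := hcl l hl m hlm
      have hlj : l ≠ j := fun e => hmi (nj m (e ▸ hlm))
      have hmj : m ≠ j := fun e => hil.ne' (nj l (e ▸ hlm.symm))
      have pj := h.self_eq_degree j
      have pi := h.self_eq_degree i
      have pij := h.inter i j hadj.ne
      have e0 : closedNbhd G i ∩ closedNbhd G j = {i, j} := by
        ext z
        simp only [mem_inter, mem_closedNbhd, mem_insert, mem_singleton]
        constructor
        · rintro ⟨-, rfl | h2⟩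
          · exact Or.inr rfl
          · exact Or.inl (nj z h2)
        · rintro (rfl | rfl)
          · exact ⟨Or.inl rfl, Or.inr hadj.symm⟩
          · exact ⟨Or.inr hadj, Or.inl rfl⟩
      rw [e0, card_insert_of_notMem (by simpa using hadj.ne), card_singleton] at pij
      rw [hj1] at pj; rw [hi4] at pi
      push_cast at pj pi pij
      have ex : x i = 2 * x j := by
        nlinarith [sq_nonneg (x i - 2 * x j), sq_nonneg (y i - 2 * y j)]
      have ey : y i = 2 * y j := by
        nlinarith [sq_nonneg (x i - 2 * x j), sq_nonneg (y i - 2 * y j)]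
      have dbl : ∀ z, z ≠ i → z ≠ j → (closedNbhd G z ∩ closedNbhd G i).card
          = 2 * (closedNbhd G z ∩ closedNbhd G j).card := by
        intro z hzi hzj
        have e1 := h.inter z i hzi
        have e2 := h.inter z j hzj
        rw [ex, ey] at e1
        have : ((closedNbhd G z ∩ closedNbhd G i).card : ℝ)
          = 2 * (closedNbhd G z ∩ closedNbhd G j).card := by rw [← e1, ← e2]; ring
        exact_mod_cast this
      have sub : ∀ z, z ≠ i → z ≠ j → closedNbhd G z ∩ closedNbhd G j ⊆ {i} := by
        intro z hzi hzj u
        simp only [mem_inter, mem_closedNbhd, mem_singleton]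
        rintro ⟨h1, rfl | h2⟩
        · rcases h1 with h1 | h1
          · exact absurd h1.symm hzj
          · exact absurd (nj z h1.symm) hzi
        · exact nj u h2
      by_cases hmi' : G.Adj m i
      · have d1 := dbl l hil.ne' hlj
        have c1 : (closedNbhd G l ∩ closedNbhd G j).card ≤ 1 := card_le_card (sub l hil.ne' hlj)
        have c2 : ({i, l, m} : Finset V) ⊆ closedNbhd G l ∩ closedNbhd G i := by
          intro z
          simp only [mem_inter, mem_closedNbhd, mem_insert, mem_singleton]
          rintro (rfl | rfl | rfl)
          · exact ⟨Or.inr hil.symm, Or.inl rfl⟩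
          · exact ⟨Or.inl rfl, Or.inr hil⟩
          · exact ⟨Or.inr hlm, Or.inr hmi'.symm⟩
        have c3 := card_le_card c2
        rw [card_insert_of_notMem (by simp [hil.ne, Ne.symm hmi]),
          card_insert_of_notMem (by simpa using hlm.ne), card_singleton] at c3
        omega
      · have d1 := dbl m hmi hmj
        have c1 : closedNbhd G m ∩ closedNbhd G j = ∅ := by
          rw [eq_empty_iff_forall_notMem]
          intro u hu
          have := sub m hmi hmj hu
          rw [mem_singleton] at this
          subst this
          have := (mem_inter.1 hu).1
          rw [mem_closedNbhd] at this
          rcases this with h' | h'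
          · exact hmi h'.symm
          · exact hmi' h'
        have c2 := inter_pos (G := G) (v := m) (w := i) (z := l) (by simp [hlm.symm])
          (by simp [hil])
        rw [c1, card_empty] at d1
        omega
    refine ⟨i, hi, G.neighborFinset i, ?_, ?_, by simp, ?_, by simp, ?_⟩
    · intro v hv; exact hcl i hi v (by simpa using hv)
    · rw [SimpleGraph.card_neighborFinset_eq_degree, hi4]
    · intro z hz
      by_contra hc
      push Not at hc
      simp only [SimpleGraph.mem_neighborFinset] at hc
      have h1 := hcommon z hz hc.1
      have h2 : (0 : ℝ) < G.degree z * G.degree i := by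
        have := degree_pos' hiso z
        have := degree_pos' hiso i
        positivity
      have h3 : closedNbhd G z ∩ closedNbhd G i ≠ ∅ := by
        intro e; rw [e, card_empty] at h1; norm_num at h1; rcases h1 with h1 | h1 <;>
          simp [h1] at h2
      obtain ⟨u, hu⟩ := nonempty_iff_ne_empty.2 h3
      simp only [mem_inter, mem_closedNbhd] at hu
      obtain ⟨h4, h5 | h5⟩ := hu
      · subst h5
        rcases h4 with h4 | h4
        · exact hc.1 h4.symm
        · exact hc.2 h4.symm
      · rcases h4 with h4 | h4
        · exact hc.2 (h4 ▸ h5)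
        · exact hc.1 (key u h5 z h4.symm)
    · intro v hv w hw hvw
      simp only [SimpleGraph.mem_neighborFinset] at hv hw
      exact hw.ne' (key v hv w hvw)

end IsGram
end ConnectedGram

/-! ### Two disjoint closed neighbourhoods: orthogonal coordinates -/

section Opposite
open scoped Classical
variable {V : Type*} [Fintype V] {G : SimpleGraph V} {x y : V → ℝ}

/-- The number of common elements of two closed neighbourhoods. -/
noncomputable def common (G : SimpleGraph V) (v w : V) : ℕ :=
  (closedNbhd G v ∩ closedNbhd G w).card

lemma common_le (v w : V) : common G v w ≤ G.degree w + 1 := by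
  rw [← card_closedNbhd]; exact card_le_card inter_subset_right

lemma two_le_common {v w : V} (hvw : G.Adj v w) : 2 ≤ common G v w := by
  have : ({v, w} : Finset V) ⊆ closedNbhd G v ∩ closedNbhd G w := by
    intro z
    simp only [mem_insert, mem_singleton, mem_inter, mem_closedNbhd]
    rintro (rfl | rfl)
    · exact ⟨Or.inl rfl, Or.inr hvw.symm⟩
    · exact ⟨Or.inr hvw, Or.inl rfl⟩
  have h2 := card_le_card this
  rwa [card_pair hvw.ne] at h2

lemma subset_of_common_eq {v w : V} (h : common G v w = G.degree w + 1) :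
    closedNbhd G w ⊆ closedNbhd G v := by
  have : closedNbhd G v ∩ closedNbhd G w = closedNbhd G w :=
    eq_of_subset_of_card_le inter_subset_right (by rw [card_closedNbhd, ← h, common])
  rw [← this]; exact inter_subset_left

lemma common_le_degree {v w : V} (hvw : v ≠ w) (h : ¬ G.Adj v w) : common G v w ≤ G.degree w := by
  by_contra hc
  have h1 := common_le (G := G) v w
  have h2 := subset_of_common_eq (G := G) (v := v) (w := w) (by omega) (self_mem_closedNbhd w)
  rcases mem_closedNbhd.1 h2 with h2 | h2
  · exact hvw h2.symm
  · exact h h2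

/-- The vertex `w` itself is not in the closed neighbourhood of `v`, so a common part of size `deg
w` consists of all neighbours of `w`. -/
lemma mem_of_common_eq {v w : V} (hvw : v ≠ w) (h : ¬ G.Adj v w)
    (hc : common G v w = G.degree w) {z : V} (hz : G.Adj w z) : z ∈ closedNbhd G v := by
  have h1 : closedNbhd G v ∩ closedNbhd G w ⊆ (closedNbhd G w).erase w := by
    intro z hz
    rw [mem_inter] at hz
    refine mem_erase.2 ⟨?_, hz.2⟩
    rintro rfl
    rcases mem_closedNbhd.1 hz.1 with h2 | h2
    · exact hvw h2.symm
    · exact h h2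
  have h2 := eq_of_subset_of_card_le h1 (by
    rw [card_erase_of_mem (self_mem_closedNbhd w), card_closedNbhd]
    unfold common at hc; omega)
  have h3 : z ∈ (closedNbhd G w).erase w := by simp [hz, hz.ne']
  rw [← h2] at h3
  exact (mem_inter.1 h3).1

/-- In the plane, the expansion with respect to two orthogonal vectors. -/
lemma plane_expand {a b c d : ℝ} (ho : a * c + b * d = 0) (h0 : a * a + b * b ≠ 0)
    (h1 : c * c + d * d ≠ 0) (e f : ℝ) :
    e = (e * a + f * b) / (a * a + b * b) * a + (e * c + f * d) / (c * c + d * d) * c ∧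
    f = (e * a + f * b) / (a * a + b * b) * b + (e * c + f * d) / (c * c + d * d) * d := by
  obtain ⟨l, hc, hd⟩ : ∃ l, c = -l * b ∧ d = l * a := by
    refine ⟨(a * d - b * c) / (a * a + b * b), ?_, ?_⟩
    · rw [neg_mul, div_mul_eq_mul_div, ← neg_div, eq_div_iff h0]; linear_combination a * ho
    · rw [div_mul_eq_mul_div, eq_div_iff h0]; linear_combination b * ho
  subst hc hd
  have hl : l ≠ 0 := by rintro rfl; exact h1 (by ring)
  have e1 : -l * b * (-l * b) + l * a * (l * a) = l * l * (a * a + b * b) := by ring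
  rw [e1]
  generalize hn : a * a + b * b = n at h0
  constructor
  · field_simp; rw [← hn]; ring
  · field_simp; rw [← hn]; ring

/-- Two vertices with disjoint closed neighbourhoods. -/
structure IsOpposite (G : SimpleGraph V) (x y : V → ℝ) (o t : V) : Prop
    extends IsConnGram G x y where
  disj : closedNbhd G o ∩ closedNbhd G t = ∅

/-- The vertices not adjacent to `o` that have the same vector. -/
noncomputable def twins (G : SimpleGraph V) (x y : V → ℝ) (o : V) : Finset V :=
  univ.filter fun z => z ≠ o ∧ SameVec x y o z ∧ ¬ G.Adj o z

/-- The vertices adjacent to neither `o` nor `t` whose vector is the sum of those of `o`, `t`. -/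
noncomputable def mids (G : SimpleGraph V) (x y : V → ℝ) (o t : V) : Finset V :=
  univ.filter fun z => ¬ G.Adj o z ∧ ¬ G.Adj t z ∧ x z = x o + x t ∧ y z = y o + y t

lemma mids_comm (o t : V) : mids G x y o t = mids G x y t o := by
  ext z; simp only [mids, mem_filter, mem_univ, true_and, add_comm]; tauto

namespace IsOpposite

variable {o t : V}

lemma symm (h : IsOpposite G x y o t) : IsOpposite G x y t o :=
  { h.toIsConnGram with disj := by rw [inter_comm]; exact h.disj }

lemma notMem (h : IsOpposite G x y o t) {z : V} (hz : z ∈ closedNbhd G o) :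
    z ∉ closedNbhd G t := fun hz' => by
  have : z ∈ closedNbhd G o ∩ closedNbhd G t := mem_inter.2 ⟨hz, hz'⟩
  rw [h.disj] at this; simp at this

lemma ne (h : IsOpposite G x y o t) : o ≠ t := by
  rintro rfl; exact h.notMem (self_mem_closedNbhd o) (self_mem_closedNbhd o)

lemma not_adj (h : IsOpposite G x y o t) : ¬ G.Adj o t := fun hh =>
  h.notMem (by simp [hh]) (self_mem_closedNbhd t)

lemma nbr (h : IsOpposite G x y o t) {j : V} (hj : G.Adj o j) :
    j ≠ o ∧ j ≠ t ∧ ¬ G.Adj j t ∧ ¬ G.Adj t j := by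
  have := h.notMem (z := j) (by simp [hj])
  rw [mem_closedNbhd, not_or] at this
  exact ⟨hj.ne', this.1, fun e => this.2 e.symm, this.2⟩

lemma ip_zero (h : IsOpposite G x y o t) : x o * x t + y o * y t = 0 := by
  rw [h.inter o t h.ne, h.disj]; simp

lemma deg_pos (h : IsOpposite G x y o t) : 0 < G.degree o :=
  IsGram.degree_pos' h.not_isolated o

lemma norm_ne (h : IsOpposite G x y o t) : x o * x o + y o * y o ≠ 0 := by
  rw [h.self_eq_degree]; exact_mod_cast h.deg_pos.ne'

lemma not_same (h : IsOpposite G x y o t) : ¬ SameVec x y o t := fun hs => by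
  have := h.ip_zero
  rw [← hs.1, ← hs.2] at this
  exact h.norm_ne this

lemma inter' (h : IsOpposite G x y o t) {v w : V} (hvw : v ≠ w) :
    x v * x w + y v * y w = common G v w := h.inter v w hvw

/-- This is Parseval's identity in the orthogonal basis formed by the vectors of `o` and `t`, with
denominators cleared. Up to scaling, the coordinates of a vertex are its common counts with `o` and
with `t`. -/
lemma common_mul (h : IsOpposite G x y o t) {j l : V} (jo : j ≠ o) (jt : j ≠ t) (lo : l ≠ o)
    (lt : l ≠ t) (jl : j ≠ l) :
    G.degree o * G.degree t * common G j l
      = common G j o * common G l o * G.degree t + common G j t * common G l t * G.degree o := by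
  have := plane_parseval h.ip_zero h.norm_ne (e := x j) (f := y j) (g := x l) (h := y l)
  rw [h.inter' jo, h.inter' jt, h.inter' lo, h.inter' lt, h.inter' jl, h.self_eq_degree,
    h.self_eq_degree] at this
  have h2 : (G.degree o * G.degree t * common G j l : ℝ)
    = common G j o * common G l o * G.degree t + common G j t * common G l t * G.degree o := by
    linarith
  exact_mod_cast h2

lemma degree_mul (h : IsOpposite G x y o t) {j : V} (jo : j ≠ o) (jt : j ≠ t) :
    G.degree o * G.degree t * G.degree j
      = common G j o * common G j o * G.degree t + common G j t * common G j t * G.degree o := by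
  have := plane_parseval h.ip_zero h.norm_ne (e := x j) (f := y j) (g := x j) (h := y j)
  rw [h.inter' jo, h.inter' jt, h.self_eq_degree, h.self_eq_degree, h.self_eq_degree] at this
  have h2 : (G.degree o * G.degree t * G.degree j : ℝ)
    = common G j o * common G j o * G.degree t + common G j t * common G j t * G.degree o := by
    linarith
  exact_mod_cast h2

lemma same_of_common (h : IsOpposite G x y o t) {j l : V} (jo : j ≠ o) (jt : j ≠ t) (lo : l ≠ o)
    (lt : l ≠ t) (h1 : common G j o = common G l o) (h2 : common G j t = common G l t) :
    SameVec x y j l := by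
  have e1 := h.inter' jo
  have e2 := h.inter' lo
  have e3 := h.inter' jt
  have e4 := h.inter' lt
  have := plane_parseval h.ip_zero h.norm_ne (e := x j - x l) (f := y j - y l) (g := x j - x l)
    (h := y j - y l)
  have z1 : (x j - x l) * x o + (y j - y l) * y o = 0 := by rw [h1] at e1; linarith
  have z2 : (x j - x l) * x t + (y j - y l) * y t = 0 := by rw [h2] at e3; linarith
  rw [z1, z2] at this
  simp only [mul_zero, add_zero] at this
  have h3 : (x j - x l) * (x j - x l) + (y j - y l) * (y j - y l) = 0 := by
    rcases mul_eq_zero.1 this.symm with h4 | h4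
    · rcases mul_eq_zero.1 h4 with h4 | h4
      · exact absurd h4 h.norm_ne
      · exact absurd h4 h.symm.norm_ne
    · exact h4
  constructor <;> nlinarith [mul_self_nonneg (x j - x l), mul_self_nonneg (y j - y l)]

/-- In the plane, a vector orthogonal to that of `t` is parallel to that of `o`, and parallel
vectors are equal here. -/
lemma same_of_common_eq_zero (h : IsOpposite G x y o t) {j : V} (jt : j ≠ t)
    (hq : common G j t = 0) : SameVec x y o j := by
  refine h.same_of_parallel _ _ ?_
  have e := h.inter' jt
  rw [hq] at e
  push_cast at e
  have e2 := h.ip_zero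
  have e3 : (x o * y j - x j * y o) * (x t * x t + y t * y t) = 0 := by
    linear_combination (y j * x t - x j * y t) * e2 + (x o * y t - y o * x t) * e
  rcases mul_eq_zero.1 e3 with h4 | h4
  · linarith
  · exact absurd h4 h.symm.norm_ne

lemma common_eq_zero_of_same (h : IsOpposite G x y o t) {j : V} (jt : j ≠ t)
    (hs : SameVec x y o j) : common G j t = 0 := by
  have e := h.inter' jt
  rw [← hs.1, ← hs.2, h.ip_zero] at e
  exact_mod_cast e.symm

lemma mem_twins {z : V} : z ∈ twins G x y o ↔ z ≠ o ∧ SameVec x y o z ∧ ¬ G.Adj o z := by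
  simp [twins]

lemma mem_mids {z : V} : z ∈ mids G x y o t ↔
    ¬ G.Adj o z ∧ ¬ G.Adj t z ∧ x z = x o + x t ∧ y z = y o + y t := by simp [mids]

lemma adj_twin (h : IsOpposite G x y o t) {z : V} (hz : z ∈ twins G x y o) (v : V) :
    G.Adj z v ↔ G.Adj o v := by
  rw [mem_twins] at hz
  exact (h.adj_iff_of_twin hz.1.symm hz.2.1 hz.2.2 v).symm

lemma twin_ne (h : IsOpposite G x y o t) {z : V} (hz : z ∈ twins G x y o) :
    z ∉ closedNbhd G o ∧ z ∉ closedNbhd G t ∧ z ∉ twins G x y t ∧ z ∉ mids G x y o t := by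
  have hz' := mem_twins.1 hz
  refine ⟨by simp [hz'.1, hz'.2.2], ?_, ?_, ?_⟩
  · rw [mem_closedNbhd, not_or]
    refine ⟨?_, fun hh => h.not_adj ((h.adj_twin hz t).1 hh.symm)⟩
    rintro rfl
    exact h.not_same hz'.2.1
  · intro hh
    exact h.not_same (hz'.2.1.trans (mem_twins.1 hh).2.1.symm)
  · intro hh
    obtain ⟨-, -, e1, e2⟩ := mem_mids.1 hh
    rw [← hz'.2.1.1] at e1
    rw [← hz'.2.1.2] at e2
    refine h.symm.norm_ne ?_
    have e1' : x t = 0 := by linarith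
    have e2' : y t = 0 := by linarith
    rw [e1', e2']; ring

lemma mid_ne (h : IsOpposite G x y o t) {z : V} (hz : z ∈ mids G x y o t) :
    z ≠ o ∧ z ≠ t ∧ z ∉ closedNbhd G o ∧ z ∉ closedNbhd G t := by
  have hz' := mem_mids.1 hz
  have z1 : z ≠ o := by
    rintro rfl
    obtain ⟨-, -, e1, e2⟩ := hz'
    refine h.symm.norm_ne ?_
    have e1' : x t = 0 := by linarith
    have e2' : y t = 0 := by linarith
    rw [e1', e2']; ring
  have z2 : z ≠ t := by
    rintro rfl
    obtain ⟨-, -, e1, e2⟩ := hz'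
    refine h.norm_ne ?_
    have e1' : x o = 0 := by linarith
    have e2' : y o = 0 := by linarith
    rw [e1', e2']; ring
  exact ⟨z1, z2, by simp [z1, hz'.1], by simp [z2, hz'.2.1]⟩

lemma adj_mid (h : IsOpposite G x y o t) {z : V} (hz : z ∈ mids G x y o t) (v : V) :
    G.Adj z v ↔ G.Adj o v ∨ G.Adj t v := by
  have hz' := mem_mids.1 hz
  have hn := h.mid_ne hz
  exact (h.between h.not_isolated one_pos one_pos (by linarith [hz'.2.2.1])
    (by linarith [hz'.2.2.2]) hn.1.symm hn.2.1 h.not_same (fun e => hz'.1 e.symm)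
    (fun e => hz'.2.1 e.symm)).2.2.2 v

/-- Expand the vector of `z` in the basis `o`, `t`. If a coordinate vanishes, `z` has the vector of
`o` or of `t`. If both are positive, `z` lies strictly between them, and `IsGram.between` forces
both coefficients to be `1`. -/
lemma far_cases (h : IsOpposite G x y o t) {z : V} (ho : z ∉ closedNbhd G o)
    (ht : z ∉ closedNbhd G t) :
    z ∈ twins G x y o ∨ z ∈ twins G x y t ∨ z ∈ mids G x y o t := by
  rw [mem_closedNbhd, not_or] at ho ht
  by_cases hq : common G z t = 0
  · exact Or.inl (mem_twins.2 ⟨ho.1, h.same_of_common_eq_zero ht.1 hq, ho.2⟩)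
  by_cases hp : common G z o = 0
  · exact Or.inr (Or.inl (mem_twins.2 ⟨ht.1, h.symm.same_of_common_eq_zero ho.1 hp, ht.2⟩))
  obtain ⟨e1, e2⟩ := plane_expand h.ip_zero h.norm_ne h.symm.norm_ne (x z) (y z)
  rw [h.inter' ho.1, h.inter' ht.1, h.self_eq_degree, h.self_eq_degree] at e1 e2
  have d1 := h.deg_pos
  have d2 := h.symm.deg_pos
  obtain ⟨a1, b1, -, -⟩ := h.between h.not_isolated
    (α := (common G z o : ℝ) / G.degree o) (β := (common G z t : ℝ) / G.degree t)
    (by have := Nat.pos_of_ne_zero hp; positivity) (by have := Nat.pos_of_ne_zero hq; positivity)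
    e1 e2 (Ne.symm ho.1) ht.1 h.not_same (fun e => ho.2 e.symm) (fun e => ht.2 e.symm)
  rw [a1, b1] at e1 e2
  exact Or.inr (Or.inr (mem_mids.2 ⟨ho.2, ht.2, by linarith, by linarith⟩))

lemma card_split (h : IsOpposite G x y o t) (S : Finset V) :
    S.card = (S ∩ closedNbhd G o).card + (S ∩ closedNbhd G t).card + (S ∩ twins G x y o).card
      + (S ∩ twins G x y t).card + (S ∩ mids G x y o t).card := by
  simp_rw [← filter_mem_eq_inter, card_filter, ← sum_add_distrib]
  rw [card_eq_sum_ones]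
  refine sum_congr rfl fun z _ => ?_
  by_cases h1 : z ∈ closedNbhd G o
  · have h2 := h.notMem h1
    have h3 : z ∉ twins G x y o := fun hh => (h.twin_ne hh).1 h1
    have h4 : z ∉ twins G x y t := fun hh => (h.symm.twin_ne hh).2.1 h1
    have h5 : z ∉ mids G x y o t := fun hh => (h.mid_ne hh).2.2.1 h1
    simp [h1, h2, h3, h4, h5]
  by_cases h2 : z ∈ closedNbhd G t
  · have h3 : z ∉ twins G x y o := fun hh => (h.twin_ne hh).2.1 h2
    have h4 : z ∉ twins G x y t := fun hh => (h.symm.twin_ne hh).1 h2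
    have h5 : z ∉ mids G x y o t := fun hh => (h.mid_ne hh).2.2.2 h2
    simp [h1, h2, h3, h4, h5]
  by_cases h3 : z ∈ twins G x y o
  · obtain ⟨-, -, h4, h5⟩ := h.twin_ne h3
    simp [h1, h2, h3, h4, h5]
  by_cases h4 : z ∈ twins G x y t
  · obtain ⟨-, -, -, h5⟩ := h.symm.twin_ne h4
    rw [mids_comm] at h5
    simp [h1, h2, h3, h4, h5]
  have h5 : z ∈ mids G x y o t := by
    rcases h.far_cases h1 h2 with h' | h' | h'
    · exact absurd h' h3
    · exact absurd h' h4
    · exact h'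
  simp [h1, h2, h3, h4, h5]

lemma twins_subset (h : IsOpposite G x y o t) {j : V} (hj : G.Adj o j) :
    twins G x y o ⊆ closedNbhd G j := fun z hz => by
  rw [mem_closedNbhd]; exact Or.inr ((h.adj_twin hz j).2 hj).symm

lemma mids_subset (h : IsOpposite G x y o t) {j : V} (hj : G.Adj o j) :
    mids G x y o t ⊆ closedNbhd G j := fun z hz => by
  rw [mem_closedNbhd]; exact Or.inr ((h.adj_mid hz j).2 (Or.inl hj)).symm

lemma inter_twins (h : IsOpposite G x y o t) {j : V} (hj : G.Adj o j) :
    closedNbhd G j ∩ twins G x y t = ∅ := by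
  rw [eq_empty_iff_forall_notMem]
  intro z hz
  rw [mem_inter, mem_closedNbhd] at hz
  rcases hz with ⟨rfl | h1, h2⟩
  · exact (h.symm.twin_ne h2).2.1 (by simp [hj])
  · exact (h.nbr hj).2.2.2 ((h.symm.adj_twin h2 j).1 h1.symm)

lemma degree_nbr (h : IsOpposite G x y o t) {j : V} (hj : G.Adj o j) :
    G.degree j + 1 = common G j o + common G j t + (twins G x y o).card
      + (mids G x y o t).card := by
  rw [← card_closedNbhd, h.card_split (closedNbhd G j), h.inter_twins hj,
    inter_eq_right.2 (h.twins_subset hj), inter_eq_right.2 (h.mids_subset hj)]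
  simp [common]

/-- The main equation for a neighbour of `o`. -/
lemma nbr_eq (h : IsOpposite G x y o t) {j : V} (hj : G.Adj o j) :
    (common G j o * (G.degree o - common G j o) * G.degree t
      + common G j t * (G.degree t - common G j t) * G.degree o : ℤ)
      = (1 - (twins G x y o).card - (mids G x y o t).card) * G.degree o * G.degree t := by
  -- Two expressions for the degree of `j` are equated: the squared length from Parseval, and the
  -- count over the five sets into which `o` and `t` divide the vertices.
  have h1 := h.degree_mul (h.nbr hj).1 (h.nbr hj).2.1
  have h2 := h.degree_nbr hj
  zify at h1 h2
  have h3 : (G.degree j : ℤ) = common G j o + common G j t + (twins G x y o).card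
      + (mids G x y o t).card - 1 := by linarith
  rw [h3] at h1
  linarith

lemma common_nbr_le (h : IsOpposite G x y o t) {j : V} (hj : G.Adj o j) :
    common G j t ≤ G.degree t :=
  common_le_degree (h.nbr hj).2.1 (h.nbr hj).2.2.1

lemma exists_nbr (h : IsOpposite G x y o t) : ∃ j, G.Adj o j ∧ ¬ SameVec x y o j := by
  by_contra hc
  push Not at hc
  exact h.not_same (h.same_of_nbhd_same h.preconnected hc t)

lemma common_pos (h : IsOpposite G x y o t) {j : V} (hj : G.Adj o j) (hs : ¬ SameVec x y o j) :
    0 < common G j t :=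
  Nat.pos_of_ne_zero fun e => hs (h.same_of_common_eq_zero (h.nbr hj).2.1 e)

/-- Twins of `o` see no neighbour of `t` and conversely, while the vertices with the sum vector see
all neighbours of both. -/
lemma card_inter_nbr (h : IsOpposite G x y o t) {j l : V} (hj : G.Adj o j) (hl : G.Adj t l) :
    common G j l = ((closedNbhd G j ∩ closedNbhd G l) ∩ closedNbhd G o).card
      + ((closedNbhd G j ∩ closedNbhd G l) ∩ closedNbhd G t).card + (mids G x y o t).card := by
  rw [common, h.card_split (closedNbhd G j ∩ closedNbhd G l)]
  have e1 : (closedNbhd G j ∩ closedNbhd G l) ∩ twins G x y o = ∅ := by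
    rw [inter_assoc, h.symm.inter_twins hl, inter_empty]
  have e2 : (closedNbhd G j ∩ closedNbhd G l) ∩ twins G x y t = ∅ := by
    rw [inter_comm (closedNbhd G j), inter_assoc, h.inter_twins hj, inter_empty]
  have e3 : (closedNbhd G j ∩ closedNbhd G l) ∩ mids G x y o t = mids G x y o t := by
    refine inter_eq_right.2 (subset_inter (h.mids_subset hj) ?_)
    rw [mids_comm]; exact h.symm.mids_subset hl
  rw [e1, e2, e3]; simp

end IsOpposite
end Opposite

/-! ### Opposite vertices, each with a neighbour joined to its whole neighbourhood -/

/-- The relations between the blocks of `G₁₁` and `G₁₂`. -/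
def kappaOpp (a b c : BlockRel) : Fin 5 → Fin 5 → BlockRel :=
  ![![.none, .none, .none, .all, .none], ![.none, .none, .none, .none, .all],
    ![.none, .none, .none, .all, .all], ![.all, .none, .all, a, b],
    ![.none, .all, .all, b, c]]

section BothFull
open scoped Classical
variable {V : Type*} [Fintype V] {G : SimpleGraph V} {x y : V → ℝ}

/-- This is the main equation for a neighbour `j` of `o` joined to all of the neighbourhood of `o`,
when `o` and `t` both have degree `d`; `q` is the common count of `j` with `t`, and `N` counts the
twins and the vertices with the sum vector. For `N = 0` it says `d (q - 2) = q² + 1`, so `q - 2`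
divides `5`; for `N = 1`, `q - 1` divides `2`; larger `N` leave almost nothing, by sign. -/
lemma full_arith {d q N : ℤ} (hd : 0 < d) (hq : 1 ≤ q) (hqd : q ≤ d) (hN : 0 ≤ N)
    (e : q * (d - q) = (2 - N) * d + 1) :
    (d = 1 ∧ N = 3 ∧ q = 1) ∨ (d = 2 ∧ N = 2 ∧ q = 1) ∨ (d = 5 ∧ N = 1 ∧ (q = 2 ∨ q = 3)) ∨
      (d = 10 ∧ N = 0 ∧ (q = 3 ∨ q = 7)) := by
  have h0 : 0 ≤ q * (d - q) := mul_nonneg (by linarith) (by linarith)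
  have hN4 : N < 4 := by
    by_contra hc
    nlinarith
  obtain rfl | rfl | rfl | rfl : N = 0 ∨ N = 1 ∨ N = 2 ∨ N = 3 := by omega
  · have e1 : d * (q - 2) = q ^ 2 + 1 := by linarith
    have q2 : 0 < q - 2 := by
      by_contra hc
      nlinarith [sq_nonneg q]
    have h5 : (q - 2) ∣ 5 := ⟨d - q - 2, by linear_combination -e1⟩
    have := Int.le_of_dvd (by norm_num) h5
    obtain rfl | rfl | rfl | rfl | rfl : q = 3 ∨ q = 4 ∨ q = 5 ∨ q = 6 ∨ q = 7 := by omega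
    all_goals omega
  · have e1 : d * (q - 1) = q ^ 2 + 1 := by linarith
    have q2 : 0 < q - 1 := by
      by_contra hc
      nlinarith [sq_nonneg q]
    have h5 : (q - 1) ∣ 2 := ⟨d - q - 1, by linear_combination -e1⟩
    have := Int.le_of_dvd (by norm_num) h5
    obtain rfl | rfl : q = 2 ∨ q = 3 := by omega
    all_goals omega
  · have e1 : q * (d - q) = 1 := by linarith
    rcases Int.mul_eq_one_iff_eq_one_or_neg_one.1 e1 with h | h <;> omega
  · have : d = 1 := by nlinarith
    omega

namespace IsOpposite

variable {o t : V}

lemma exists_cl (_ : IsOpposite G x y o t) {v : V} (hv : v ∈ insert o (twins G x y o)) :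
    v = o ∨ v ∈ twins G x y o := by simpa using hv

lemma adj_cl (h : IsOpposite G x y o t) {v : V} (hv : v ∈ insert o (twins G x y o)) (w : V) :
    G.Adj v w ↔ G.Adj o w := by
  rcases h.exists_cl hv with rfl | hv
  · rfl
  · exact h.adj_twin hv w

lemma cl_far (h : IsOpposite G x y o t) {v : V} (hv : v ∈ insert o (twins G x y o)) :
    ¬ G.Adj o v ∧ v ∉ closedNbhd G t ∧ v ∉ insert t (twins G x y t) ∧ v ∉ mids G x y o t := by
  rcases h.exists_cl hv with rfl | hv
  · refine ⟨by simp, h.notMem (self_mem_closedNbhd _), ?_, ?_⟩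
    · rw [mem_insert, not_or]
      exact ⟨h.ne, fun hh => (h.symm.twin_ne hh).2.1 (self_mem_closedNbhd _)⟩
    · exact fun hh => (h.mid_ne hh).1 rfl
  · have := h.twin_ne hv
    refine ⟨fun hh => this.1 (by simp [hh]), this.2.1, ?_, this.2.2.2⟩
    rw [mem_insert, not_or]
    refine ⟨?_, this.2.2.1⟩
    rintro rfl
    exact this.2.1 (self_mem_closedNbhd _)

lemma card_cl (_ : IsOpposite G x y o t) :
    (insert o (twins G x y o)).card = (twins G x y o).card + 1 :=
  card_insert_of_notMem (by simp [mem_twins])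

lemma cover (h : IsOpposite G x y o t) (v : V) :
    v ∈ insert o (twins G x y o) ∨ v ∈ insert t (twins G x y t) ∨ v ∈ mids G x y o t ∨
      G.Adj o v ∨ G.Adj t v := by
  simp only [mem_insert]
  by_cases h1 : v ∈ closedNbhd G o
  · rw [mem_closedNbhd] at h1; tauto
  by_cases h2 : v ∈ closedNbhd G t
  · rw [mem_closedNbhd] at h2; tauto
  have := h.far_cases h1 h2
  tauto

/-- Neighbours of `o` are determined by their closed neighbourhoods within those of `o`, `t`. -/
lemma nbr_ext (h : IsOpposite G x y o t) {j l : V} (hj : G.Adj o j) (hl : G.Adj o l)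
    (h1 : closedNbhd G j ∩ closedNbhd G o = closedNbhd G l ∩ closedNbhd G o)
    (h2 : closedNbhd G j ∩ closedNbhd G t = closedNbhd G l ∩ closedNbhd G t) : j = l := by
  refine h.closedNbhd_injective ?_
  ext z
  by_cases z1 : z ∈ closedNbhd G o
  · have := congrArg (z ∈ ·) h1
    simpa [z1, mem_inter, -mem_closedNbhd] using this
  by_cases z2 : z ∈ closedNbhd G t
  · have := congrArg (z ∈ ·) h2
    simpa [z2, mem_inter, -mem_closedNbhd] using this
  have aux : ∀ j, G.Adj o j → z ∈ twins G x y t → z ∉ closedNbhd G j := by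
    intro j hj hz hzj
    have : z ∈ closedNbhd G j ∩ twins G x y t := mem_inter.2 ⟨hzj, hz⟩
    rw [h.inter_twins hj] at this
    simp at this
  rcases h.far_cases z1 z2 with hz | hz | hz
  · exact iff_of_true (h.twins_subset hj hz) (h.twins_subset hl hz)
  · exact iff_of_false (aux j hj hz) (aux l hl hz)
  · exact iff_of_true (h.mids_subset hj hz) (h.mids_subset hl hz)

lemma common_of_same (h : IsOpposite G x y o t) {j : V} (hj : j ≠ o) (hs : SameVec x y o j) :
    common G j o = G.degree o := by
  have e := h.inter' hj
  rw [← hs.1, ← hs.2, h.self_eq_degree] at e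
  exact_mod_cast e.symm

lemma ne_nbr (h : IsOpposite G x y o t) {j l : V} (hj : G.Adj o j) (hl : G.Adj t l) : j ≠ l := by
  rintro rfl
  exact (h.nbr hj).2.2.2 hl

lemma full_pos (h : IsOpposite G x y o t) {j : V} (hj : G.Adj o j)
    (hB : common G j o = G.degree o + 1) : 0 < common G j t := by
  refine h.common_pos hj fun hs => ?_
  have := h.common_of_same hj.ne' hs
  omega

/-- A common count of `d + 1` contributes `-(d + 1) D` to the main equation, where `d` and `D` are
the degrees of `o` and `t`. Modulo `d` this yields `d ∣ D`, and by symmetry `D ∣ d`. -/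
lemma full_degree_eq (h : IsOpposite G x y o t) {j l : V} (hj : G.Adj o j)
    (hjB : common G j o = G.degree o + 1) (hl : G.Adj t l)
    (hlB : common G l t = G.degree t + 1) : G.degree o = G.degree t := by
  have e1 := h.nbr_eq hj
  have e2 := h.symm.nbr_eq hl
  rw [hjB] at e1
  rw [hlB] at e2
  refine Nat.dvd_antisymm ?_ ?_
  · zify
    have : (G.degree o : ℤ) ∣ G.degree t * 1 := by
      refine (Int.dvd_iff_dvd_of_dvd_sub ?_).1 (dvd_zero _)
      push_cast at e1
      exact ⟨-(common G j t * (G.degree t - common G j t) - G.degree t *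
        (2 - (twins G x y o).card - (mids G x y o t).card)), by linear_combination e1⟩
    simpa using this
  · zify
    have : (G.degree t : ℤ) ∣ G.degree o * 1 := by
      refine (Int.dvd_iff_dvd_of_dvd_sub ?_).1 (dvd_zero _)
      push_cast at e2
      exact ⟨-(common G l o * (G.degree o - common G l o) - G.degree o *
        (2 - (twins G x y t).card - (mids G x y t o).card)), by linear_combination e2⟩
    simpa using this

lemma full_cases (h : IsOpposite G x y o t) {j : V} (hj : G.Adj o j)
    (hjB : common G j o = G.degree o + 1) (hd : G.degree o = G.degree t) :
    (G.degree o = 1 ∧ (twins G x y o).card + (mids G x y o t).card = 3 ∧ common G j t = 1) ∨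
    (G.degree o = 2 ∧ (twins G x y o).card + (mids G x y o t).card = 2 ∧ common G j t = 1) ∨
    (G.degree o = 5 ∧ (twins G x y o).card + (mids G x y o t).card = 1 ∧
      (common G j t = 2 ∨ common G j t = 3)) ∨
    (G.degree o = 10 ∧ (twins G x y o).card + (mids G x y o t).card = 0 ∧
      (common G j t = 3 ∨ common G j t = 7)) := by
  have e1 := h.nbr_eq hj
  have hp := h.deg_pos
  have hq := h.full_pos hj hjB
  have hq' := h.common_nbr_le hj
  rw [hjB, ← hd] at e1
  rw [← hd] at hq'
  have hp' : (G.degree o : ℤ) ≠ 0 := by exact_mod_cast hp.ne'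
  push_cast at e1
  have e2 : (common G j t : ℤ) * (G.degree o - common G j t)
      = (2 - ((twins G x y o).card + (mids G x y o t).card)) * G.degree o + 1 := by
    refine mul_right_cancel₀ hp' ?_
    linear_combination e1
  have := full_arith (by exact_mod_cast hp) (by exact_mod_cast hq) (by exact_mod_cast hq')
    (by positivity) e2
  omega

/-- Both sides count the edges between the neighbourhoods of `o` and `t`. -/
lemma sum_common (h : IsOpposite G x y o t) :
    ∑ j ∈ G.neighborFinset o, common G j t = ∑ l ∈ G.neighborFinset t, common G l o := by
  have aux : ∀ {o t : V}, IsOpposite G x y o t → ∀ j ∈ G.neighborFinset o, common G j t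
      = ((G.neighborFinset t).filter fun l => G.Adj j l).card := by
    intro o t h j hj
    rw [SimpleGraph.mem_neighborFinset] at hj
    unfold common
    congr 1
    ext l
    simp only [mem_inter, mem_closedNbhd, mem_filter, SimpleGraph.mem_neighborFinset]
    have := h.nbr hj
    constructor
    · rintro ⟨rfl | h1, rfl | h2⟩
      · exact absurd rfl this.2.1
      · exact absurd h2 this.2.2.2
      · exact absurd h1 this.2.2.1
      · exact ⟨h2, h1⟩
    · rintro ⟨h1, h2⟩
      exact ⟨Or.inr h2, Or.inr h1⟩
  rw [sum_congr rfl (aux h), sum_congr rfl (aux h.symm)]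
  have := sum_card_bipartiteAbove_eq_sum_card_bipartiteBelow (s := G.neighborFinset o)
    (t := G.neighborFinset t) (fun j l => G.Adj j l)
  simp only [bipartiteAbove, bipartiteBelow] at this
  rw [this]
  refine sum_congr rfl fun l _ => ?_
  congr 1
  ext j
  simp [G.adj_comm]

/-- The blocks are `o` with its twins, `t` with its twins, the vertices with the sum vector, and the
two neighbourhoods. All relations that involve one of the first three are forced, so only those
within and between the neighbourhoods remain to be supplied. -/
lemma pattern_five (h : IsOpposite G x y o t) {a b c : BlockRel} {f g : ℕ → V}
    (hf : IsEnum f (G.degree o) (G.neighborFinset o))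
    (hg : IsEnum g (G.degree t) (G.neighborFinset t))
    (ha : ∀ k l, k < G.degree o → l < G.degree o → (G.Adj (f k) (f l) ↔ a.Holds k l))
    (hb : ∀ k l, k < G.degree o → l < G.degree t → (G.Adj (f k) (g l) ↔ b.Holds k l))
    (hc : ∀ k l, k < G.degree t → l < G.degree t → (G.Adj (g k) (g l) ↔ c.Holds k l)) :
    HasPattern G ![(twins G x y o).card + 1, (twins G x y t).card + 1, (mids G x y o t).card,
      G.degree o, G.degree t] (kappaOpp a b c) := by
  have : Nonempty V := ⟨o⟩
  obtain ⟨f0, hf0⟩ := IsEnum.exists (insert o (twins G x y o)) h.card_cl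
  obtain ⟨f1, hf1⟩ := IsEnum.exists (insert t (twins G x y t)) h.symm.card_cl
  obtain ⟨f2, hf2⟩ := IsEnum.exists (mids G x y o t) rfl
  have nO : ∀ {v}, v ∈ G.neighborFinset o ↔ G.Adj o v := by simp
  have nT : ∀ {v}, v ∈ G.neighborFinset t ↔ G.Adj t v := by simp
  have k1 := fun v (hv : v ∈ insert o (twins G x y o)) => h.cl_far hv
  have k2 := fun v (hv : v ∈ insert t (twins G x y t)) => h.symm.cl_far hv
  have k3 := fun v (hv : v ∈ mids G x y o t) => h.mid_ne hv
  refine HasPattern.of_enum ![f0, f1, f2, f, g]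
    ![insert o (twins G x y o), insert t (twins G x y t), mids G x y o t, G.neighborFinset o,
      G.neighborFinset t] ?_ ?_ ?_ ?_ ?_
  · intro i
    fin_cases i
    exacts [hf0, hf1, hf2, hf, hg]
  · intro i j
    fin_cases i <;> fin_cases j <;> rfl
  · intro i j hij v
    fin_cases i <;> fin_cases j <;>
      first
      | exact absurd hij (by decide)
      | skip
    · exact fun hv => (k1 v hv).2.2.1
    · exact fun hv => (k1 v hv).2.2.2
    · exact fun hv hv' => (k1 v hv).1 (nO.1 hv')
    · exact fun hv hv' => (k1 v hv).2.1 (mem_closedNbhd.2 (Or.inr (nT.1 hv')))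
    · exact fun hv => by have := (k2 v hv).2.2.2; rwa [mids_comm] at this
    · exact fun hv hv' => (k2 v hv).2.1 (mem_closedNbhd.2 (Or.inr (nO.1 hv')))
    · exact fun hv hv' => (k2 v hv).1 (nT.1 hv')
    · exact fun hv hv' => (k3 v hv).2.2.1 (mem_closedNbhd.2 (Or.inr (nO.1 hv')))
    · exact fun hv hv' => (k3 v hv).2.2.2 (mem_closedNbhd.2 (Or.inr (nT.1 hv')))
    · exact fun hv hv' => (h.nbr (nO.1 hv)).2.2.2 (nT.1 hv')
  · intro v
    rcases h.cover v with hv | hv | hv | hv | hv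
    exacts [⟨0, hv⟩, ⟨1, hv⟩, ⟨2, hv⟩, ⟨3, nO.2 hv⟩, ⟨4, nT.2 hv⟩]
  · intro i j hij k l hk hl hv hw
    fin_cases i <;> fin_cases j <;>
      first
      | exact absurd hij (by decide)
      | skip
    · exact iff_of_false (by rw [h.adj_cl hv]; exact (k1 _ hw).1) id
    · exact iff_of_false (fun e => (k2 _ hw).2.1
        (mem_closedNbhd.2 (Or.inr ((h.adj_cl hv _).1 e)))) id
    · exact iff_of_false (fun e => (k3 _ hw).2.2.1
        (mem_closedNbhd.2 (Or.inr ((h.adj_cl hv _).1 e)))) id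
    · exact iff_of_true ((h.adj_cl hv _).2 (nO.1 hw)) trivial
    · exact iff_of_false (fun e => (h.nbr ((h.adj_cl hv _).1 e)).2.2.2 (nT.1 hw)) id
    · exact iff_of_false (by rw [h.symm.adj_cl hv]; exact (k2 _ hw).1) id
    · exact iff_of_false (fun e => (k3 _ hw).2.2.2
        (mem_closedNbhd.2 (Or.inr ((h.symm.adj_cl hv _).1 e)))) id
    · exact iff_of_false (fun e => (h.nbr (nO.1 hw)).2.2.2 ((h.symm.adj_cl hv _).1 e)) id
    · exact iff_of_true ((h.symm.adj_cl hv _).2 (nT.1 hw)) trivial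
    · refine iff_of_false (fun e => ?_) id
      have := mem_mids.1 hw
      rcases (h.adj_mid hv _).1 e with e | e
      · exact this.1 e
      · exact this.2.1 e
    · exact iff_of_true ((h.adj_mid hv _).2 (Or.inl (nO.1 hw))) trivial
    · exact iff_of_true ((h.adj_mid hv _).2 (Or.inr (nT.1 hw))) trivial
    · exact ha k l hk hl
    · exact hb k l hk hl
    · exact hc k l hk hl

lemma full_one (h : IsOpposite G x y o t) {j l : V} (hj : G.Adj o j)
    (hjB : common G j o = G.degree o + 1) (hl : G.Adj t l)
    (hlB : common G l t = G.degree t + 1) (hd : G.degree o = 1) (hD : G.degree t = 1)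
    (hN : (twins G x y o).card + (mids G x y o t).card = 3)
    (hN' : (twins G x y t).card + (mids G x y o t).card = 3) (hq : common G j t = 1)
    (hp : common G l o = 1) : HasPattern G ![2, 2, 2, 1, 1] (kappaOpp .none .all .none) := by
  have : Nonempty V := ⟨o⟩
  have no : ∀ v, G.Adj o v → v = j := by
    intro v hv
    rw [← SimpleGraph.card_neighborFinset_eq_degree, card_eq_one] at hd
    obtain ⟨u, hu⟩ := hd
    have h1 : v ∈ G.neighborFinset o := by simpa using hv
    have h2 : j ∈ G.neighborFinset o := by simpa using hj
    rw [hu, mem_singleton] at h1 h2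
    rw [h1, h2]
  have nt : ∀ v, G.Adj t v → v = l := by
    intro v hv
    rw [← SimpleGraph.card_neighborFinset_eq_degree, card_eq_one] at hD
    obtain ⟨u, hu⟩ := hD
    have h1 : v ∈ G.neighborFinset t := by simpa using hv
    have h2 : l ∈ G.neighborFinset t := by simpa using hl
    rw [hu, mem_singleton] at h1 h2
    rw [h1, h2]
  have jl := h.ne_nbr hj hl
  have ajl : G.Adj j l := by
    obtain ⟨u, hu⟩ := card_pos.1 (show 0 < (closedNbhd G j ∩ closedNbhd G t).card by
      unfold common at hq; omega)
    simp only [mem_inter, mem_closedNbhd] at hu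
    rcases hu with ⟨h1, rfl | h2⟩
    · rcases h1 with h1 | h1
      · exact absurd h1.symm (h.nbr hj).2.1
      · exact absurd h1 (h.nbr hj).2.2.1
    · rw [nt u h2] at h1
      rcases h1 with h1 | h1
      · exact absurd h1.symm jl
      · exact h1
  -- Parseval gives the value `2 + 2`. Counting the same set directly gives `j`, `l` and the
  -- vertices with the sum vector, so there are two of the latter and one twin on each side.
  have hc : common G j l = 4 := by
    have := h.common_mul (h.nbr hj).1 (h.nbr hj).2.1 (h.symm.nbr hl).2.1 (h.symm.nbr hl).1 jl
    rw [hjB, hlB, hd, hD, hp, hq] at this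
    omega
  have hc2 := h.card_inter_nbr hj hl
  have e1 : closedNbhd G j ∩ closedNbhd G l ∩ closedNbhd G o = {j} := by
    ext z
    simp only [mem_inter, mem_closedNbhd, mem_singleton]
    constructor
    · rintro ⟨⟨-, h1⟩, rfl | h2⟩
      · rcases h1 with h1 | h1
        · exact absurd h1.symm (h.symm.nbr hl).2.1
        · exact absurd h1 (h.symm.nbr hl).2.2.1
      · exact no z h2
    · rintro rfl
      exact ⟨⟨Or.inl rfl, Or.inr ajl.symm⟩, Or.inr hj⟩
  have e2 : closedNbhd G j ∩ closedNbhd G l ∩ closedNbhd G t = {l} := by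
    ext z
    simp only [mem_inter, mem_closedNbhd, mem_singleton]
    constructor
    · rintro ⟨⟨h1, -⟩, rfl | h2⟩
      · rcases h1 with h1 | h1
        · exact absurd h1.symm (h.nbr hj).2.1
        · exact absurd h1 (h.nbr hj).2.2.1
      · exact nt z h2
    · rintro rfl
      exact ⟨⟨Or.inr ajl, Or.inl rfl⟩, Or.inr hl⟩
  rw [e1, e2, hc, card_singleton, card_singleton] at hc2
  have hnO : G.neighborFinset o = {j} := by
    ext v
    simp only [SimpleGraph.mem_neighborFinset, mem_singleton]
    exact ⟨no v, fun e => e ▸ hj⟩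
  have hnT : G.neighborFinset t = {l} := by
    ext v
    simp only [SimpleGraph.mem_neighborFinset, mem_singleton]
    exact ⟨nt v, fun e => e ▸ hl⟩
  have := h.pattern_five (a := .none) (b := .all) (c := .none) (f := fun _ => j) (g := fun _ => l)
    (by rw [hd, hnO]; exact IsEnum.singleton j) (by rw [hD, hnT]; exact IsEnum.singleton l)
    (fun _ _ _ _ => iff_of_false (by simp) id) (fun _ _ _ _ => iff_of_true ajl trivial)
    (fun _ _ _ _ => iff_of_false (by simp) id)
  rwa [hd, hD, show (twins G x y o).card = 1 by omega, show (twins G x y t).card = 1 by omega,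
    show (mids G x y o t).card = 2 by omega] at this

lemma full_two (h : IsOpposite G x y o t) (hd : G.degree o = 2) (hD : G.degree t = 2)
    (hN : (twins G x y o).card + (mids G x y o t).card = 2)
    (hN' : (twins G x y t).card + (mids G x y o t).card = 2) :
    HasPattern G ![2, 2, 1, 2, 2] (kappaOpp .ne .eq .ne) := by
  have : Nonempty V := ⟨o⟩
  have types : ∀ {o t : V}, IsOpposite G x y o t → G.degree o = 2 → G.degree t = 2 →
      (twins G x y o).card + (mids G x y o t).card = 2 → ∀ j, G.Adj o j →
      common G j o = 3 ∧ common G j t = 1 := by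
    intro o t h hd hD hN j hj
    have e := h.nbr_eq hj
    have h1 := two_le_common hj.symm
    have h2 := common_le (G := G) j o
    have h3 := h.common_nbr_le hj
    rw [hd] at e h2
    rw [hD] at e h3
    have hN' : ((twins G x y o).card : ℤ) = 2 - (mids G x y o t).card := by omega
    rw [hN'] at e
    generalize common G j o = p at *
    generalize common G j t = q at *
    interval_cases p <;> interval_cases q <;> simp at e ⊢ <;> omega
  have tO := types h hd hD hN
  have tT := types h.symm hD hd (by rw [mids_comm]; exact hN')
  have clique : ∀ {o t : V}, IsOpposite G x y o t → G.degree o = 2 →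
      (∀ j, G.Adj o j → common G j o = 3 ∧ common G j t = 1) →
      ∀ j j', G.Adj o j → G.Adj o j' → j ≠ j' → G.Adj j j' := by
    intro o t h hd tO j j' hj hj' hne
    have := subset_of_common_eq (G := G) (v := j) (w := o) (by rw [(tO j hj).1, hd])
      (mem_closedNbhd.2 (Or.inr hj'))
    exact (mem_closedNbhd.1 this).resolve_left hne.symm
  have match' : ∀ {o t : V}, IsOpposite G x y o t →
      (∀ j, G.Adj o j → common G j o = 3 ∧ common G j t = 1) →
      ∀ j, G.Adj o j → ∃ l, G.Adj t l ∧ ∀ l', G.Adj t l' → (G.Adj j l' ↔ l' = l) := by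
    intro o t h tO j hj
    obtain ⟨l, hl⟩ := card_eq_one.1 (tO j hj).2
    have hn := h.nbr hj
    have hl' : l ∈ closedNbhd G j ∩ closedNbhd G t := by simp [hl]
    have mem : ∀ l', G.Adj t l' → (G.Adj j l' ↔ l' = l) := by
      intro l' hl'
      have : l' ∈ closedNbhd G j ∩ closedNbhd G t ↔ l' = l := by simp [hl]
      rw [← this]
      simp [hl', (h.ne_nbr hj hl').symm]
    refine ⟨l, ?_, mem⟩
    simp only [mem_inter, mem_closedNbhd] at hl'
    rcases hl' with ⟨h1 | h1, h2 | h2⟩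
    · exact absurd (h1 ▸ h2) hn.2.1
    · exact absurd (h1 ▸ h2) hn.2.2.2
    · exact absurd (h2 ▸ h1) hn.2.2.1
    · exact h2
  obtain ⟨f, g, hf, hg, hfg⟩ := exists_matched_enum (G.neighborFinset o) (G.neighborFinset t) G.Adj
    (by simpa using match' h tO)
    (by simpa only [SimpleGraph.mem_neighborFinset, G.adj_comm] using match' h.symm tT)
  have c1 : (G.neighborFinset o).card = 2 := by
    rw [SimpleGraph.card_neighborFinset_eq_degree, hd]
  rw [c1] at hf hg hfg
  have fO : ∀ a, a < 2 → G.Adj o (f a) := fun a ha => by simpa using hf.mem a ha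
  have gT : ∀ a, a < 2 → G.Adj t (g a) := fun a ha => by simpa using hg.mem a ha
  -- For a matched pair the direct count is `1 + 1` plus the number of vertices with the sum vector,
  -- while Parseval gives `3`; so there is exactly one such vertex.
  have e := h.card_inter_nbr (fO 0 (by omega)) (gT 0 (by omega))
  have e2 := h.common_mul (h.nbr (fO 0 (by omega))).1 (h.nbr (fO 0 (by omega))).2.1
    (h.symm.nbr (gT 0 (by omega))).2.1 (h.symm.nbr (gT 0 (by omega))).1
    (h.ne_nbr (fO 0 (by omega)) (gT 0 (by omega)))
  rw [hd, hD, (tO _ (fO 0 (by omega))).1, (tO _ (fO 0 (by omega))).2,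
    (tT _ (gT 0 (by omega))).1, (tT _ (gT 0 (by omega))).2] at e2
  have e3 : closedNbhd G (f 0) ∩ closedNbhd G (g 0) ∩ closedNbhd G o
      = closedNbhd G (g 0) ∩ closedNbhd G o := by
    rw [inter_comm (closedNbhd G (f 0)), inter_assoc]
    congr 1
    exact inter_eq_right.2 (subset_of_common_eq (by rw [(tO _ (fO 0 (by omega))).1, hd]))
  have e4 : closedNbhd G (f 0) ∩ closedNbhd G (g 0) ∩ closedNbhd G t
      = closedNbhd G (f 0) ∩ closedNbhd G t := by
    rw [inter_assoc]
    congr 1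
    exact inter_eq_right.2 (subset_of_common_eq (by rw [(tT _ (gT 0 (by omega))).1, hD]))
  rw [e3, e4] at e
  have e5 := (tO _ (fO 0 (by omega))).2
  have e6 := (tT _ (gT 0 (by omega))).2
  unfold common at e5 e6
  have key := h.pattern_five (a := .ne) (b := .eq) (c := .ne) (by rw [hd]; exact hf)
    (by rw [hD]; exact hg) (by
      rw [hd]
      intro k l hk hl
      refine ⟨?_, fun hkl => clique h hd tO _ _ (fO k hk) (fO l hl) fun e => hkl
        (hf.inj k l hk hl e)⟩
      rintro hh rfl
      exact hh.ne rfl) (by rw [hd, hD]; exact hfg) (by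
      rw [hD]
      intro k l hk hl
      refine ⟨?_, fun hkl => clique h.symm hD tT _ _ (gT k hk) (gT l hl) fun e => hkl
        (hg.inj k l hk hl e)⟩
      rintro hh rfl
      exact hh.ne rfl)
  rwa [hd, hD, show (twins G x y o).card = 1 by omega, show (twins G x y t).card = 1 by omega,
    show (mids G x y o t).card = 1 by omega] at key

/-- With both degrees equal to `d`, Parseval for `j` and `l` becomes `d · c = (d + 1) · s`, where
`s` is the sum in question and `c` the common count of `j` and `l`. Since `d` is coprime to `d + 1`,
it divides `s`. -/
lemma full_sum (h : IsOpposite G x y o t) (hd : G.degree o = G.degree t) {j l : V}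
    (hj : G.Adj o j) (hjB : common G j o = G.degree o + 1) (hl : G.Adj t l)
    (hlB : common G l t = G.degree t + 1) : G.degree o ∣ common G l o + common G j t := by
  have e := h.common_mul (h.nbr hj).1 (h.nbr hj).2.1 (h.symm.nbr hl).2.1 (h.symm.nbr hl).1
    (h.ne_nbr hj hl)
  rw [hjB, hlB, ← hd] at e
  have hp := h.deg_pos
  have e2 : G.degree o * common G j l = (G.degree o + 1) * (common G l o + common G j t) := by
    refine Nat.eq_of_mul_eq_mul_left hp ?_
    linarith
  have : G.degree o ∣ G.degree o * (common G l o + common G j t)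
      + (common G l o + common G j t) := ⟨common G j l, by rw [e2]; ring⟩
  exact (Nat.dvd_add_right (dvd_mul_right _ _)).1 this

lemma full_ten (h : IsOpposite G x y o t) {j l : V} (hj : G.Adj o j)
    (hl : G.Adj t l) (hd : G.degree o = 10) (hD : G.degree t = 10)
    (hN : (twins G x y o).card + (mids G x y o t).card = 0)
    (hN' : (twins G x y t).card + (mids G x y o t).card = 0) : False := by
  have types : ∀ {o t : V}, IsOpposite G x y o t → G.degree o = 10 → G.degree t = 10 →
      (twins G x y o).card + (mids G x y o t).card = 0 → ∀ j, G.Adj o j →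
      common G j o = 11 ∧ (common G j t = 3 ∨ common G j t = 7) := by
    intro o t h hd hD hN j hj
    have e := h.nbr_eq hj
    have h1 := two_le_common hj.symm
    have h2 := common_le (G := G) j o
    have h3 := h.common_nbr_le hj
    rw [hd] at e h2
    rw [hD] at e h3
    have hN1 : ((twins G x y o).card : ℤ) = 0 := by omega
    have hN2 : ((mids G x y o t).card : ℤ) = 0 := by omega
    rw [hN1, hN2] at e
    generalize common G j o = p at *
    generalize common G j t = q at *
    clear hN hj hN1 hN2 hd hD h
    interval_cases p <;> interval_cases q <;> simp at e ⊢
  have tO := types h hd hD hN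
  have tT := types h.symm hD hd (by rw [mids_comm]; exact hN')
  -- The counts are `3` or `7` and their sum is divisible by `10`. Hence the count is constant on
  -- each side, and counting the edges between the two neighbourhoods makes the two constants equal,
  -- although they must be `3` and `7`.
  have s : ∀ j l, G.Adj o j → G.Adj t l → common G j t + common G l o = 10 := by
    intro j l hj hl
    obtain ⟨k, hk⟩ := h.full_sum (by rw [hd, hD]) hj (by rw [(tO j hj).1, hd]) hl
      (by rw [(tT l hl).1, hD])
    rw [hd] at hk
    have := (tO j hj).2
    have := (tT l hl).2
    omega
  have hs := h.sum_common
  rw [sum_congr rfl (g := fun _ => common G j t) (fun a ha => by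
      have ha' : G.Adj o a := by simpa using ha
      have := s a l ha' hl; have := s j l hj hl; omega),
    sum_congr rfl (s₁ := G.neighborFinset t) (g := fun _ => common G l o) (fun a ha => by
      have ha' : G.Adj t a := by simpa using ha
      have := s j a hj ha'; have := s j l hj hl; omega)] at hs
  simp only [sum_const, SimpleGraph.card_neighborFinset_eq_degree, hd, hD, smul_eq_mul] at hs
  have := s j l hj hl
  have := (tO j hj).2
  omega

lemma five_types (h : IsOpposite G x y o t) (hd : G.degree o = 5) (hD : G.degree t = 5)
    (hN : (twins G x y o).card + (mids G x y o t).card = 1) {j : V} (hj : G.Adj o j) :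
    (common G j o = 6 ∧ (common G j t = 2 ∨ common G j t = 3)) ∨
      (common G j o = 5 ∧ (common G j t = 5 ∨ common G j t = 0)) := by
  have e := h.nbr_eq hj
  have h1 := two_le_common hj.symm
  have h2 := common_le (G := G) j o
  have h3 := h.common_nbr_le hj
  rw [hd] at e h2
  rw [hD] at e h3
  have hN1 : ((twins G x y o).card : ℤ) = 1 - (mids G x y o t).card := by omega
  rw [hN1] at e
  generalize common G j o = p at *
  generalize common G j t = q at *
  clear hN hj hN1 hd hD h
  interval_cases p <;> interval_cases q <;> simp at e ⊢

/-- Equal coordinates mean equal vectors. The swap between `a` and `b` then exchanges `o` for `t`,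
which would have equal vectors despite being orthogonal. -/
lemma five_not_both (h : IsOpposite G x y o t) {a b : V} (ha : G.Adj o a) (hb : G.Adj t b)
    (h1 : common G a o = common G b o) (h2 : common G a t = common G b t) : False := by
  have na := h.nbr ha
  have nb := h.symm.nbr hb
  have hs := h.same_of_common na.1 na.2.1 nb.2.1 nb.1 h1 h2
  obtain ⟨a', b', ea, eb, hs'⟩ := h.exists_swap (h.ne_nbr ha hb) hs
  have m1 : o ∈ closedNbhd G a \ closedNbhd G b := by
    simp [ha.symm, nb.2.1.symm, nb.2.2.1]
  have m2 : t ∈ closedNbhd G b \ closedNbhd G a := by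
    simp [hb.symm, na.2.1.symm, na.2.2.1]
  rw [ea, mem_singleton] at m1
  rw [eb, mem_singleton] at m2
  subst m1 m2
  exact h.not_same hs'

/-- Let `u` be the one neighbour of `o` that `a` misses. If `u` also has both counts `5`, then `o`,
`a`, `o'`, `u` form a four-cycle, and a neighbour `l` of `t` sees `a` and `u` but neither `o` nor
`o'`. If `u` has the vector of `o`, the swap between `o` and `u` exchanges `a` for `o'`, so `a` has
the vector of `o`, which is orthogonal to that of `t`. If `u` is joined to the whole neighbourhood
of `o`, it is adjacent to `a`. -/
lemma five_no_twin (h : IsOpposite G x y o t) (hd : G.degree o = 5) (hD : G.degree t = 5)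
    (hN : (twins G x y o).card + (mids G x y o t).card = 1)
    {o' : V} (ho' : o' ∈ twins G x y o) {l : V} (hl : G.Adj t l)
    {a : V} (ha : G.Adj o a) (hp : common G a o = 5) : common G a t ≠ 5 := by
  intro hq
  obtain ⟨u, hu⟩ : ∃ u, u ∈ closedNbhd G o \ closedNbhd G a := by
    refine card_pos.1 ?_
    have := card_sdiff_add_card_inter (closedNbhd G o) (closedNbhd G a)
    rw [inter_comm, card_closedNbhd, hd] at this
    unfold common at hp
    omega
  rw [mem_sdiff] at hu
  have huo : G.Adj o u := by
    rcases mem_closedNbhd.1 hu.1 with rfl | h'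
    · exact absurd (mem_closedNbhd.2 (Or.inr ha.symm)) hu.2
    · exact h'
  have hua : u ≠ a ∧ ¬ G.Adj a u := by simpa [not_or] using hu.2
  have na := h.nbr ha
  have hTa : ∀ v, G.Adj t v → v ∈ closedNbhd G a := fun v hv =>
    mem_of_common_eq na.2.1 na.2.2.1 (by rw [hq, hD]) hv
  have ho'' := mem_twins.1 ho'
  rcases h.five_types hd hD hN huo with ⟨h1, -⟩ | ⟨h1, h2 | h2⟩
  · have := subset_of_common_eq (G := G) (v := u) (w := o) (by rw [h1, hd])
      (mem_closedNbhd.2 (Or.inr ha))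
    rw [mem_closedNbhd_comm] at this
    exact hu.2 this
  · have hTu : ∀ v, G.Adj t v → v ∈ closedNbhd G u := fun v hv =>
      mem_of_common_eq (h.nbr huo).2.1 (h.nbr huo).2.2.1 (by rw [h2, hD]) hv
    have al : G.Adj l a := by
      have := hTa l hl
      rw [mem_closedNbhd] at this
      exact (this.resolve_left (h.ne_nbr ha hl).symm).symm
    have ul : G.Adj l u := by
      have := hTu l hl
      rw [mem_closedNbhd] at this
      exact (this.resolve_left (h.ne_nbr huo hl).symm).symm
    have nl := h.symm.nbr hl
    have nlo' : ¬ G.Adj l o' := fun e => nl.2.2.2 ((h.adj_twin ho' l).1 e.symm)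
    have nlo : l ≠ o' := by
      rintro rfl
      exact (h.twin_ne ho').2.1 (mem_closedNbhd.2 (Or.inr hl))
    have := h.four_cycle (t := o) (t' := o') (w := a) (w' := u) ho''.1.symm ho''.2.2 hua.1.symm
      hua.2 ha huo ((h.adj_twin ho' a).2 ha) ((h.adj_twin ho' u).2 huo) (z := l) nl.2.1 nlo al.ne
      ul.ne
    rw [closedInd_of_adj al, closedInd_of_adj ul, closedInd_of_not_adj nl.2.1 nl.2.2.1,
      closedInd_of_not_adj nlo nlo'] at this
    norm_num at this
  · have hs := h.same_of_common_eq_zero (h.nbr huo).2.1 h2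
    obtain ⟨a', b', ea, eb, hs'⟩ := h.exists_swap huo.ne hs
    have m1 : a ∈ closedNbhd G o \ closedNbhd G u := by
      rw [mem_sdiff, mem_closedNbhd]
      exact ⟨Or.inr ha, fun e => hu.2 (mem_closedNbhd_comm.1 e)⟩
    have m2 : o' ∈ closedNbhd G u \ closedNbhd G o :=
      mem_sdiff.2 ⟨h.twins_subset huo ho', (h.twin_ne ho').1⟩
    rw [ea, mem_singleton] at m1
    rw [eb, mem_singleton] at m2
    subst m1 m2
    have := h.common_eq_zero_of_same na.2.1 (ho''.2.1.trans hs'.symm)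
    omega

/-- Joined neighbours have constant counts `c` on the side of `o` and `5 - c` on the side of `t`,
with `c` equal to `2` or `3`. Counting the edges between the neighbourhoods gives `c |B| + 5 |A| =
(5 - c) |B'|`. This has no admissible solution if `B'` is the whole neighbourhood of `t`; otherwise
it produces two vertices with equal closed neighbourhoods. -/
lemma five_aux (h : IsOpposite G x y o t) (hd : G.degree o = 5) (hD : G.degree t = 5)
    (hN : (twins G x y o).card + (mids G x y o t).card = 1)
    (hN' : (twins G x y t).card + (mids G x y o t).card = 1) {j l : V} (hj : G.Adj o j)
    (hjB : common G j o = 6) (hl : G.Adj t l) (hlB : common G l t = 6)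
    (hno : ∀ b, G.Adj t b → common G b o ≠ 5) : False := by
  have tO := fun j (hj : G.Adj o j) => h.five_types hd hD hN hj
  have tT := fun j (hj : G.Adj t j) =>
    h.symm.five_types hD hd (by rw [mids_comm]; exact hN') hj
  have s : ∀ j l, G.Adj o j → G.Adj t l → common G j o = 6 → common G l t = 6 →
      common G j t + common G l o = 5 := by
    intro j l hj hl h1 h2
    obtain ⟨k, hk⟩ := h.full_sum (by rw [hd, hD]) hj (by rw [h1, hd]) hl (by rw [h2, hD])
    rw [hd] at hk
    have := tO j hj
    have := tT l hl
    omega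
  obtain ⟨c, hc⟩ : ∃ c, common G j t = c := ⟨_, rfl⟩
  have hc' : c = 2 ∨ c = 3 := by have := tO j hj; omega
  have hlc := s j l hj hl hjB hlB
  set B := (G.neighborFinset o).filter fun j => common G j o = 6 with hBdef
  set A := (G.neighborFinset o).filter fun j => common G j t = 5 with hAdef
  set B' := (G.neighborFinset t).filter fun j => common G j t = 6 with hB'def
  have hcO : (G.neighborFinset o).card = 5 := by
    rw [SimpleGraph.card_neighborFinset_eq_degree, hd]
  have hcT : (G.neighborFinset t).card = 5 := by
    rw [SimpleGraph.card_neighborFinset_eq_degree, hD]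
  have s1 : ∑ j ∈ G.neighborFinset o, common G j t = c * B.card + 5 * A.card := by
    rw [hBdef, hAdef, card_filter, card_filter, mul_sum, mul_sum, ← sum_add_distrib]
    refine sum_congr rfl fun a ha => ?_
    have ha' : G.Adj o a := by simpa using ha
    have h1 := s a l ha' hl
    have h2 := tO a ha'
    split_ifs <;> omega
  have s2 : ∑ j ∈ G.neighborFinset t, common G j o = (5 - c) * B'.card := by
    rw [hB'def, card_filter, mul_sum]
    refine sum_congr rfl fun a ha => ?_
    have ha' : G.Adj t a := by simpa using ha
    have h1 := s j a hj ha' hjB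
    have h2 := tT a ha'
    have h3 := hno a ha'
    split_ifs <;> omega
  have s3 : B.card + A.card ≤ 5 := by
    rw [← hcO, hBdef, hAdef, card_filter, card_filter, ← sum_add_distrib, card_eq_sum_ones]
    refine sum_le_sum fun a ha => ?_
    have h2 := tO a (by simpa using ha)
    split_ifs <;> omega
  have s4 : 0 < B.card := card_pos.2 ⟨j, by simp [hBdef, hj, hjB]⟩
  have s5 : 0 < B'.card := card_pos.2 ⟨l, by simp [hB'def, hl, hlB]⟩
  have s6 : B'.card ≤ 5 := by rw [← hcT]; exact card_filter_le _ _
  have hsum := h.sum_common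
  rw [s1, s2] at hsum
  by_cases hT : (twins G x y t).card = 0
  -- Without twins of `t` there is a vertex `m` with the sum vector. A neighbour of `t` with the
  -- vector of `t` would exchange `m` for a neighbour of `t`, which would then have the sum vector
  -- and common count `5` with `o`; this is excluded by `hno`.
  · have : B' = G.neighborFinset t := by
      refine filter_true_of_mem fun a ha => ?_
      have ha' : G.Adj t a := by simpa using ha
      by_contra hne
      have h0 : common G a o = 0 := by
        have := tT a ha'; have := hno a ha'; omega
      have hs := h.symm.same_of_common_eq_zero (h.symm.nbr ha').2.1 h0
      obtain ⟨a', b', ea, eb, hs'⟩ := h.exists_swap ha'.ne hs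
      obtain ⟨m, hm⟩ := card_pos.1 (show 0 < (mids G x y t o).card by rw [mids_comm]; omega)
      have m1 : m ∈ closedNbhd G a \ closedNbhd G t :=
        mem_sdiff.2 ⟨h.symm.mids_subset ha' hm, (h.symm.mid_ne hm).2.2.1⟩
      rw [eb, mem_singleton] at m1
      subst m1
      have m2 : a' ∈ closedNbhd G t \ closedNbhd G a := by simp [ea]
      rw [mem_sdiff] at m2
      have m3 : G.Adj t a' := by
        rcases mem_closedNbhd.1 m2.1 with rfl | h'
        · exact absurd (mem_closedNbhd.2 (Or.inr ha'.symm)) m2.2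
        · exact h'
      refine hno a' m3 ?_
      have hm' := mem_mids.1 hm
      have e := h.inter' (h.symm.nbr m3).2.1
      have e2 := h.ip_zero
      have e3 := h.self_eq_degree o
      rw [hs'.1, hs'.2, hm'.2.2.1, hm'.2.2.2] at e
      rw [hd] at e3
      push_cast at e3
      have : (common G a' o : ℝ) = 5 := by linarith
      exact_mod_cast this
    rw [this, hcT] at hsum
    rcases hc' with rfl | rfl <;> omega
  -- Now there is no vertex with the sum vector, so `o` has a twin and `A` is empty. The equation
  -- becomes `c |B| = (5 - c) |B'|`, whence `|B'| = c`, and all vertices of `B` see exactly `B'`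
  -- around `t`.
  · obtain ⟨o', ho'⟩ := card_pos.1 (show 0 < (twins G x y o).card by omega)
    have hA0 : A.card = 0 := by
      rw [card_eq_zero, hAdef]
      refine filter_false_of_mem fun a ha e => ?_
      have ha' : G.Adj o a := by simpa using ha
      exact h.five_no_twin hd hD hN ho' hl ha' (by have := tO a ha'; omega) e
    have hBc : B'.card = c ∧ 1 < B.card := by
      rw [hA0] at hsum
      rcases hc' with rfl | rfl <;> omega
    obtain ⟨j1, hj1, j2, hj2, hne⟩ := one_lt_card.1 hBc.2
    have key : ∀ j, j ∈ B → G.Adj o j ∧ closedNbhd G o ⊆ closedNbhd G j ∧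
        closedNbhd G j ∩ closedNbhd G t = B' := by
      intro j1 hj1
      rw [hBdef, mem_filter, SimpleGraph.mem_neighborFinset] at hj1
      refine ⟨hj1.1, subset_of_common_eq (by rw [hj1.2, hd]), ?_⟩
      refine eq_of_subset_of_card_le ?_ ?_
      · intro z hz
        rw [mem_inter] at hz
        have hn := h.nbr hj1.1
        have hz2 : G.Adj t z := by
          rcases mem_closedNbhd.1 hz.2 with rfl | h'
          · rcases mem_closedNbhd.1 hz.1 with h'' | h''
            · exact absurd h''.symm hn.2.1
            · exact absurd h'' hn.2.2.1
          · exact h'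
        rw [hB'def, mem_filter, SimpleGraph.mem_neighborFinset]
        refine ⟨hz2, ?_⟩
        have p : 0 < common G z o := IsGram.inter_pos (z := j1) (mem_closedNbhd_comm.1 hz.1)
          (by simp [hj1.1])
        have := tT z hz2; have := hno z hz2
        omega
      · have := s j1 l hj1.1 hl hj1.2 hlB
        unfold common at *
        omega
    obtain ⟨a1, a2, a3⟩ := key j1 hj1
    obtain ⟨b1, b2, b3⟩ := key j2 hj2
    exact hne (h.nbr_ext a1 b1 (by rw [inter_eq_right.2 a2, inter_eq_right.2 b2])
      (by rw [a3, b3]))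

/-- Two opposite vertices such that each of them has a neighbour joined to all its
neighbours. -/
lemma full_both (h : IsOpposite G x y o t) {j l : V} (hj : G.Adj o j)
    (hjB : common G j o = G.degree o + 1) (hl : G.Adj t l)
    (hlB : common G l t = G.degree t + 1) :
    HasPattern G ![2, 2, 2, 1, 1] (kappaOpp .none .all .none) ∨
      HasPattern G ![2, 2, 1, 2, 2] (kappaOpp .ne .eq .ne) := by
  have hd := h.full_degree_eq hj hjB hl hlB
  have c1 := h.full_cases hj hjB hd
  have c2 := h.symm.full_cases hl hlB hd.symm
  rw [mids_comm] at c2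
  rcases c1 with c1 | c1 | c1 | c1
  · exact Or.inl (h.full_one hj hjB hl hlB c1.1 (by omega) c1.2.1 (by omega) c1.2.2 (by omega))
  · exact Or.inr (h.full_two c1.1 (by omega) c1.2.1 (by omega))
  · exfalso
    have hN : (twins G x y o).card + (mids G x y o t).card = 1 := c1.2.1
    have hN' : (twins G x y t).card + (mids G x y o t).card = 1 := by omega
    have hdo : G.degree o = 5 := c1.1
    have hdt : G.degree t = 5 := by omega
    -- Neighbours with both counts equal to `5` cannot occur on both sides, so the counting argument
    -- applies to at least one of them.
    by_cases hA : ∀ b, G.Adj t b → common G b o ≠ 5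
    · exact h.five_aux hdo hdt hN hN' hj (by omega) hl (by omega) hA
    · push Not at hA
      obtain ⟨b, hb, hb5⟩ := hA
      refine h.symm.five_aux hdt hdo (by rw [mids_comm]; exact hN') (by rw [mids_comm]; exact hN)
        hl (by omega) hj (by omega) fun a ha ha5 => ?_
      have t1 := h.five_types hdo hdt hN ha
      have t2 := h.symm.five_types hdt hdo (by rw [mids_comm]; exact hN') hb
      exact h.five_not_both ha hb (by omega) (by omega)
  · exact (h.full_ten hj hl c1.1 (by omega) c1.2.1 (by omega)).elim

end IsOpposite
end BothFull

/-! ### Opposite vertices, one of which has no neighbour joined to its whole neighbourhood -/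

/-- The relations between the blocks of a graph consisting of two cliques joined by the
complement of a perfect matching, a vertex joined to one of them, and pendant vertices. -/
def kappaTail : Fin 4 → Fin 4 → BlockRel :=
  ![![.none, .all, .none, .none], ![.all, .none, .all, .none], ![.none, .all, .ne, .ne],
    ![.none, .none, .ne, .ne]]

section OneFull
open scoped Classical
variable {V : Type*} [Fintype V] {G : SimpleGraph V} {x y : V → ℝ}

/-- If neither `q = D` nor `p = d`, then `q (D - q) ≥ D - 1` and `p (d - p) ≥ d - 1`, which makes
the left side exceed `d D`. In the boundary cases the other variable satisfies `p (d - p) = d`, that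
is `(p - 1)(d - p - 1) = 1`. -/
lemma not_full_arith {d D p q : ℤ} (hd : 0 < d) (hD : 0 < D) (hq : 2 ≤ q) (hqD : q ≤ D)
    (hp : 1 ≤ p) (hpd : p ≤ d) (e : q * (D - q) * d + p * (d - p) * D = d * D) :
    (d = 4 ∧ p = 2 ∧ q = D) ∨ (D = 4 ∧ q = 2 ∧ p = d) := by
  have key : ∀ {d p : ℤ}, 1 ≤ p → p * (d - p) = d → d = 4 ∧ p = 2 := by
    intro d p hp e
    have e1 : (p - 1) * (d - p - 1) = 1 := by linarith
    rcases Int.mul_eq_one_iff_eq_one_or_neg_one.1 e1 with h | h <;> omega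
  by_cases h1 : q = D
  · subst h1
    have : p * (d - p) = d := mul_right_cancel₀ hD.ne' (by linarith)
    have := key hp this
    omega
  by_cases h2 : p = d
  · subst h2
    have : q * (D - q) = D := mul_right_cancel₀ hd.ne' (by linarith)
    have := key (by omega) this
    omega
  exfalso
  have h3 : D - 1 ≤ q * (D - q) := by
    have : 0 ≤ (q - 1) * (D - q - 1) := mul_nonneg (by omega) (by omega)
    linarith
  have h4 : d - 1 ≤ p * (d - p) := by
    have : 0 ≤ (p - 1) * (d - p - 1) := mul_nonneg (by omega) (by omega)
    linarith
  have h5 : (D - 1) * d ≤ q * (D - q) * d := mul_le_mul_of_nonneg_right h3 hd.le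
  have h6 : (d - 1) * D ≤ p * (d - p) * D := mul_le_mul_of_nonneg_right h4 hD.le
  have h7 : 0 ≤ (d - 2) * (D - 3) := mul_nonneg (by omega) (by omega)
  have : 3 ≤ D := by omega
  have : 2 ≤ d := by omega
  nlinarith

namespace IsOpposite

variable {o t : V}

lemma exists_missed {z : V} (hz : G.Adj t z) (hq : common G z t = G.degree t) :
    ∃ u, G.Adj t u ∧ u ≠ z ∧ ¬ G.Adj z u ∧ ∀ v, v ∈ closedNbhd G t → v ∉ closedNbhd G z → v = u := by
  have h1 := card_sdiff_add_card_inter (closedNbhd G t) (closedNbhd G z)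
  rw [inter_comm, card_closedNbhd] at h1
  unfold common at hq
  obtain ⟨u, hu⟩ := card_eq_one.1 (show (closedNbhd G t \ closedNbhd G z).card = 1 by omega)
  have hu' : u ∈ closedNbhd G t \ closedNbhd G z := by simp [hu]
  rw [mem_sdiff] at hu'
  have h3 : u ≠ z ∧ ¬ G.Adj z u := by simpa [not_or] using hu'.2
  refine ⟨u, ?_, h3.1, h3.2, ?_⟩
  · rcases mem_closedNbhd.1 hu'.1 with rfl | h'
    · exact absurd hz.symm h3.2
    · exact h'
  · intro v hv hv'
    have : v ∈ closedNbhd G t \ closedNbhd G z := mem_sdiff.2 ⟨hv, hv'⟩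
    rwa [hu, mem_singleton] at this

lemma mem_of_full (h : IsOpposite G x y o t) {z : V} (hz : G.Adj t z)
    (hp : common G z o = G.degree o) {v : V} (hv : G.Adj o v) : G.Adj z v := by
  have n := h.symm.nbr hz
  have := mem_of_common_eq n.2.1 n.2.2.1 hp hv
  rw [mem_closedNbhd] at this
  exact this.resolve_left (h.ne_nbr hv hz)

/-- Every neighbour of `t` has one of the two types of `not_full_arith`. If all have `q = 2`, they
are pairwise nonadjacent but all adjacent to a neighbour `v` of `o`, and a third one violates the
four-cycle condition. If all have `q = deg t`, some neighbour of `t` and a vertex it misses are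
twins in a four-cycle through `t` and a neighbour of `o`, and `o` violates the condition. Mixed
types contradict a count. -/
lemma not_full_zero (h : IsOpposite G x y o t)
    (hno : ∀ z, G.Adj t z → common G z t ≠ G.degree t + 1)
    (hT : (twins G x y t).card = 0) (hM : (mids G x y t o).card = 0) : False := by
  have types : ∀ z, G.Adj t z → (G.degree o = 4 ∧ common G z o = 2 ∧ common G z t = G.degree t) ∨
      (G.degree t = 4 ∧ common G z t = 2 ∧ common G z o = G.degree o) := by
    intro z hz
    have e := h.symm.nbr_eq hz
    rw [hT, hM] at e
    have h1 := two_le_common hz.symm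
    have h2 := common_le (G := G) z t
    have h3 := hno z hz
    have h4 := h.symm.common_nbr_le hz
    have hd := h.deg_pos
    have hD := h.symm.deg_pos
    have hp : 0 < common G z o := by
      refine h.symm.common_pos hz fun hs => ?_
      have e1 := h.symm.common_of_same hz.ne' hs
      have e2 := h.symm.common_eq_zero_of_same (h.symm.nbr hz).2.1 hs
      rw [e1, e2] at e
      have : (G.degree t : ℤ) * G.degree o = 0 := by push_cast at e; linarith
      have : G.degree t * G.degree o = 0 := by exact_mod_cast this
      rcases mul_eq_zero.1 this with h' | h' <;> omega
    have := not_full_arith (d := G.degree o) (D := G.degree t) (p := common G z o)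
      (q := common G z t) (by omega) (by omega) (by omega) (by omega) (by omega) (by omega)
      (by push_cast at e; linarith)
    omega
  have nb := fun z (hz : G.Adj t z) => h.symm.nbr hz
  by_cases h2 : ∃ z, G.Adj t z ∧ G.degree t = 4 ∧ common G z t = 2 ∧ common G z o = G.degree o
  · obtain ⟨z2, hz2, hD, hq2, hp2⟩ := h2
    have only : ∀ z, G.Adj t z → common G z t = 2 → ∀ v, v ∈ closedNbhd G z →
        v ∈ closedNbhd G t → v = t ∨ v = z := by
      intro z hz hq v hv hv'
      have h1 : ({t, z} : Finset V) ⊆ closedNbhd G z ∩ closedNbhd G t := by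
        intro w
        simp only [mem_insert, mem_singleton, mem_inter, mem_closedNbhd]
        rintro (rfl | rfl)
        · exact ⟨Or.inr hz.symm, Or.inl rfl⟩
        · exact ⟨Or.inl rfl, Or.inr hz⟩
      have h2 := eq_of_subset_of_card_le h1 (by
        rw [card_pair hz.ne]; unfold common at hq; omega)
      have : v ∈ closedNbhd G z ∩ closedNbhd G t := mem_inter.2 ⟨hv, hv'⟩
      rw [← h2] at this
      simpa using this
    by_cases h1 : ∃ z, G.Adj t z ∧ G.degree o = 4 ∧ common G z o = 2 ∧ common G z t = G.degree t
    · obtain ⟨z1, hz1, hd, hp1, hq1⟩ := h1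
      have hne : z1 ≠ z2 := by rintro rfl; omega
      -- Parseval gives `4`, but the two vertices share at most two vertices around `o` and only `t`
      -- around `t`.
      have hc : common G z1 z2 = 4 := by
        have := h.common_mul (nb z1 hz1).2.1 (nb z1 hz1).1 (nb z2 hz2).2.1 (nb z2 hz2).1 hne
        rw [hd, hD, hp1, hp2, hq1, hq2, hd, hD] at this
        omega
      have hs := h.card_split (closedNbhd G z1 ∩ closedNbhd G z2)
      have e1 : (closedNbhd G z1 ∩ closedNbhd G z2 ∩ closedNbhd G o).card ≤ 2 := by
        rw [← hp1]
        refine card_le_card fun v hv => ?_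
        simp only [mem_inter] at hv ⊢
        exact ⟨hv.1.1, hv.2⟩
      have e2 : (closedNbhd G z1 ∩ closedNbhd G z2 ∩ closedNbhd G t).card ≤ 1 := by
        rw [← card_singleton t]
        refine card_le_card fun v hv => ?_
        simp only [mem_inter] at hv
        rw [mem_singleton]
        rcases only z2 hz2 hq2 v hv.1.2 hv.2 with h' | rfl
        · exact h'
        · have := mem_closedNbhd_comm.1 hv.1.1
          rcases only v hz2 hq2 z1 this (by simp [hz1]) with h' | h'
          · exact absurd h' hz1.ne'
          · exact absurd h' hne
      have e3 : closedNbhd G z1 ∩ closedNbhd G z2 ∩ twins G x y o = ∅ := by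
        rw [inter_assoc, h.symm.inter_twins hz2, inter_empty]
      rw [mids_comm] at hM
      rw [card_eq_zero] at hT hM
      rw [e3, hT, hM] at hs
      simp only [inter_empty, card_empty] at hs
      unfold common at hc
      omega
    · have all2 : ∀ z, G.Adj t z → common G z t = 2 ∧ common G z o = G.degree o := by
        intro z hz
        rcases types z hz with h' | h'
        · exact absurd ⟨z, hz, h'⟩ h1
        · exact h'.2
      obtain ⟨z1, z2, z3, m1, m2, m3, n12, n13, n23⟩ := two_lt_card_iff.1
        (show 2 < (G.neighborFinset t).card by
          rw [SimpleGraph.card_neighborFinset_eq_degree, hD]; omega)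
      rw [SimpleGraph.mem_neighborFinset] at m1 m2 m3
      have nadj : ∀ z z', G.Adj t z → G.Adj t z' → z ≠ z' → ¬ G.Adj z z' := by
        intro z z' hz hz' hne hadj
        rcases only z hz (all2 z hz).1 z' (by simp [hadj]) (by simp [hz']) with h' | h'
        · exact hz'.ne' h'
        · exact hne h'.symm
      obtain ⟨v, hv⟩ := IsGram.exists_adj h.not_isolated o
      have av := fun z hz => h.mem_of_full hz (all2 z hz).2 hv
      have nv := h.nbr hv
      have := h.four_cycle n12 (nadj _ _ m1 m2 n12) nv.2.1.symm nv.2.2.2 m1.symm (av _ m1)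
        m2.symm (av _ m2) (z := z3) n13.symm n23.symm m3.ne' (av _ m3).ne
      rw [closedInd_of_not_adj n13.symm (nadj _ _ m3 m1 n13.symm),
        closedInd_of_not_adj n23.symm (nadj _ _ m3 m2 n23.symm), closedInd_of_adj m3.symm,
        closedInd_of_adj (av _ m3)] at this
      norm_num at this
  · have all1 : ∀ z, G.Adj t z →
        G.degree o = 4 ∧ common G z o = 2 ∧ common G z t = G.degree t := by
      intro z hz
      rcases types z hz with h' | h'
      · exact h'
      · exact absurd ⟨z, hz, h'⟩ h2
    obtain ⟨z, hz⟩ := IsGram.exists_adj h.not_isolated t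
    obtain ⟨u, hu, huz, hzu, -⟩ := exists_missed hz (all1 z hz).2.2
    have hs := h.same_of_common (nb z hz).2.1 (nb z hz).1 (nb u hu).2.1 (nb u hu).1
      (by rw [(all1 z hz).2.1, (all1 u hu).2.1]) (by rw [(all1 z hz).2.2, (all1 u hu).2.2])
    have htw := h.adj_iff_of_twin huz.symm hs hzu
    obtain ⟨v, hv⟩ := card_pos.1 (show 0 < (closedNbhd G z ∩ closedNbhd G o).card by
      have := (all1 z hz).2.1; unfold common at this; omega)
    rw [mem_inter, mem_closedNbhd, mem_closedNbhd] at hv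
    have nz := nb z hz
    have hvz : G.Adj z v := by
      rcases hv with ⟨rfl | h1, h2⟩
      · rcases h2 with h2 | h2
        · exact absurd h2 nz.2.1
        · exact absurd h2 nz.2.2.2
      · exact h1
    have hvo : G.Adj o v := by
      rcases hv.2 with rfl | h2
      · exact absurd hvz nz.2.2.1
      · exact h2
    have nv := h.nbr hvo
    have := h.four_cycle huz.symm hzu nv.2.1.symm nv.2.2.2 hz.symm hvz hu.symm ((htw v).1 hvz)
      (z := o) nz.2.1.symm (nb u hu).2.1.symm h.ne hvo.ne
    rw [closedInd_of_not_adj nz.2.1.symm nz.2.2.2,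
      closedInd_of_not_adj (nb u hu).2.1.symm (nb u hu).2.2.2, closedInd_of_not_adj h.ne h.not_adj,
      closedInd_of_adj hvo] at this
    norm_num at this

-- The neighbours of `t` split into a set `Z` joined to all neighbours of `o` and a set `U` with the
-- vector of `t` joined to none of them. Adding to `Z` the unique vertex `s` with the sum vector,
-- and `t` to `U`, gives two cliques between which nonadjacency is a perfect matching. The main
-- equation at `o` then shows that `o` is pendant and bounds the sizes.
set_option maxHeartbeats 1000000 in
lemma not_full (h : IsOpposite G x y o t)
    (hno : ∀ z, G.Adj t z → common G z t ≠ G.degree t + 1) :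
    HasPattern G ![1, 1, 5, 5] kappaTail ∨ HasPattern G ![2, 1, 3, 3] kappaTail := by
  have : Nonempty V := ⟨o⟩
  have hd := h.deg_pos
  have hD := h.symm.deg_pos
  have nb := fun z (hz : G.Adj t z) => h.symm.nbr hz
  -- Without a joined neighbour, the left side of the main equation at `t` is nonnegative, so at
  -- most one twin or vertex with the sum vector exists. If there is one, the right side is zero and
  -- so are both summands on the left.
  have types : ∀ z, G.Adj t z → (twins G x y t).card + (mids G x y t o).card ≤ 1 ∧
      ((twins G x y t).card + (mids G x y t o).card = 1 →
        common G z t = G.degree t ∧ (common G z o = 0 ∨ common G z o = G.degree o)) := by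
    intro z hz
    have e := h.symm.nbr_eq hz
    have h1 := two_le_common hz.symm
    have h2 := common_le (G := G) z t
    have h3 := hno z hz
    have h4 := h.symm.common_nbr_le hz
    obtain ⟨a, ha⟩ : ∃ a, common G z t + a = G.degree t := ⟨G.degree t - common G z t, by omega⟩
    obtain ⟨b, hb⟩ : ∃ b, common G z o + b = G.degree o := ⟨G.degree o - common G z o, by omega⟩
    have e1 : (common G z t * a * G.degree o + common G z o * b * G.degree t : ℤ)
        = (1 - ((twins G x y t).card + (mids G x y t o).card)) * G.degree t * G.degree o := by
      zify at ha hb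
      rw [show (a : ℤ) = G.degree t - common G z t by linarith,
        show (b : ℤ) = G.degree o - common G z o by linarith]
      linarith
    have e2 : (0 : ℤ) ≤ common G z t * a * G.degree o + common G z o * b * G.degree t := by
      positivity
    have hpos : (0 : ℤ) < G.degree t * G.degree o := by positivity
    constructor
    · by_contra hc
      have : (2 : ℤ) ≤ (twins G x y t).card + (mids G x y t o).card := by omega
      rw [e1] at e2
      nlinarith
    · intro hN
      have hN' : ((twins G x y t).card + (mids G x y t o).card : ℤ) = 1 := by exact_mod_cast hN
      rw [hN', sub_self, zero_mul, zero_mul] at e1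
      have e3 : common G z t * a * G.degree o + common G z o * b * G.degree t = 0 := by
        exact_mod_cast e1
      have e4 : a = 0 := by
        have : common G z t * a * G.degree o = 0 := by omega
        simp only [mul_eq_zero] at this
        omega
      have e5 : common G z o = 0 ∨ b = 0 := by
        have : common G z o * b * G.degree t = 0 := by omega
        simp only [mul_eq_zero] at this
        omega
      omega
  obtain ⟨z0, hz0, hz0s⟩ := h.symm.exists_nbr
  have hz0p := h.symm.common_pos hz0 hz0s
  have hN := (types z0 hz0).1
  by_cases hN1 : (twins G x y t).card + (mids G x y t o).card = 1
  swap
  · exact (h.not_full_zero hno (by omega) (by omega)).elim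
  have tT := fun z hz => (types z hz).2 hN1
  have full : ∀ z, G.Adj t z → 0 < common G z o → ∀ v, G.Adj o v → G.Adj z v := by
    intro z hz hp v hv
    have := tT z hz
    exact h.mem_of_full hz (by omega) hv
  obtain ⟨v0, hv0⟩ := IsGram.exists_adj h.not_isolated o
  -- Suppose the missed vertex `u` had a positive count with `o`. If `t` has a twin, then `z`, `u`,
  -- `t` and the twin form a four-cycle, and a neighbour of `o` sees only `z` and `u`. Otherwise `z`
  -- has the sum vector, and its swap with `s` exchanges `t` for `u`, so that `u` has the vector of
  -- `t`.
  have missed : ∀ z, G.Adj t z → 0 < common G z o → ∃ u, G.Adj t u ∧ common G u o = 0 ∧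
      ∀ v ∈ closedNbhd G t, v ∉ closedNbhd G z ↔ v = u := by
    intro z hz hp
    obtain ⟨u, hu, huz, hzu, hun⟩ := exists_missed hz (tT z hz).1
    refine ⟨u, hu, ?_, fun v hv => ⟨hun v hv, by rintro rfl; simp [huz, hzu]⟩⟩
    by_contra hpu
    have hpu : 0 < common G u o := by omega
    by_cases hM : (mids G x y t o).card = 0
    · obtain ⟨t', ht'⟩ := card_pos.1 (show 0 < (twins G x y t).card by omega)
      have ht'' := mem_twins.1 ht'
      have at' := h.symm.adj_twin ht'
      have nv := h.nbr hv0
      have vt' : ¬ G.Adj v0 t' := fun e => nv.2.2.2 ((at' v0).1 e.symm)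
      have vne : v0 ≠ t' := by
        rintro rfl
        exact (h.symm.twin_ne ht').2.1 (by simp [hv0])
      have := h.four_cycle huz.symm hzu ht''.1.symm ht''.2.2 hz.symm ((at' z).2 hz).symm hu.symm
        ((at' u).2 hu).symm (z := v0) (full z hz hp v0 hv0).ne' (full u hu hpu v0 hv0).ne'
        nv.2.1 vne
      rw [closedInd_of_adj (full z hz hp v0 hv0).symm, closedInd_of_adj (full u hu hpu v0 hv0).symm,
        closedInd_of_not_adj nv.2.1 nv.2.2.1, closedInd_of_not_adj vne vt'] at this
      norm_num at this
    · obtain ⟨s, hs⟩ := card_pos.1 (Nat.pos_of_ne_zero hM)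
      have hs' := mem_mids.1 hs
      have sne := h.symm.mid_ne hs
      have hzs : SameVec x y z s := by
        have e1 := h.inter' sne.2.1
        have e2 := h.inter' sne.1
        rw [hs'.2.2.1, hs'.2.2.2] at e1 e2
        have e3 := h.ip_zero
        have e4 := h.self_eq_degree o
        have e5 := h.self_eq_degree t
        have e6 := tT z hz
        refine h.same_of_common (nb z hz).2.1 (nb z hz).1 sne.2.1 sne.1 ?_ ?_
        · have : (common G s o : ℝ) = G.degree o := by linarith
          have : common G s o = G.degree o := by exact_mod_cast this
          omega
        · have : (common G s t : ℝ) = G.degree t := by linarith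
          have : common G s t = G.degree t := by exact_mod_cast this
          omega
      have hzs' : z ≠ s := by
        rintro rfl
        exact sne.2.2.1 (by simp [hz])
      obtain ⟨a, b, ea, eb, hab⟩ := h.exists_swap hzs' hzs
      have m1 : t ∈ closedNbhd G z \ closedNbhd G s := by
        rw [mem_sdiff, mem_closedNbhd]
        exact ⟨Or.inr hz.symm, fun e => sne.2.2.1 (mem_closedNbhd_comm.1 e)⟩
      have m2 : u ∈ closedNbhd G s \ closedNbhd G z := by
        rw [mem_sdiff, mem_closedNbhd, mem_closedNbhd]
        exact ⟨Or.inr ((h.symm.adj_mid hs u).2 (Or.inl hu)), by simp [huz, hzu]⟩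
      rw [ea, mem_singleton] at m1
      rw [eb, mem_singleton] at m2
      subst m1 m2
      have := h.symm.common_eq_zero_of_same (nb u hu).2.1 hab
      omega
  obtain ⟨x0, hx0, hx0p, hx0u⟩ := missed z0 hz0 hz0p
  have loop : ∀ u, G.Adj t u → common G u o = 0 → SameVec x y t u := fun u hu hu0 =>
    h.symm.same_of_common_eq_zero (nb u hu).2.1 hu0
  -- A twin of `t` would be exchanged for `z0` in the swap between `t` and `x0`, so `z0` would have
  -- the vector of `t`.
  have hT0 : (twins G x y t).card = 0 := by
    by_contra hc
    obtain ⟨t', ht'⟩ := card_pos.1 (Nat.pos_of_ne_zero hc)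
    obtain ⟨a, b, ea, eb, hab⟩ := h.exists_swap hx0.ne (loop x0 hx0 hx0p)
    have m1 : z0 ∈ closedNbhd G t \ closedNbhd G x0 := by
      rw [mem_sdiff, mem_closedNbhd]
      exact ⟨Or.inr hz0, fun e => (hx0u x0 (by simp [hx0])).2 rfl (mem_closedNbhd_comm.1 e)⟩
    have m2 : t' ∈ closedNbhd G x0 \ closedNbhd G t :=
      mem_sdiff.2 ⟨h.symm.twins_subset hx0 ht', (h.symm.twin_ne ht').1⟩
    rw [ea, mem_singleton] at m1
    rw [eb, mem_singleton] at m2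
    subst m1 m2
    exact hz0s ((mem_twins.1 ht').2.1.trans hab.symm)
  obtain ⟨s, hs1⟩ := card_eq_one.1 (show (mids G x y t o).card = 1 by omega)
  have hs : s ∈ mids G x y t o := by simp [hs1]
  have hs' := mem_mids.1 hs
  have sne := h.symm.mid_ne hs
  have sadj := h.symm.adj_mid hs
  -- The swap between `t` and a vertex of `U` exchanges `s` for a neighbour of `t` with the sum
  -- vector; this is a vertex of `Z`.
  have missed' : ∀ u, G.Adj t u → common G u o = 0 → ∃ z, G.Adj t z ∧ 0 < common G z o ∧
      ∀ v ∈ closedNbhd G t, v ∉ closedNbhd G u ↔ v = z := by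
    intro u hu hu0
    obtain ⟨a, b, ea, eb, hab⟩ := h.exists_swap hu.ne (loop u hu hu0)
    have m2 : s ∈ closedNbhd G u \ closedNbhd G t :=
      mem_sdiff.2 ⟨h.symm.mids_subset hu hs, sne.2.2.1⟩
    rw [eb, mem_singleton] at m2
    subst m2
    have m1 : a ∈ closedNbhd G t \ closedNbhd G u := by simp [ea]
    rw [mem_sdiff] at m1
    have hta : G.Adj t a := by
      rcases mem_closedNbhd.1 m1.1 with rfl | h'
      · exact absurd (mem_closedNbhd.2 (Or.inr hu.symm)) m1.2
      · exact h'
    refine ⟨a, hta, ?_, ?_⟩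
    · have e := h.inter' (nb a hta).2.1
      rw [hab.1, hab.2, hs'.2.2.1, hs'.2.2.2] at e
      have e3 := h.ip_zero
      have e4 := h.self_eq_degree o
      have : (common G a o : ℝ) = G.degree o := by linarith
      have : common G a o = G.degree o := by exact_mod_cast this
      omega
    · intro v hv
      have : v ∈ closedNbhd G t \ closedNbhd G u ↔ v = a := by simp [ea]
      rw [← this, mem_sdiff]
      simp [hv, -mem_closedNbhd]
  set Z := (G.neighborFinset t).filter fun z => 0 < common G z o with hZdef
  set U := (G.neighborFinset t).filter fun z => common G z o = 0 with hUdef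
  have mZ : ∀ z, z ∈ Z ↔ G.Adj t z ∧ 0 < common G z o := by intro z; simp [hZdef]
  have mU : ∀ z, z ∈ U ↔ G.Adj t z ∧ common G z o = 0 := by intro z; simp [hUdef]
  have sZ : s ∉ Z := fun e => sne.2.2.1 (by simp [((mZ s).1 e).1])
  have tU : t ∉ U := by simp [mU]
  have adjT : ∀ v, G.Adj t v → v ∈ closedNbhd G t := fun v hv => mem_closedNbhd.2 (Or.inr hv)
  -- The vertices `s` and `t` are nonadjacent to each other and adjacent to the remaining vertices
  -- of the opposite set, so they extend the matching of nonadjacent pairs between `Z` and `U`.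
  obtain ⟨f, g, hf, hg, hfg⟩ := exists_matched_enum (insert s Z) (insert t U)
    (fun v w => ¬ G.Adj v w) (by
      intro v hv
      rcases mem_insert.1 hv with rfl | hv
      · refine ⟨t, mem_insert_self _ _, fun w hw => ?_⟩
        rcases mem_insert.1 hw with rfl | hw
        · simpa using fun e : G.Adj v w => sne.2.2.1 (by simp [e.symm])
        · have hw' := ((mU w).1 hw).1
          simp [(sadj w).2 (Or.inl hw'), hw'.ne']
      · obtain ⟨hv1, hv2⟩ := (mZ v).1 hv
        obtain ⟨u, hu1, hu2, hu3⟩ := missed v hv1 hv2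
        refine ⟨u, mem_insert_of_mem ((mU u).2 ⟨hu1, hu2⟩), fun w hw => ?_⟩
        have hwt : w ∈ closedNbhd G t := by
          rcases mem_insert.1 hw with rfl | hw
          · exact self_mem_closedNbhd _
          · exact adjT _ ((mU w).1 hw).1
        have hwv : w ≠ v := by
          rintro rfl
          rcases mem_insert.1 hw with rfl | hw
          · exact hv1.ne rfl
          · have := ((mU w).1 hw).2; omega
        rw [← hu3 w hwt, mem_closedNbhd]
        simp [hwv]) (by
      intro w hw
      rcases mem_insert.1 hw with rfl | hw
      · refine ⟨s, mem_insert_self _ _, fun v hv => ?_⟩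
        rcases mem_insert.1 hv with rfl | hv
        · simpa using fun e : G.Adj v w => sne.2.2.1 (by simp [e.symm])
        · have hv' := ((mZ v).1 hv).1
          have : v ≠ s := fun e => sZ (e ▸ ‹v ∈ Z›)
          simp [hv'.symm, this]
      · obtain ⟨hw1, hw2⟩ := (mU w).1 hw
        obtain ⟨z, hz1, hz2, hz3⟩ := missed' w hw1 hw2
        refine ⟨z, mem_insert_of_mem ((mZ z).2 ⟨hz1, hz2⟩), fun v hv => ?_⟩
        rcases mem_insert.1 hv with rfl | hv
        · have : v ≠ z := by rintro rfl; exact sZ ((mZ _).2 ⟨hz1, hz2⟩)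
          simp [(sadj w).2 (Or.inl hw1), this]
        · have hvw : v ≠ w := by
            rintro rfl
            have := ((mZ v).1 hv).2; omega
          rw [← hz3 v (adjT _ ((mZ v).1 hv).1), mem_closedNbhd]
          simp [hvw, G.adj_comm v w])
  have hcards : (insert s Z).card = (insert t U).card := hg.card.symm
  rw [card_insert_of_notMem sZ, card_insert_of_notMem tU] at hcards
  have hDZ : G.degree t = 2 * Z.card := by
    have h1 : Z.card + U.card = (G.neighborFinset t).card := by
      rw [hZdef, hUdef, card_filter, card_filter, ← sum_add_distrib, card_eq_sum_ones]
      refine sum_congr rfl fun a _ => ?_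
      split_ifs <;> omega
    rw [SimpleGraph.card_neighborFinset_eq_degree] at h1
    omega
  have hZpos : 0 < Z.card := card_pos.2 ⟨z0, (mZ z0).2 ⟨hz0, hz0p⟩⟩
  have nU : ∀ u v, u ∈ U → G.Adj o v → ¬ G.Adj v u := by
    intro u v hu hv e
    have h1 := IsGram.inter_pos (G := G) (v := u) (w := o) (z := v) (by simp [e.symm]) (by simp [hv])
    have h2 := ((mU u).1 hu).2
    unfold common at h2
    omega
  have aZ : ∀ z v, z ∈ Z → G.Adj o v → G.Adj v z := fun z v hz hv =>
    (full z ((mZ z).1 hz).1 ((mZ z).1 hz).2 v hv).symm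
  have split : ∀ v, G.Adj t v → v ∈ Z ∨ v ∈ U := by
    intro v hv
    rw [mZ, mU]
    have := tT v hv
    by_cases h0 : common G v o = 0
    · exact Or.inr ⟨hv, h0⟩
    · exact Or.inl ⟨hv, by omega⟩
  have interZ : ∀ j, G.Adj o j → closedNbhd G j ∩ closedNbhd G t = Z := by
    intro j hj
    have nj := h.nbr hj
    ext z
    rw [mem_inter, mem_closedNbhd, mem_closedNbhd]
    constructor
    · rintro ⟨h1, rfl | h2⟩
      · rcases h1 with h1 | h1
        · exact absurd h1.symm nj.2.1
        · exact absurd h1 nj.2.2.1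
      · rcases split z h2 with h3 | h3
        · exact h3
        · rcases h1 with rfl | h1
          · exact absurd h2 nj.2.2.2
          · exact absurd h1 (nU z j h3 hj)
    · intro hz
      exact ⟨Or.inr (aZ z j hz hj), Or.inr ((mZ z).1 hz).1⟩
  have hmid : (mids G x y o t).card = 1 := by rw [mids_comm]; omega
  -- With `deg t = 2 |Z|` and `p`, `d` for the common count of `j` with `o` and the degree of `o`,
  -- the main equation becomes `2 p (p - d) = d (|Z| + 2 |twins|)`. The right side is positive, so
  -- `p = d + 1`.
  have fullO : ∀ j, G.Adj o j → common G j o = G.degree o + 1 ∧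
      2 * (G.degree o + 1) = G.degree o * (Z.card + 2 * (twins G x y o).card) := by
    intro j hj
    have e := h.nbr_eq hj
    have hq : common G j t = Z.card := by unfold common; rw [interZ j hj]
    rw [hq, hmid, hDZ] at e
    have h1 := common_le (G := G) j o
    have hZ' : (Z.card : ℤ) ≠ 0 := by exact_mod_cast hZpos.ne'
    have hd' : (0 : ℤ) < G.degree o := by exact_mod_cast hd
    have hZ'' : (0 : ℤ) < Z.card := by exact_mod_cast hZpos
    push_cast at e
    have e2 : 2 * (common G j o : ℤ) * (common G j o - G.degree o)
        = G.degree o * (Z.card + 2 * (twins G x y o).card) := by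
      refine mul_right_cancel₀ hZ' ?_
      linear_combination -e
    have e3 : (0 : ℤ) < 2 * (common G j o : ℤ) * (common G j o - G.degree o) := by
      rw [e2]; positivity
    have e4 : (G.degree o : ℤ) < common G j o := by
      by_contra hc
      have : (common G j o : ℤ) - G.degree o ≤ 0 := by linarith
      have h5 : (0 : ℤ) ≤ 2 * common G j o := by positivity
      nlinarith
    have e5 : common G j o = G.degree o + 1 := by omega
    refine ⟨e5, ?_⟩
    rw [e5] at e2
    push_cast at e2
    zify
    linarith
  -- All neighbours of `o` contain the closed neighbourhood of `o` and meet that of `t` in `Z`, so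
  -- they have equal closed neighbourhoods.
  have uniq : ∀ j, G.Adj o j → j = v0 := by
    intro j hj
    refine h.nbr_ext hj hv0 ?_ ?_
    · rw [inter_eq_right.2 (subset_of_common_eq (fullO j hj).1),
        inter_eq_right.2 (subset_of_common_eq (fullO v0 hv0).1)]
    · rw [interZ j hj, interZ v0 hv0]
  have hNO : G.neighborFinset o = {v0} := by
    ext v
    simp only [SimpleGraph.mem_neighborFinset, mem_singleton]
    exact ⟨uniq v, fun e => e ▸ hv0⟩
  have hd1 : G.degree o = 1 := by
    rw [← SimpleGraph.card_neighborFinset_eq_degree, hNO, card_singleton]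
  have harith := (fullO v0 hv0).2
  rw [hd1] at harith
  have key : HasPattern G ![(twins G x y o).card + 1, 1, (insert s Z).card, (insert s Z).card]
      kappaTail := by
    obtain ⟨f0, hf0⟩ := IsEnum.exists (insert o (twins G x y o)) h.card_cl
    have nv0 := h.nbr hv0
    have k1 := fun v (hv : v ∈ insert o (twins G x y o)) => h.cl_far hv
    have oW : ∀ w ∈ insert s Z, ¬ G.Adj o w := by
      intro w hw e
      rcases mem_insert.1 hw with rfl | hw
      · exact hs'.2.1 e
      · exact (nb w ((mZ w).1 hw).1).2.2.2 e
    have oK : ∀ w ∈ insert t U, w ∈ closedNbhd G t := by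
      intro w hw
      rcases mem_insert.1 hw with rfl | hw
      · exact self_mem_closedNbhd _
      · exact adjT _ ((mU w).1 hw).1
    have vW : ∀ w ∈ insert s Z, G.Adj v0 w := by
      intro w hw
      rcases mem_insert.1 hw with rfl | hw
      · exact ((sadj v0).2 (Or.inr hv0)).symm
      · exact aZ w v0 hw hv0
    have vK : ∀ w ∈ insert t U, ¬ G.Adj v0 w := by
      intro w hw
      rcases mem_insert.1 hw with rfl | hw
      · exact nv0.2.2.1
      · exact nU w v0 hw hv0
    have WW : ∀ v ∈ insert s Z, ∀ w ∈ insert s Z, v ≠ w → G.Adj v w := by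
      intro v hv w hw hvw
      rcases mem_insert.1 hv with rfl | hv <;> rcases mem_insert.1 hw with rfl | hw
      · exact absurd rfl hvw
      · exact (sadj w).2 (Or.inl ((mZ w).1 hw).1)
      · exact ((sadj v).2 (Or.inl ((mZ v).1 ‹v ∈ Z›).1)).symm
      · obtain ⟨u, hu1, hu2, hu3⟩ := missed v ((mZ v).1 hv).1 ((mZ v).1 hv).2
        by_contra hn
        have := (hu3 w (adjT _ ((mZ w).1 hw).1)).1 (by simp [hn, hvw.symm])
        have := ((mZ w).1 hw).2
        subst_vars
        omega
    have KK : ∀ v ∈ insert t U, ∀ w ∈ insert t U, v ≠ w → G.Adj v w := by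
      intro v hv w hw hvw
      rcases mem_insert.1 hv with rfl | hv <;> rcases mem_insert.1 hw with rfl | hw
      · exact absurd rfl hvw
      · exact ((mU w).1 hw).1
      · exact ((mU v).1 hv).1.symm
      · obtain ⟨u, hu1, hu2, hu3⟩ := missed' v ((mU v).1 hv).1 ((mU v).1 hv).2
        by_contra hn
        have := (hu3 w (adjT _ ((mU w).1 hw).1)).1 (by simp [hn, hvw.symm])
        have := ((mU w).1 hw).2
        subst_vars
        omega
    refine HasPattern.of_enum ![f0, fun _ => v0, f, g]
      ![insert o (twins G x y o), {v0}, insert s Z, insert t U] ?_ ?_ ?_ ?_ ?_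
    · intro i
      fin_cases i
      exacts [hf0, IsEnum.singleton v0, hf, hg]
    · decide
    · intro i j hij v
      fin_cases i <;> fin_cases j <;>
        first
        | exact absurd hij (by decide)
        | skip
      · exact fun hv hv' => (k1 v hv).1 (by rw [mem_singleton.1 hv']; exact hv0)
      · intro hv hv'
        rcases mem_insert.1 hv' with rfl | hv'
        · exact (k1 v hv).2.2.2 (by rw [mids_comm]; exact hs)
        · exact (k1 v hv).2.1 (adjT _ ((mZ v).1 hv').1)
      · exact fun hv hv' => (k1 v hv).2.1 (oK v hv')
      · intro hv hv'
        have := vW v hv'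
        rw [mem_singleton.1 hv] at this
        exact this.ne rfl
      · intro hv hv'
        have := oK v hv'
        rw [mem_singleton.1 hv] at this
        exact h.notMem (by simp [hv0]) this
      · intro hv hv'
        rcases mem_insert.1 hv with rfl | hv
        · exact sne.2.2.1 (oK v hv')
        · rcases mem_insert.1 hv' with rfl | hv'
          · exact ((mZ v).1 hv).1.ne rfl
          · have := ((mZ v).1 hv).2
            have := ((mU v).1 hv').2
            omega
    · intro v
      rcases h.cover v with hv | hv | hv | hv | hv
      · exact ⟨0, hv⟩
      · refine ⟨3, ?_⟩
        rw [card_eq_zero.1 hT0] at hv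
        exact mem_insert.2 (Or.inl (by simpa using hv))
      · refine ⟨2, ?_⟩
        rw [mids_comm, hs1, mem_singleton] at hv
        exact mem_insert.2 (Or.inl hv)
      · exact ⟨1, mem_singleton.2 (uniq v hv)⟩
      · rcases split v hv with hv | hv
        · exact ⟨2, mem_insert_of_mem hv⟩
        · exact ⟨3, mem_insert_of_mem hv⟩
    · intro i j hij k l hk hl hv hw
      fin_cases i <;> fin_cases j <;>
        first
        | exact absurd hij (by decide)
        | skip
      · exact iff_of_false (by rw [h.adj_cl hv]; exact (k1 _ hw).1) id
      · exact iff_of_true ((h.adj_cl hv _).2 hv0) trivial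
      · exact iff_of_false (by rw [h.adj_cl hv]; exact oW _ hw) id
      · exact iff_of_false (fun e => h.notMem
          (mem_closedNbhd.2 (Or.inr ((h.adj_cl hv _).1 e))) (oK _ hw)) id
      · exact iff_of_false (by simp) id
      · exact iff_of_true (vW _ hw) trivial
      · exact iff_of_false (vK _ hw) id
      · refine ⟨fun e => ?_, fun e => WW _ hv _ hw fun e' => e (hf.inj _ _ hk hl e')⟩
        rintro rfl; exact e.ne rfl
      · have := hfg k l hk hl
        show G.Adj (f k) (g l) ↔ k ≠ l
        rw [Ne, ← this, not_not]
      · refine ⟨fun e => ?_, fun e => KK _ hv _ hw fun e' => e (hg.inj _ _ hk hl e')⟩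
        rintro rfl; exact e.ne rfl
  rw [card_insert_of_notMem sZ] at key
  -- With `deg o = 1` the equation reads `4 = |Z| + 2 |twins|`, and `Z` is nonempty.
  have : Z.card = 4 ∧ (twins G x y o).card = 0 ∨ Z.card = 2 ∧ (twins G x y o).card = 1 := by omega
  rcases this with ⟨h1, h2⟩ | ⟨h1, h2⟩
  · rw [h1, h2] at key; exact Or.inl key
  · rw [h1, h2] at key; exact Or.inr key

/-- The graphs with two vertices whose closed neighbourhoods are disjoint. -/
lemma classification (h : IsOpposite G x y o t) :
    HasPattern G ![2, 2, 2, 1, 1] (kappaOpp .none .all .none) ∨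
      HasPattern G ![2, 2, 1, 2, 2] (kappaOpp .ne .eq .ne) ∨
      HasPattern G ![1, 1, 5, 5] kappaTail ∨ HasPattern G ![2, 1, 3, 3] kappaTail := by
  by_cases h1 : ∀ z, G.Adj t z → common G z t ≠ G.degree t + 1
  · exact Or.inr (Or.inr (h.not_full h1))
  by_cases h2 : ∀ z, G.Adj o z → common G z o ≠ G.degree o + 1
  · exact Or.inr (Or.inr (h.symm.not_full h2))
  push Not at h1 h2
  obtain ⟨l, hl, hlB⟩ := h1
  obtain ⟨j, hj, hjB⟩ := h2
  rcases h.full_both hj hjB hl hlB with h3 | h3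
  · exact Or.inl h3
  · exact Or.inr (Or.inl h3)

end IsOpposite
end OneFull

/-! ### Classes of equal vectors and their partner classes -/

section Partners
open scoped Classical
variable {V : Type*} [Fintype V] {G : SimpleGraph V} {x y : V → ℝ}

/-- `R` is a perfect matching between `K` and `L`. -/
def IsMatched (R : V → V → Prop) (K L : Finset V) : Prop :=
  (∀ v ∈ K, ∃ w ∈ L, ∀ w' ∈ L, R v w' ↔ w' = w) ∧ ∀ w ∈ L, ∃ v ∈ K, ∀ v' ∈ K, R v' w ↔ v' = v

lemma sum_card_inter_filter (R : V → V → Prop) (K L : Finset V) (v : V) :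
    ∑ w ∈ K, (L.filter (R v) ∩ L.filter (R w)).card
      = ∑ a ∈ L.filter (R v), (K.filter fun w => R w a).card := by
  simp_rw [card_filter]
  rw [sum_comm]
  refine sum_congr rfl fun w _ => ?_
  rw [← card_filter]
  congr 1
  ext a
  simp; tauto

/-- A relation between two sets such that of any two elements on one side, each has exactly one
private partner, is a perfect matching or the complement of one. -/
lemma isMatched_of_swap (R : V → V → Prop) {K L : Finset V}
    (hK : ∀ v ∈ K, ∀ w ∈ K, v ≠ w → (L.filter (R v) \ L.filter (R w)).card = 1)
    (hL : ∀ a ∈ L, ∀ b ∈ L, a ≠ b →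
      ((K.filter fun v => R v a) \ K.filter fun v => R v b).card = 1)
    (cK : 1 < K.card) (cL : 1 < L.card) :
    L.card = K.card ∧ (IsMatched R K L ∨ IsMatched (fun v w => ¬ R v w) K L) := by
  -- Sets that pairwise differ by exchanging one element all have the same size `e`, and distinct
  -- ones meet in `e - 1` elements.
  have const : ∀ {K L : Finset V} {R : V → V → Prop},
      (∀ v ∈ K, ∀ w ∈ K, v ≠ w → (L.filter (R v) \ L.filter (R w)).card = 1) → 1 < K.card →
      ∃ e, 1 ≤ e ∧ (∀ v ∈ K, (L.filter (R v)).card = e) ∧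
        ∀ v ∈ K, ∑ w ∈ K, (L.filter (R v) ∩ L.filter (R w)).card = e + (K.card - 1) * (e - 1) := by
    intro K L R hK cK
    obtain ⟨v0, hv0, w0, hw0, hne⟩ := one_lt_card.1 cK
    have h1 : ∀ v ∈ K, (L.filter (R v)).card = (L.filter (R v0)).card := by
      intro v hv
      by_cases hvv : v = v0
      · rw [hvv]
      have e1 := card_sdiff_add_card_inter (L.filter (R v)) (L.filter (R v0))
      have e2 := card_sdiff_add_card_inter (L.filter (R v0)) (L.filter (R v))
      rw [inter_comm] at e2
      rw [hK v hv v0 hv0 hvv] at e1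
      rw [hK v0 hv0 v hv (Ne.symm hvv)] at e2
      omega
    refine ⟨(L.filter (R v0)).card, ?_, h1, ?_⟩
    · have := card_le_card (sdiff_subset (s := L.filter (R v0)) (t := L.filter (R w0)))
      rwa [hK v0 hv0 w0 hw0 hne] at this
    · intro v hv
      rw [← add_sum_erase _ _ hv, inter_self, h1 v hv]
      congr 1
      rw [sum_congr rfl (g := fun _ => (L.filter (R v0)).card - 1), sum_const,
        card_erase_of_mem hv, smul_eq_mul]
      intro w hw
      rw [mem_erase] at hw
      have e1 := card_sdiff_add_card_inter (L.filter (R v)) (L.filter (R w))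
      rw [hK v hv w hw.2 (Ne.symm hw.1), h1 v hv] at e1
      omega
  obtain ⟨e, he1, he, hes⟩ := const hK cK
  obtain ⟨e', he1', he', hes'⟩ := const (R := fun a v => R v a) hL cL
  obtain ⟨v0, hv0⟩ := card_pos.1 (show 0 < K.card by omega)
  obtain ⟨a0, ha0⟩ := card_pos.1 (show 0 < L.card by omega)
  -- The incidences with a fixed trace are counted in two ways, from either side. Together with `|K|
  -- e = |L| e'` this forces `|K| = |L|` and `e = e'`.
  have s1 : e * e' = e + (K.card - 1) * (e - 1) := by
    rw [← hes v0 hv0, sum_card_inter_filter,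
      sum_congr rfl (fun a ha => he' a (mem_filter.1 ha).1), sum_const, he v0 hv0, smul_eq_mul]
  have s2 : e' * e = e' + (L.card - 1) * (e' - 1) := by
    rw [← hes' a0 ha0, sum_card_inter_filter (fun a v => R v a) L K a0,
      sum_congr rfl (fun a ha => he a (mem_filter.1 ha).1), sum_const, he' a0 ha0, smul_eq_mul]
  have s3 : K.card * e = L.card * e' := by
    have := sum_card_bipartiteAbove_eq_sum_card_bipartiteBelow (s := K) (t := L) R
    simp only [bipartiteAbove, bipartiteBelow] at this
    rw [sum_congr rfl he, sum_congr rfl he'] at this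
    simpa using this
  obtain ⟨k, hk⟩ : ∃ k, K.card = k + 1 := ⟨K.card - 1, by omega⟩
  obtain ⟨l, hl⟩ : ∃ l, L.card = l + 1 := ⟨L.card - 1, by omega⟩
  obtain ⟨p, rfl⟩ : ∃ p, e = p + 1 := ⟨e - 1, by omega⟩
  obtain ⟨q, rfl⟩ : ∃ q, e' = q + 1 := ⟨e' - 1, by omega⟩
  rw [hk, hl] at s3
  rw [hk] at s1
  rw [hl] at s2
  simp only [Nat.add_sub_cancel] at s1 s2
  have kl : k = l := by nlinarith
  subst kl
  have pq : p = q := by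
    have : p + 1 = q + 1 := Nat.eq_of_mul_eq_mul_left (Nat.succ_pos k) s3
    omega
  subst pq
  -- Here `p = e - 1` and `k = |K| - 1`: either every vertex has one partner, or every vertex misses
  -- exactly one.
  have s4 : p = 0 ∨ p + 1 = k := by
    have : p * (p + 1) = p * k := by nlinarith
    rcases Nat.eq_zero_or_pos p with h0 | h0
    · exact Or.inl h0
    · exact Or.inr (Nat.eq_of_mul_eq_mul_left h0 this)
  refine ⟨by rw [hk, hl], ?_⟩
  have uniq : ∀ {L : Finset V} {P : V → Prop}, (L.filter P).card = 1 →
      ∃ w ∈ L, ∀ w' ∈ L, P w' ↔ w' = w := by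
    intro L P hc
    obtain ⟨w, hw⟩ := card_eq_one.1 hc
    have : w ∈ L.filter P := by simp [hw]
    refine ⟨w, (mem_filter.1 this).1, fun w' hw' => ?_⟩
    have : w' ∈ L.filter P ↔ w' = w := by simp [hw]
    rw [← this, mem_filter]
    simp [hw']
  have compl : ∀ {L : Finset V} {P : V → Prop}, (L.filter P).card + 1 = L.card →
      ∃ w ∈ L, ∀ w' ∈ L, ¬ P w' ↔ w' = w := by
    intro L P hc
    refine uniq (P := fun w => ¬ P w) ?_
    have := card_filter_add_card_filter_not (s := L) P
    convert (show (L.filter fun w => ¬ P w).card = 1 by omega)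
  rcases s4 with h0 | h0
  · left
    exact ⟨fun v hv => uniq (by rw [he v hv, h0]), fun w hw => uniq (by rw [he' w hw, h0])⟩
  · right
    exact ⟨fun v hv => compl (by rw [he v hv]; omega), fun w hw => compl (by rw [he' w hw]; omega)⟩

/-- The set of vertices with the same vector as `v`. -/
noncomputable def cls (x y : V → ℝ) (v : V) : Finset V := univ.filter (SameVec x y v)

@[simp] lemma mem_cls {v w : V} : w ∈ cls x y v ↔ SameVec x y v w := by simp [cls]

lemma SameVec.refl (v : V) : SameVec x y v v := ⟨rfl, rfl⟩

/-- The vertices with the vectors of `k` and `l` form two cliques that are joined by a perfect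
matching or the complement of one, and all other vertices are joined to all or to none of the
vertices of each of these cliques. -/
structure IsPartner (G : SimpleGraph V) (x y : V → ℝ) (k l : V) : Prop where
  not_same : ¬ SameVec x y k l
  clique_left : ∀ v ∈ cls x y k, ∀ w ∈ cls x y k, v ≠ w → G.Adj v w
  clique_right : ∀ v ∈ cls x y l, ∀ w ∈ cls x y l, v ≠ w → G.Adj v w
  card_eq : (cls x y l).card = (cls x y k).card
  two_le : 2 ≤ (cls x y k).card
  left : ∀ z, z ∉ cls x y k → z ∉ cls x y l →
    (∀ v ∈ cls x y k, G.Adj z v) ∨ ∀ v ∈ cls x y k, ¬ G.Adj z v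
  right : ∀ z, z ∉ cls x y k → z ∉ cls x y l →
    (∀ v ∈ cls x y l, G.Adj z v) ∨ ∀ v ∈ cls x y l, ¬ G.Adj z v
  matched : IsMatched G.Adj (cls x y k) (cls x y l) ∨
    IsMatched (fun v w => ¬ G.Adj v w) (cls x y k) (cls x y l)

lemma IsMatched.symm {R : V → V → Prop} {K L : Finset V} (h : IsMatched R K L)
    (hR : ∀ v w, R v w ↔ R w v) : IsMatched R L K := by
  refine ⟨fun w hw => ?_, fun v hv => ?_⟩
  · obtain ⟨v, hv, hv'⟩ := h.2 w hw
    exact ⟨v, hv, fun v' h' => by rw [hR, hv' v' h']⟩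
  · obtain ⟨w, hw, hw'⟩ := h.1 v hv
    exact ⟨w, hw, fun w' h' => by rw [hR, hw' w' h']⟩

lemma IsPartner.symm {k l : V} (h : IsPartner G x y k l) : IsPartner G x y l k where
  not_same := fun hs => h.not_same hs.symm
  clique_left := h.clique_right
  clique_right := h.clique_left
  card_eq := h.card_eq.symm
  two_le := h.card_eq ▸ h.two_le
  left := fun z h1 h2 => h.right z h2 h1
  right := fun z h1 h2 => h.left z h2 h1
  matched := h.matched.imp (fun hm => hm.symm fun v w => G.adj_comm v w)
    fun hm => hm.symm fun v w => by rw [G.adj_comm]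

namespace IsGram

/-- A vertex is adjacent to all or to none of the vertices in a class of twins. -/
lemma adj_iff_of_twin_class (h : IsGram G x y) {s s' : V} (hne : s ≠ s') (hs : SameVec x y s s')
    (hn : ¬ G.Adj s s') {z : V} (hz : SameVec x y s z) {v : V} (hv : ¬ SameVec x y s v) :
    G.Adj v z ↔ G.Adj v s := by
  by_cases hsz : s = z
  · rw [hsz]
  by_cases hadj : G.Adj s z
  -- The swap between `s` and `z` exchanges some `a` for the twin `s'`. Both belong to the class, so
  -- a vertex outside it is not affected.
  · obtain ⟨a, b, ha, hb, hab⟩ := h.exists_swap hsz hz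
    have m1 : s' ∈ closedNbhd G z \ closedNbhd G s := by
      rw [mem_sdiff, mem_closedNbhd, mem_closedNbhd]
      exact ⟨Or.inr ((h.adj_iff_of_twin hne hs hn z).1 hadj).symm, by simp [hne.symm, hn]⟩
    rw [hb, mem_singleton] at m1
    subst m1
    have va : v ≠ a := by rintro rfl; exact hv (hs.trans hab.symm)
    have vs' : v ≠ s' := by rintro rfl; exact hv hs
    have e1 : v ∉ closedNbhd G s \ closedNbhd G z := by simp [ha, va]
    have e2 : v ∉ closedNbhd G z \ closedNbhd G s := by simp [hb, vs']
    have vs : v ≠ s := by rintro rfl; exact hv (SameVec.refl _)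
    have vz : v ≠ z := by rintro rfl; exact hv hz
    simp only [mem_sdiff, mem_closedNbhd, vs, vz, false_or] at e1 e2
    rw [G.adj_comm v z, G.adj_comm v s]
    tauto
  · rw [G.adj_comm v z, G.adj_comm v s]
    exact (h.adj_iff_of_twin hsz hz hadj v).symm

/-- Two members of the class differ by a single vertex on each side, and the two exchanged vertices
have equal vectors. Comparing three members through the pair `w`, `u` shows that the exchanged
vertices for `v`, `w` and for `v`, `u` have equal vectors, so one class contains all of them. -/
lemma exists_diff_class (h : IsGram G x y) {K : Finset V}
    (hK : ∀ v ∈ K, ∀ w ∈ K, SameVec x y v w) (cK : 1 < K.card) :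
    ∃ l, ∀ v ∈ K, ∀ w ∈ K, v ≠ w → ∀ a, a ∈ closedNbhd G v \ closedNbhd G w → SameVec x y l a := by
  have sw : ∀ v ∈ K, ∀ w ∈ K, v ≠ w → ∀ a a', a ∈ closedNbhd G v \ closedNbhd G w →
      a' ∈ closedNbhd G v \ closedNbhd G w → a = a' := by
    intro v hv w hw hvw a a' ha ha'
    obtain ⟨c, d, hc, -, -⟩ := h.exists_swap hvw (hK v hv w hw)
    rw [hc, mem_singleton] at ha ha'
    rw [ha, ha']
  have sw' : ∀ v ∈ K, ∀ w ∈ K, v ≠ w → ∀ a b, a ∈ closedNbhd G v \ closedNbhd G w →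
      b ∈ closedNbhd G w \ closedNbhd G v → SameVec x y a b := by
    intro v hv w hw hvw a b ha hb
    obtain ⟨c, d, hc, hd, hcd⟩ := h.exists_swap hvw (hK v hv w hw)
    rw [hc, mem_singleton] at ha
    rw [hd, mem_singleton] at hb
    rw [ha, hb]; exact hcd
  have ex : ∀ v ∈ K, ∀ w ∈ K, v ≠ w → ∃ a, a ∈ closedNbhd G v \ closedNbhd G w := by
    intro v hv w hw hvw
    obtain ⟨c, d, hc, -, -⟩ := h.exists_swap hvw (hK v hv w hw)
    exact ⟨c, by simp [hc]⟩
  have triple : ∀ v ∈ K, ∀ w ∈ K, ∀ u ∈ K, v ≠ w → v ≠ u → ∀ a a',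
      a ∈ closedNbhd G v \ closedNbhd G w → a' ∈ closedNbhd G v \ closedNbhd G u →
      SameVec x y a a' := by
    intro v hv w hw u hu hvw hvu a a' ha ha'
    by_cases hwu : w = u
    · subst hwu; rw [sw v hv w hw hvw a a' ha ha']; exact SameVec.refl _
    rw [mem_sdiff] at ha ha'
    by_cases hau : a ∈ closedNbhd G u
    · by_cases haw : a' ∈ closedNbhd G w
      · exact sw' u hu w hw (Ne.symm hwu) a a' (mem_sdiff.2 ⟨hau, ha.2⟩)
          (mem_sdiff.2 ⟨haw, ha'.2⟩)
      · rw [sw v hv w hw hvw a a' (mem_sdiff.2 ha) (mem_sdiff.2 ⟨ha'.1, haw⟩)]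
        exact SameVec.refl _
    · rw [sw v hv u hu hvu a a' (mem_sdiff.2 ⟨ha.1, hau⟩) (mem_sdiff.2 ha')]
      exact SameVec.refl _
  obtain ⟨v0, hv0, w0, hw0, hne⟩ := one_lt_card.1 cK
  obtain ⟨a0, ha0⟩ := ex v0 hv0 w0 hw0 hne
  refine ⟨a0, fun v hv w hw hvw a ha => ?_⟩
  by_cases hvv : v = v0
  · subst hvv
    exact triple v hv w0 hw0 w hw hne hvw a0 a ha0 ha
  · obtain ⟨c, hc⟩ := ex v0 hv0 v hv (Ne.symm hvv)
    obtain ⟨c', hc'⟩ := ex v hv v0 hv0 hvv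
    exact ((triple v0 hv0 w0 hw0 v hv hne (Ne.symm hvv) a0 c ha0 hc).trans
      (sw' v0 hv0 v hv (Ne.symm hvv) c c' hc hc')).trans
      (triple v hv v0 hv0 w hw hvv hvw c' a hc' ha)

/-- A class of vertices that is a clique with at least two elements has a partner. -/
lemma exists_partner (h : IsGram G x y) {k : V}
    (hcl : ∀ v ∈ cls x y k, ∀ w ∈ cls x y k, v ≠ w → G.Adj v w) (hc : 1 < (cls x y k).card) :
    ∃ l, IsPartner G x y k l := by
  have same : ∀ (k : V), ∀ v ∈ cls x y k, ∀ w ∈ cls x y k, SameVec x y v w := by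
    intro k v hv w hw
    exact (mem_cls.1 hv).symm.trans (mem_cls.1 hw)
  -- The partner is the class in which all exchanged vertices lie.
  obtain ⟨l, hl⟩ := h.exists_diff_class (same k) hc
  obtain ⟨v0, hv0, w0, hw0, hne⟩ := one_lt_card.1 hc
  obtain ⟨a0, b0, ha, hb, -⟩ := h.exists_swap hne (same k v0 hv0 w0 hw0)
  have ha0 : a0 ∈ closedNbhd G v0 \ closedNbhd G w0 := by simp [ha]
  have hb0 : b0 ∈ closedNbhd G w0 \ closedNbhd G v0 := by simp [hb]
  have la := hl v0 hv0 w0 hw0 hne a0 ha0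
  have lb := hl w0 hw0 v0 hv0 hne.symm b0 hb0
  rw [mem_sdiff] at ha0 hb0
  have hab : a0 ≠ b0 := by rintro rfl; exact ha0.2 hb0.1
  have hkl : ¬ SameVec x y k l := by
    intro hs
    have : a0 ∈ cls x y k := mem_cls.2 (hs.trans la)
    by_cases hh : w0 = a0
    · subst hh; exact ha0.2 (self_mem_closedNbhd _)
    · exact ha0.2 (mem_closedNbhd.2 (Or.inr (hcl w0 hw0 a0 this hh)))
  have notl : ∀ v, v ∈ cls x y k → ¬ SameVec x y l v := fun v hv hs =>
    hkl ((mem_cls.1 hv).trans hs.symm)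
  have adj0 : G.Adj v0 a0 := by
    rcases mem_closedNbhd.1 ha0.1 with rfl | h'
    · exact absurd la (notl _ hv0)
    · exact h'
  have nadj0 : ¬ G.Adj v0 b0 := fun e => hb0.2 (mem_closedNbhd.2 (Or.inr e))
  -- A nonadjacent pair in the partner class would make every outside vertex adjacent to all or none
  -- of it, but `v0` is adjacent to `a0` and not to `b0`.
  have hcl' : ∀ v ∈ cls x y l, ∀ w ∈ cls x y l, v ≠ w → G.Adj v w := by
    intro s hs s' hs' hss
    by_contra hn
    have e := fun z hz => h.adj_iff_of_twin_class hss (same l s hs s' hs') hn (z := z) hz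
      (v := v0) (fun e => notl v0 hv0 ((mem_cls.1 hs).trans e))
    have e1 := e a0 ((mem_cls.1 hs).symm.trans la)
    have e2 := e b0 ((mem_cls.1 hs).symm.trans lb)
    exact nadj0 (e2.2 (e1.1 adj0))
  have hc' : 1 < (cls x y l).card := one_lt_card.2 ⟨a0, mem_cls.2 la, b0, mem_cls.2 lb, hab⟩
  obtain ⟨k', hk'⟩ := h.exists_diff_class (same l) hc'
  -- The vertex `v0` distinguishes `a0` from `b0`, so the class of vertices exchanged within the
  -- partner class is the original class.
  have hk : ∀ v ∈ cls x y l, ∀ w ∈ cls x y l, v ≠ w → ∀ a,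
      a ∈ closedNbhd G v \ closedNbhd G w → SameVec x y k a := by
    have := hk' a0 (mem_cls.2 la) b0 (mem_cls.2 lb) hab v0 (mem_sdiff.2
      ⟨mem_closedNbhd_comm.1 ha0.1, fun e => hb0.2 (mem_closedNbhd_comm.1 e)⟩)
    intro v hv w hw hvw a ha
    exact ((mem_cls.1 hv0).trans this.symm).trans (hk' v hv w hw hvw a ha)
  have sw : ∀ {k l : V}, ¬ SameVec x y k l →
      (∀ v ∈ cls x y k, ∀ w ∈ cls x y k, v ≠ w → ∀ a,
        a ∈ closedNbhd G v \ closedNbhd G w → SameVec x y l a) →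
      ∀ v ∈ cls x y k, ∀ w ∈ cls x y k, v ≠ w →
        (((cls x y l).filter (G.Adj v)) \ (cls x y l).filter (G.Adj w)).card = 1 := by
    intro k l hkl hl v hv w hw hvw
    obtain ⟨a, b, ha, -, -⟩ := h.exists_swap hvw (same k v hv w hw)
    rw [card_eq_one]
    refine ⟨a, ?_⟩
    rw [← ha]
    ext z
    simp only [mem_sdiff, mem_filter, mem_closedNbhd]
    have nv : ∀ v ∈ cls x y k, z ∈ cls x y l → z ≠ v := by
      rintro v hv hz rfl
      exact hkl ((mem_cls.1 hv).trans (mem_cls.1 hz).symm)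
    constructor
    · rintro ⟨⟨h1, h2⟩, h3⟩
      have := nv w hw h1
      exact ⟨Or.inr h2, by tauto⟩
    · intro hz
      have hzl : z ∈ cls x y l := mem_cls.2 (hl v hv w hw hvw z (by
        simpa only [mem_sdiff, mem_closedNbhd] using hz))
      have := nv v hv hzl
      tauto
  have hm := isMatched_of_swap G.Adj (K := cls x y k) (L := cls x y l) (sw hkl hl) (by
    have := sw (fun e => hkl e.symm) hk
    simpa only [G.adj_comm] using this) hc hc'
  have other : ∀ {k l : V},
      (∀ v ∈ cls x y k, ∀ w ∈ cls x y k, v ≠ w → ∀ a,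
        a ∈ closedNbhd G v \ closedNbhd G w → SameVec x y l a) →
      ∀ z, z ∉ cls x y k → z ∉ cls x y l →
      (∀ v ∈ cls x y k, G.Adj z v) ∨ ∀ v ∈ cls x y k, ¬ G.Adj z v := by
    intro k l hl z hzk hzl
    by_contra hcon
    push Not at hcon
    obtain ⟨⟨v, hv, hv'⟩, w, hw, hw'⟩ := hcon
    refine hzl (mem_cls.2 (hl w hw v hv (by rintro rfl; exact hv' hw') z ?_))
    rw [mem_sdiff, mem_closedNbhd, mem_closedNbhd]
    refine ⟨Or.inr hw'.symm, ?_⟩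
    rintro (rfl | h')
    · exact hzk hv
    · exact hv' h'.symm
  exact ⟨l, hkl, hcl, hcl', hm.1, hc, other hl, fun z h1 h2 => other hk z h2 h1, hm.2⟩

end IsGram
end Partners

/-! ### Closed neighbourhoods that pairwise meet: vectors ordered by direction -/

/-- The relations between the blocks of `G₈`. -/
def kappa8 : Fin 5 → Fin 5 → BlockRel :=
  ![![.ne, .ne, .none, .none, .all], ![.ne, .ne, .none, .none, .all],
    ![.none, .none, .ne, .ne, .all], ![.none, .none, .ne, .ne, .all],
    ![.all, .all, .all, .all, .none]]

/-- The relations between the blocks of `G₉`. -/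
def kappa9 : Fin 4 → Fin 4 → BlockRel :=
  ![![.ne, .ne, .all, .none], ![.ne, .ne, .all, .none], ![.all, .all, .ne, .ne],
    ![.none, .none, .ne, .ne]]

section Meeting
open scoped Classical
variable {V : Type*} [Fintype V] {G : SimpleGraph V} {x y : V → ℝ}

/-- Graphs in which any two closed neighbourhoods meet, with at least two vectors. -/
structure IsMeeting (G : SimpleGraph V) (x y : V → ℝ) : Prop extends IsConnGram G x y where
  meet : ∀ v w, (closedNbhd G v ∩ closedNbhd G w).Nonempty
  exists_not_same : ∀ v, ∃ w, ¬ SameVec x y v w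

/-- The cross product of the vectors of two vertices. -/
def cross (x y : V → ℝ) (v w : V) : ℝ := x v * y w - y v * x w

lemma cross_neg (v w : V) : cross x y v w = - cross x y w v := by unfold cross; ring

lemma IsPartner.exists_trace {k l : V} (h : IsPartner G x y k l) :
    ∃ e, (e = 1 ∧ IsMatched G.Adj (cls x y k) (cls x y l) ∨
        e + 1 = (cls x y k).card ∧ IsMatched (fun v w => ¬ G.Adj v w) (cls x y k) (cls x y l)) ∧
      (∀ v ∈ cls x y k, ((cls x y l).filter (G.Adj v)).card = e) ∧
      ∀ v ∈ cls x y l, ((cls x y k).filter (G.Adj v)).card = e := by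
  have one : ∀ {K : Finset V} {P : V → Prop}, (∃ w ∈ K, ∀ w' ∈ K, P w' ↔ w' = w) →
      (K.filter P).card = 1 := by
    rintro K P ⟨w, hw, hw'⟩
    rw [card_eq_one]
    refine ⟨w, ?_⟩
    ext u
    rw [mem_filter, mem_singleton]
    exact ⟨fun hu => (hw' u hu.1).1 hu.2, by rintro rfl; exact ⟨hw, (hw' u hw).2 rfl⟩⟩
  have co : ∀ {K : Finset V} {P : V → Prop}, (∃ w ∈ K, ∀ w' ∈ K, ¬ P w' ↔ w' = w) →
      (K.filter P).card + 1 = K.card := by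
    intro K P hK
    have h1 := card_filter_add_card_filter_not (s := K) P
    have h2 := one hK
    convert h1
    convert h2.symm
  rcases h.matched with hm | hm
  · refine ⟨1, Or.inl ⟨rfl, hm⟩, fun v hv => one (hm.1 v hv), fun v hv => ?_⟩
    have := one (hm.2 v hv)
    simpa only [G.adj_comm] using this
  · have hc := h.two_le
    refine ⟨(cls x y k).card - 1, Or.inr ⟨by omega, hm⟩, fun v hv => ?_, fun v hv => ?_⟩
    · have := co (hm.1 v hv)
      rw [h.card_eq] at this
      omega
    · have := co (P := G.Adj v) (by
        obtain ⟨u, hu, hu'⟩ := hm.2 v hv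
        exact ⟨u, hu, fun w hw => by rw [← hu' w hw, G.adj_comm]⟩)
      omega

namespace IsMeeting

lemma ip_pos (h : IsMeeting G x y) (v w : V) : 0 < x v * x w + y v * y w := by
  by_cases hvw : v = w
  · subst hvw
    rw [h.self_eq_degree]
    exact_mod_cast IsGram.degree_pos' h.not_isolated v
  · rw [h.inter v w hvw]
    exact_mod_cast card_pos.2 (h.meet v w)

lemma cross_ne (h : IsMeeting G x y) {v w : V} (hs : ¬ SameVec x y v w) : cross x y v w ≠ 0 := by
  intro e
  refine hs (h.same_of_parallel v w ?_)
  unfold cross at e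
  linarith

/-- All inner products are positive, so the vectors lie within an acute sector and the sign of the
cross product is a linear order of directions. -/
lemma cross_trans (h : IsMeeting G x y) {u v w : V} (h1 : 0 < cross x y u v)
    (h2 : 0 < cross x y v w) : 0 < cross x y u w := by
  have e : cross x y u w * (x v * x v + y v * y v)
      = cross x y u v * (x v * x w + y v * y w) + cross x y v w * (x u * x v + y u * y v) := by
    unfold cross; ring
  have p1 := mul_pos h1 (h.ip_pos v w)
  have p2 := mul_pos h2 (h.ip_pos u v)
  by_contra hc
  have p3 := mul_nonneg (neg_nonneg.2 (not_lt.1 hc)) (h.ip_pos v v).le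
  linarith

/-- By Cramer's rule the vector of `j` is a positive combination of those of `i` and `k`. If `j`
were adjacent to neither, `IsGram.between` would make the closed neighbourhoods of `i` and `k`
disjoint. -/
lemma adj_of_between (h : IsMeeting G x y) {i j k : V} (h1 : 0 < cross x y i j)
    (h2 : 0 < cross x y j k) : G.Adj j i ∨ G.Adj j k := by
  by_contra hc
  push Not at hc
  have h3 := h.cross_trans h1 h2
  have e1 : x j = cross x y j k / cross x y i k * x i + cross x y i j / cross x y i k * x k := by
    field_simp
    unfold cross; ring
  have e2 : y j = cross x y j k / cross x y i k * y i + cross x y i j / cross x y i k * y k := by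
    field_simp
    unfold cross; ring
  have z : ∀ v, cross x y v v = 0 := fun v => by unfold cross; ring
  have := (h.between h.not_isolated (div_pos h2 h3) (div_pos h1 h3) e1 e2
    (by rintro rfl; rw [z] at h1; exact h1.ne rfl) (by rintro rfl; rw [z] at h2; exact h2.ne rfl)
    (by
      rintro ⟨e1, e2⟩
      unfold cross at h3
      rw [e1, e2] at h3
      nlinarith) hc.1 hc.2).2.2.1
  have hm := h.meet i k
  rw [this] at hm
  simp at hm

/-- Lagrange's identity. It turns products of cross products into counts of common neighbours, and
the identity `(ab)² = a² b²` for cross products into an equation between integers. -/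
lemma cross_mul (_ : IsMeeting G x y) (t v w : V) :
    cross x y t v * cross x y t w = (x t * x t + y t * y t) * (x v * x w + y v * y w)
      - (x t * x v + y t * y v) * (x t * x w + y t * y w) := by
  unfold cross; ring

lemma same_of_cross (h : IsMeeting G x y) {t v w : V}
    (h1 : x t * x v + y t * y v = x t * x w + y t * y w) (h2 : cross x y t v = cross x y t w) :
    SameVec x y v w := by
  have h0 := h.ip_pos t t
  unfold cross at h2
  have e1 : (x v - x w) * (x t * x t + y t * y t) = 0 := by
    linear_combination x t * h1 - y t * h2
  have e2 : (y v - y w) * (x t * x t + y t * y t) = 0 := by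
    linear_combination y t * h1 + x t * h2
  rcases mul_eq_zero.1 e1 with e1 | e1
  · rcases mul_eq_zero.1 e2 with e2 | e2
    · exact ⟨by linarith, by linarith⟩
    · exact absurd e2 h0.ne'
  · exact absurd e1 h0.ne'

/-- A vertex has at most one twin. -/
lemma twin_unique (h : IsMeeting G x y) {t t' t'' : V} (h1 : t ≠ t') (s1 : SameVec x y t t')
    (n1 : ¬ G.Adj t t') (h2 : t ≠ t'') (s2 : SameVec x y t t'') (n2 : ¬ G.Adj t t'') :
    t' = t'' := by
  by_contra hne
  have a1 := h.adj_iff_of_twin h1 s1 n1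
  have a2 := h.adj_iff_of_twin h2 s2 n2
  have n3 : ¬ G.Adj t' t'' := fun e => n2 ((a1 t'').2 e)
  -- If `t` were adjacent to `v` of the same class, both `t'` and `t''` would lie in the difference
  -- of their closed neighbourhoods, which has only one element.
  have tw : ∀ v, SameVec x y t v → v ≠ t → ¬ G.Adj t v := by
    intro v hv hvt hadj
    obtain ⟨a, b, -, hb, -⟩ := h.exists_swap hvt.symm hv
    have m1 : t' ∈ closedNbhd G v \ closedNbhd G t := by
      simp [h1.symm, n1, ((a1 v).1 hadj).symm]
    have m2 : t'' ∈ closedNbhd G v \ closedNbhd G t := by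
      simp [h2.symm, n2, ((a2 v).1 hadj).symm]
    rw [hb, mem_singleton] at m1 m2
    exact hne (m1.trans m2.symm)
  obtain ⟨j, hj⟩ := IsGram.exists_adj h.not_isolated t
  -- Two nonadjacent neighbours of `t` form a four-cycle with `t` and `t'` that `t''` violates. For
  -- two adjacent ones, the coclique condition says that three times one indicator equals a sum of
  -- two indicators, so all three vanish, and the two neighbours would have equal closed
  -- neighbourhoods.
  have uj : ∀ v, G.Adj t v → v = j := by
    intro w hw
    by_contra hwj
    have adj : G.Adj j w := by
      by_contra hn
      have key := fun z => h.four_cycle h1 n1 (Ne.symm hwj) hn hj hw ((a1 j).1 hj) ((a1 w).1 hw)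
        (z := z)
      have := key t'' h2.symm (Ne.symm hne) (((a2 j).1 hj).ne) (((a2 w).1 hw).ne)
      rw [closedInd_of_adj ((a2 j).1 hj), closedInd_of_adj ((a2 w).1 hw),
        closedInd_of_not_adj h2.symm (fun e => n2 e.symm),
        closedInd_of_not_adj (Ne.symm hne) (fun e => n3 e.symm)] at this
      norm_num at this
    have key := fun z => h.coclique_join_edge h1 h2 hne n1 n2 n3 adj hj ((a1 j).1 hj)
      ((a2 j).1 hj) hw ((a1 w).1 hw) ((a2 w).1 hw) (z := z)
    have hcases : ∀ v w, closedInd G v w = 0 ∨ closedInd G v w = 1 := by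
      intro v w; unfold closedInd; split_ifs <;> simp
    have hm : ∀ v w, w ∈ closedNbhd G v ↔ closedInd G v w = 1 := by
      intro v w; unfold closedInd; split_ifs <;> simp_all
    refine hwj (h.closedNbhd_injective ?_).symm
    ext z
    by_cases z1 : z = t
    · subst z1; simp [hj.symm, hw.symm]
    by_cases z2 : z = t'
    · subst z2; simp [((a1 j).1 hj).symm, ((a1 w).1 hw).symm]
    by_cases z3 : z = t''
    · subst z3; simp [((a2 j).1 hj).symm, ((a2 w).1 hw).symm]
    by_cases z4 : z = j
    · subst z4; simp [adj.symm]
    by_cases z5 : z = w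
    · subst z5; simp [adj]
    have e := key z z1 z2 z3 z4 z5
    have e1 : closedInd G z t' = closedInd G z t := by
      by_cases hz : G.Adj t z
      · rw [closedInd_of_adj hz.symm, closedInd_of_adj ((a1 z).1 hz).symm]
      · rw [closedInd_of_not_adj z1 (fun e => hz e.symm),
          closedInd_of_not_adj z2 (fun e => hz ((a1 z).2 e.symm))]
    have e2 : closedInd G z t'' = closedInd G z t := by
      by_cases hz : G.Adj t z
      · rw [closedInd_of_adj hz.symm, closedInd_of_adj ((a2 z).1 hz).symm]
      · rw [closedInd_of_not_adj z1 (fun e => hz e.symm),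
          closedInd_of_not_adj z3 (fun e => hz ((a2 z).2 e.symm))]
    rw [e1, e2] at e
    rw [hm, hm, closedInd_comm j, closedInd_comm w]
    rcases hcases z t with c1 | c1 <;> rcases hcases z j with c2 | c2 <;>
      rcases hcases z w with c3 | c3 <;> rw [c1, c2, c3] at e <;> rw [c2, c3] <;> norm_num at e
  have cnt : closedNbhd G t = {t, j} := by
    ext v
    simp only [mem_closedNbhd, mem_insert, mem_singleton]
    refine ⟨fun hv => hv.imp id (uj v), ?_⟩
    rintro (rfl | rfl)
    exacts [Or.inl rfl, Or.inr hj]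
  -- The closed neighbourhood of `t` is `{t, j}`, and every other closed neighbourhood meets it.
  have univ_j : ∀ v, v ≠ j → G.Adj j v := by
    intro v hv
    obtain ⟨u, hu⟩ := h.meet v t
    rw [cnt, mem_inter, mem_closedNbhd, mem_insert, mem_singleton] at hu
    rcases hu with ⟨h3, rfl | rfl⟩
    · rcases h3 with rfl | h3
      · exact hj.symm
      · exact absurd (uj v h3.symm) hv
    · rcases h3 with h3 | h3
      · exact absurd h3.symm hv
      · exact h3.symm
  have dt : x t * x t + y t * y t = 1 := by
    have := h.self t
    rw [cnt, card_pair hj.ne] at this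
    push_cast at this
    linarith
  have jt : x t * x j + y t * y j = 2 := by
    rw [h.inter t j hj.ne]
    have : closedNbhd G t ∩ closedNbhd G j = {t, j} := by
      rw [← cnt]
      refine inter_eq_left.2 ?_
      rw [cnt]
      intro v
      simp only [mem_insert, mem_singleton, mem_closedNbhd]
      rintro (rfl | rfl)
      · exact Or.inr hj.symm
      · exact Or.inl rfl
    rw [this, card_pair hj.ne]; norm_num
  have cj : closedNbhd G j = univ := by
    ext v
    simp only [mem_univ, iff_true, mem_closedNbhd]
    by_cases hv : v = j
    · exact Or.inl hv
    · exact Or.inr (univ_j v hv)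
  have jj := h.self j
  rw [cj, card_univ] at jj
  have hjs : ¬ SameVec x y t j := by
    rintro ⟨e1, e2⟩
    rw [← e1, ← e2] at jt
    linarith
  by_cases hY : ∃ v, v ≠ j ∧ ¬ SameVec x y t v
  -- As `j` is adjacent to everything, Lagrange's identity gives the same value for the square of
  -- the cross product of `t`, `v` and for its product with that of `t`, `j`. The two cross products
  -- are therefore equal, and comparing their squares gives the degree.
  · have facts : ∀ v, v ≠ j → ¬ SameVec x y t v → x t * x v + y t * y v = 1 ∧
        cross x y t v = cross x y t j ∧ (closedNbhd G v).card + 3 = Fintype.card V := by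
      intro v hvj hvs
      have ntv : ¬ G.Adj t v := fun e => hvj (uj v e)
      have tv : t ≠ v := by rintro rfl; exact hvs (SameVec.refl _)
      have e1 : x t * x v + y t * y v = 1 := by
        rw [h.inter t v tv]
        have : closedNbhd G t ∩ closedNbhd G v = {j} := by
          rw [cnt]
          ext z
          simp only [mem_inter, mem_insert, mem_singleton, mem_closedNbhd]
          constructor
          · rintro ⟨rfl | rfl, h4⟩
            · rcases h4 with h4 | h4
              · exact absurd h4 tv
              · exact absurd h4.symm ntv
            · rfl
          · rintro rfl
            exact ⟨Or.inr rfl, Or.inr (univ_j v hvj).symm⟩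
        rw [this, card_singleton]; norm_num
      have e2 := h.self v
      have e3 := h.inter v j hvj
      rw [cj, inter_univ] at e3
      have c1 := h.cross_mul t v v
      have c2 := h.cross_mul t v j
      rw [dt, e1] at c1 c2
      rw [jt, e3] at c2
      have hne := h.cross_ne hvs
      have e4 : cross x y t v = cross x y t j := by
        refine mul_left_cancel₀ hne ?_
        rw [c1, c2]; linarith
      refine ⟨e1, e4, ?_⟩
      have c3 := h.cross_mul t j j
      rw [← e4, c1, dt, jt] at c3
      have : ((closedNbhd G v).card + 3 : ℝ) = Fintype.card V := by linarith
      exact_mod_cast this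
    obtain ⟨v, hvj, hvs⟩ := hY
    -- By its size, the closed neighbourhood omits only the three twins. So there is only one such
    -- vertex `v`, the graph has five vertices, and `v` turns out to be parallel to `t`.
    have nT : ∀ v, v ≠ j → ¬ SameVec x y t v → closedNbhd G v = univ \ {t, t', t''} := by
      intro v hvj hvs
      have f := facts v hvj hvs
      refine eq_of_subset_of_card_le ?_ ?_
      · intro z hz
        simp only [mem_sdiff, mem_univ, true_and, mem_insert, mem_singleton, not_or]
        have tv : t ≠ v := by rintro rfl; exact hvs (SameVec.refl _)
        have ntv : ¬ G.Adj t v := fun e => hvj (uj v e)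
        rw [mem_closedNbhd] at hz
        refine ⟨?_, ?_, ?_⟩
        · rintro rfl
          rcases hz with rfl | hz
          · exact tv rfl
          · exact ntv hz.symm
        · rintro rfl
          rcases hz with rfl | hz
          · exact hvs s1
          · exact ntv ((a1 v).2 hz.symm)
        · rintro rfl
          rcases hz with rfl | hz
          · exact hvs s2
          · exact ntv ((a2 v).2 hz.symm)
      · rw [card_sdiff_of_subset (subset_univ _), card_univ,
          card_insert_of_notMem (by simp [h1, h2]), card_pair hne]
        omega
    have uv : ∀ z, z = t ∨ z = t' ∨ z = t'' ∨ z = j ∨ z = v := by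
      intro z
      by_contra hc
      push Not at hc
      obtain ⟨z1, z2, z3, z4, z5⟩ := hc
      by_cases hs : SameVec x y t z
      · have : z ∈ closedNbhd G v := by rw [nT v hvj hvs]; simp [z1, z2, z3]
        rcases mem_closedNbhd.1 this with h5 | h5
        · exact z5 h5
        · have := (h.adj_iff_of_twin z1.symm hs (tw z hs z1) v).2 h5.symm
          exact hvj (uj v this)
      · refine z5 (h.closedNbhd_injective ?_)
        rw [nT z z4 hs, nT v hvj hvs]
    have hv := h.self v
    have e : closedNbhd G v = {j, v} := by
      rw [nT v hvj hvs]
      have j1 : j ≠ t' := ((a1 j).1 hj).ne'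
      have j2 : j ≠ t'' := ((a2 j).1 hj).ne'
      have v0 : v ≠ t := by rintro rfl; exact hvs (SameVec.refl _)
      have v1 : v ≠ t' := by rintro rfl; exact hvs s1
      have v2 : v ≠ t'' := by rintro rfl; exact hvs s2
      ext z
      simp only [mem_sdiff, mem_univ, true_and, mem_insert, mem_singleton, not_or]
      constructor
      · rintro ⟨z1, z2, z3⟩
        have := uv z
        tauto
      · rintro (rfl | rfl)
        · exact ⟨hj.ne', j1, j2⟩
        · exact ⟨v0, v1, v2⟩
    rw [e, card_pair hvj.symm] at hv
    have c1 := h.cross_mul t v v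
    rw [dt, (facts v hvj hvs).1] at c1
    have := h.cross_ne hvs
    apply this
    push_cast at hv
    have : cross x y t v * cross x y t v = 0 := by rw [c1]; linarith
    exact mul_self_eq_zero.1 this
  · push Not at hY
    -- All vertices except `j` now have the vector of `t`, so the graph is a star. A nonzero cross
    -- product requires at least five leaves, and the fifth violates the condition of
    -- `IsGram.four_star`.
    have c3 := h.cross_mul t j j
    rw [dt, jt] at c3
    have hpos : 0 < cross x y t j * cross x y t j := by
      exact mul_self_pos.2 (h.cross_ne hjs)
    have h5 : (5 : ℝ) < Fintype.card V := by linarith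
    have h5' : 5 < Fintype.card V := by exact_mod_cast h5
    set S : Finset V := {t, t', t'', j} with hS
    have hSc : S.card ≤ 4 := card_le_four
    obtain ⟨p, hp, q, hq, hpq⟩ := one_lt_card.1 (show 1 < (univ \ S).card by
      rw [card_sdiff_of_subset (subset_univ _), card_univ]; omega)
    simp only [hS, mem_sdiff, mem_univ, true_and, mem_insert, mem_singleton, not_or] at hp hq
    have sp := hY p hp.2.2.2
    have sq := hY q hq.2.2.2
    have np := tw p sp hp.1
    have nq := tw q sq hq.1
    have ap := h.adj_iff_of_twin (Ne.symm hp.1) sp np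
    have aq := h.adj_iff_of_twin (Ne.symm hq.1) sq nq
    have := h.four_star h1 h2 (Ne.symm hp.1) hne (Ne.symm hp.2.1) (Ne.symm hp.2.2.1) n1 n2 np n3
      (fun e => np ((a1 p).2 e)) (fun e => np ((a2 p).2 e)) hj ((a1 j).1 hj) ((a2 j).1 hj)
      ((ap j).1 hj) (z := q) hq.1 hq.2.1 hq.2.2.1 (Ne.symm hpq) hq.2.2.2
    rw [closedInd_of_not_adj hq.1 (fun e => nq e.symm),
      closedInd_of_not_adj hq.2.1 (fun e => nq ((a1 q).2 e.symm)),
      closedInd_of_not_adj hq.2.2.1 (fun e => nq ((a2 q).2 e.symm)),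
      closedInd_of_not_adj (Ne.symm hpq) (fun e => nq ((ap q).2 e.symm)),
      closedInd_of_adj ((aq j).1 hj)] at this
    norm_num at this

end IsMeeting
end Meeting

/-! ### Nonadjacent vertices with equal vectors, leading to `G₈` and `G₉` -/

section Twins
open scoped Classical
variable {V : Type*} [Fintype V] {G : SimpleGraph V} {x y : V → ℝ}

/-- Two nonadjacent vertices with the same vector. -/
structure IsTwin (G : SimpleGraph V) (x y : V → ℝ) (t t' : V) : Prop
    extends IsMeeting G x y where
  ne : t ≠ t'
  same : SameVec x y t t'
  not_adj : ¬ G.Adj t t'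

/-- The neighbours of `t` with a different vector. -/
noncomputable def near (G : SimpleGraph V) (x y : V → ℝ) (t : V) : Finset V :=
  univ.filter fun w => G.Adj t w ∧ ¬ SameVec x y t w

/-- The vertices with a different vector not adjacent to `t`. -/
noncomputable def far (G : SimpleGraph V) (x y : V → ℝ) (t : V) : Finset V :=
  univ.filter fun w => ¬ G.Adj t w ∧ ¬ SameVec x y t w

lemma mem_near {t w : V} : w ∈ near G x y t ↔ G.Adj t w ∧ ¬ SameVec x y t w := by simp [near]

lemma mem_far {t w : V} : w ∈ far G x y t ↔ ¬ G.Adj t w ∧ ¬ SameVec x y t w := by simp [far]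

namespace IsTwin

variable {t t' : V}

lemma adj_cls (h : IsTwin G x y t t') {v z : V} (hv : SameVec x y t v) (hz : ¬ SameVec x y t z) :
    G.Adj z v ↔ G.Adj z t := h.adj_iff_of_twin_class h.ne h.same h.not_adj hv hz

/-- If `v` is adjacent to `t`, the swap between them exchanges `t'` for a vertex of the class not
adjacent to `v`; uniqueness is `IsMeeting.twin_unique`. The class therefore induces a cocktail party
graph. -/
lemma exists_mate (h : IsTwin G x y t t') : ∀ v ∈ cls x y t, ∃ v' ∈ cls x y t, v' ≠ v ∧
    ∀ w ∈ cls x y t, w ≠ v → (G.Adj v w ↔ w ≠ v') := by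
  have key : ∀ v, SameVec x y t v → ∃ v', SameVec x y t v' ∧ v' ≠ v ∧ ¬ G.Adj v v' := by
    intro v hv
    by_cases hvt : v = t
    · subst hvt; exact ⟨t', h.same, h.ne.symm, h.not_adj⟩
    by_cases hadj : G.Adj t v
    · obtain ⟨a, b, ha, hb, hab⟩ := h.exists_swap (Ne.symm hvt) hv
      have m1 : t' ∈ closedNbhd G v \ closedNbhd G t := by
        simp [h.ne.symm, h.not_adj, ((h.adj_iff_of_twin h.ne h.same h.not_adj v).1 hadj).symm]
      rw [hb, mem_singleton] at m1
      subst m1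
      have m2 : a ∈ closedNbhd G t \ closedNbhd G v := by simp [ha]
      simp only [mem_sdiff, mem_closedNbhd, not_or] at m2
      exact ⟨a, h.same.trans hab.symm, m2.2.1, m2.2.2⟩
    · exact ⟨t, SameVec.refl _, Ne.symm hvt, fun e => hadj e.symm⟩
  intro v hv
  rw [mem_cls] at hv
  obtain ⟨v', h1, h2, h3⟩ := key v hv
  refine ⟨v', mem_cls.2 h1, h2, fun w hw hwv => ⟨by rintro e rfl; exact h3 e, fun hne => ?_⟩⟩
  by_contra hn
  exact hne (h.twin_unique (Ne.symm h2) (hv.symm.trans h1) h3 (Ne.symm hwv)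
    (hv.symm.trans (mem_cls.1 hw)) hn).symm

/-- If `v` and `w` were nonadjacent, they would form a four-cycle with `t` and `t'`. Its condition
makes the closed neighbourhoods of `t` and `v` agree up to `w` and `t'`, so that `t` and `v` would
have equal vectors. -/
lemma near_clique (h : IsTwin G x y t t') {v w : V} (hv : v ∈ near G x y t)
    (hw : w ∈ near G x y t) (hvw : v ≠ w) : G.Adj v w := by
  by_contra hn
  rw [mem_near] at hv hw
  have tw := h.adj_iff_of_twin h.ne h.same h.not_adj
  refine hv.2 (h.same_of_card_le (v := t) (w := v) ?_)
  have key : ∀ z, z ≠ t → z ≠ t' → z ≠ v → z ≠ w → (G.Adj t z ↔ G.Adj v z) := by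
    intro z z1 z2 z3 z4
    have e := h.four_cycle h.ne h.not_adj hvw hn hv.1 hw.1 ((tw v).1 hv.1) ((tw w).1 hw.1) z1 z2 z3
      z4
    have hc : closedInd G z w = 0 ∨ closedInd G z w = 1 := by
      unfold closedInd; split_ifs <;> simp
    by_cases hz : G.Adj t z <;> by_cases hz' : G.Adj v z
    · simp [hz, hz']
    · rw [closedInd_of_adj hz.symm, closedInd_of_adj ((tw z).1 hz).symm,
        closedInd_of_not_adj z3 (fun e => hz' e.symm)] at e
      rcases hc with hc | hc <;> rw [hc] at e <;> norm_num at e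
    · rw [closedInd_of_not_adj z1 (fun e => hz e.symm), closedInd_of_not_adj z2
        (fun e => hz ((tw z).2 e.symm)), closedInd_of_adj hz'.symm] at e
      rcases hc with hc | hc <;> rw [hc] at e <;> norm_num at e
    · simp [hz, hz']
  have c1 : closedNbhd G t \ closedNbhd G v ⊆ {w} := by
    intro z
    simp only [mem_sdiff, mem_closedNbhd, mem_singleton, not_or]
    rintro ⟨h1, h2, h3⟩
    by_contra hzw
    have z1 : z ≠ t := by rintro rfl; exact h3 hv.1.symm
    have z2 : z ≠ t' := by rintro rfl; exact h3 ((tw v).1 hv.1).symm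
    exact h3 ((key z z1 z2 h2 hzw).1 (h1.resolve_left z1))
  have c2 : closedNbhd G v \ closedNbhd G t ⊆ {t'} := by
    intro z
    simp only [mem_sdiff, mem_closedNbhd, mem_singleton, not_or]
    rintro ⟨h1, h2, h3⟩
    by_contra hzt
    have z3 : z ≠ v := by rintro rfl; exact h3 hv.1
    have z4 : z ≠ w := by rintro rfl; exact h3 hw.1
    exact h3 ((key z h2 hzt z3 z4).2 (h1.resolve_left z3))
  have := card_le_card c1
  have := card_le_card c2
  simp only [card_singleton] at *
  omega

lemma card_split (S : Finset V) : S.card = (S ∩ cls x y t).card + (S ∩ near G x y t).card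
    + (S ∩ far G x y t).card := by
  simp_rw [← filter_mem_eq_inter, card_filter, ← sum_add_distrib]
  rw [card_eq_sum_ones]
  refine sum_congr rfl fun z _ => ?_
  by_cases h1 : SameVec x y t z <;> by_cases h2 : G.Adj t z <;>
    simp [mem_cls, mem_near, mem_far, h1, h2]

lemma near_sub (h : IsTwin G x y t t') {w : V} (hw : w ∈ near G x y t) :
    cls x y t ⊆ closedNbhd G w ∧ near G x y t ⊆ closedNbhd G w := by
  constructor
  · intro v hv
    rw [mem_closedNbhd]
    exact Or.inr ((h.adj_cls (mem_cls.1 hv) (mem_near.1 hw).2).2 (mem_near.1 hw).1.symm)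
  · intro v hv
    rw [mem_closedNbhd]
    by_cases hvw : v = w
    · exact Or.inl hvw
    · exact Or.inr (h.near_clique hw hv (Ne.symm hvw))

lemma far_inter (h : IsTwin G x y t t') {z : V} (hz : z ∈ far G x y t) :
    closedNbhd G z ∩ cls x y t = ∅ := by
  rw [eq_empty_iff_forall_notMem]
  intro v hv
  rw [mem_inter, mem_closedNbhd, mem_cls] at hv
  rw [mem_far] at hz
  rcases hv with ⟨rfl | h1, h2⟩
  · exact hz.2 h2
  · exact hz.1 ((h.adj_cls h2 hz.2).1 h1).symm

lemma degree_eq (h : IsTwin G x y t t') :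
    G.degree t + 2 = (cls x y t).card + (near G x y t).card := by
  have h1 := card_split (G := G) (x := x) (y := y) (t := t) (closedNbhd G t)
  rw [card_closedNbhd] at h1
  have e1 : closedNbhd G t ∩ cls x y t = (cls x y t).erase t' := by
    obtain ⟨m, -, hm', hm⟩ := h.exists_mate t (mem_cls.2 (SameVec.refl _))
    have : m = t' := by
      by_contra hne
      exact h.not_adj ((hm t' (mem_cls.2 h.same) h.ne.symm).2 (Ne.symm hne))
    subst this
    ext v
    rw [mem_inter, mem_erase, mem_closedNbhd]
    constructor
    · rintro ⟨rfl | h2, h3⟩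
      · exact ⟨h.ne, h3⟩
      · exact ⟨(hm v h3 h2.ne').1 h2, h3⟩
    · rintro ⟨h2, h3⟩
      by_cases hvt : v = t
      · exact ⟨Or.inl hvt, h3⟩
      · exact ⟨Or.inr ((hm v h3 hvt).2 h2), h3⟩
  have e2 : closedNbhd G t ∩ near G x y t = near G x y t := by
    refine inter_eq_right.2 fun v hv => ?_
    rw [mem_closedNbhd]; exact Or.inr (mem_near.1 hv).1
  have e3 : closedNbhd G t ∩ far G x y t = ∅ := by
    rw [eq_empty_iff_forall_notMem]
    intro v hv
    rw [mem_inter, mem_closedNbhd, mem_far] at hv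
    rcases hv with ⟨rfl | h1, h2⟩
    · exact h2.2 (SameVec.refl _)
    · exact h2.1 h1
  have hc : 0 < (cls x y t).card := card_pos.2 ⟨t, mem_cls.2 (SameVec.refl _)⟩
  rw [e1, e2, e3, card_erase_of_mem (mem_cls.2 h.same)] at h1
  simp at h1
  omega

lemma two_le_cls (h : IsTwin G x y t t') : 2 ≤ (cls x y t).card := by
  rw [← card_pair h.ne]
  refine card_le_card fun v => ?_
  simp only [mem_insert, mem_singleton, mem_cls]
  rintro (rfl | rfl)
  · exact SameVec.refl _
  · exact h.same

lemma ip_near (h : IsTwin G x y t t') {w : V} (hw : w ∈ near G x y t) :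
    x t * x w + y t * y w = G.degree t + 1 := by
  have hw' := mem_near.1 hw
  rw [h.inter t w hw'.1.ne]
  have : closedNbhd G t ∩ closedNbhd G w = closedNbhd G t := by
    refine inter_eq_left.2 fun v hv => ?_
    by_cases hs : SameVec x y t v
    · exact (h.near_sub hw).1 (mem_cls.2 hs)
    · rw [mem_closedNbhd] at hv
      rcases hv with rfl | hv
      · exact absurd (SameVec.refl _) hs
      · exact (h.near_sub hw).2 (mem_near.2 ⟨hv, hs⟩)
  rw [this, card_closedNbhd]; push_cast; rfl

lemma ip_far (h : IsTwin G x y t t') {z : V} (hz : z ∈ far G x y t) :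
    x t * x z + y t * y z = (closedNbhd G z ∩ near G x y t).card := by
  have hz' := mem_far.1 hz
  rw [h.inter t z (by rintro rfl; exact hz'.2 (SameVec.refl _))]
  congr 2
  ext v
  rw [mem_inter, mem_inter, mem_near, mem_closedNbhd]
  have := h.far_inter hz
  constructor
  · rintro ⟨h1, h2⟩
    have hs : ¬ SameVec x y t v := fun hs => by
      have : v ∈ closedNbhd G z ∩ cls x y t := mem_inter.2 ⟨h2, mem_cls.2 hs⟩
      rw [h.far_inter hz] at this
      simp at this
    refine ⟨h2, h1.resolve_left ?_, hs⟩
    rintro rfl; exact hs (SameVec.refl _)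
  · rintro ⟨h1, h2, -⟩
    exact ⟨Or.inr h2, h1⟩

lemma far_meets (h : IsTwin G x y t t') {z : V} (hz : z ∈ far G x y t) :
    0 < (closedNbhd G z ∩ near G x y t).card := by
  have := h.ip_pos t z
  rw [h.ip_far hz] at this
  exact_mod_cast this

lemma inter_near (h : IsTwin G x y t t') {v w : V} (hv : v ∈ near G x y t)
    (hw : w ∈ near G x y t) : (closedNbhd G v ∩ closedNbhd G w).card
      = G.degree t + 2 + (closedNbhd G v ∩ closedNbhd G w ∩ far G x y t).card := by
  rw [card_split (G := G) (x := x) (y := y) (t := t) (closedNbhd G v ∩ closedNbhd G w),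
    h.degree_eq, inter_eq_right.2 (subset_inter (h.near_sub hv).1 (h.near_sub hw).1),
    inter_eq_right.2 (subset_inter (h.near_sub hv).2 (h.near_sub hw).2)]

lemma inter_near_far (h : IsTwin G x y t t') {w z : V} (hw : w ∈ near G x y t)
    (hz : z ∈ far G x y t) : (closedNbhd G w ∩ closedNbhd G z).card
      = (closedNbhd G z ∩ near G x y t).card
        + (closedNbhd G w ∩ closedNbhd G z ∩ far G x y t).card := by
  rw [card_split (G := G) (x := x) (y := y) (t := t) (closedNbhd G w ∩ closedNbhd G z),
    inter_assoc, h.far_inter hz, inter_empty, card_empty, zero_add]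
  congr 2
  ext v
  simp only [mem_inter]
  exact ⟨fun hv => ⟨hv.1.2, hv.2⟩, fun hv => ⟨⟨(h.near_sub hw).2 hv.2, hv.1⟩, hv.2⟩⟩

lemma near_ne_far {v w : V} (hv : v ∈ near G x y t) (hw : w ∈ far G x y t) : v ≠ w := by
  rintro rfl
  exact (mem_far.1 hw).1 (mem_near.1 hv).1

/-- Lagrange's identity with the counts inserted: `w` is joined to the whole class of `t` and to all
other near vertices, so only its far neighbours remain variable. The three statements below are its
analogues for other pairs. -/
lemma cross_near_self (h : IsTwin G x y t t') {w : V} (hw : w ∈ near G x y t) :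
    cross x y t w * cross x y t w
      = G.degree t * (closedNbhd G w ∩ far G x y t).card - G.degree t - 1 := by
  have e := h.inter_near hw hw
  rw [inter_self] at e
  have e2 := h.self w
  rw [e] at e2
  push_cast at e2
  rw [h.cross_mul, h.ip_near hw, h.self_eq_degree]
  rw [show x w * x w + y w * y w = G.degree t + 1 + (closedNbhd G w ∩ far G x y t).card by linarith]
  ring

lemma cross_near_near (h : IsTwin G x y t t') {v w : V} (hv : v ∈ near G x y t)
    (hw : w ∈ near G x y t) (hvw : v ≠ w) : cross x y t v * cross x y t w
      = G.degree t * (closedNbhd G v ∩ closedNbhd G w ∩ far G x y t).card - 1 := by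
  rw [h.cross_mul, h.ip_near hw, h.ip_near hv, h.self_eq_degree, h.inter v w hvw,
    h.inter_near hv hw]
  push_cast
  ring

lemma cross_near_far (h : IsTwin G x y t t') {w z : V} (hw : w ∈ near G x y t)
    (hz : z ∈ far G x y t) : cross x y t w * cross x y t z
      = G.degree t * ((closedNbhd G z ∩ near G x y t).card
        + (closedNbhd G w ∩ closedNbhd G z ∩ far G x y t).card)
        - (G.degree t + 1) * (closedNbhd G z ∩ near G x y t).card := by
  rw [h.cross_mul, h.ip_near hw, h.ip_far hz, h.self_eq_degree, h.inter w z (near_ne_far hw hz),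
    h.inter_near_far hw hz]
  push_cast
  ring

lemma cross_far_self (h : IsTwin G x y t t') {z : V} (hz : z ∈ far G x y t) :
    cross x y t z * cross x y t z = G.degree t * ((closedNbhd G z ∩ near G x y t).card
        + (closedNbhd G z ∩ far G x y t).card - 1)
        - (closedNbhd G z ∩ near G x y t).card ^ 2 := by
  have e := card_split (G := G) (x := x) (y := y) (t := t) (closedNbhd G z)
  rw [h.far_inter hz, card_empty, zero_add] at e
  have e2 := h.self z
  rw [e] at e2
  push_cast at e2
  rw [h.cross_mul, h.ip_far hz, h.self_eq_degree]
  rw [show x z * x z + y z * y z = (closedNbhd G z ∩ near G x y t).card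
    + (closedNbhd G z ∩ far G x y t).card - 1 by linarith]
  ring

/-- Far vertices on both sides of `t` would place `t` between two vertices to which it is not
adjacent. -/
lemma far_same_side (h : IsTwin G x y t t') {v w : V} (hv : v ∈ far G x y t)
    (hw : w ∈ far G x y t) : 0 < cross x y t v * cross x y t w := by
  have h1 := h.cross_ne (mem_far.1 hv).2
  have h2 := h.cross_ne (mem_far.1 hw).2
  by_contra hc
  have key : ∀ v w, v ∈ far G x y t → w ∈ far G x y t → cross x y t v < 0 →
      0 < cross x y t w → False := by
    intro v w hv hw h1 h2
    rcases h.adj_of_between (i := v) (j := t) (k := w) (by rw [cross_neg]; linarith) h2 with h3 | h3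
    · exact (mem_far.1 hv).1 h3
    · exact (mem_far.1 hw).1 h3
  rcases lt_or_gt_of_ne h1 with h1 | h1 <;> rcases lt_or_gt_of_ne h2 with h2 | h2
  · exact hc (mul_pos_of_neg_of_neg h1 h2)
  · exact key v w hv hw h1 h2
  · exact key w v hw hv h2 h1
  · exact hc (mul_pos h1 h2)

/-- Both vertices lie on the same side of `t`, so one lies between `t` and the other; it is not
adjacent to `t`. -/
lemma far_adj (h : IsTwin G x y t t') {v w : V} (hv : v ∈ far G x y t) (hw : w ∈ far G x y t)
    (hs : ¬ SameVec x y v w) : G.Adj v w := by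
  have hvw := h.cross_ne hs
  have hpos := h.far_same_side hv hw
  wlog hlt : 0 < cross x y v w generalizing v w
  · have hlt' : cross x y v w < 0 := lt_of_le_of_ne (not_lt.1 hlt) hvw
    have hneg := cross_neg (x := x) (y := y) w v
    exact (this hw hv (fun e => hs e.symm) (by rw [hneg]; exact neg_ne_zero.2 hvw)
      (by rwa [mul_comm]) (by rw [hneg]; linarith)).symm
  have n1 : ¬ G.Adj v t := fun e => (mem_far.1 hv).1 e.symm
  have n2 : ¬ G.Adj w t := fun e => (mem_far.1 hw).1 e.symm
  rcases lt_or_gt_of_ne (h.cross_ne (mem_far.1 hv).2) with h1 | h1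
  · have h2 : cross x y t w < 0 := by
      by_contra hc
      nlinarith [not_lt.1 hc]
    exact ((h.adj_of_between hlt (by rw [cross_neg]; linarith)).resolve_right n2).symm
  · exact (h.adj_of_between h1 hlt).resolve_left n1

lemma near_nonempty (h : IsTwin G x y t t') : (near G x y t).Nonempty := by
  by_contra hc
  rw [not_nonempty_iff_eq_empty] at hc
  obtain ⟨w, hw⟩ := h.exists_not_same t
  refine hw (h.same_of_nbhd_same h.preconnected (fun v hv => ?_) w)
  by_contra hs
  have : v ∈ near G x y t := mem_near.2 ⟨hv, hs⟩
  rw [hc] at this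
  simp at this

/-- The equation states that the squared product of two cross products is the product of their
squares. If `m = 0`, two positive integers have product `1`. If `m > 0`, then `m < D` would make the
left side too small, so `m = D`; with `E = m + f` the equation becomes `(d m - d - 1)(f - 2) = d`,
which leaves only `m = d = 2` and `f = 4`. -/
lemma two_class_arith {d D E m : ℤ} (hd : 2 ≤ d) (h1 : 0 < d * D - d - 1) (hDE : D ≤ E)
    (hm : 0 ≤ m) (hmD : m ≤ D) (hne : 0 < m → D ≠ E)
    (e : (d * m - 1) * (d * m - 1) = (d * D - d - 1) * (d * E - d - 1)) :
    d = 2 ∧ ((m = 0 ∧ D = 2 ∧ E = 2) ∨ (m = 2 ∧ D = 2 ∧ E = 6)) := by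
  have h2 : 0 < d * E - d - 1 := by nlinarith
  rcases hm.eq_or_lt with rfl | hm
  · have e1 : (d * D - d - 1) * (d * E - d - 1) = 1 := by linarith
    have e2 : d * D - d - 1 = 1 ∧ d * E - d - 1 = 1 := by
      rcases Int.mul_eq_one_iff_eq_one_or_neg_one.1 e1 with h | h <;> omega
    have h3 : d ∣ 2 := ⟨D - 1, by linarith⟩
    have := Int.le_of_dvd (by norm_num) h3
    obtain rfl : d = 2 := by omega
    omega
  · have hlt : D < E := lt_of_le_of_ne hDE (hne hm)
    have hmD' : m = D := by
      by_contra hc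
      have h3 : m ≤ D - 1 := by omega
      have h4 : d * m ≤ d * (D - 1) := by nlinarith
      have h5 : 0 < d * m - 1 := by nlinarith
      have h6 : (d * m - 1) * (d * m - 1) ≤ (d * D - d - 1) * (d * D - d - 1) := by
        apply mul_le_mul <;> nlinarith
      have h7 : d * D - d - 1 < d * E - d - 1 := by nlinarith
      nlinarith
    subst hmD'
    obtain ⟨f, rfl⟩ : ∃ f, E = m + f := ⟨E - m, by ring⟩
    have e1 : (d * m - d - 1) * (f - 2) = d := by
      have : d * ((d * m - d - 1) * (f - 2)) = d * d := by linear_combination -e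
      exact mul_left_cancel₀ (by omega) this
    have hf : 0 < f - 2 := by
      by_contra hc
      nlinarith
    have h3 : d * m - d - 1 ≤ d := by nlinarith
    have h4 : m ≤ 2 := by
      by_contra hc
      nlinarith
    have h5 : 2 ≤ m := by
      by_contra hc
      nlinarith
    obtain rfl : m = 2 := by omega
    have e2 : (d - 1) * (f - 3) = 1 := by linarith
    rcases Int.mul_eq_one_iff_eq_one_or_neg_one.1 e2 with h | h <;> omega

/-- Two near vertices with different vectors have to satisfy `two_class_arith`, where `D`, `E`, `m`
are the numbers of far neighbours of each and of both. Both solutions are refuted by looking at a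
far vertex. -/
lemma near_same (h : IsTwin G x y t t') {v w : V} (hv : v ∈ near G x y t)
    (hw : w ∈ near G x y t) : SameVec x y v w := by
  by_contra hs
  have hvw : v ≠ w := by rintro rfl; exact hs (SameVec.refl _)
  wlog hle : (closedNbhd G v ∩ far G x y t).card ≤ (closedNbhd G w ∩ far G x y t).card
    generalizing v w
  · exact this hw hv (fun e => hs e.symm) hvw.symm (by omega)
  have cv := h.cross_near_self hv
  have cw := h.cross_near_self hw
  have cvw := h.cross_near_near hv hw hvw
  have nv := mul_self_pos.2 (h.cross_ne (mem_near.1 hv).2)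
  rw [cv] at nv
  have hd := h.degree_eq
  have hT := h.two_le_cls
  have hW : ({v, w} : Finset V) ⊆ near G x y t := by
    intro z
    simp only [mem_insert, mem_singleton]
    rintro (rfl | rfl) <;> assumption
  have hW2 := card_le_card hW
  rw [card_pair hvw] at hW2
  have hsub1 : closedNbhd G v ∩ closedNbhd G w ∩ far G x y t ⊆ closedNbhd G v ∩ far G x y t := by
    intro z; simp only [mem_inter]; tauto
  have hsub2 : closedNbhd G v ∩ closedNbhd G w ∩ far G x y t ⊆ closedNbhd G w ∩ far G x y t := by
    intro z; simp only [mem_inter]; tauto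
  have hm := card_le_card hsub1
  have key : (cross x y t v * cross x y t w) * (cross x y t v * cross x y t w)
      = (cross x y t v * cross x y t v) * (cross x y t w * cross x y t w) := by ring
  have hne : 0 < (closedNbhd G v ∩ closedNbhd G w ∩ far G x y t).card →
      (closedNbhd G v ∩ far G x y t).card ≠ (closedNbhd G w ∩ far G x y t).card := by
    intro hm hDE
    rw [hDE, ← cw] at cv
    have hpos : 0 < cross x y t v * cross x y t w := by
      rw [cvw]
      have h1 : (1 : ℝ) ≤ (closedNbhd G v ∩ closedNbhd G w ∩ far G x y t).card := by
        exact_mod_cast hm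
      have h2 : (2 : ℝ) ≤ G.degree t := by exact_mod_cast (show 2 ≤ G.degree t by omega)
      nlinarith
    rcases mul_self_eq_mul_self_iff.1 cv with e | e
    · exact hs (h.same_of_cross (by rw [h.ip_near hv, h.ip_near hw]) e)
    · rw [e] at hpos
      nlinarith [mul_self_nonneg (cross x y t w)]
  rw [cv, cw, cvw] at key
  obtain ⟨hd2, hcase⟩ := two_class_arith (d := G.degree t)
    (D := (closedNbhd G v ∩ far G x y t).card) (E := (closedNbhd G w ∩ far G x y t).card)
    (m := (closedNbhd G v ∩ closedNbhd G w ∩ far G x y t).card) (by omega)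
    (by exact_mod_cast nv) (by exact_mod_cast hle) (by positivity) (by exact_mod_cast hm)
    (fun h1 => by exact_mod_cast hne (by exact_mod_cast h1)) (by exact_mod_cast key)
  have hd2' : G.degree t = 2 := by exact_mod_cast hd2
  have hnear : ({v, w} : Finset V) = near G x y t := by
    refine eq_of_subset_of_card_le hW ?_
    rw [card_pair hvw]; omega
  rw [hd2'] at cv cw cvw
  rcases hcase with ⟨hm0, hD, hE⟩ | ⟨hm2, hD, hE⟩
  · have hm0' : (closedNbhd G v ∩ closedNbhd G w ∩ far G x y t) = ∅ :=
      card_eq_zero.1 (by exact_mod_cast hm0)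
    rw [hm0', card_empty] at cvw
    -- Here the product of the two cross products is `-1`, so `v` and `w` lie on opposite sides of
    -- `t`. Each has a far neighbour on its own side, whereas all far vertices lie on one side.
    have side : ∀ {v w}, v ∈ near G x y t → ({v, w} : Finset V) = near G x y t → v ≠ w →
        (closedNbhd G v ∩ closedNbhd G w ∩ far G x y t) = ∅ →
        (closedNbhd G v ∩ far G x y t).card = 2 →
        ∃ z ∈ far G x y t, 0 < cross x y t v * cross x y t z := by
      intro v w hv hnear hvw hm0 hD
      obtain ⟨z, hz⟩ := card_pos.1 (show 0 < (closedNbhd G v ∩ far G x y t).card by omega)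
      rw [mem_inter] at hz
      refine ⟨z, hz.2, ?_⟩
      rw [h.cross_near_far hv hz.2, hd2']
      have e1 : closedNbhd G z ∩ near G x y t = {v} := by
        rw [← hnear]
        ext u
        simp only [mem_inter, mem_insert, mem_singleton]
        constructor
        · rintro ⟨h1, rfl | rfl⟩
          · rfl
          · exfalso
            have : z ∈ closedNbhd G v ∩ closedNbhd G u ∩ far G x y t := by
              rw [mem_inter, mem_inter]
              exact ⟨⟨hz.1, mem_closedNbhd_comm.1 h1⟩, hz.2⟩
            rw [hm0] at this
            simp at this
        · rintro rfl
          exact ⟨mem_closedNbhd_comm.1 hz.1, Or.inl rfl⟩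
      have e2 : 0 < (closedNbhd G v ∩ closedNbhd G z ∩ far G x y t).card :=
        card_pos.2 ⟨z, by rw [mem_inter, mem_inter]; exact ⟨⟨hz.1, self_mem_closedNbhd _⟩, hz.2⟩⟩
      have e3 : (1 : ℝ) ≤ (closedNbhd G v ∩ closedNbhd G z ∩ far G x y t).card := by
        exact_mod_cast e2
      rw [e1, card_singleton]
      push_cast
      linarith
    obtain ⟨z, hz, hz'⟩ := side hv hnear hvw hm0' (by exact_mod_cast hD)
    obtain ⟨z', hz1, hz1'⟩ := side hw (by rw [pair_comm]; exact hnear) hvw.symm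
      (by rw [inter_comm (closedNbhd G w)]; exact hm0') (by exact_mod_cast hE)
    have e1 := mul_pos hz' hz1'
    have e2 := h.far_same_side hz hz1
    have e3 : cross x y t v * cross x y t z * (cross x y t w * cross x y t z')
      = (cross x y t v * cross x y t w) * (cross x y t z * cross x y t z') := by ring
    rw [e3, cvw] at e1
    push_cast at e1
    nlinarith
  -- A far vertex `z` adjacent to both has only far neighbours that are adjacent to `w`. With `r`
  -- the size of its closed neighbourhood among the far vertices, the identity for cross products
  -- becomes `(2r - 2)² = 9 (2r - 2)`, which is impossible by positivity and parity.
  · have hm2' : (closedNbhd G v ∩ closedNbhd G w ∩ far G x y t).card = 2 := by exact_mod_cast hm2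
    have hE' : (closedNbhd G w ∩ far G x y t).card = 6 := by exact_mod_cast hE
    have hD' : (closedNbhd G v ∩ far G x y t).card = 2 := by exact_mod_cast hD
    have hsub := eq_of_subset_of_card_le hsub1 (by omega)
    obtain ⟨z, hz⟩ := card_pos.1
      (show 0 < (closedNbhd G v ∩ closedNbhd G w ∩ far G x y t).card by omega)
    have hz' := hz
    rw [mem_inter, mem_inter] at hz
    have e1 : closedNbhd G z ∩ near G x y t = {v, w} := by
      rw [← hnear]
      refine inter_eq_right.2 fun u => ?_
      simp only [mem_insert, mem_singleton]
      rintro (rfl | rfl)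
      · exact mem_closedNbhd_comm.1 hz.1.1
      · exact mem_closedNbhd_comm.1 hz.1.2
    have e2 : closedNbhd G w ∩ closedNbhd G z ∩ far G x y t = closedNbhd G z ∩ far G x y t := by
      rw [inter_assoc]
      refine inter_eq_right.2 fun u hu => ?_
      rw [mem_inter] at hu
      obtain ⟨p, hp⟩ := card_pos.1 (h.far_meets hu.2)
      rw [mem_inter, ← hnear, mem_insert, mem_singleton] at hp
      rcases hp with ⟨h1, rfl | rfl⟩
      · have : u ∈ closedNbhd G p ∩ far G x y t := mem_inter.2 ⟨mem_closedNbhd_comm.1 h1, hu.2⟩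
        rw [← hsub, mem_inter, mem_inter] at this
        exact this.1.2
      · exact mem_closedNbhd_comm.1 h1
    have c1 := h.cross_far_self hz.2
    have c2 := h.cross_near_far hw hz.2
    rw [e1, card_pair hvw, hd2'] at c1 c2
    rw [e2] at c2
    rw [hE'] at cw
    set r := (closedNbhd G z ∩ far G x y t).card
    have hnz := h.cross_ne (mem_far.1 hz.2).2
    have key2 : (cross x y t w * cross x y t z) * (cross x y t w * cross x y t z)
      = (cross x y t w * cross x y t w) * (cross x y t z * cross x y t z) := by ring
    have hpos := mul_self_pos.2 hnz
    rw [c1] at hpos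
    rw [c1, c2, cw] at key2
    push_cast at key2 hpos
    have k3 : (2 * (r : ℝ) - 2) * ((2 * r - 2) - 9) = 0 := by linarith
    rcases mul_eq_zero.1 k3 with k4 | k4
    · linarith
    · have : (2 * r : ℝ) = 11 := by linarith
      have : 2 * r = 11 := by exact_mod_cast this
      omega

/-- One vertex joined to two classes of twins. -/
lemma single_near (h : IsTwin G x y t t') (hc : (near G x y t).card = 1) :
    ∃ k l, 1 ≤ k ∧ 1 ≤ l ∧ 3 ≤ k + l ∧ HasPattern G ![k, k, l, l, 1] kappa8 := by
  have : Nonempty V := ⟨t⟩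
  obtain ⟨w, hw1⟩ := card_eq_one.1 hc
  have hw : w ∈ near G x y t := by simp [hw1]
  have hd := h.degree_eq
  rw [hc] at hd
  have wfar : ∀ z, z ∈ far G x y t → G.Adj w z := by
    intro z hz
    obtain ⟨p, hp⟩ := card_pos.1 (h.far_meets hz)
    rw [mem_inter, hw1, mem_singleton] at hp
    obtain ⟨h1, rfl⟩ := hp
    rw [mem_closedNbhd] at h1
    exact (h1.resolve_left (near_ne_far hw hz)).symm
  have one : ∀ z, z ∈ far G x y t → (closedNbhd G z ∩ near G x y t).card = 1 := by
    intro z hz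
    have h1 := h.far_meets hz
    have h2 := card_le_card (inter_subset_right (s₁ := closedNbhd G z) (s₂ := near G x y t))
    omega
  have wf : closedNbhd G w ∩ far G x y t = far G x y t :=
    inter_eq_right.2 fun z hz => mem_closedNbhd.2 (Or.inr (wfar z hz))
  have dpos : (0 : ℝ) < G.degree t := by exact_mod_cast IsGram.degree_pos' h.not_isolated t
  have cw := h.cross_near_self hw
  rw [wf] at cw
  -- Every far vertex is adjacent to `w`, and the square of its cross product coincides with its
  -- product with that of `w`. Equality of the two then shows that each far vertex misses exactly
  -- one other, so the far vertices induce a cocktail party graph.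
  have eqc : ∀ z, z ∈ far G x y t → cross x y t z = cross x y t w ∧
      (closedNbhd G z ∩ far G x y t).card + 1 = (far G x y t).card := by
    intro z hz
    have c1 := h.cross_far_self hz
    have c2 := h.cross_near_far hw hz
    rw [one z hz] at c1 c2
    have e : closedNbhd G w ∩ closedNbhd G z ∩ far G x y t = closedNbhd G z ∩ far G x y t := by
      rw [inter_comm (closedNbhd G w), inter_assoc, wf]
    rw [e] at c2
    have e2 : cross x y t z = cross x y t w := by
      refine mul_right_cancel₀ (h.cross_ne (mem_far.1 hz).2) ?_
      rw [c1, c2]; push_cast; ring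
    refine ⟨e2, ?_⟩
    rw [e2, cw] at c1
    push_cast at c1
    have : ((closedNbhd G z ∩ far G x y t).card + 1 : ℝ) = (far G x y t).card := by
      refine mul_left_cancel₀ dpos.ne' ?_
      linarith
    exact_mod_cast this
  have mates : ∀ v ∈ far G x y t, ∃ v' ∈ far G x y t, v' ≠ v ∧
      ∀ u ∈ far G x y t, u ≠ v → (G.Adj v u ↔ u ≠ v') := by
    intro v hv
    have h1 := card_sdiff_add_card_inter (far G x y t) (closedNbhd G v)
    rw [inter_comm] at h1
    have h2 := (eqc v hv).2
    obtain ⟨v', hv'⟩ := card_eq_one.1 (show (far G x y t \ closedNbhd G v).card = 1 by omega)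
    have hm : ∀ u, u ∈ far G x y t → (u ∉ closedNbhd G v ↔ u = v') := by
      intro u hu
      have : u ∈ far G x y t \ closedNbhd G v ↔ u = v' := by rw [hv', mem_singleton]
      rw [← this, mem_sdiff]
      simp [hu, -mem_closedNbhd]
    have hv'' : v' ∈ far G x y t \ closedNbhd G v := by simp [hv']
    rw [mem_sdiff, mem_closedNbhd, not_or] at hv''
    refine ⟨v', hv''.1, hv''.2.1, fun u hu huv => ?_⟩
    rw [Ne, ← hm u hu, not_not, mem_closedNbhd]
    simp [huv]
  obtain ⟨k, f, g, hk, hfg, f1, g1, fg1, sur, ff, gg, fg⟩ := exists_enum_mates _ h.exists_mate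
  obtain ⟨l, f', g', hl, hfg', f1', g1', fg1', sur', ff', gg', fg'⟩ := exists_enum_mates _ mates
  have hwpos := mul_self_pos.2 (h.cross_ne (mem_near.1 hw).2)
  rw [cw, hl] at hwpos
  have hkd : G.degree t + 1 = 2 * k := by omega
  have hkd' : (G.degree t : ℝ) = 2 * k - 1 := by
    have : (G.degree t + 1 : ℝ) = 2 * k := by exact_mod_cast hkd
    linarith
  have hk1 : 1 ≤ k := by omega
  have hl1 : 1 ≤ l := by
    by_contra hl0
    have : l = 0 := by omega
    rw [this] at hwpos
    push_cast at hwpos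
    linarith
  refine ⟨k, l, hk1, hl1, ?_, ?_⟩
  -- For `k = l = 1` the cross product of `t` and `w` would vanish.
  · by_contra hkl
    have e1 : k = 1 := by omega
    have e2 : l = 1 := by omega
    rw [hkd', e1, e2] at hwpos
    norm_num at hwpos
  have fT := fun a (ha : a < k) => mem_cls.1 (hfg a ha).1
  have gT := fun a (ha : a < k) => mem_cls.1 (hfg a ha).2
  have fF := fun a (ha : a < l) => mem_far.1 (hfg' a ha).1
  have gF := fun a (ha : a < l) => mem_far.1 (hfg' a ha).2
  have nTF : ∀ u v, SameVec x y t u → (¬ G.Adj t v ∧ ¬ SameVec x y t v) → u ≠ v ∧ ¬ G.Adj u v := by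
    intro u v hu hv
    refine ⟨by rintro rfl; exact hv.2 hu, fun e => hv.1 ?_⟩
    exact ((h.adj_cls hu hv.2).1 e.symm).symm
  have wT : ∀ u, SameVec x y t u → u ≠ w ∧ G.Adj u w := by
    intro u hu
    refine ⟨by rintro rfl; exact (mem_near.1 hw).2 hu, ?_⟩
    exact ((h.adj_cls hu (mem_near.1 hw).2).2 (mem_near.1 hw).1.symm).symm
  have wF : ∀ v, (¬ G.Adj t v ∧ ¬ SameVec x y t v) → v ≠ w ∧ G.Adj v w := by
    intro v hv
    have := wfar v (mem_far.2 hv)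
    exact ⟨this.ne', this.symm⟩
  refine HasPattern.of_lt ![f, g, f', g', fun _ => w] ?_ ?_ ?_ ?_ ?_
  · decide
  · intro i
    fin_cases i
    · exact f1
    · exact g1
    · exact f1'
    · exact g1'
    · intro a b ha hb _
      have : a < 1 := ha
      have : b < 1 := hb
      omega
  · intro i j hij
    fin_cases i <;> fin_cases j <;>
      first
      | exact absurd hij (by decide)
      | skip
    · exact fg1
    · exact fun a b ha hb => (nTF _ _ (fT a ha) (fF b hb)).1
    · exact fun a b ha hb => (nTF _ _ (fT a ha) (gF b hb)).1
    · exact fun a b ha hb => (wT _ (fT a ha)).1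
    · exact fun a b ha hb => (nTF _ _ (gT a ha) (fF b hb)).1
    · exact fun a b ha hb => (nTF _ _ (gT a ha) (gF b hb)).1
    · exact fun a b ha hb => (wT _ (gT a ha)).1
    · exact fg1'
    · exact fun a b ha hb => (wF _ (fF a ha)).1
    · exact fun a b ha hb => (wF _ (gF a ha)).1
  · intro v
    by_cases h1 : SameVec x y t v
    · obtain ⟨a, ha, e | e⟩ := sur v (mem_cls.2 h1)
      exacts [⟨0, a, ha, e⟩, ⟨1, a, ha, e⟩]
    by_cases h2 : G.Adj t v
    · have : v ∈ near G x y t := mem_near.2 ⟨h2, h1⟩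
      rw [hw1, mem_singleton] at this
      exact ⟨4, 0, Nat.one_pos, this.symm⟩
    · obtain ⟨a, ha, e | e⟩ := sur' v (mem_far.2 ⟨h2, h1⟩)
      exacts [⟨2, a, ha, e⟩, ⟨3, a, ha, e⟩]
  · intro i j hij
    fin_cases i <;> fin_cases j <;>
      first
      | exact absurd hij (by decide)
      | skip
    · exact ff
    · exact fg
    · exact fun a b ha hb => iff_of_false (nTF _ _ (fT a ha) (fF b hb)).2 id
    · exact fun a b ha hb => iff_of_false (nTF _ _ (fT a ha) (gF b hb)).2 id
    · exact fun a b ha hb => iff_of_true (wT _ (fT a ha)).2 trivial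
    · exact gg
    · exact fun a b ha hb => iff_of_false (nTF _ _ (gT a ha) (fF b hb)).2 id
    · exact fun a b ha hb => iff_of_false (nTF _ _ (gT a ha) (gF b hb)).2 id
    · exact fun a b ha hb => iff_of_true (wT _ (gT a ha)).2 trivial
    · exact ff'
    · exact fg'
    · exact fun a b ha hb => iff_of_true (wF _ (fF a ha)).2 trivial
    · exact gg'
    · exact fun a b ha hb => iff_of_true (wF _ (gF a ha)).2 trivial
    · exact fun a b ha hb => iff_of_false (by simp) id

/-- For `e = 1` the equation becomes `(d s - 1)(k - 2) = d`. Then `d s - 1` divides `d`, hence `1`,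
and `k - 2 = d` contradicts `k ≤ d`. For `k = e + 1` it factors as `(d - e + 1)(d s (e - 1) + e d (e
- 2)) = 0`, where both summands of the second factor are nonnegative. -/
lemma many_arith {d k e s : ℤ} (hk : 2 ≤ k) (hd : k ≤ d) (hs : 0 ≤ s) (he : e = 1 ∨ e + 1 = k)
    (hpos : 0 < d * (e + s) - d - 1)
    (h : (d * (2 * e + s) - (d + 1) * e) * (d * (2 * e + s) - (d + 1) * e)
      = (d * (e + s) - d - 1) * (d * (e + k + s - 1) - e ^ 2)) : e = 2 ∧ k = 3 ∧ s = 0 := by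
  by_cases he1 : e = 1
  · subst he1
    exfalso
    have e1 : (d * s - 1) * (k - 2) = d := by
      have : d * ((d * s - 1) * (k - 2)) = d * d := by linear_combination -h
      exact mul_left_cancel₀ (by omega) this
    have h2 : 0 < d * s - 1 := by linarith
    have h3 : (d * s - 1) ∣ d := ⟨k - 2, e1.symm⟩
    have h4 : (d * s - 1) ∣ 1 := by
      have := (dvd_sub_right (h3.mul_right s)).2 (dvd_refl (d * s - 1))
      simpa using this
    have h5 := Int.le_of_dvd (by norm_num) h4
    have h6 : d * s - 1 = 1 := by omega
    rw [h6] at e1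
    omega
  · have hk' : k = e + 1 := by omega
    subst hk'
    have e1 : (d - e + 1) * (d * s * (e - 1) + e * d * (e - 2)) = 0 := by linear_combination -h
    have h2 : d - e + 1 ≠ 0 := by omega
    have h3 := (mul_eq_zero.1 e1).resolve_left h2
    have h4 : 0 ≤ d * s * (e - 1) := mul_nonneg (mul_nonneg (by omega) hs) (by omega)
    have h5 : 0 ≤ e * d * (e - 2) := mul_nonneg (mul_nonneg (by omega) (by omega)) (by omega)
    have h6 : e * d * (e - 2) = 0 := by linarith
    have h7 : e = 2 := by
      rcases mul_eq_zero.1 h6 with h | h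
      · rcases mul_eq_zero.1 h with h | h <;> omega
      · omega
    subst h7
    refine ⟨rfl, rfl, ?_⟩
    have h8 : d * s = 0 := by linarith
    rcases mul_eq_zero.1 h8 with h | h <;> omega

/-- A class of twins joined to a clique. -/
lemma many_near (h : IsTwin G x y t t') (hc : 2 ≤ (near G x y t).card) :
    ∃ l, 1 ≤ l ∧ HasPattern G ![l, l, 3, 3] kappa9 := by
  have : Nonempty V := ⟨t⟩
  obtain ⟨w, hw⟩ := h.near_nonempty
  have hd := h.degree_eq
  have hT := h.two_le_cls
  -- A vertex outside the near set with the same vector would be far and would have `deg t + 1` near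
  -- neighbours, more than there are near vertices.
  have hclsw : cls x y w = near G x y t := by
    ext v
    rw [mem_cls]
    refine ⟨fun hs => ?_, fun hv => h.near_same hw hv⟩
    by_contra hv
    have hvs : ¬ SameVec x y t v := fun e => (mem_near.1 hw).2 (e.trans hs.symm)
    have hvf : v ∈ far G x y t := mem_far.2 ⟨fun e => hv (mem_near.2 ⟨e, hvs⟩), hvs⟩
    have e1 := h.ip_near hw
    rw [hs.1, hs.2, h.ip_far hvf] at e1
    have e2 : (closedNbhd G v ∩ near G x y t).card = G.degree t + 1 := by exact_mod_cast e1
    have e3 := card_le_card (inter_subset_right (s₁ := closedNbhd G v) (s₂ := near G x y t))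
    omega
  obtain ⟨l0, hp⟩ := h.exists_partner (k := w) (by
    rw [hclsw]; exact fun v hv u hu hvu => h.near_clique hv hu hvu) (by rw [hclsw]; omega)
  obtain ⟨e, hem, het, het'⟩ := hp.exists_trace
  have hcard := hp.card_eq
  rw [hclsw] at hem het' hcard
  have hnear := fun z h1 h2 => hclsw ▸ hp.left z h1 h2
  -- The partner class is not the class of `t`, since `w` is adjacent to all of the latter but
  -- misses a vertex of the former.
  have hfarL : cls x y l0 ⊆ far G x y t := by
    intro a ha
    have hna : a ∉ near G x y t := by
      rw [← hclsw, mem_cls]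
      exact fun hs => hp.not_same (hs.trans (mem_cls.1 ha).symm)
    have hsa : ¬ SameVec x y t a := by
      intro hs
      have e1 : (cls x y l0).filter (G.Adj w) = cls x y l0 := by
        refine filter_true_of_mem fun b hb => ?_
        have : SameVec x y t b := (hs.trans (mem_cls.1 ha).symm).trans (mem_cls.1 hb)
        exact (h.adj_cls this (mem_near.1 hw).2).2 (mem_near.1 hw).1.symm
      have e2 := het w (mem_cls.2 (SameVec.refl _))
      rw [e1] at e2
      rcases hem with ⟨h1, -⟩ | ⟨h1, -⟩ <;> omega
    exact mem_far.2 ⟨fun e => hna (mem_near.2 ⟨e, hsa⟩), hsa⟩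
  set R := far G x y t \ cls x y l0 with hR
  have hRadj : ∀ r ∈ R, ∀ v ∈ near G x y t, G.Adj r v := by
    intro r hr
    rw [hR, mem_sdiff] at hr
    rcases hnear r (by
      intro hh
      have := mem_near.1 (hclsw ▸ hh)
      exact (mem_far.1 hr.1).1 this.1) hr.2 with h1 | h1
    · exact h1
    · obtain ⟨p, hp⟩ := card_pos.1 (h.far_meets hr.1)
      rw [mem_inter, mem_closedNbhd] at hp
      exact absurd (hp.1.resolve_left (near_ne_far hp.2 hr.1)) (h1 p hp.2)
  obtain ⟨z, hz⟩ := card_pos.1 (show 0 < (cls x y l0).card by omega)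
  have hzf := hfarL hz
  have cf : (far G x y t).card = R.card + (cls x y l0).card := by
    rw [hR, card_sdiff_of_subset hfarL]
    have := card_le_card hfarL
    omega
  have wfar : (closedNbhd G w ∩ far G x y t).card = e + R.card := by
    have : closedNbhd G w ∩ far G x y t = (cls x y l0).filter (G.Adj w) ∪ R := by
      ext v
      rw [mem_inter, mem_union, mem_filter, mem_closedNbhd]
      constructor
      · rintro ⟨h1, h2⟩
        by_cases hv : v ∈ cls x y l0
        · exact Or.inl ⟨hv, h1.resolve_left (near_ne_far hw h2).symm⟩
        · exact Or.inr (mem_sdiff.2 ⟨h2, hv⟩)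
      · rintro (⟨h1, h2⟩ | h1)
        · exact ⟨Or.inr h2, hfarL h1⟩
        · exact ⟨Or.inr (hRadj v h1 w hw).symm, (mem_sdiff.1 h1).1⟩
    rw [this, card_union_of_disjoint, het w (mem_cls.2 (SameVec.refl _))]
    rw [disjoint_left]
    intro v hv hv'
    exact (mem_sdiff.1 hv').2 (mem_filter.1 hv).1
  have znear : (closedNbhd G z ∩ near G x y t).card = e := by
    rw [← het' z hz]
    congr 1
    ext v
    rw [mem_inter, mem_filter, mem_closedNbhd]
    constructor
    · rintro ⟨h1, h2⟩
      exact ⟨h2, h1.resolve_left (near_ne_far h2 hzf)⟩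
    · rintro ⟨h1, h2⟩
      exact ⟨Or.inr h2, h1⟩
  have zfar : closedNbhd G z ∩ far G x y t = far G x y t := by
    refine inter_eq_right.2 fun v hv => mem_closedNbhd.2 ?_
    by_cases hvz : v = z
    · exact Or.inl hvz
    right
    by_cases hv' : v ∈ cls x y l0
    · exact hp.clique_right z hz v hv' (Ne.symm hvz)
    · refine h.far_adj hzf hv fun hs => hv' (mem_cls.2 ((mem_cls.1 hz).trans hs))
  have c1 := h.cross_near_self hw
  have c2 := h.cross_far_self hzf
  have c3 := h.cross_near_far hw hzf
  rw [inter_assoc, zfar, wfar, znear] at c3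
  rw [wfar] at c1
  rw [znear, zfar, cf, hcard] at c2
  have hpos := mul_self_pos.2 (h.cross_ne (mem_near.1 hw).2)
  have key : (cross x y t w * cross x y t z) * (cross x y t w * cross x y t z)
      = (cross x y t w * cross x y t w) * (cross x y t z * cross x y t z) := by ring
  rw [c1] at hpos
  rw [c1, c2, c3] at key
  -- Every near vertex has `e` neighbours in the partner class and is joined to the remaining far
  -- vertices `R`, while a vertex `z` of the partner class is adjacent to all other far vertices.
  -- The cross products of `t` with `w` and with `z` then give the equation of `many_arith`.
  have harith := many_arith (d := G.degree t) (k := (near G x y t).card) (e := e) (s := R.card)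
    (by exact_mod_cast hc) (by omega) (by positivity) (by omega) (by
      have : (0 : ℝ) < G.degree t * (e + R.card) - G.degree t - 1 := by push_cast at hpos; exact hpos
      exact_mod_cast this) (by
      have : ((G.degree t * (2 * e + R.card) - (G.degree t + 1) * e)
          * (G.degree t * (2 * e + R.card) - (G.degree t + 1) * e) : ℝ)
        = (G.degree t * (e + R.card) - G.degree t - 1)
          * (G.degree t * (e + (near G x y t).card + R.card - 1) - e ^ 2) := by
        push_cast at key
        have e1 : (G.degree t * (e + (e + R.card)) - (G.degree t + 1) * e : ℝ)
          = G.degree t * (2 * e + R.card) - (G.degree t + 1) * e := by ring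
        have e2 : (G.degree t * (e + (R.card + (near G x y t).card) - 1) - e ^ 2 : ℝ)
          = G.degree t * (e + (near G x y t).card + R.card - 1) - e ^ 2 := by ring
        rw [e1, e2] at key
        exact key
      exact_mod_cast this)
  obtain ⟨he2, hk3, hs0⟩ := harith
  have hk3' : (near G x y t).card = 3 := by exact_mod_cast hk3
  have hR0 : R = ∅ := card_eq_zero.1 (by exact_mod_cast hs0)
  have hLfar : cls x y l0 = far G x y t :=
    Subset.antisymm hfarL (sdiff_eq_empty_iff_subset.1 hR0)
  have hm : IsMatched (fun v w => ¬ G.Adj v w) (near G x y t) (cls x y l0) := by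
    rcases hem with ⟨h1, -⟩ | ⟨-, h1⟩
    · omega
    · exact h1
  obtain ⟨p, q, hp1, hq1, hpq⟩ := exists_matched_enum _ _ _ hm.1 hm.2
  rw [hk3'] at hp1 hq1 hpq
  obtain ⟨k, f, g, hk, hfg, f1, g1, fg1, sur, ff, gg, fg⟩ := exists_enum_mates _ h.exists_mate
  refine ⟨k, by omega, ?_⟩
  have fT := fun a (ha : a < k) => mem_cls.1 (hfg a ha).1
  have gT := fun a (ha : a < k) => mem_cls.1 (hfg a ha).2
  have pN := fun a (ha : a < 3) => hp1.mem a ha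
  have qF := fun a (ha : a < 3) => mem_far.1 (hLfar ▸ hq1.mem a ha)
  have nTF : ∀ u v, SameVec x y t u → (¬ G.Adj t v ∧ ¬ SameVec x y t v) → u ≠ v ∧ ¬ G.Adj u v := by
    intro u v hu hv
    refine ⟨by rintro rfl; exact hv.2 hu, fun e => hv.1 ?_⟩
    exact ((h.adj_cls hu hv.2).1 e.symm).symm
  have wT : ∀ u w, SameVec x y t u → w ∈ near G x y t → u ≠ w ∧ G.Adj u w := by
    intro u w hu hw
    refine ⟨by rintro rfl; exact (mem_near.1 hw).2 hu, ?_⟩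
    exact ((h.adj_cls hu (mem_near.1 hw).2).2 (mem_near.1 hw).1.symm).symm
  refine HasPattern.of_lt ![f, g, p, q] ?_ ?_ ?_ ?_ ?_
  · decide
  · intro i
    fin_cases i
    exacts [f1, g1, hp1.inj, hq1.inj]
  · intro i j hij
    fin_cases i <;> fin_cases j <;>
      first
      | exact absurd hij (by decide)
      | skip
    · exact fg1
    · exact fun a b ha hb => (wT _ _ (fT a ha) (pN b hb)).1
    · exact fun a b ha hb => (nTF _ _ (fT a ha) (qF b hb)).1
    · exact fun a b ha hb => (wT _ _ (gT a ha) (pN b hb)).1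
    · exact fun a b ha hb => (nTF _ _ (gT a ha) (qF b hb)).1
    · exact fun a b ha hb => near_ne_far (pN a ha) (mem_far.2 (qF b hb))
  · intro v
    by_cases h1 : SameVec x y t v
    · obtain ⟨a, ha, e | e⟩ := sur v (mem_cls.2 h1)
      exacts [⟨0, a, ha, e⟩, ⟨1, a, ha, e⟩]
    by_cases h2 : G.Adj t v
    · obtain ⟨a, ha, e⟩ := hp1.surj v (mem_near.2 ⟨h2, h1⟩)
      exact ⟨2, a, ha, e⟩
    · obtain ⟨a, ha, e⟩ := hq1.surj v (hLfar ▸ mem_far.2 ⟨h2, h1⟩)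
      exact ⟨3, a, ha, e⟩
  · intro i j hij
    fin_cases i <;> fin_cases j <;>
      first
      | exact absurd hij (by decide)
      | skip
    · exact ff
    · exact fg
    · exact fun a b ha hb => iff_of_true (wT _ _ (fT a ha) (pN b hb)).2 trivial
    · exact fun a b ha hb => iff_of_false (nTF _ _ (fT a ha) (qF b hb)).2 id
    · exact gg
    · exact fun a b ha hb => iff_of_true (wT _ _ (gT a ha) (pN b hb)).2 trivial
    · exact fun a b ha hb => iff_of_false (nTF _ _ (gT a ha) (qF b hb)).2 id
    · refine fun a b ha hb => ⟨?_, fun e => h.near_clique (pN a ha) (pN b hb)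
        fun e' => e (hp1.inj a b ha hb e')⟩
      rintro hh rfl; exact hh.ne rfl
    · intro a b ha hb
      show G.Adj (p a) (q b) ↔ a ≠ b
      rw [Ne, ← hpq a b ha hb, not_not]
    · refine fun a b ha hb => ⟨?_, fun e => hp.clique_right _ (hq1.mem a ha) _ (hq1.mem b hb)
        fun e' => e (hq1.inj a b ha hb e')⟩
      rintro hh rfl; exact hh.ne rfl

lemma classification (h : IsTwin G x y t t') :
    (∃ k l, 1 ≤ k ∧ 1 ≤ l ∧ 3 ≤ k + l ∧ HasPattern G ![k, k, l, l, 1] kappa8) ∨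
      ∃ l, 1 ≤ l ∧ HasPattern G ![l, l, 3, 3] kappa9 := by
  have := card_pos.2 h.near_nonempty
  by_cases hc : (near G x y t).card = 1
  · exact Or.inl (h.single_near hc)
  · exact Or.inr (h.many_near (by omega))

end IsTwin
end Twins

/-! ### Graphs covered by two cliques -/

/-- The relations between the blocks of `G₆`. -/
def kappa6 : Fin 2 → Fin 2 → BlockRel := ![![.ne, .eq], ![.eq, .ne]]

section TwoCliques
open scoped Classical
variable {V : Type*} [Fintype V] {G : SimpleGraph V} {x y : V → ℝ}

/-- The vertices are covered by two disjoint cliques that are unions of classes. -/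
structure IsTwoClique (G : SimpleGraph V) (x y : V → ℝ) (X Y : Finset V) : Prop
    extends IsMeeting G x y where
  cover : ∀ v, v ∈ X ∨ v ∈ Y
  disj : ∀ v ∈ X, v ∉ Y
  clique_left : ∀ v ∈ X, ∀ w ∈ X, v ≠ w → G.Adj v w
  clique_right : ∀ v ∈ Y, ∀ w ∈ Y, v ≠ w → G.Adj v w
  sat_left : ∀ v ∈ X, ∀ w, SameVec x y v w → w ∈ X
  sat_right : ∀ v ∈ Y, ∀ w, SameVec x y v w → w ∈ Y
  nonempty_left : X.Nonempty
  nonempty_right : Y.Nonempty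

/-- Any two sets `K`, `L` such that the adjacency between them is regular, and such that all other
vertices are adjacent to all or none of the vertices in each of them. -/
structure IsLinked (G : SimpleGraph V) (K L : Finset V) (e a : ℕ) : Prop where
  adj_left : ∀ v ∈ K, (L.filter (G.Adj v)).card = e
  not_left : ∀ v ∈ K, (L.filter fun w => ¬ G.Adj v w).card = a
  adj_right : ∀ v ∈ L, (K.filter (G.Adj v)).card = e
  not_right : ∀ v ∈ L, (K.filter fun w => ¬ G.Adj v w).card = a
  one : e = 1 ∨ a = 1
  left : ∀ z, z ∉ K → z ∉ L → (∀ v ∈ K, G.Adj z v) ∨ ∀ v ∈ K, ¬ G.Adj z v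
  right : ∀ z, z ∉ K → z ∉ L → (∀ v ∈ L, G.Adj z v) ∨ ∀ v ∈ L, ¬ G.Adj z v

lemma IsPartner.exists_linked {k l : V} (h : IsPartner G x y k l) :
    ∃ e a, 1 ≤ e ∧ 1 ≤ a ∧ IsLinked G (cls x y k) (cls x y l) e a := by
  obtain ⟨e, he, h1, h2⟩ := h.exists_trace
  have c2 := h.two_le
  have ce := h.card_eq
  refine ⟨e, (cls x y k).card - e, ?_, ?_, h1, fun v hv => ?_, h2, fun v hv => ?_, ?_, h.left,
    h.right⟩
  · rcases he with he | he <;> omega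
  · rcases he with he | he <;> omega
  · have := card_filter_add_card_filter_not (s := cls x y l) (G.Adj v)
    have := h1 v hv
    omega
  · have := card_filter_add_card_filter_not (s := cls x y k) (G.Adj v)
    have := h2 v hv
    omega
  · rcases he with he | he <;> omega

/-- Singleton classes have no partner; this degenerate link lets them be counted like partner
classes. -/
lemma IsLinked.singleton (G : SimpleGraph V) (w z : V) :
    ∃ e a, IsLinked G {w} {z} e a := by
  have c : ∀ w' z', w' ∈ ({w} : Finset V) → z' ∈ ({z} : Finset V) → w' = w ∧ z' = z := by simp
  have const : ∀ (u z' : V),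
      (∀ v ∈ ({u} : Finset V), G.Adj z' v) ∨ ∀ v ∈ ({u} : Finset V), ¬ G.Adj z' v := by
    intro u z'
    by_cases h : G.Adj z' u
    · left; simpa using h
    · right; simpa using h
  by_cases h : G.Adj w z
  · refine ⟨1, 0, ?_, ?_, ?_, ?_, Or.inl rfl, fun u _ _ => const w u, fun u _ _ => const z u⟩ <;>
      simp [filter_singleton, h, h.symm]
  · have h' : ¬ G.Adj z w := fun e => h e.symm
    refine ⟨0, 1, ?_, ?_, ?_, ?_, Or.inr rfl, fun u _ _ => const w u, fun u _ _ => const z u⟩ <;>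
      simp [filter_singleton, h, h']

/-- Counting common neighbours of two vertices in a set on which one is constant. -/
lemma exists_indicator {L : Finset V} {v w z : V} {e a : ℕ} (hz : z ∈ L)
    (h1 : (L.filter (G.Adj v)).card = e) (h2 : (L.filter fun u => ¬ G.Adj v u).card = a)
    (hw : (∀ u ∈ L, G.Adj w u) ∨ ∀ u ∈ L, ¬ G.Adj w u) :
    (G.Adj w z ∧ (L.filter fun u => G.Adj v u ∧ G.Adj w u).card = e ∧
      (L.filter fun u => ¬ G.Adj v u ∧ ¬ G.Adj w u).card = 0 ∧
      (L.filter fun u => G.Adj v u ∧ ¬ G.Adj w u).card = 0 ∧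
      (L.filter fun u => G.Adj w u ∧ ¬ G.Adj v u).card = a) ∨
    (¬ G.Adj w z ∧ (L.filter fun u => G.Adj v u ∧ G.Adj w u).card = 0 ∧
      (L.filter fun u => ¬ G.Adj v u ∧ ¬ G.Adj w u).card = a ∧
      (L.filter fun u => G.Adj v u ∧ ¬ G.Adj w u).card = e ∧
      (L.filter fun u => G.Adj w u ∧ ¬ G.Adj v u).card = 0) := by
  subst h1 h2
  rcases hw with hw | hw
  · left
    refine ⟨hw z hz, ?_, ?_, ?_, ?_⟩
    · exact congrArg card (filter_congr fun u hu => by simp [hw u hu])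
    · rw [card_eq_zero, filter_eq_empty_iff]; intro u hu; simp [hw u hu]
    · rw [card_eq_zero, filter_eq_empty_iff]; intro u hu; simp [hw u hu]
    · exact congrArg card (filter_congr fun u hu => by simp [hw u hu])
  · right
    refine ⟨hw z hz, ?_, ?_, ?_, ?_⟩
    · rw [card_eq_zero, filter_eq_empty_iff]; intro u hu; simp [hw u hu]
    · exact congrArg card (filter_congr fun u hu => by simp [hw u hu])
    · exact congrArg card (filter_congr fun u hu => by simp [hw u hu])
    · rw [card_eq_zero, filter_eq_empty_iff]; intro u hu; simp [hw u hu]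

lemma exists_indicator' {L : Finset V} {v w z : V} {e a : ℕ} (hz : z ∈ L)
    (h1 : (L.filter (G.Adj v)).card = e) (h2 : (L.filter fun u => ¬ G.Adj v u).card = a)
    (hw : (∀ u ∈ L, G.Adj w u) ∨ ∀ u ∈ L, ¬ G.Adj w u) :
    (G.Adj w z ∧ (L.filter fun u => G.Adj w u ∧ G.Adj v u).card = e ∧
      (L.filter fun u => ¬ G.Adj w u ∧ ¬ G.Adj v u).card = 0 ∧
      (L.filter fun u => G.Adj v u ∧ ¬ G.Adj w u).card = 0 ∧
      (L.filter fun u => G.Adj w u ∧ ¬ G.Adj v u).card = a) ∨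
    (¬ G.Adj w z ∧ (L.filter fun u => G.Adj w u ∧ G.Adj v u).card = 0 ∧
      (L.filter fun u => ¬ G.Adj w u ∧ ¬ G.Adj v u).card = a ∧
      (L.filter fun u => G.Adj v u ∧ ¬ G.Adj w u).card = e ∧
      (L.filter fun u => G.Adj w u ∧ ¬ G.Adj v u).card = 0) := by
  have := exists_indicator hz h1 h2 hw
  rwa [filter_congr (s := L) (q := fun u => G.Adj w u ∧ G.Adj v u) (fun u _ => and_comm),
    filter_congr (s := L) (q := fun u => ¬ G.Adj w u ∧ ¬ G.Adj v u) (fun u _ => and_comm)] at this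

/-- Three vectors in the plane are linearly dependent, so their Gram determinant vanishes. -/
lemma gram_det (a b c d e f : ℝ) :
    (a * a + b * b) * ((c * c + d * d) * (e * e + f * f) - (c * e + d * f) ^ 2)
      - (a * c + b * d) * ((a * c + b * d) * (e * e + f * f) - (c * e + d * f) * (a * e + b * f))
      + (a * e + b * f) * ((a * c + b * d) * (c * e + d * f) - (c * c + d * d) * (a * e + b * f))
      = 0 := by ring

namespace IsTwoClique

variable {X Y : Finset V}

lemma symm (h : IsTwoClique G x y X Y) : IsTwoClique G x y Y X where
  toIsMeeting := h.toIsMeeting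
  cover := fun v => (h.cover v).symm
  disj := fun v hv hv' => h.disj v hv' hv
  clique_left := h.clique_right
  clique_right := h.clique_left
  sat_left := h.sat_right
  sat_right := h.sat_left
  nonempty_left := h.nonempty_right
  nonempty_right := h.nonempty_left

lemma closedNbhd_eq (h : IsTwoClique G x y X Y) {v : V} (hv : v ∈ X) :
    closedNbhd G v = X ∪ Y.filter (G.Adj v) := by
  ext z
  rw [mem_closedNbhd, mem_union, mem_filter]
  constructor
  · rintro (rfl | hz)
    · exact Or.inl hv
    · exact (h.cover z).imp id fun hzY => ⟨hzY, hz⟩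
  · rintro (hz | hz)
    · by_cases hvz : z = v
      · exact Or.inl hvz
      · exact Or.inr (h.clique_left v hv z hz (Ne.symm hvz))
    · exact Or.inr hz.2

lemma disjoint (h : IsTwoClique G x y X Y) (P Q : V → Prop) :
    Disjoint (X.filter P) (Y.filter Q) := by
  rw [disjoint_left]
  intro z hz hz'
  exact h.disj z (mem_filter.1 hz).1 (mem_filter.1 hz').1

lemma card_self (h : IsTwoClique G x y X Y) {v : V} (hv : v ∈ X) :
    x v * x v + y v * y v + 1 = X.card + (Y.filter (G.Adj v)).card := by
  rw [h.self, h.closedNbhd_eq hv, card_union_of_disjoint]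
  · push_cast; rfl
  · exact disjoint_left.2 fun z hz hz' => h.disj z hz (mem_filter.1 hz').1

lemma card_inter (h : IsTwoClique G x y X Y) {v w : V} (hv : v ∈ X) (hw : w ∈ X) (hvw : v ≠ w) :
    x v * x w + y v * y w = X.card + (Y.filter fun u => G.Adj v u ∧ G.Adj w u).card := by
  rw [h.inter v w hvw, h.closedNbhd_eq hv, h.closedNbhd_eq hw, ← union_inter_distrib_left,
    ← filter_and, card_union_of_disjoint]
  · push_cast; rfl
  · exact disjoint_left.2 fun z hz hz' => h.disj z hz (mem_filter.1 hz').1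

lemma card_cross (h : IsTwoClique G x y X Y) {v u : V} (hv : v ∈ X) (hu : u ∈ Y) :
    x v * x u + y v * y u = (Y.filter (G.Adj v)).card + (X.filter (G.Adj u)).card := by
  have hvu : v ≠ u := by rintro rfl; exact h.disj v hv hu
  have : closedNbhd G v ∩ closedNbhd G u = X.filter (G.Adj u) ∪ Y.filter (G.Adj v) := by
    rw [h.closedNbhd_eq hv, h.symm.closedNbhd_eq hu]
    ext z
    simp only [mem_inter, mem_union, mem_filter]
    have := h.disj z
    tauto
  rw [h.inter v u hvu, this, card_union_of_disjoint (h.disjoint _ _)]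
  push_cast; ring

/-- Vertices of the same clique can differ only in the other one, and vertices with different
vectors differ in at least three places. -/
lemma delta (h : IsTwoClique G x y X Y) {v w : V} (hv : v ∈ X) (hw : w ∈ X)
    (hs : ¬ SameVec x y v w) :
    3 ≤ (Y.filter fun u => G.Adj v u ∧ ¬ G.Adj w u).card
      + (Y.filter fun u => G.Adj w u ∧ ¬ G.Adj v u).card := by
  have hd : ∀ v ∈ X, ∀ w ∈ X, closedNbhd G v \ closedNbhd G w
      = Y.filter fun u => G.Adj v u ∧ ¬ G.Adj w u := by
    intro v hv w hw
    rw [h.closedNbhd_eq hv, h.closedNbhd_eq hw]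
    ext z
    simp only [mem_sdiff, mem_union, mem_filter]
    have := h.disj z
    tauto
  rw [← hd v hv w hw, ← hd w hw v hv]
  exact h.three_le_card_sdiff_add hs

lemma eq_of_adj (h : IsTwoClique G x y X Y) {v w : V} (hv : v ∈ X) (hw : w ∈ X)
    (hvw : ∀ u ∈ Y, G.Adj v u ↔ G.Adj w u) : v = w := by
  refine h.closedNbhd_injective ?_
  rw [h.closedNbhd_eq hv, h.closedNbhd_eq hw, filter_congr hvw]

lemma cls_subset (h : IsTwoClique G x y X Y) {v : V} (hv : v ∈ X) : cls x y v ⊆ X :=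
  fun w hw => h.sat_left v hv w (mem_cls.1 hw)

/-- The partner of a class in one of the cliques lies in the other one. -/
lemma exists_partner_right (h : IsTwoClique G x y X Y) {v : V} (hv : v ∈ X)
    (hc : 1 < (cls x y v).card) : ∃ l ∈ Y, IsPartner G x y v l := by
  obtain ⟨l, hl⟩ := h.exists_partner (fun u hu w hw =>
    h.clique_left u (h.cls_subset hv hu) w (h.cls_subset hv hw)) hc
  refine ⟨l, (h.cover l).resolve_left fun hlX => ?_, hl⟩
  obtain ⟨e, a, -, ha, hlink⟩ := hl.exists_linked
  have := hlink.not_left v (mem_cls.2 (SameVec.refl v))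
  rw [filter_false_of_mem] at this
  · simp at this; omega
  · intro w hw
    rw [not_not]
    refine h.clique_left v hv w (h.cls_subset hlX hw) ?_
    rintro rfl
    exact hl.not_same (mem_cls.1 hw).symm

/-- The case of two classes. -/
lemma two_classes (h : IsTwoClique G x y X Y) (hX : ∀ v ∈ X, ∀ w ∈ X, SameVec x y v w)
    (hY : ∀ v ∈ Y, ∀ w ∈ Y, SameVec x y v w) : ∃ k, 3 ≤ k ∧ HasPattern G ![k, k] kappa6 := by
  have main : ∀ {X Y : Finset V}, IsTwoClique G x y X Y →
      (∀ v ∈ X, ∀ w ∈ X, SameVec x y v w) → (∀ v ∈ Y, ∀ w ∈ Y, SameVec x y v w) →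
      1 < X.card → ∃ k, 3 ≤ k ∧ HasPattern G ![k, k] kappa6 := by
    intro X Y h hX hY hc
    obtain ⟨v, hv⟩ := h.nonempty_left
    have eX : cls x y v = X := Subset.antisymm (h.cls_subset hv) fun w hw => mem_cls.2 (hX v hv w hw)
    obtain ⟨l, hl, hp⟩ := h.exists_partner_right hv (by rwa [eX])
    have eY : cls x y l = Y :=
      Subset.antisymm (h.symm.cls_subset hl) fun w hw => mem_cls.2 (hY l hl w hw)
    obtain ⟨e, hem, he1, he2⟩ := hp.exists_trace
    have ce := hp.card_eq
    rw [eX, eY] at hem he1 he2 ce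
    -- If each vertex missed exactly one on the other side, the closed neighbourhoods of a
    -- nonadjacent pair across would differ in at most two vertices, and the two cliques would have
    -- the same vector.
    have hne : e + 1 ≠ X.card := by
      intro he
      obtain ⟨u, hu, hvu⟩ : ∃ u ∈ Y, ¬ G.Adj v u := by
        by_contra hcon
        push Not at hcon
        have := he1 v hv
        rw [filter_true_of_mem hcon] at this
        omega
      have hvu' : ¬ SameVec x y v u := fun e => h.disj u (h.sat_left v hv u e) hu
      have hd : ∀ {X Y : Finset V}, IsTwoClique G x y X Y → Y.card = X.card →
          (∀ v ∈ Y, (X.filter (G.Adj v)).card = e) → e + 1 = X.card →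
          ∀ v ∈ X, ∀ u ∈ Y, (closedNbhd G v \ closedNbhd G u).card ≤ 1 := by
        intro X Y h ce he2 he v hv u hu
        have hsub : closedNbhd G v \ closedNbhd G u ⊆ X.filter fun z => ¬ G.Adj u z := by
          rw [h.closedNbhd_eq hv, h.symm.closedNbhd_eq hu]
          intro z
          simp only [mem_sdiff, mem_union, mem_filter]
          have := h.disj z
          tauto
        have := card_le_card hsub
        have := card_filter_add_card_filter_not (s := X) (G.Adj u)
        have := he2 u hu
        omega
      have h1 := hd h ce he2 he v hv u hu
      have h2 := hd h.symm ce.symm he1 (by omega) u hu v hv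
      exact hvu' (h.same_of_card_le (by omega))
    rcases hem with ⟨he, hm⟩ | ⟨he, -⟩
    · have : Nonempty V := ⟨v⟩
      obtain ⟨f, g, hf, hg, hfg⟩ := exists_matched_enum _ _ _ hm.1 hm.2
      refine ⟨X.card, by omega, HasPattern.of_enum ![f, g] ![X, Y] ?_ ?_ ?_ ?_ ?_⟩
      · intro i; fin_cases i
        exacts [hf, hg]
      · decide
      · intro i j hij v hv
        fin_cases i <;> fin_cases j <;> simp at hij
        exact h.disj v hv
      · intro v
        rcases h.cover v with hv | hv
        exacts [⟨0, hv⟩, ⟨1, hv⟩]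
      · intro i j hij a b ha hb m1 m2
        fin_cases i <;> fin_cases j
        · exact ⟨fun hh e => by subst e; exact G.loopless.irrefl _ hh, fun hab =>
            h.clique_left _ m1 _ m2 fun e => hab (hf.inj a b ha hb e)⟩
        · exact hfg a b ha hb
        · exact absurd hij (by decide)
        · exact ⟨fun hh e => by subst e; exact G.loopless.irrefl _ hh, fun hab =>
            h.clique_right _ m1 _ m2 fun e => hab (hg.inj a b ha hb e)⟩
    · exact absurd he hne
  by_cases c1 : 1 < X.card
  · exact main h hX hY c1
  by_cases c2 : 1 < Y.card
  · exact main h.symm hY hX c2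
  obtain ⟨v, hv⟩ := h.nonempty_left
  obtain ⟨u, hu⟩ := h.nonempty_right
  have hXv : ∀ w ∈ X, w = v := fun w hw => card_le_one.1 (not_lt.1 c1) w hw v hv
  have hYu : ∀ w ∈ Y, w = u := fun w hw => card_le_one.1 (not_lt.1 c2) w hw u hu
  obtain ⟨w, hw⟩ := IsGram.exists_adj h.not_isolated v
  have hwu : w = u := by
    rcases h.cover w with hh | hh
    · exact absurd (hXv w hh) hw.ne'
    · exact hYu w hh
  subst hwu
  refine absurd (h.closedNbhd_injective (a₁ := v) (a₂ := w) ?_) hw.ne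
  ext z
  rw [mem_closedNbhd, mem_closedNbhd]
  rcases h.cover z with hh | hh
  · rw [hXv z hh]; simp [hw.symm]
  · rw [hYu z hh]; simp [hw]

/-- The case in which one of the cliques is a class and the other one is not. -/
lemma one_class (h : IsTwoClique G x y X Y) (hX : ∃ v ∈ X, ∃ w ∈ X, ¬ SameVec x y v w)
    (hY : ∀ v ∈ Y, ∀ w ∈ Y, SameVec x y v w) : HasPattern G ![0, 1, 7, 7] kappaTail := by
  obtain ⟨v, hv, w, hw, hvw⟩ := hX
  have cY : 3 ≤ Y.card := by
    have h1 := h.delta hv hw hvw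
    rw [← card_union_of_disjoint] at h1
    · exact h1.trans (card_le_card (union_subset (filter_subset _ _) (filter_subset _ _)))
    · rw [disjoint_left]
      intro z hz hz'
      exact (mem_filter.1 hz').2.2 (mem_filter.1 hz).2.1
  obtain ⟨q, hq⟩ := h.nonempty_right
  have eY : cls x y q = Y := Subset.antisymm (h.symm.cls_subset hq) fun w hw => mem_cls.2 (hY q hq w hw)
  obtain ⟨p, hp, hpart⟩ := h.symm.exists_partner_right hq (by rw [eY]; omega)
  have hpart := hpart.symm
  obtain ⟨e, hem, he1, he2⟩ := hpart.exists_trace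
  have ce := hpart.card_eq
  have hright := hpart.right
  have hPX := h.cls_subset hp
  rw [eY] at hem he1 he2 ce hright
  set P := cls x y p
  have hpP : p ∈ P := mem_cls.2 (SameVec.refl p)
  -- A vertex of `X` outside the partner class `P` of `Y` sees all or nothing of `Y`, so there is at
  -- most one of each sort. The bounds `3 ≤ e` and `e + 3 ≤ |Y|` below, with `e = 1` or `e + 1 =
  -- |Y|`, exclude that both sorts occur: `X` is `P` with one further vertex `i`.
  have const : ∀ z ∈ X, z ∉ P → (∀ u ∈ Y, G.Adj z u) ∨ ∀ u ∈ Y, ¬ G.Adj z u := fun z hz hzP =>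
    hright z hzP (h.disj z hz)
  have uniq_all : ∀ z ∈ X, ∀ z' ∈ X, (∀ u ∈ Y, G.Adj z u) → (∀ u ∈ Y, G.Adj z' u) → z = z' :=
    fun z hz z' hz' h1 h2 => h.eq_of_adj hz hz' fun u hu => by simp [h1 u hu, h2 u hu]
  have uniq_none : ∀ z ∈ X, ∀ z' ∈ X, (∀ u ∈ Y, ¬ G.Adj z u) → (∀ u ∈ Y, ¬ G.Adj z' u) → z = z' :=
    fun z hz z' hz' h1 h2 => h.eq_of_adj hz hz' fun u hu => by simp [h1 u hu, h2 u hu]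
  have notP : ∀ z, z ∉ P → ¬ SameVec x y p z := fun z hz hs => hz (mem_cls.2 hs)
  have d_none : ∀ z ∈ X, z ∉ P → (∀ u ∈ Y, ¬ G.Adj z u) → 3 ≤ e := by
    intro z hz hzP hn
    have := h.delta hp hz (notP z hzP)
    rw [filter_congr (q := G.Adj p) (fun u hu => by simp [hn u hu]), he1 p hpP,
      filter_false_of_mem (s := Y) (fun u hu => by simp [hn u hu])] at this
    simpa using this
  have d_all : ∀ z ∈ X, z ∉ P → (∀ u ∈ Y, G.Adj z u) → e + 3 ≤ Y.card := by
    intro z hz hzP hn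
    have := h.delta hp hz (notP z hzP)
    rw [filter_false_of_mem (s := Y) (fun u hu => by simp [hn u hu]),
      filter_congr (s := Y) (q := fun u => ¬ G.Adj p u) (fun u hu => by simp [hn u hu])] at this
    have h2 := card_filter_add_card_filter_not (s := Y) (G.Adj p)
    have h3 := he1 p hpP
    rw [card_empty] at this
    omega
  obtain ⟨i, hi, hiP⟩ : ∃ i ∈ X, i ∉ P := by
    by_contra hcon
    push Not at hcon
    exact hvw ((mem_cls.1 (hcon v hv)).symm.trans (mem_cls.1 (hcon w hw)))
  have hne : p ≠ i := by rintro rfl; exact hiP hpP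
  have XPi : ∀ (hh : ∀ z ∈ X, z ∉ P → z = i), X = insert i P := by
    intro hh
    ext z
    rw [mem_insert]
    constructor
    · intro hz
      by_cases hzP : z ∈ P
      · exact Or.inr hzP
      · exact Or.inl (hh z hz hzP)
    · rintro (rfl | hz)
      exacts [hi, hPX hz]
  -- Three classes are represented by `p`, `i`, `q`. If `i` sees all of `Y`, the determinant cannot
  -- vanish; if `i` sees none of it, the condition is `e (e - 6) = 0`, so both `P` and `Y` have
  -- seven vertices.
  have det := gram_det (x p) (y p) (x i) (y i) (x q) (y q)
  have pp := h.card_self hp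
  have ii := h.card_self hi
  have qq := h.symm.card_self hq
  have pi := h.card_inter hp hi hne
  have pq := h.card_cross hp hq
  have iq := h.card_cross hi hq
  rw [he1 p hpP] at pp pq
  rcases const i hi hiP with hall | hnone
  · exfalso
    have e1 : e = 1 := by
      have := d_all i hi hiP hall
      rcases hem with hem | hem <;> omega
    have hh : ∀ z ∈ X, z ∉ P → z = i := by
      intro z hz hzP
      rcases const z hz hzP with h1 | h1
      · exact uniq_all z hz i hi h1 hall
      · have := d_none z hz hzP h1
        omega
    have eX := XPi hh
    have cX : X.card = Y.card + 1 := by rw [eX, card_insert_of_notMem hiP, ce]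
    have f1 : (Y.filter (G.Adj i)).card = Y.card := by rw [filter_true_of_mem hall]
    have f2 : (Y.filter fun u => G.Adj p u ∧ G.Adj i u).card = e := by
      rw [← he1 p hpP]
      exact congrArg card (filter_congr fun u hu => by simp [hall u hu])
    have f3 : (X.filter (G.Adj q)).card = e + 1 := by
      rw [eX, filter_insert, if_pos (hall q hq).symm, card_insert_of_notMem (by simp [hiP]),
        he2 q hq]
    rw [f1, cX] at ii
    rw [f2, cX] at pi
    rw [f3] at qq pq iq
    rw [f1] at iq
    rw [cX] at pp
    subst e1
    push_cast at pp ii qq pi pq iq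
    rw [show x p * x p + y p * y p = (Y.card : ℝ) + 1 by linarith,
      show x i * x i + y i * y i = 2 * (Y.card : ℝ) by linarith,
      show x q * x q + y q * y q = (Y.card : ℝ) + 1 by linarith, pi, pq, iq] at det
    have : (3 : ℝ) ≤ Y.card := by exact_mod_cast cY
    nlinarith
  · have h3 := d_none i hi hiP hnone
    have e1 : Y.card = e + 1 := by rcases hem with hem | hem <;> omega
    have hh : ∀ z ∈ X, z ∉ P → z = i := by
      intro z hz hzP
      rcases const z hz hzP with h1 | h1
      · have := d_all z hz hzP h1
        omega
      · exact uniq_none z hz i hi h1 hnone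
    have eX := XPi hh
    have cX : X.card = Y.card + 1 := by rw [eX, card_insert_of_notMem hiP, ce]
    have f1 : (Y.filter (G.Adj i)).card = 0 := by rw [filter_false_of_mem hnone, card_empty]
    have f2 : (Y.filter fun u => G.Adj p u ∧ G.Adj i u).card = 0 := by
      rw [card_eq_zero, filter_eq_empty_iff]
      intro u hu; simp [hnone u hu]
    have f3 : (X.filter (G.Adj q)).card = e := by
      rw [eX, filter_insert, if_neg (fun hh => hnone q hq hh.symm), he2 q hq]
    rw [f1, cX, e1] at ii
    rw [f2, cX, e1] at pi
    rw [f3] at qq pq iq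
    rw [f1] at iq
    rw [cX, e1] at pp
    rw [e1] at qq
    push_cast at pp ii qq pi pq iq
    rw [show x p * x p + y p * y p = 2 * (e : ℝ) + 1 by linarith,
      show x i * x i + y i * y i = (e : ℝ) + 1 by linarith,
      show x q * x q + y q * y q = 2 * (e : ℝ) by linarith, pi, pq, iq] at det
    have he3 : (3 : ℝ) ≤ e := by exact_mod_cast h3
    have e6 : (e : ℝ) * (e - 6) = 0 := by linear_combination det
    have e6' : (e : ℝ) = 6 := by
      rcases mul_eq_zero.1 e6 with h0 | h0 <;> linarith
    have e6n : e = 6 := by exact_mod_cast e6'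
    have hm : IsMatched (fun v w => ¬ G.Adj v w) P Y := by
      rcases hem with hem | hem
      · omega
      · exact hem.2
    have : Nonempty V := ⟨v⟩
    obtain ⟨f, g, hf, hg, hfg⟩ := exists_matched_enum _ _ _ hm.1 hm.2
    have c7 : P.card = 7 := by omega
    rw [c7] at hf hg hfg
    -- The pendant block of `kappaTail` is empty here; the single vertex of the next block is `i`.
    refine HasPattern.of_enum ![fun _ => i, fun _ => i, f, g] ![∅, {i}, P, Y] ?_ ?_ ?_ ?_ ?_
    · intro j
      fin_cases j
      · exact ⟨fun a ha => absurd ha (Nat.not_lt_zero a),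
          fun a b ha => absurd ha (Nat.not_lt_zero a), fun v hv => absurd hv (notMem_empty v)⟩
      · exact IsEnum.singleton i
      · exact hf
      · exact hg
    · decide
    · intro a b hab u hu
      fin_cases a <;> fin_cases b <;> first | exact absurd hab (by decide) | skip
      · exact absurd hu (notMem_empty u)
      · exact absurd hu (notMem_empty u)
      · exact absurd hu (notMem_empty u)
      · intro hu'; exact hiP (mem_singleton.1 hu ▸ hu')
      · intro hu'; exact h.disj i hi (mem_singleton.1 hu ▸ hu')
      · exact h.disj u (hPX hu)
    · intro u
      rcases h.cover u with hu | hu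
      · rw [eX, mem_insert] at hu
        rcases hu with rfl | hu
        exacts [⟨1, mem_singleton_self _⟩, ⟨2, hu⟩]
      · exact ⟨3, hu⟩
    · intro j l hjl a b ha hb m1 m2
      fin_cases j
      · exact absurd ha (Nat.not_lt_zero a)
      all_goals fin_cases l <;> first | exact absurd hjl (by decide) | skip
      · exact ⟨fun e => G.loopless.irrefl _ e, fun e => absurd e id⟩
      · exact ⟨fun _ => trivial, fun _ => h.clique_left _ hi _ (hPX m2)
          (fun e => hiP (Eq.subst (motive := (· ∈ P)) e.symm m2))⟩
      · exact ⟨fun e => hnone _ m2 e, fun e => absurd e id⟩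
      · exact ⟨fun hh e => by subst e; exact G.loopless.irrefl _ hh, fun hab =>
          h.clique_left _ (hPX m1) _ (hPX m2) fun e => hab (hf.inj a b ha hb e)⟩
      · exact not_iff_comm.1 (hfg a b ha hb) |>.symm
      · exact ⟨fun hh e => by subst e; exact G.loopless.irrefl _ hh, fun hab =>
          h.clique_right _ m1 _ m2 fun e => hab (hg.inj a b ha hb e)⟩

/-- Each of the two cliques has at most two classes, if both have at least two. -/
lemma class_left (h : IsTwoClique G x y X Y) {v w q z : V} (hv : v ∈ X) (hw : w ∈ X)
    (hvw : ¬ SameVec x y v w) (hq : q ∈ Y) (hz : z ∈ Y) (hqz : ¬ SameVec x y q z) {t : V}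
    (ht : t ∈ X) (htv : ¬ SameVec x y v t) : SameVec x y w t := by
  -- The inner product of a vertex of `X` with one of `Y` is a sum of two terms depending on one of
  -- them each, so differences within `X` are orthogonal to differences within `Y`: the vectors of
  -- `X` lie on a line.
  have perp : ∀ a ∈ X, ∀ b ∈ X, (x a - x b) * (x q - x z) + (y a - y b) * (y q - y z) = 0 := by
    intro a ha b hb
    have h1 := h.card_cross ha hq
    have h2 := h.card_cross ha hz
    have h3 := h.card_cross hb hq
    have h4 := h.card_cross hb hz
    linear_combination h1 - h2 - h3 + h4
  -- On `X` the squared length minus the inner product with `q` is constant, so the vectors of `X`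
  -- also lie on a circle around half the vector of `q`. A line meets a circle in at most two
  -- points.
  have perp' : ∀ a ∈ X, ∀ b ∈ X,
      (x a - x b) * (x a + x b - x q) + (y a - y b) * (y a + y b - y q) = 0 := by
    intro a ha b hb
    have h1 := h.card_self ha
    have h2 := h.card_self hb
    have h3 := h.card_cross ha hq
    have h4 := h.card_cross hb hq
    linear_combination h1 - h2 - h3 + h4
  have hpos : (x q - x z) * (x q - x z) + (y q - y z) * (y q - y z) ≠ 0 := by
    intro e
    have := mul_self_add_mul_self_eq_zero.1 e
    exact hqz ⟨sub_eq_zero.1 this.1, sub_eq_zero.1 this.2⟩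
  set r := x q - x z
  set s := y q - y z
  have dir : ∀ a ∈ X, ∀ b ∈ X, ∃ l, x a - x b = l * -s ∧ y a - y b = l * r := by
    intro a ha b hb
    have := perp a ha b hb
    refine ⟨(r * (y a - y b) - s * (x a - x b)) / (r * r + s * s), ?_, ?_⟩
    · rw [div_mul_eq_mul_div, eq_div_iff hpos]; linear_combination r * this
    · rw [div_mul_eq_mul_div, eq_div_iff hpos]; linear_combination s * this
  have dsum : ∀ a ∈ X, ∀ b ∈ X, ¬ SameVec x y a b →
      -s * (x a + x b - x q) + r * (y a + y b - y q) = 0 := by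
    intro a ha b hb hab
    obtain ⟨l, h1, h2⟩ := dir a ha b hb
    have := perp' a ha b hb
    rw [h1, h2] at this
    have h3 : l * (-s * (x a + x b - x q) + r * (y a + y b - y q)) = 0 := by
      linear_combination this
    rcases mul_eq_zero.1 h3 with h0 | h0
    · rw [h0] at h1 h2
      exact absurd ⟨by linarith, by linarith⟩ hab
    · exact h0
  obtain ⟨l, h1, h2⟩ := dir w hw t ht
  have h3 := dsum v hv w hw hvw
  have h4 := dsum v hv t ht htv
  have h5 : l * (r * r + s * s) = 0 := by linear_combination s * h1 - r * h2 + h3 - h4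
  rcases mul_eq_zero.1 h5 with h0 | h0
  · rw [h0] at h1 h2
    exact ⟨by linarith, by linarith⟩
  · exact absurd h0 hpos

lemma filter_union_cls {P K L : Finset V} (hP : P = K ∪ L) (hKL : Disjoint K L) (p : V → Prop)
    [DecidablePred p] : (P.filter p).card = (K.filter p).card + (L.filter p).card := by
  rw [hP, filter_union, card_union_of_disjoint]
  exact disjoint_filter_filter hKL

/-- The relation between the numbers of common neighbours and common nonneighbours. -/
lemma common_count (h : IsTwoClique G x y X Y) {v w q z : V} (hv : v ∈ X) (hw : w ∈ X)
    (hvw : ¬ SameVec x y v w) (hq : q ∈ Y) (hz : z ∈ Y) (hqz : ¬ SameVec x y q z) :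
    (Y.filter fun u => G.Adj v u ∧ G.Adj w u).card + (X.filter fun u => G.Adj q u ∧ G.Adj z u).card
      + 2 = 2 * ((Y.filter fun u => ¬ G.Adj v u ∧ ¬ G.Adj w u).card
        + (X.filter fun u => ¬ G.Adj q u ∧ ¬ G.Adj z u).card) := by
  have cnt : ∀ (Z : Finset V) (a b : V), (Z.filter (G.Adj a)).card + (Z.filter (G.Adj b)).card
      + (Z.filter fun u => ¬ G.Adj a u ∧ ¬ G.Adj b u).card
      = Z.card + (Z.filter fun u => G.Adj a u ∧ G.Adj b u).card := by
    intro Z a b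
    have h1 := card_union_add_card_inter (Z.filter (G.Adj a)) (Z.filter (G.Adj b))
    rw [← filter_or, ← filter_and] at h1
    have h2 := card_filter_add_card_filter_not (s := Z) (fun u => G.Adj a u ∨ G.Adj b u)
    have h3 : (Z.filter fun u => ¬ (G.Adj a u ∨ G.Adj b u))
      = Z.filter fun u => ¬ G.Adj a u ∧ ¬ G.Adj b u := filter_congr fun u _ => not_or
    rw [h3] at h2
    omega
  have c1 := cnt Y v w
  have c2 := cnt X q z
  have vw : v ≠ w := by rintro rfl; exact hvw (SameVec.refl _)
  have qz : q ≠ z := by rintro rfl; exact hqz (SameVec.refl _)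
  have hvv := h.card_self hv
  have hww := h.card_self hw
  have hqq := h.symm.card_self hq
  have hzz := h.symm.card_self hz
  have hvw' := h.card_inter hv hw vw
  have hqz' := h.symm.card_inter hq hz qz
  have vq := h.card_cross hv hq
  have vz := h.card_cross hv hz
  have wq := h.card_cross hw hq
  have wz := h.card_cross hw hz
  set r := x q - x z
  set s := y q - y z
  have hpos : r * r + s * s ≠ 0 := by
    intro e
    have := mul_self_add_mul_self_eq_zero.1 e
    exact hqz ⟨sub_eq_zero.1 this.1, sub_eq_zero.1 this.2⟩
  -- As vectors, `v - w` is orthogonal to `q - z` and to `2(v + w) - (q + z)`, and `q - z` is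
  -- orthogonal to `2(q + z) - (v + w)`. In the plane this makes the two combinations of sums
  -- orthogonal to each other, which is `key` below; the counts turn it into the claim.
  have hf : (x v - x w) * r + (y v - y w) * s = 0 := by
    linear_combination vq - vz - wq + wz
  have e1 : (x v - x w) * (2 * (x v + x w) - (x q + x z))
      + (y v - y w) * (2 * (y v + y w) - (y q + y z)) = 0 := by
    linear_combination 2 * hvv - 2 * hww - vq + wq - vz + wz
  have e2 : r * (2 * (x q + x z) - (x v + x w)) + s * (2 * (y q + y z) - (y v + y w)) = 0 := by
    linear_combination 2 * hqq - 2 * hzz - vq - wq + vz + wz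
  set l := (r * (y v - y w) - s * (x v - x w)) / (r * r + s * s) with hl
  have d1 : x v - x w = l * -s := by
    rw [hl, div_mul_eq_mul_div, eq_div_iff hpos]; linear_combination r * hf
  have d2 : y v - y w = l * r := by
    rw [hl, div_mul_eq_mul_div, eq_div_iff hpos]; linear_combination s * hf
  have l0 : l ≠ 0 := by
    intro e
    rw [e] at d1 d2
    exact hvw ⟨by linarith, by linarith⟩
  rw [d1, d2] at e1
  have e1' : -s * (2 * (x v + x w) - (x q + x z)) + r * (2 * (y v + y w) - (y q + y z)) = 0 := by
    refine (mul_eq_zero.1 (show l * _ = 0 from ?_)).resolve_left l0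
    linear_combination e1
  have key : (2 * (x v + x w) - (x q + x z)) * (2 * (x q + x z) - (x v + x w))
      + (2 * (y v + y w) - (y q + y z)) * (2 * (y q + y z) - (y v + y w)) = 0 := by
    refine (mul_eq_zero.1 (show (r * r + s * s) * _ = 0 from ?_)).resolve_left hpos
    linear_combination (r * (2 * (x v + x w) - (x q + x z)) + s * (2 * (y v + y w) - (y q + y z)))
      * e2 + (-s * (2 * (x q + x z) - (x v + x w)) + r * (2 * (y q + y z) - (y v + y w))) * e1'
  have c1' : ((Y.filter (G.Adj v)).card + (Y.filter (G.Adj w)).card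
      + (Y.filter fun u => ¬ G.Adj v u ∧ ¬ G.Adj w u).card : ℝ)
      = Y.card + (Y.filter fun u => G.Adj v u ∧ G.Adj w u).card := by exact_mod_cast c1
  have c2' : ((X.filter (G.Adj q)).card + (X.filter (G.Adj z)).card
      + (X.filter fun u => ¬ G.Adj q u ∧ ¬ G.Adj z u).card : ℝ)
      = X.card + (X.filter fun u => G.Adj q u ∧ G.Adj z u).card := by exact_mod_cast c2
  have : ((Y.filter fun u => G.Adj v u ∧ G.Adj w u).card
      + (X.filter fun u => G.Adj q u ∧ G.Adj z u).card + 2 : ℝ)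
      = 2 * ((Y.filter fun u => ¬ G.Adj v u ∧ ¬ G.Adj w u).card
        + (X.filter fun u => ¬ G.Adj q u ∧ ¬ G.Adj z u).card) := by
    linarith
  exact_mod_cast this

/-- It is impossible that both cliques have several classes. -/
lemma not_many (h : IsTwoClique G x y X Y) (hX : ∃ v ∈ X, ∃ w ∈ X, ¬ SameVec x y v w)
    (hY : ∃ v ∈ Y, ∃ w ∈ Y, ¬ SameVec x y v w) : False := by
  have main : ∀ {X Y : Finset V}, IsTwoClique G x y X Y →
      (∃ v ∈ X, ∃ w ∈ X, ¬ SameVec x y v w) → (∃ v ∈ Y, ∃ w ∈ Y, ¬ SameVec x y v w) →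
      (∃ v ∈ X, 1 < (cls x y v).card) → False := by
    rintro X Y h ⟨a, ha, b, hb, hab⟩ ⟨c, hc, d, hd, hcd⟩ ⟨v, hv, cv⟩
    obtain ⟨w, hw, hvw⟩ : ∃ w ∈ X, ¬ SameVec x y v w := by
      by_cases hva : SameVec x y v a
      · exact ⟨b, hb, fun e => hab (hva.symm.trans e)⟩
      · exact ⟨a, ha, hva⟩
    obtain ⟨q, hq, hp⟩ := h.exists_partner_right hv cv
    obtain ⟨z, hz, hqz⟩ : ∃ z ∈ Y, ¬ SameVec x y q z := by
      by_cases hva : SameVec x y q c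
      · exact ⟨d, hd, fun e => hcd (hva.symm.trans e)⟩
      · exact ⟨c, hc, hva⟩
    obtain ⟨e, a', he, ha', hlink⟩ := hp.exists_linked
    have eX : X = cls x y v ∪ cls x y w := by
      ext t
      rw [mem_union]
      constructor
      · intro ht
        by_cases hvt : SameVec x y v t
        · exact Or.inl (mem_cls.2 hvt)
        · exact Or.inr (mem_cls.2 (h.class_left hv hw hvw hq hz hqz ht hvt))
      · rintro (ht | ht)
        exacts [h.cls_subset hv ht, h.cls_subset hw ht]
    have eY : Y = cls x y q ∪ cls x y z := by
      ext t
      rw [mem_union]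
      constructor
      · intro ht
        by_cases hvt : SameVec x y q t
        · exact Or.inl (mem_cls.2 hvt)
        · exact Or.inr (mem_cls.2 (h.symm.class_left hq hz hqz hv hw hvw ht hvt))
      · rintro (ht | ht)
        exacts [h.symm.cls_subset hq ht, h.symm.cls_subset hz ht]
    have dcls : ∀ {a b : V}, ¬ SameVec x y a b → Disjoint (cls x y a) (cls x y b) := by
      intro a b hab
      rw [disjoint_left]
      intro t h1 h2
      exact hab ((mem_cls.1 h1).trans (mem_cls.1 h2).symm)
    have nXY : ∀ {a b : V}, a ∈ X → b ∈ Y → ¬ SameVec x y a b := fun ha hb e =>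
      h.disj _ (h.sat_left _ ha _ e) hb
    -- If the class of `w` has several elements, its partner lies in `Y` and cannot be the class of
    -- `q`, of which `w` sees all or nothing; so it is the class of `z`. If only the class of `z`
    -- has several elements, its partner would have to be the class of `v`, excluded likewise, or a
    -- singleton. Two singletons are linked trivially.
    have hlink2 : ∃ f b, IsLinked G (cls x y w) (cls x y z) f b := by
      have partner : ∀ {w z v q : V}, ¬ SameVec x y w q → ¬ SameVec x y v w →
          (∃ e a, 1 ≤ e ∧ 1 ≤ a ∧ IsLinked G (cls x y v) (cls x y q) e a) →
          (∀ l, IsPartner G x y w l → SameVec x y q l ∨ SameVec x y z l) →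
          ∀ l, IsPartner G x y w l → IsPartner G x y w z := by
        rintro w z v q nwq nvw ⟨e, a, he, ha, hlink⟩ hcl l hl
        have hlz : SameVec x y z l := by
          refine (hcl l hl).resolve_left fun hql => ?_
          obtain ⟨e', a', he', ha', hlink'⟩ := hl.exists_linked
          have cl : cls x y l = cls x y q := by
            ext t; rw [mem_cls, mem_cls]
            exact ⟨fun e => hql.trans e, fun e => hql.symm.trans e⟩
          rw [cl] at hlink'
          have h1 := hlink'.adj_left w (mem_cls.2 (SameVec.refl w))
          have h2 := hlink'.not_left w (mem_cls.2 (SameVec.refl w))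
          rcases hlink.right w (fun e => nvw (mem_cls.1 e)) (fun e => nwq (mem_cls.1 e).symm)
            with hh | hh
          · rw [filter_false_of_mem (fun u hu => not_not.2 (hh u hu)), card_empty] at h2
            omega
          · rw [filter_false_of_mem hh, card_empty] at h1
            omega
        have cl : cls x y l = cls x y z := by
          ext t; rw [mem_cls, mem_cls]
          exact ⟨fun e => hlz.trans e, fun e => hlz.symm.trans e⟩
        exact ⟨fun e => hl.not_same (e.trans hlz), hl.clique_left, cl ▸ hl.clique_right,
          cl ▸ hl.card_eq, hl.two_le, cl ▸ hl.left, cl ▸ hl.right, cl ▸ hl.matched⟩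
      by_cases cw : 1 < (cls x y w).card
      · obtain ⟨l, hl, hl'⟩ := h.exists_partner_right hw cw
        have := partner (z := z) (nXY hw hq) hvw ⟨e, a', he, ha', hlink⟩ (by
          intro l hl
          have hlY : l ∈ Y := by
            refine (h.cover l).resolve_left fun hlX => ?_
            obtain ⟨e', a'', -, ha', hlink'⟩ := hl.exists_linked
            have := hlink'.not_left w (mem_cls.2 (SameVec.refl w))
            rw [filter_false_of_mem] at this
            · simp at this; omega
            · intro u hu
              rw [not_not]
              refine h.clique_left w hw u (h.cls_subset hlX hu) ?_
              rintro rfl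
              exact hl.not_same (mem_cls.1 hu).symm
          rw [eY, mem_union, mem_cls, mem_cls] at hlY
          exact hlY) l hl'
        obtain ⟨f, b, -, -, hh⟩ := this.exists_linked
        exact ⟨f, b, hh⟩
      by_cases cz : 1 < (cls x y z).card
      · obtain ⟨l, hl, hl'⟩ := h.symm.exists_partner_right hz cz
        exfalso
        rw [eX, mem_union, mem_cls, mem_cls] at hl
        rcases hl with hl | hl
        · obtain ⟨e', a'', he', ha'', hlink'⟩ := hl'.exists_linked
          have cl : cls x y l = cls x y v := by
            ext t; rw [mem_cls, mem_cls]
            exact ⟨fun e => hl.trans e, fun e => hl.symm.trans e⟩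
          rw [cl] at hlink'
          have h1 := hlink'.adj_left z (mem_cls.2 (SameVec.refl z))
          have h2 := hlink'.not_left z (mem_cls.2 (SameVec.refl z))
          rcases hlink.left z (fun e => nXY hv hz (mem_cls.1 e)) (fun e => hqz (mem_cls.1 e))
            with hh | hh
          · rw [filter_false_of_mem (fun u hu => not_not.2 (hh u hu)), card_empty] at h2
            omega
          · rw [filter_false_of_mem hh, card_empty] at h1
            omega
        · have := hl'.card_eq
          have cl : cls x y l = cls x y w := by
            ext t; rw [mem_cls, mem_cls]
            exact ⟨fun e => hl.trans e, fun e => hl.symm.trans e⟩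
          rw [cl] at this
          omega
      · have one : ∀ a : V, ¬ 1 < (cls x y a).card → cls x y a = {a} := by
          intro a ha
          refine eq_singleton_iff_unique_mem.2 ⟨mem_cls.2 (SameVec.refl a), fun u hu => ?_⟩
          exact card_le_one.1 (not_lt.1 ha) u hu a (mem_cls.2 (SameVec.refl a))
        rw [one w cw, one z cz]
        exact IsLinked.singleton G w z
    obtain ⟨f, b', hlink2⟩ := hlink2
    have self : ∀ a, a ∈ cls x y a := fun a => mem_cls.2 (SameVec.refl a)
    have nm : ∀ {a b : V}, ¬ SameVec x y a b → b ∉ cls x y a := fun hab e => hab (mem_cls.1 e)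
    have nm' : ∀ {a b : V}, ¬ SameVec x y a b → a ∉ cls x y b := fun hab e =>
      hab (mem_cls.1 e).symm
    have i1 := exists_indicator (self q) (hlink.adj_left v (self v)) (hlink.not_left v (self v))
      (hlink.right w (nm hvw) (nm' (nXY hw hq)))
    have i2 := exists_indicator' (self z) (hlink2.adj_left w (self w)) (hlink2.not_left w (self w))
      (hlink2.right v (nm' hvw) (nm' (nXY hv hz)))
    have i3 := exists_indicator (self v) (hlink.adj_right q (self q)) (hlink.not_right q (self q))
      (hlink.left z (nm (nXY hv hz)) (nm hqz))
    have i4 := exists_indicator' (self w) (hlink2.adj_right z (self z))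
      (hlink2.not_right z (self z)) (hlink2.left q (nm (nXY hw hq)) (nm' hqz))
    -- Whether `w` sees the class of `q`, and `v` that of `z`, leaves four consistent cases. In each
    -- of them all counts are known in terms of the two links, and the counting relation contradicts
    -- the lower bounds on differences.
    have cc := h.common_count hv hw hvw hq hz hqz
    have d1 := h.delta hv hw hvw
    have d2 := h.symm.delta hq hz hqz
    simp only [filter_union_cls eX (dcls hvw), filter_union_cls eY (dcls hqz)] at cc d1 d2
    have s1 : G.Adj q w ↔ G.Adj w q := G.adj_comm q w
    have s2 : G.Adj z v ↔ G.Adj v z := G.adj_comm z v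
    have o1 := hlink.one
    have o2 := hlink2.one
    rcases i1 with ⟨t1, i1⟩ | ⟨t1, i1⟩ <;> rcases i2 with ⟨t2, i2⟩ | ⟨t2, i2⟩ <;>
      rcases i3 with ⟨t3, i3⟩ | ⟨t3, i3⟩ <;> rcases i4 with ⟨t4, i4⟩ | ⟨t4, i4⟩ <;>
      first
      | exact absurd (s1.1 t4) t1
      | exact absurd (s1.2 t1) t4
      | exact absurd (s2.1 t3) t2
      | exact absurd (s2.2 t2) t3
      | (clear s1 s2 t1 t2 t3 t4; omega)
  by_cases c1 : ∃ v ∈ X, 1 < (cls x y v).card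
  · exact main h hX hY c1
  by_cases c2 : ∃ v ∈ Y, 1 < (cls x y v).card
  · exact main h.symm hY hX c2
  push Not at c1 c2
  obtain ⟨v, hv, w, hw, hvw⟩ := hX
  obtain ⟨q, hq, z, hz, hqz⟩ := hY
  -- With all classes singletons, `Y` has only two vertices, so no two vertices of `X` can differ in
  -- three places.
  have hYle : Y ⊆ {q, z} := by
    intro t ht
    rw [mem_insert, mem_singleton]
    by_cases hqt : SameVec x y q t
    · exact Or.inl (card_le_one.1 (c2 q hq) t (mem_cls.2 hqt) q (mem_cls.2 (SameVec.refl q)))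
    · exact Or.inr (card_le_one.1 (c2 z hz) t
        (mem_cls.2 (h.symm.class_left hq hz hqz hv hw hvw ht hqt)) z (mem_cls.2 (SameVec.refl z)))
  have h1 := h.delta hv hw hvw
  rw [← card_union_of_disjoint] at h1
  · have := (h1.trans (card_le_card (union_subset (filter_subset _ _) (filter_subset _ _)))).trans
      ((card_le_card hYle).trans card_le_two)
    omega
  · rw [disjoint_left]
    intro t ht ht'
    exact (mem_filter.1 ht').2.2 (mem_filter.1 ht).2.1

lemma classification (h : IsTwoClique G x y X Y) :
    (∃ k, 3 ≤ k ∧ HasPattern G ![k, k] kappa6) ∨ HasPattern G ![0, 1, 7, 7] kappaTail := by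
  by_cases hX : ∃ v ∈ X, ∃ w ∈ X, ¬ SameVec x y v w
  · by_cases hY : ∃ v ∈ Y, ∃ w ∈ Y, ¬ SameVec x y v w
    · exact (h.not_many hX hY).elim
    · push Not at hY
      exact Or.inr (h.one_class hX hY)
  · by_cases hY : ∃ v ∈ Y, ∃ w ∈ Y, ¬ SameVec x y v w
    · push Not at hX
      exact Or.inr (h.symm.one_class hY hX)
    · push Not at hX hY
      exact Or.inl (h.two_classes hX hY)

end IsTwoClique

/-- A graph in which any two closed neighbourhoods meet and in which vertices with the same vector
are adjacent is covered by two cliques. -/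
lemma IsMeeting.exists_twoClique (h : IsMeeting G x y) [Nonempty V]
    (ht : ∀ v w, v ≠ w → SameVec x y v w → G.Adj v w) : ∃ X Y, IsTwoClique G x y X Y := by
  -- In the order by direction, `Y` consists of the vertices with an earlier nonneighbour.
  set Y : Finset V := univ.filter fun v => ∃ w, 0 < cross x y w v ∧ ¬ G.Adj w v with hYdef
  set X : Finset V := univ.filter fun v => ¬ ∃ w, 0 < cross x y w v ∧ ¬ G.Adj w v with hXdef
  have memY : ∀ v, v ∈ Y ↔ ∃ w, 0 < cross x y w v ∧ ¬ G.Adj w v := fun v => by simp [hYdef]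
  have memX : ∀ v, v ∈ X ↔ ∀ w, 0 < cross x y w v → G.Adj w v := fun v => by simp [hXdef]
  have order : ∀ v w, ¬ SameVec x y v w → 0 < cross x y v w ∨ 0 < cross x y w v := by
    intro v w hs
    rcases lt_or_gt_of_ne (h.cross_ne hs) with h1 | h1
    · right; rw [cross_neg]; linarith
    · exact Or.inl h1
  have clX : ∀ v ∈ X, ∀ w ∈ X, v ≠ w → G.Adj v w := by
    intro v hv w hw hvw
    by_cases hs : SameVec x y v w
    · exact ht v w hvw hs
    · rcases order v w hs with h1 | h1
      · exact (memX w).1 hw v h1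
      · exact ((memX v).1 hv w h1).symm
  -- A vertex of `Y` lies between its earlier nonneighbour and any later vertex, so it is adjacent
  -- to the latter.
  have clY : ∀ v ∈ Y, ∀ w ∈ Y, v ≠ w → G.Adj v w := by
    have key : ∀ v ∈ Y, ∀ w, 0 < cross x y v w → G.Adj v w := by
      intro v hv w hvw
      obtain ⟨u, hu, hn⟩ := (memY v).1 hv
      exact (h.adj_of_between hu hvw).resolve_left fun e => hn e.symm
    intro v hv w hw hvw
    by_cases hs : SameVec x y v w
    · exact ht v w hvw hs
    · rcases order v w hs with h1 | h1
      · exact key v hv w h1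
      · exact (key w hw v h1).symm
  have cover : ∀ v, v ∈ X ∨ v ∈ Y := by
    intro v
    by_cases hv : v ∈ Y
    · exact Or.inr hv
    · left
      rw [hXdef, mem_filter]
      exact ⟨mem_univ _, fun e => hv ((memY v).2 e)⟩
  have disj : ∀ v ∈ X, v ∉ Y := by
    intro v hv hv'
    obtain ⟨w, h1, h2⟩ := (memY v).1 hv'
    exact h2 ((memX v).1 hv w h1)
  -- If a class met both sets, an earlier nonneighbour `w` of `u` would be adjacent to `v` and hence
  -- belong to the partner class. Then the whole partner class precedes `v`, so `v` is adjacent to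
  -- all of it, although every vertex misses one of its partner class.
  have straddle : ∀ v ∈ X, ∀ u ∈ Y, ¬ SameVec x y v u := by
    intro v hv u hu hs
    obtain ⟨w, hw, hn⟩ := (memY u).1 hu
    have hvu : v ≠ u := by rintro rfl; exact disj v hv hu
    have ceq : ∀ {a b : V}, SameVec x y a b → ∀ c, cross x y c a = cross x y c b := by
      intro a b hab c
      unfold cross
      rw [hab.1, hab.2]
    have ceq' : ∀ {a b : V}, SameVec x y a b → ∀ c, cross x y a c = cross x y b c := by
      intro a b hab c
      unfold cross
      rw [hab.1, hab.2]
    obtain ⟨l, hl⟩ := h.exists_partner (k := v) (fun a ha b hb hab =>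
      ht a b hab ((mem_cls.1 ha).symm.trans (mem_cls.1 hb)))
      (one_lt_card.2 ⟨v, mem_cls.2 (SameVec.refl v), u, mem_cls.2 hs, hvu⟩)
    have hwv : 0 < cross x y w v := by rwa [ceq hs]
    have hwK : w ∉ cls x y v := by
      intro e
      rw [← ceq' (mem_cls.1 e)] at hwv
      have : cross x y v v = 0 := by unfold cross; ring
      linarith
    have hwl : w ∈ cls x y l := by
      by_contra hwl
      rcases hl.left w hwK hwl with h1 | h1
      · exact hn (h1 u (mem_cls.2 hs))
      · exact h1 v (mem_cls.2 (SameVec.refl v)) ((memX v).1 hv w hwv)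
    obtain ⟨e, a, -, ha, hlink⟩ := hl.exists_linked
    have := hlink.not_left v (mem_cls.2 (SameVec.refl v))
    rw [filter_false_of_mem] at this
    · simp at this; omega
    · intro w' hw'
      rw [not_not]
      refine ((memX v).1 hv w' ?_).symm
      rwa [ceq' ((mem_cls.1 hw').symm.trans (mem_cls.1 hwl))]
  have noncomplete : ∀ Z : Finset V, (∀ v ∈ Z, ∀ w ∈ Z, v ≠ w → G.Adj v w) → ∃ v, v ∉ Z := by
    intro Z hZ
    by_contra hcon
    push Not at hcon
    obtain ⟨w, hw⟩ := h.exists_not_same (Classical.arbitrary V)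
    have : Classical.arbitrary V = w := h.closedNbhd_injective (by
      ext u
      have : ∀ v u, u ∈ closedNbhd G v := by
        intro v u
        rw [mem_closedNbhd]
        by_cases huv : u = v
        · exact Or.inl huv
        · exact Or.inr (hZ v (hcon v) u (hcon u) (Ne.symm huv))
      simp only [this])
    exact hw (this ▸ SameVec.refl _)
  refine ⟨X, Y, h, cover, disj, clX, clY, ?_, ?_, ?_, ?_⟩
  · intro v hv w hs
    exact (cover w).resolve_right fun hw => straddle v hv w hw hs
  · intro v hv w hs
    exact (cover w).resolve_left fun hw => straddle w hw v hv hs.symm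
  · obtain ⟨v, hv⟩ := noncomplete Y clY
    exact ⟨v, (cover v).resolve_right hv⟩
  · obtain ⟨v, hv⟩ := noncomplete X clX
    exact ⟨v, (cover v).resolve_left hv⟩

end TwoCliques

/-! ### Assembly of the classification in the plane -/

/-- The relations between the blocks of a disjoint union of two graphs with two blocks. -/
def kappaSum (s r s' r' : BlockRel) : Fin 4 → Fin 4 → BlockRel :=
  ![![s, r, .none, .none], ![r, s, .none, .none], ![.none, .none, s', r'], ![.none, .none, r', s']]

/-- The relations between two blocks with the same inner relation. -/
def kappaTwo (s r : BlockRel) : Fin 2 → Fin 2 → BlockRel := ![![s, r], ![r, s]]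

section Assembly
open scoped Classical
variable {V : Type*} [Fintype V] {G : SimpleGraph V} {x y : V → ℝ}

/-- The graph induced on `S` is described by two blocks of sizes `m` and `n`. -/
def IsPart (G : SimpleGraph V) (S : Finset V) (m n : ℕ) (s r : BlockRel) : Prop :=
  ∃ (f g : ℕ → V) (M N : Finset V), IsEnum f m M ∧ IsEnum g n N ∧ (∀ v ∈ M, v ∉ N) ∧
    (∀ v, v ∈ S ↔ v ∈ M ∨ v ∈ N) ∧
    (∀ a b, a < m → b < m → (G.Adj (f a) (f b) ↔ s.Holds a b)) ∧
    (∀ a b, a < n → b < n → (G.Adj (g a) (g b) ↔ s.Holds a b)) ∧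
    ∀ a b, a < m → b < n → (G.Adj (f a) (g b) ↔ r.Holds a b)

lemma IsPart.hasPattern {S : Finset V} {m n : ℕ} {s r : BlockRel} (h : IsPart G S m n s r)
    (hS : ∀ v, v ∈ S) : HasPattern G ![m, n] (kappaTwo s r) := by
  obtain ⟨f, g, M, N, hf, hg, hd, hc, h1, h2, h3⟩ := h
  refine HasPattern.of_enum ![f, g] ![M, N] ?_ ?_ ?_ ?_ ?_
  · intro i; fin_cases i
    exacts [hf, hg]
  · intro i j; fin_cases i <;> fin_cases j <;> rfl
  · intro i j hij v hv
    fin_cases i <;> fin_cases j <;> first | exact absurd hij (by decide) | exact hd v hv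
  · intro v
    rcases (hc v).1 (hS v) with hv | hv
    exacts [⟨0, hv⟩, ⟨1, hv⟩]
  · intro i j hij a b ha hb _ _
    fin_cases i <;> fin_cases j
    exacts [h1 a b ha hb, h3 a b ha hb, absurd hij (by decide), h2 a b ha hb]

lemma IsPart.hasPattern_sum {S T : Finset V} {m n m' n' : ℕ} {s r s' r' : BlockRel}
    (h : IsPart G S m n s r) (h' : IsPart G T m' n' s' r') (hST : ∀ v, v ∈ T ↔ v ∉ S)
    (hcl : ∀ v ∈ S, ∀ w ∈ T, ¬ G.Adj v w) :
    HasPattern G ![m, n, m', n'] (kappaSum s r s' r') := by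
  obtain ⟨f, g, M, N, hf, hg, hd, hc, h1, h2, h3⟩ := h
  obtain ⟨f', g', M', N', hf', hg', hd', hc', h1', h2', h3'⟩ := h'
  have dis : ∀ v, v ∈ M ∨ v ∈ N → ¬ (v ∈ M' ∨ v ∈ N') := fun v hv hv' =>
    (hST v).1 ((hc' v).2 hv') ((hc v).2 hv)
  have no : ∀ v w, v ∈ M ∨ v ∈ N → w ∈ M' ∨ w ∈ N' → ¬ G.Adj v w := fun v w hv hw =>
    hcl v ((hc v).2 hv) w ((hc' w).2 hw)
  refine HasPattern.of_enum ![f, g, f', g'] ![M, N, M', N'] ?_ ?_ ?_ ?_ ?_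
  · intro i; fin_cases i
    exacts [hf, hg, hf', hg']
  · intro i j; fin_cases i <;> fin_cases j <;> rfl
  · intro i j hij v hv
    fin_cases i <;> fin_cases j <;> first | exact absurd hij (by decide) | skip
    · exact hd v hv
    · exact fun e => dis v (Or.inl hv) (Or.inl e)
    · exact fun e => dis v (Or.inl hv) (Or.inr e)
    · exact fun e => dis v (Or.inr hv) (Or.inl e)
    · exact fun e => dis v (Or.inr hv) (Or.inr e)
    · exact hd' v hv
  · intro v
    by_cases hv : v ∈ S
    · rcases (hc v).1 hv with hv | hv
      exacts [⟨0, hv⟩, ⟨1, hv⟩]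
    · rcases (hc' v).1 ((hST v).2 hv) with hv | hv
      exacts [⟨2, hv⟩, ⟨3, hv⟩]
  · intro i j hij a b ha hb m1 m2
    fin_cases i <;> fin_cases j <;> first | exact absurd hij (by decide) | skip
    · exact h1 a b ha hb
    · exact h3 a b ha hb
    · exact iff_of_false (no _ _ (Or.inl m1) (Or.inl m2)) id
    · exact iff_of_false (no _ _ (Or.inl m1) (Or.inr m2)) id
    · exact h2 a b ha hb
    · exact iff_of_false (no _ _ (Or.inr m1) (Or.inl m2)) id
    · exact iff_of_false (no _ _ (Or.inr m1) (Or.inr m2)) id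
    · exact h1' a b ha hb
    · exact h3' a b ha hb
    · exact h2' a b ha hb

lemma isPart_star {S L : Finset V} {i : V} (hLS : L ⊆ S) (hi : i ∈ S) (hL : L.card = 4)
    (hiL : i ∉ L) (hS : ∀ v ∈ S, v = i ∨ v ∈ L) (hadj : ∀ v ∈ L, G.Adj i v)
    (hno : ∀ v ∈ L, ∀ w ∈ L, ¬ G.Adj v w) : IsPart G S 1 4 .none .all := by
  have : Nonempty V := ⟨i⟩
  obtain ⟨g, hg⟩ := IsEnum.exists L hL
  refine ⟨fun _ => i, g, {i}, L, IsEnum.singleton i, hg, ?_, ?_, ?_, ?_, ?_⟩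
  · intro v hv; rw [mem_singleton.1 hv]; exact hiL
  · intro v
    rw [mem_singleton]
    refine ⟨hS v, ?_⟩
    rintro (rfl | hv)
    exacts [hi, hLS hv]
  · exact fun a b _ _ => iff_of_false (G.loopless.irrefl i) id
  · exact fun a b ha hb => iff_of_false (hno _ (hg.mem a ha) _ (hg.mem b hb)) id
  · exact fun a b ha hb => iff_of_true (hadj _ (hg.mem b hb)) trivial

lemma isPart_cocktail {S : Finset V} {v w : V} (hv : v ∈ S) (hwS : w ∈ S) (hw : G.Adj v w)
    (hS : ∀ v ∈ S, ∃ v' ∈ S, v' ≠ v ∧ ∀ w ∈ S, w ≠ v → (G.Adj v w ↔ w ≠ v')) :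
    ∃ k, 2 ≤ k ∧ IsPart G S k k .ne .ne := by
  have : Nonempty V := ⟨v⟩
  obtain ⟨k, f, g, hk, hfg, f1, g1, fg1, sur, ff, gg, fg⟩ := exists_enum_mates S hS
  obtain ⟨v', hv', hne, hvv'⟩ := hS v hv
  have hwv' := (hvv' w hwS hw.ne').1 hw
  -- A vertex, its mate and a neighbour are three vertices, so there are at least two pairs.
  have c3 : 3 ≤ S.card := by
    have : ({v, v', w} : Finset V) ⊆ S := by
      intro z; simp only [mem_insert, mem_singleton]
      rintro (rfl | rfl | rfl) <;> assumption
    have h3 := card_le_card this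
    rwa [card_insert_of_notMem (by simp [hne.symm, hw.ne]), card_pair hwv'.symm] at h3
  refine ⟨k, by omega, f, g, (range k).image f, (range k).image g, ?_, ?_, ?_, ?_, ff, gg, fg⟩
  · exact ⟨fun a ha => mem_image_of_mem _ (mem_range.2 ha), f1, fun v hv => by
      obtain ⟨a, ha, e⟩ := mem_image.1 hv; exact ⟨a, mem_range.1 ha, e⟩⟩
  · exact ⟨fun a ha => mem_image_of_mem _ (mem_range.2 ha), g1, fun v hv => by
      obtain ⟨a, ha, e⟩ := mem_image.1 hv; exact ⟨a, mem_range.1 ha, e⟩⟩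
  · intro v hv hv'
    obtain ⟨a, ha, e⟩ := mem_image.1 hv
    obtain ⟨b, hb, e'⟩ := mem_image.1 hv'
    exact fg1 a b (mem_range.1 ha) (mem_range.1 hb) (e.trans e'.symm)
  · intro v
    rw [mem_image, mem_image]
    constructor
    · intro hv
      obtain ⟨a, ha, e | e⟩ := sur v hv
      exacts [Or.inl ⟨a, mem_range.2 ha, e⟩, Or.inr ⟨a, mem_range.2 ha, e⟩]
    · rintro (⟨a, ha, rfl⟩ | ⟨a, ha, rfl⟩)
      exacts [(hfg a (mem_range.1 ha)).1, (hfg a (mem_range.1 ha)).2]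

namespace IsGram

lemma exists_part (h : IsGram G x y) (hiso : ∀ v, ¬ G.IsIsolated v) {S : Finset V}
    (hne : S.Nonempty) (hcl : ∀ v ∈ S, ∀ w, G.Adj v w → w ∈ S)
    (hpar : ∀ v ∈ S, ∀ w ∈ S, x v * y w = x w * y v) :
    IsPart G S 1 4 .none .all ∨ ∃ k, 2 ≤ k ∧ IsPart G S k k .ne .ne := by
  rcases h.rank_one_part hiso S hcl hpar with ⟨i, hi, L, h1, h2, h3, h4, h5, h6⟩ | h1
  · exact Or.inl (isPart_star h1 hi h2 h3 h4 h5 h6)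
  · obtain ⟨v, hv⟩ := hne
    obtain ⟨w, hw⟩ := exists_adj hiso v
    exact Or.inr (isPart_cocktail hv (hcl v hv w hw) hw h1)

/-- A connected graph with different, parallel vectors is a star. -/
lemma star_of_parallel (h : IsGram G x y) (hiso : ∀ v, ¬ G.IsIsolated v) (hc : G.Preconnected)
    {v w : V} (hp : x v * y w = x w * y v) (hs : ¬ SameVec x y v w) :
    IsPart G univ 1 4 .none .all := by
  obtain ⟨i, j, hij, dj, di, hadj⟩ := h.parallel hiso hp hs
  have hp' : x i * y j = x j * y i := by
    rcases hij with ⟨rfl, rfl⟩ | ⟨rfl, rfl⟩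
    · exact hp
    · exact hp.symm
  have uj : ∀ u, G.Adj j u → u = i := by
    intro u hu
    obtain ⟨z, hz⟩ := card_eq_one.1 ((SimpleGraph.card_neighborFinset_eq_degree G j).trans dj)
    have e1 : u ∈ G.neighborFinset j := by simpa using hu
    have e2 : i ∈ G.neighborFinset j := by simpa using hadj.symm
    rw [hz, mem_singleton] at e1 e2
    rw [e1, e2]
  have cj : closedNbhd G j = {j, i} := by
    ext u
    rw [mem_closedNbhd, mem_insert, mem_singleton]
    exact or_congr Iff.rfl ⟨uj u, by rintro rfl; exact hadj.symm⟩
  have jj := h.self_eq_degree j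
  have ii := h.self_eq_degree i
  rw [dj] at jj
  rw [di] at ii
  have ij : x i * x j + y i * y j = 2 := by
    rw [h.inter i j hadj.ne]
    have : closedNbhd G i ∩ closedNbhd G j = {j, i} := by
      rw [← cj, inter_eq_right, cj]
      intro u
      rw [mem_insert, mem_singleton, mem_closedNbhd]
      rintro (rfl | rfl)
      exacts [Or.inr hadj, Or.inl rfl]
    rw [this, card_pair hadj.ne']
    norm_num
  push_cast at jj ii
  -- The lengths are `2` and `1` and the inner product is `2`, so the vector of the centre `i` is
  -- twice that of the leaf `j`.
  have xi : x i = 2 * x j := by linear_combination (-x i) * jj + x j * ij + y j * hp'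
  have yi : y i = 2 * y j := by linear_combination (-y i) * jj + y j * ij - x j * hp'
  have ipi : ∀ u, x i * x u + y i * y u = 2 * (x j * x u + y j * y u) := by
    intro u; rw [xi, yi]; ring
  have uji : ∀ u, u ∉ closedNbhd G i → x j * x u + y j * y u = 0 := by
    intro u hu
    rw [mem_closedNbhd, not_or] at hu
    have huj : j ≠ u := by rintro rfl; exact hu.2 hadj
    rw [h.inter j u huj, cj]
    norm_cast
    rw [card_eq_zero, ← disjoint_iff_inter_eq_empty, disjoint_left]
    intro z hz
    rw [mem_insert, mem_singleton] at hz
    rw [mem_closedNbhd]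
    rintro (rfl | hz')
    · rcases hz with rfl | rfl
      exacts [huj rfl, hu.1 rfl]
    · rcases hz with rfl | rfl
      exacts [hu.1 (uj u hz'.symm), hu.2 hz'.symm]
  -- A vertex outside the closed neighbourhood of `i` is orthogonal to `j`, hence to `i`, so its
  -- closed neighbourhood does not meet that of `i`; by connectedness there is none.
  have clo : ∀ u, u ∈ closedNbhd G i := by
    refine closed_eq_univ hc (fun u => u ∈ closedNbhd G i) (self_mem_closedNbhd i) ?_
    intro u z hu huz
    by_contra hz
    have e1 := uji z hz
    have hiz : i ≠ z := by rintro rfl; exact hz (self_mem_closedNbhd _)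
    have e2 := h.inter i z hiz
    rw [ipi, e1, mul_zero] at e2
    have := inter_pos hu (mem_closedNbhd.2 (Or.inr huz.symm))
    have h0 : (closedNbhd G i ∩ closedNbhd G z).card = 0 := by exact_mod_cast e2.symm
    omega
  refine isPart_star (i := i) (L := G.neighborFinset i) (subset_univ _) (mem_univ _)
    ((SimpleGraph.card_neighborFinset_eq_degree G i).trans di) (by simp) ?_ (by simp) ?_
  · intro u _
    rw [SimpleGraph.mem_neighborFinset]
    exact mem_closedNbhd.1 (clo u)
  · intro u hu z hz huz
    rw [SimpleGraph.mem_neighborFinset] at hu hz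
    have huj : j ≠ u := by
      rintro rfl; exact hz.ne' (uj z huz)
    have hji := hadj.ne'
    have e1 : x j * x u + y j * y u ≤ 1 := by
      rw [h.inter j u huj, cj]
      have : ({j, i} : Finset V) ∩ closedNbhd G u ⊆ {i} := by
        intro t
        rw [mem_inter, mem_insert, mem_singleton, mem_closedNbhd]
        rintro ⟨rfl | rfl, ht⟩
        · rcases ht with rfl | ht
          · exact absurd rfl huj
          · exact absurd (uj u ht.symm) hu.ne'
        · rfl
      have := card_le_card this
      rw [card_singleton] at this
      exact_mod_cast this
    have e2 := h.inter i u hu.ne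
    have e3 : 3 ≤ (closedNbhd G i ∩ closedNbhd G u).card := by
      have : ({i, u, z} : Finset V) ⊆ closedNbhd G i ∩ closedNbhd G u := by
        intro t
        rw [mem_insert, mem_insert, mem_singleton, mem_inter, mem_closedNbhd, mem_closedNbhd]
        rintro (rfl | rfl | rfl)
        · exact ⟨Or.inl rfl, Or.inr hu.symm⟩
        · exact ⟨Or.inr hu, Or.inl rfl⟩
        · exact ⟨Or.inr hz, Or.inr huz⟩
      have h3 := card_le_card this
      rwa [card_insert_of_notMem (by simp [hu.ne, hz.ne]), card_pair huz.ne] at h3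
    have e4 : (3 : ℝ) ≤ (closedNbhd G i ∩ closedNbhd G u).card := by exact_mod_cast e3
    have := ipi u
    linarith

/-- The graphs whose matrix `A² + 2A` is the Gram matrix of vectors in the plane. -/
theorem classification (h : IsGram G x y) [Nonempty V] (hiso : ∀ v, ¬ G.IsIsolated v) :
    HasPattern G ![1, 4] (kappaTwo .none .all) ∨
    (∃ k, 2 ≤ k ∧ HasPattern G ![k, k] (kappaTwo .ne .ne)) ∨
    HasPattern G ![1, 4, 1, 4] (kappaSum .none .all .none .all) ∨
    (∃ k, 2 ≤ k ∧ HasPattern G ![1, 4, k, k] (kappaSum .none .all .ne .ne)) ∨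
    (∃ k l, 2 ≤ k ∧ 2 ≤ l ∧ HasPattern G ![k, k, l, l] (kappaSum .ne .ne .ne .ne)) ∨
    HasPattern G ![2, 2, 2, 1, 1] (kappaOpp .none .all .none) ∨
    HasPattern G ![2, 2, 1, 2, 2] (kappaOpp .ne .eq .ne) ∨
    HasPattern G ![1, 1, 5, 5] kappaTail ∨
    HasPattern G ![2, 1, 3, 3] kappaTail ∨
    HasPattern G ![0, 1, 7, 7] kappaTail ∨
    (∃ k, 3 ≤ k ∧ HasPattern G ![k, k] kappa6) ∨
    (∃ k l, 1 ≤ k ∧ 1 ≤ l ∧ 3 ≤ k + l ∧ HasPattern G ![k, k, l, l, 1] kappa8) ∨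
    ∃ l, 1 ≤ l ∧ HasPattern G ![l, l, 3, 3] kappa9 := by
  by_cases hc : G.Preconnected
  · by_cases hpar : ∀ v w, x v * y w = x w * y v
    · rcases h.exists_part hiso univ_nonempty (fun _ _ _ _ => mem_univ _)
        (fun v _ w _ => hpar v w) with h1 | ⟨k, hk, h1⟩
      · exact Or.inl (h1.hasPattern mem_univ)
      · exact Or.inr (Or.inl ⟨k, hk, h1.hasPattern mem_univ⟩)
    by_cases hs : ∀ v w, x v * y w = x w * y v → SameVec x y v w
    · have hC : IsConnGram G x y := ⟨h, hiso, hc, hs⟩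
      by_cases hm : ∀ v w, (closedNbhd G v ∩ closedNbhd G w).Nonempty
      · have hM : IsMeeting G x y := ⟨hC, hm, fun v => by
          by_contra hcon
          push Not at hcon
          refine hpar fun a b => ?_
          have ha := hcon a
          have hb := hcon b
          rw [← ha.1, ← ha.2, ← hb.1, ← hb.2]⟩
        by_cases ht : ∀ v w, v ≠ w → SameVec x y v w → G.Adj v w
        · obtain ⟨X, Y, hXY⟩ := hM.exists_twoClique ht
          rcases hXY.classification with h1 | h1 <;> simp only [h1, true_or, or_true]
        · push Not at ht
          obtain ⟨t, t', h1, h2, h3⟩ := ht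
          rcases IsTwin.classification ⟨hM, h1, h2, h3⟩ with h1 | h1 <;>
            simp only [h1, true_or, or_true]
      · push Not at hm
        obtain ⟨o, t, hot⟩ := hm
        rcases IsOpposite.classification ⟨hC, hot⟩ with h1 | h1 | h1 | h1 <;>
          simp only [h1, true_or, or_true]
    · push Not at hs
      obtain ⟨v, w, hp, hs⟩ := hs
      exact Or.inl ((h.star_of_parallel hiso hc hp hs).hasPattern mem_univ)
  -- Different components have orthogonal vectors. The vectors of the component `S` of `o` are
  -- therefore all orthogonal to `t`, and those of the rest `T` are orthogonal to `o`, so each of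
  -- the two sets spans a single line.
  · have hc' : ∃ o t, ¬ G.Reachable o t := by
      by_contra hcon
      push Not at hcon
      exact hc hcon
    obtain ⟨o, t, hot⟩ := hc'
    set S : Finset V := univ.filter (G.Reachable o) with hS
    set T : Finset V := univ.filter fun v => ¬ G.Reachable o v with hT
    have memS : ∀ v, v ∈ S ↔ G.Reachable o v := fun v => by simp [hS]
    have memT : ∀ v, v ∈ T ↔ ¬ G.Reachable o v := fun v => by simp [hT]
    have clS : ∀ v ∈ S, ∀ w, G.Adj v w → w ∈ S := fun v hv w hvw =>
      (memS w).2 (((memS v).1 hv).trans hvw.reachable)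
    have clT : ∀ v ∈ T, ∀ w, G.Adj v w → w ∈ T := fun v hv w hvw =>
      (memT w).2 fun e => (memT v).1 hv (e.trans hvw.symm.reachable)
    have orth : ∀ v ∈ S, ∀ w ∈ T, x v * x w + y v * y w = 0 := by
      intro v hv w hw
      have hvw : v ≠ w := by rintro rfl; exact (memT v).1 hw ((memS v).1 hv)
      rw [h.inter v w hvw]
      norm_cast
      rw [card_eq_zero, ← disjoint_iff_inter_eq_empty, disjoint_left]
      intro z hz hz'
      have h1 : z ∈ S := by
        rcases mem_closedNbhd.1 hz with rfl | hz
        exacts [hv, clS v hv z hz]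
      have h2 : z ∈ T := by
        rcases mem_closedNbhd.1 hz' with rfl | hz
        exacts [hw, clT w hw z hz]
      exact (memT z).1 h2 ((memS z).1 h1)
    have pos : ∀ v, x v * x v + y v * y v ≠ 0 := by
      intro v
      rw [h.self_eq_degree]
      exact_mod_cast (degree_pos' hiso v).ne'
    have par : ∀ {u v w : V}, x v * x u + y v * y u = 0 → x w * x u + y w * y u = 0 →
        x v * y w = x w * y v := by
      intro u v w h1 h2
      have e1 : (x v * y w - x w * y v) * (x u * x u + y u * y u) = 0 := by
        linear_combination (x u * y w - y u * x w) * h1 + (y u * x v - x u * y v) * h2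
      exact sub_eq_zero.1 ((mul_eq_zero.1 e1).resolve_right (pos u))
    have oS : o ∈ S := (memS o).2 (SimpleGraph.Reachable.refl o)
    have tT : t ∈ T := (memT t).2 hot
    have pS := h.exists_part hiso ⟨o, oS⟩ clS fun v hv w hw =>
      par (orth v hv t tT) (orth w hw t tT)
    have pT := h.exists_part hiso ⟨t, tT⟩ clT fun v hv w hw =>
      par (u := o) (by linarith [orth o oS v hv]) (by linarith [orth o oS w hw])
    have hST : ∀ v, v ∈ T ↔ v ∉ S := fun v => by rw [memT, memS]
    have hTS : ∀ v, v ∈ S ↔ v ∉ T := fun v => by rw [memT, memS, not_not]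
    have noST : ∀ v ∈ S, ∀ w ∈ T, ¬ G.Adj v w := fun v hv w hw e =>
      (hST w).1 hw (clS v hv w e)
    have noTS : ∀ v ∈ T, ∀ w ∈ S, ¬ G.Adj v w := fun v hv w hw e => noST w hw v hv e.symm
    rcases pS with pS | ⟨k, hk, pS⟩ <;> rcases pT with pT | ⟨l, hl, pT⟩
    · exact Or.inr (Or.inr (Or.inl (pS.hasPattern_sum pT hST noST)))
    · exact Or.inr (Or.inr (Or.inr (Or.inl ⟨l, hl, pS.hasPattern_sum pT hST noST⟩)))
    · exact Or.inr (Or.inr (Or.inr (Or.inl ⟨k, hk, pT.hasPattern_sum pS hTS noTS⟩)))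
    · exact Or.inr (Or.inr (Or.inr (Or.inr (Or.inl
        ⟨k, l, hk, hl, pS.hasPattern_sum pT hST noST⟩))))

end IsGram
end Assembly

/-! ### Spectral decomposition and exceptional eigenvalues -/

section Spectrum
open scoped Classical
variable {V : Type*} [Fintype V] {G : SimpleGraph V}

/-- The entries of the adjacency matrix. -/
noncomputable def adjInd (G : SimpleGraph V) (v w : V) : ℝ := if G.Adj v w then 1 else 0

lemma adjInd_comm (v w : V) : adjInd G v w = adjInd G w v := by
  unfold adjInd; simp only [G.adj_comm v w]

/-- The vectors `u i` form an orthonormal basis of eigenvectors of the adjacency matrix, with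
eigenvalues `lam i`. -/
structure IsDiag (G : SimpleGraph V) (lam : V → ℝ) (u : V → V → ℝ) : Prop where
  eig : ∀ i v, ∑ w, adjInd G v w * u i w = lam i * u i v
  orth : ∀ i j, ∑ v, u i v * u j v = if i = j then 1 else 0
  complete : ∀ v w, ∑ i, u i v * u i w = if v = w then 1 else 0

/-- The spectral theorem for the symmetric adjacency matrix. Completeness follows from
orthonormality because a one-sided inverse of a square matrix is two-sided. -/
lemma exists_isDiag [DecidableEq V] (G : SimpleGraph V) [DecidableRel G.Adj] :
    ∃ lam u, IsDiag G lam u ∧ adjSpectrum G = univ.val.map lam := by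
  have hA : (G.adjMatrix ℝ).IsHermitian := by
    rw [Matrix.IsHermitian, Matrix.conjTranspose_eq_transpose_of_trivial]
    exact G.isSymm_adjMatrix
  have ho : ∀ i j, ∑ v, hA.eigenvectorBasis i v * hA.eigenvectorBasis j v
      = if i = j then 1 else 0 := by
    intro i j
    have := orthonormal_iff_ite.1 hA.eigenvectorBasis.orthonormal j i
    rw [PiLp.inner_apply] at this
    simpa [eq_comm] using this
  refine ⟨hA.eigenvalues, fun i v => hA.eigenvectorBasis i v, ⟨?_, ?_, ?_⟩, ?_⟩
  · intro i v
    have := congrFun (hA.mulVec_eigenvectorBasis i) v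
    rw [Matrix.mulVec, dotProduct] at this
    refine Eq.trans (sum_congr rfl fun w _ => ?_) this
    rw [SimpleGraph.adjMatrix_apply, adjInd]
    congr
  · intro i j
    convert ho i j
  · intro v w
    set U : Matrix V V ℝ := fun i v => hA.eigenvectorBasis i v
    have h1 : U * U.transpose = 1 := by
      ext i j
      rw [Matrix.mul_apply, Matrix.one_apply, ← ho i j]
      rfl
    have h3 : U.transpose * U = 1 := mul_eq_one_comm.1 h1
    have h2 := congrFun (congrFun h3 v) w
    rw [Matrix.mul_apply, Matrix.one_apply] at h2
    change ∑ j, U.transpose v j * U j w = _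
    convert h2
  · exact hA.roots_charpoly_eq_eigenvalues

namespace IsDiag

variable {lam : V → ℝ} {u : V → V → ℝ}

lemma expand (_ : IsDiag G lam u) (h2 : ∀ v w, ∑ i, u i v * u i w = if v = w then 1 else 0)
    (g : V → ℝ) (v : V) : g v = ∑ i, (∑ w, u i w * g w) * u i v := by
  simp_rw [sum_mul]
  rw [sum_comm]
  have : ∀ w, ∑ i, u i w * g w * u i v = g w * if w = v then 1 else 0 := by
    intro w
    rw [← h2 w v, mul_sum]
    exact sum_congr rfl fun i _ => by ring
  simp_rw [this]
  simp

lemma adjInd_eq (h : IsDiag G lam u) (v w : V) : adjInd G v w = ∑ i, lam i * u i v * u i w := by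
  have e := h.expand h.complete (adjInd G v) w
  rw [e]
  refine sum_congr rfl fun i _ => ?_
  rw [← h.eig i v]
  congr 1
  exact sum_congr rfl fun z _ => mul_comm _ _

lemma adjInd_sq (h : IsDiag G lam u) (v w : V) :
    ∑ z, adjInd G v z * adjInd G z w = ∑ i, lam i ^ 2 * u i v * u i w := by
  have : ∀ z, adjInd G v z * adjInd G z w = ∑ i, adjInd G v z * (lam i * u i z * u i w) := by
    intro z
    rw [h.adjInd_eq z w, mul_sum]
  simp_rw [this]
  rw [sum_comm]
  refine sum_congr rfl fun i _ => ?_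
  have e : ∀ z, adjInd G v z * (lam i * u i z * u i w)
      = lam i * u i w * (adjInd G v z * u i z) := fun z => by ring
  simp_rw [e]
  rw [← mul_sum, h.eig]
  ring

/-- The indices of the eigenvalues different from `-2` and `0`. -/
noncomputable def excIdx (lam : V → ℝ) : Finset V := univ.filter fun i => lam i ≠ -2 ∧ lam i ≠ 0

lemma mem_excIdx {i : V} : i ∈ excIdx lam ↔ lam i ≠ -2 ∧ lam i ≠ 0 := by simp [excIdx]

/-- The coefficient `λ (λ + 2)` vanishes at the eigenvalues `0` and `-2`, so only the exceptional
terms of the spectral decomposition remain. -/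
lemma gram (h : IsDiag G lam u) (v w : V) :
    ∑ z, adjInd G v z * adjInd G z w + 2 * adjInd G v w
      = ∑ i ∈ excIdx lam, lam i * (lam i + 2) * u i v * u i w := by
  rw [h.adjInd_sq, h.adjInd_eq, mul_sum, ← sum_add_distrib, excIdx, sum_filter]
  refine sum_congr rfl fun i _ => ?_
  split_ifs with hi
  · ring
  · rcases not_and_or.1 hi with hi | hi
    · rw [not_not.1 hi]; ring
    · rw [not_not.1 hi]; ring

lemma sum_lam (h : IsDiag G lam u) : ∑ i, lam i = 0 := by
  have h1 : ∑ v, adjInd G v v = 0 := sum_eq_zero fun v _ => by simp [adjInd]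
  simp_rw [h.adjInd_eq] at h1
  rw [sum_comm] at h1
  rw [← h1]
  refine sum_congr rfl fun i _ => ?_
  have e : ∀ z, lam i * u i z * u i z = lam i * (u i z * u i z) := fun z => by ring
  simp_rw [e]
  rw [← mul_sum, h.orth]
  simp

/-- The number of edges in terms of the exceptional eigenvalues. -/
lemma sum_exc (h : IsDiag G lam u) :
    ∑ i ∈ excIdx lam, lam i * (lam i + 2) = ∑ v, ∑ w, adjInd G v w := by
  have h1 : ∀ v, ∑ w, adjInd G v w
      = ∑ i ∈ excIdx lam, lam i * (lam i + 2) * u i v * u i v := by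
    intro v
    rw [← h.gram v v]
    have : adjInd G v v = 0 := by simp [adjInd]
    rw [this, mul_zero, add_zero]
    refine sum_congr rfl fun w _ => ?_
    rw [adjInd_comm w v, adjInd]
    split_ifs <;> simp
  simp_rw [h1]
  rw [sum_comm]
  refine sum_congr rfl fun i _ => ?_
  have e : ∀ z, lam i * (lam i + 2) * u i z * u i z
    = lam i * (lam i + 2) * (u i z * u i z) := fun z => by ring
  simp_rw [e]
  rw [← mul_sum, h.orth]
  simp

lemma quadratic_form (h : IsDiag G lam u) (f : V → ℝ) :
    ∑ v, f v * ∑ w, adjInd G v w * f w = ∑ i, lam i * (∑ w, u i w * f w) ^ 2 := by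
  have e1 : ∀ v, f v * ∑ w, adjInd G v w * f w
      = ∑ i, lam i * (∑ w, u i w * f w) * (u i v * f v) := by
    intro v
    simp_rw [h.adjInd_eq, sum_mul]
    rw [sum_comm, mul_sum]
    refine sum_congr rfl fun i _ => ?_
    rw [mul_sum, mul_sum, sum_mul]
    exact sum_congr rfl fun w _ => by ring
  simp_rw [e1]
  rw [sum_comm]
  refine sum_congr rfl fun i _ => ?_
  rw [← mul_sum]
  ring

lemma closedInd_eq (v w : V) : closedInd G v w = adjInd G v w + if v = w then 1 else 0 := by
  unfold closedInd adjInd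
  by_cases hvw : v = w
  · subst hvw; simp
  · simp [hvw, Ne.symm hvw]

/-- The matrix `A² + 2A` in terms of closed neighbourhoods. -/
lemma inter_eq (v w : V) : ∑ z, adjInd G v z * adjInd G z w + 2 * adjInd G v w
    + (if v = w then 1 else 0) = (closedNbhd G v ∩ closedNbhd G w).card := by
  rw [← sum_closedInd_mul]
  have e : ∀ z, closedInd G v z * closedInd G w z
      = adjInd G v z * adjInd G z w + adjInd G v z * (if w = z then 1 else 0)
        + (if v = z then 1 else 0) * adjInd G w z
        + (if v = z then 1 else 0) * if w = z then 1 else 0 := by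
    intro z
    rw [closedInd_eq, closedInd_eq, adjInd_comm z w]; ring
  simp_rw [e, sum_add_distrib]
  simp [adjInd_comm w v]
  ring

/-- A sum over at most two indices, as a sum of two terms. -/
lemma exists_two {s : Finset V} (hs : s.card ≤ 2) (c : V → ℝ) (u : V → V → ℝ) :
    ∃ (p q : ℝ) (a b : V → ℝ), (∀ v w, ∑ i ∈ s, c i * u i v * u i w
      = p * a v * a w + q * b v * b w) ∧ ((∀ i ∈ s, 0 ≤ c i) → 0 ≤ p ∧ 0 ≤ q) := by
  rcases Nat.lt_or_ge s.card 1 with h0 | h1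
  · have : s = ∅ := card_eq_zero.1 (by omega)
    exact ⟨0, 0, 0, 0, by simp [this], by simp⟩
  rcases Nat.lt_or_ge s.card 2 with h0 | h1
  · obtain ⟨i, rfl⟩ := card_eq_one.1 (show s.card = 1 by omega)
    exact ⟨c i, 0, u i, 0, by simp, by simp⟩
  · obtain ⟨i, j, hij, rfl⟩ := card_eq_two.1 (show s.card = 2 by omega)
    exact ⟨c i, c j, u i, u j, fun v w => by rw [sum_pair hij], fun h =>
      ⟨h i (by simp), h j (by simp)⟩⟩

/-- If the exceptional eigenvalues are positive, then `A² + 2A` is the Gram matrix of vectors in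
the plane. -/
lemma exists_isGram (h : IsDiag G lam u) (h2 : (excIdx lam).card ≤ 2)
    (hpos : ∀ i ∈ excIdx lam, 0 < lam i) : ∃ x y, IsGram G x y := by
  obtain ⟨p, q, a, b, hab, hpq⟩ := exists_two h2 (fun i => lam i * (lam i + 2)) u
  obtain ⟨hp, hq⟩ := hpq fun i hi => by
    have := hpos i hi
    positivity
  have key : ∀ v w, Real.sqrt p * a v * (Real.sqrt p * a w)
      + Real.sqrt q * b v * (Real.sqrt q * b w) + (if v = w then 1 else 0)
      = (closedNbhd G v ∩ closedNbhd G w).card := by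
    intro v w
    rw [← inter_eq, h.gram, hab]
    have e1 := Real.mul_self_sqrt hp
    have e2 := Real.mul_self_sqrt hq
    linear_combination a v * a w * e1 + b v * b w * e2
  refine ⟨fun v => Real.sqrt p * a v, fun v => Real.sqrt q * b v, ?_, ?_, ?_⟩
  · intro v
    have := key v v
    rwa [if_pos rfl, inter_self] at this
  · intro v w hvw
    have := key v w
    rwa [if_neg hvw, add_zero] at this
  · intro f
    have e : ∀ v, f v * (f v + ∑ w, closedInd G v w * f w)
        = 2 * (f v * ∑ w, (if v = w then 1 else 0) * f w) + f v * ∑ w, adjInd G v w * f w := by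
      intro v
      simp_rw [closedInd_eq, add_mul, sum_add_distrib]
      simp
      ring
    simp_rw [e]
    rw [sum_add_distrib, h.quadratic_form, ← mul_sum]
    have e2 : ∑ v, f v * ∑ w, (if v = w then 1 else 0) * f w
        = ∑ i, (∑ w, u i w * f w) ^ 2 := by
      have e1 : ∀ v, f v * ∑ w, (if v = w then 1 else 0) * f w
          = ∑ i, (∑ w, u i w * f w) * (u i v * f v) := by
        intro v
        have : ∑ w, (if v = w then 1 else 0) * f w = f v := by simp
        rw [this]
        nth_rewrite 1 [h.expand h.complete f v]
        rw [sum_mul]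
        exact sum_congr rfl fun i _ => by ring
      simp_rw [e1]
      rw [sum_comm]
      refine sum_congr rfl fun i _ => ?_
      rw [← mul_sum]
      ring
    rw [e2, mul_sum, ← sum_add_distrib]
    refine sum_nonneg fun i _ => ?_
    -- The exceptional eigenvalues are positive and the others are `-2` or `0`; this gives positive
    -- semidefiniteness of `A + 2I`.
    have : -2 ≤ lam i := by
      by_cases hi : i ∈ excIdx lam
      · linarith [hpos i hi]
      · rw [mem_excIdx, not_and_or, not_not, not_not] at hi
        rcases hi with hi | hi <;> linarith
    have := mul_nonneg (show 0 ≤ lam i + 2 by linarith) (sq_nonneg (∑ w, u i w * f w))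
    linarith

/-- With a negative exceptional eigenvalue, there is at most one positive eigenvalue. -/
lemma exists_bound (h : IsDiag G lam u) (h2 : (excIdx lam).card ≤ 2)
    (hneg : ∃ i ∈ excIdx lam, lam i < 0) :
    ∃ g : V → ℝ, ∀ f : V → ℝ,
      ∑ v, f v * ∑ w, adjInd G v w * f w ≤ (∑ v, g v * f v) ^ 2 := by
  obtain ⟨i, hi, hneg⟩ := hneg
  -- The trace is zero, so a negative eigenvalue is accompanied by a positive one. These two are all
  -- exceptional eigenvalues, and the quadratic form is bounded by the positive term alone.
  obtain ⟨j, -, hj⟩ : ∃ j ∈ univ, 0 < lam j := by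
    by_contra hcon
    push Not at hcon
    have := sum_lt_sum hcon ⟨i, mem_univ i, hneg⟩
    rw [h.sum_lam] at this
    simp at this
  have hje : j ∈ excIdx lam := mem_excIdx.2 ⟨by linarith, hj.ne'⟩
  have hij : i ≠ j := by rintro rfl; linarith
  have he : excIdx lam = {i, j} := by
    refine (eq_of_subset_of_card_le ?_ (by rw [card_pair hij]; exact h2)).symm
    intro k; rw [mem_insert, mem_singleton]
    rintro (rfl | rfl) <;> assumption
  refine ⟨fun v => Real.sqrt (lam j) * u j v, fun f => ?_⟩
  have e : (∑ v, Real.sqrt (lam j) * u j v * f v) ^ 2 = lam j * (∑ w, u j w * f w) ^ 2 := by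
    simp_rw [mul_assoc]
    rw [← mul_sum, mul_pow, Real.sq_sqrt hj.le]
  rw [h.quadratic_form, e, ← add_sum_erase _ _ (mem_univ j)]
  have : ∑ k ∈ univ.erase j, lam k * (∑ w, u k w * f w) ^ 2 ≤ 0 := by
    refine sum_nonpos fun k hk => mul_nonpos_of_nonpos_of_nonneg ?_ (sq_nonneg _)
    by_cases hke : k ∈ excIdx lam
    · rw [he, mem_insert, mem_singleton] at hke
      rcases hke with rfl | rfl
      · exact hneg.le
      · exact absurd rfl (ne_of_mem_erase hk)
    · rw [mem_excIdx, not_and_or, not_not, not_not] at hke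
      rcases hke with hk | hk <;> linarith
  linarith

/-- The coefficients of an eigenvector vanish outside the eigenvalue. -/
lemma coeff (h : IsDiag G lam u) {g : V → ℝ} {θ : ℝ}
    (hg : ∀ v, ∑ w, adjInd G v w * g w = θ * g v) (i : V) (hi : lam i ≠ θ) :
    ∑ w, u i w * g w = 0 := by
  have e1 : ∑ w, (∑ v, adjInd G w v * u i v) * g w = lam i * ∑ w, u i w * g w := by
    simp_rw [h.eig]
    rw [mul_sum]
    exact sum_congr rfl fun w _ => by ring
  have e2 : ∑ w, (∑ v, adjInd G w v * u i v) * g w = θ * ∑ w, u i w * g w := by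
    simp_rw [sum_mul]
    rw [sum_comm, mul_sum]
    refine sum_congr rfl fun v _ => ?_
    have : u i v * (θ * g v) = θ * (u i v * g v) := by ring
    rw [← this, ← hg v, mul_sum]
    exact sum_congr rfl fun w _ => by rw [adjInd_comm]; ring
  have : (lam i - θ) * ∑ w, u i w * g w = 0 := by linear_combination e2 - e1
  exact (mul_eq_zero.1 this).resolve_left (sub_ne_zero.2 hi)

lemma exists_lam (h : IsDiag G lam u) {g : V → ℝ} {θ : ℝ}
    (hg : ∀ v, ∑ w, adjInd G v w * g w = θ * g v) {v : V} (hv : g v ≠ 0) : ∃ i, lam i = θ := by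
  by_contra hcon
  push Not at hcon
  refine hv ?_
  rw [h.expand h.complete g v]
  exact sum_eq_zero fun i _ => by rw [h.coeff hg i (hcon i), zero_mul]

/-- The alternative `hne` makes the two eigenvectors linearly independent, so a single index cannot
account for both, even if the eigenvalues agree. -/
lemma exists_lam_pair (h : IsDiag G lam u) {g g' : V → ℝ} {θ θ' : ℝ}
    (hg : ∀ v, ∑ w, adjInd G v w * g w = θ * g v)
    (hg' : ∀ v, ∑ w, adjInd G v w * g' w = θ' * g' v) {v w : V} (hv : g v ≠ 0) (hw : g' w ≠ 0)
    (hne : θ ≠ θ' ∨ g' v = 0) : ∃ i j, i ≠ j ∧ lam i = θ ∧ lam j = θ' := by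
  obtain ⟨i, hi⟩ := h.exists_lam hg hv
  obtain ⟨j, hj⟩ := h.exists_lam hg' hw
  by_cases hij : i = j
  · subst hij
    have hθ : θ = θ' := hi.symm.trans hj
    subst hθ
    have hv' := hne.resolve_left (fun h => h rfl)
    by_contra hcon
    push Not at hcon
    have huniq : ∀ k, lam k = θ → k = i := by
      intro k hk
      by_contra hki
      exact hcon i k (Ne.symm hki) hi hk
    have exp : ∀ (f : V → ℝ), (∀ v, ∑ w, adjInd G v w * f w = θ * f v) → ∀ z,
        f z = (∑ w, u i w * f w) * u i z := by
      intro f hf z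
      nth_rewrite 1 [h.expand h.complete f z]
      refine sum_eq_single i (fun k _ hk => ?_) (by simp)
      rw [h.coeff hf k (fun e => hk (huniq k e)), zero_mul]
    have e1 := exp g hg v
    have e2 := exp g' hg' v
    have e3 := exp g' hg' w
    rw [hv'] at e2
    rcases mul_eq_zero.1 e2.symm with h0 | h0
    · rw [h0, zero_mul] at e3; exact hw e3
    · rw [h0, mul_zero] at e1; exact hv e1
  · exact ⟨i, j, hij, hi, hj⟩

end IsDiag

/-- The eigenvalues different from `-2` and `0`. -/
noncomputable def exceptional [DecidableEq V] (G : SimpleGraph V) [DecidableRel G.Adj] :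
    Multiset ℝ := (adjSpectrum G).filter (fun x => x ≠ -2 ∧ x ≠ 0)

/-- The exceptional eigenvalues are the nonzero ones among two numbers with sum `S` and
product `P`. -/
def HasExc [DecidableEq V] (G : SimpleGraph V) [DecidableRel G.Adj] (S P : ℝ) : Prop :=
  (exceptional G).sum = S ∧ ((exceptional G).map (· ^ 2)).sum = S ^ 2 - 2 * P

section Instances

variable [DecidableEq V] [DecidableRel G.Adj]

lemma exceptional_eq {lam : V → ℝ} (hs : adjSpectrum G = univ.val.map lam) :
    exceptional G = (IsDiag.excIdx lam).val.map lam := by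
  rw [exceptional, hs, Multiset.filter_map, IsDiag.excIdx, filter_val]
  congr

lemma IsInH.card_le {lam : V → ℝ} (hG : IsInH G) (hs : adjSpectrum G = univ.val.map lam) :
    (IsDiag.excIdx lam).card ≤ 2 := by
  have := hG
  unfold IsInH at this
  rw [← card_val, ← Multiset.card_map lam, ← exceptional_eq hs]
  exact this

lemma HasExc.of_pair (hG : IsInH G) {g g' : V → ℝ} {θ θ' : ℝ}
    (hg : ∀ v, ∑ w, adjInd G v w * g w = θ * g v)
    (hg' : ∀ v, ∑ w, adjInd G v w * g' w = θ' * g' v) {v w : V} (hv : g v ≠ 0) (hw : g' w ≠ 0)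
    (hne : θ ≠ θ' ∨ g' v = 0) (h1 : θ ≠ -2 ∧ θ ≠ 0) (h2 : θ' ≠ -2 ∧ θ' ≠ 0) :
    HasExc G (θ + θ') (θ * θ') := by
  obtain ⟨lam, u, h, hs⟩ := exists_isDiag G
  obtain ⟨i, j, hij, hi, hj⟩ := h.exists_lam_pair hg hg' hv hw hne
  have he : IsDiag.excIdx lam = {i, j} := by
    refine (eq_of_subset_of_card_le ?_ (by rw [card_pair hij]; exact hG.card_le hs)).symm
    intro k; rw [mem_insert, mem_singleton, IsDiag.mem_excIdx]
    rintro (rfl | rfl)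
    · rwa [hi]
    · rwa [hj]
  have e : ∀ f : ℝ → ℝ, ((exceptional G).map f).sum = f θ + f θ' := by
    intro f
    rw [exceptional_eq hs, he, Multiset.map_map]
    change ∑ k ∈ {i, j}, f (lam k) = _
    rw [sum_pair hij, hi, hj]
  refine ⟨?_, ?_⟩
  · have := e id
    rwa [Multiset.map_id] at this
  · rw [e]; ring

/-- The sum of `λ (λ + 2)` over the exceptional eigenvalues is the sum of the degrees. If `θ`
accounts for all of it, a second exceptional eigenvalue would satisfy `λ (λ + 2) = 0`. -/
lemma HasExc.of_single (hG : IsInH G) {g : V → ℝ} {θ : ℝ}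
    (hg : ∀ v, ∑ w, adjInd G v w * g w = θ * g v) {v : V} (hv : g v ≠ 0)
    (h1 : θ ≠ -2 ∧ θ ≠ 0) (he : ∑ v, ∑ w, adjInd G v w = θ * (θ + 2)) : HasExc G θ 0 := by
  obtain ⟨lam, u, h, hs⟩ := exists_isDiag G
  obtain ⟨i, hi⟩ := h.exists_lam hg hv
  have hie : i ∈ IsDiag.excIdx lam := by rw [IsDiag.mem_excIdx, hi]; exact h1
  have hc := hG.card_le hs
  have h0 := h.sum_exc
  rw [he, ← add_sum_erase _ _ hie, hi, add_eq_left] at h0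
  have he' : IsDiag.excIdx lam = {i} := by
    have c1 := card_erase_of_mem hie
    rcases Nat.lt_or_ge ((IsDiag.excIdx lam).erase i).card 1 with h3 | h3
    · have := card_eq_zero.1 (show ((IsDiag.excIdx lam).erase i).card = 0 by omega)
      rw [← insert_erase hie, this]; rfl
    · obtain ⟨j, hj⟩ := card_eq_one.1 (show ((IsDiag.excIdx lam).erase i).card = 1 by omega)
      rw [hj, sum_singleton] at h0
      have hje : j ∈ IsDiag.excIdx lam := erase_subset i _ (by rw [hj]; simp)
      rw [IsDiag.mem_excIdx] at hje
      rcases mul_eq_zero.1 h0 with h4 | h4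
      · exact absurd h4 hje.2
      · exact absurd (by linarith) hje.1
  have e : ∀ f : ℝ → ℝ, ((exceptional G).map f).sum = f θ := by
    intro f
    rw [exceptional_eq hs, he', Multiset.map_map]
    change ∑ k ∈ {i}, f (lam k) = _
    rw [sum_singleton, hi]
  refine ⟨?_, ?_⟩
  · have := e id
    rwa [Multiset.map_id] at this
  · rw [e]; ring

lemma nonzeroSpectrum_eq : nonzeroSpectrum G
    = exceptional G + Multiset.replicate ((adjSpectrum G).count (-2)) (-2) := by
  rw [nonzeroSpectrum, exceptional, ← Multiset.filter_eq, ← Multiset.filter_add_not (fun x => x ≠ -2)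
    ((adjSpectrum G).filter fun x => x ≠ 0), Multiset.filter_filter, Multiset.filter_filter]
  congr 1
  exact Multiset.filter_congr fun x _ => ⟨fun h => (not_not.1 h.1).symm, fun h => by
    subst h; norm_num⟩

lemma exceptional_eq_filter : exceptional G = (nonzeroSpectrum G).filter (fun x => x ≠ -2) := by
  rw [nonzeroSpectrum, exceptional, Multiset.filter_filter]

/-- The trace of the adjacency matrix vanishes. -/
lemma sum_exceptional : (exceptional G).sum = 2 * (adjSpectrum G).count (-2) := by
  obtain ⟨lam, u, h, hs⟩ := exists_isDiag G
  have h1 : (adjSpectrum G).sum = 0 := by rw [hs]; exact h.sum_lam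
  have h2 : (nonzeroSpectrum G).sum = 0 := by
    rw [← h1, ← Multiset.filter_add_not (fun x => x ≠ 0) (adjSpectrum G), Multiset.sum_add,
      nonzeroSpectrum, left_eq_add]
    refine Multiset.sum_eq_zero fun x hx => ?_
    simpa using (Multiset.mem_filter.1 hx).2
  rw [nonzeroSpectrum_eq, Multiset.sum_add, Multiset.sum_replicate, nsmul_eq_mul] at h2
  linarith

end Instances

/-- The multiplicity of `-2` is recovered from the sum of the exceptional eigenvalues. -/
lemma nonzeroSpectrum_eq_iff {W : Type*} [Fintype W] {H : SimpleGraph W} [DecidableEq V]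
    [DecidableRel G.Adj] [DecidableEq W] [DecidableRel H.Adj] :
    nonzeroSpectrum G = nonzeroSpectrum H ↔ exceptional G = exceptional H := by
  constructor
  · intro h; rw [exceptional_eq_filter, exceptional_eq_filter, h]
  · intro h
    have h1 := sum_exceptional (G := G)
    rw [h, sum_exceptional] at h1
    have h2 : (adjSpectrum H).count (-2) = (adjSpectrum G).count (-2) := by
      exact_mod_cast mul_left_cancel₀ two_ne_zero h1
    rw [nonzeroSpectrum_eq, nonzeroSpectrum_eq, h, h2]

/-- A multiset of at most two nonzero numbers is determined by the sums of the numbers and of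
their squares. -/
lemma Multiset.eq_of_sums {s t : Multiset ℝ} (hs : s.card ≤ 2) (ht : t.card ≤ 2)
    (hs0 : ∀ a ∈ s, a ≠ 0) (ht0 : ∀ a ∈ t, a ≠ 0) (h1 : s.sum = t.sum)
    (h2 : (s.map (· ^ 2)).sum = (t.map (· ^ 2)).sum) : s = t := by
  -- Padding with zeros turns the multiset into a pair, without changing the sums.
  have rep : ∀ s : Multiset ℝ, s.card ≤ 2 → (∀ a ∈ s, a ≠ 0) →
      ∃ a b, s = ({a, b} : Multiset ℝ).filter (· ≠ 0) ∧ s.sum = a + b ∧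
        (s.map (· ^ 2)).sum = a ^ 2 + b ^ 2 := by
    intro s hs h0
    have hc : s.card = 0 ∨ s.card = 1 ∨ s.card = 2 := by omega
    rcases hc with hc | hc | hc
    · rw [Multiset.card_eq_zero] at hc
      subst hc
      exact ⟨0, 0, by simp [Multiset.insert_eq_cons, Multiset.filter_singleton], by simp, by simp⟩
    · obtain ⟨a, rfl⟩ := Multiset.card_eq_one.1 hc
      have := h0 a (by simp)
      refine ⟨a, 0, ?_, by simp, by simp⟩
      simp [Multiset.insert_eq_cons, Multiset.filter_singleton, this]
    · obtain ⟨a, b, rfl⟩ := Multiset.card_eq_two.1 hc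
      refine ⟨a, b, ?_, by simp, by simp⟩
      exact (Multiset.filter_eq_self.2 h0).symm
  obtain ⟨a, b, e1, e2, e3⟩ := rep s hs hs0
  obtain ⟨c, d, f1, f2, f3⟩ := rep t ht ht0
  rw [e1, f1]
  have h3 : (a - c) * (a - d) = 0 := by
    have g1 : a + b = c + d := by linarith
    have g2 : a ^ 2 + b ^ 2 = c ^ 2 + d ^ 2 := by linarith
    linear_combination (g2 - (a + b + c + d) * g1) / 2 + a * g1
  rcases mul_eq_zero.1 h3 with h4 | h4
  · rw [show a = c by linarith, show b = d by linarith]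
  · rw [show a = d by linarith, show b = c by linarith, Multiset.pair_comm]

lemma IsInH.exceptional_eq_iff {W : Type*} [Fintype W] {H : SimpleGraph W} [DecidableEq V]
    [DecidableRel G.Adj] [DecidableEq W] [DecidableRel H.Adj] (hG : IsInH G) (hH : IsInH H)
    {S P S' P' : ℝ} (h : HasExc G S P) (h' : HasExc H S' P') :
    nonzeroSpectrum G = nonzeroSpectrum H ↔ S = S' ∧ P = P' := by
  rw [nonzeroSpectrum_eq_iff]
  constructor
  · intro e
    have h1 : S = S' := by rw [← h.1, ← h'.1, e]
    have h2 := h.2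
    rw [e, h'.2, h1] at h2
    exact ⟨h1, by linarith⟩
  · rintro ⟨rfl, rfl⟩
    exact Multiset.eq_of_sums hG hH (fun a ha => (Multiset.mem_filter.1 ha).2.2)
      (fun a ha => (Multiset.mem_filter.1 ha).2.2) (h.1.trans h'.1.symm) (h.2.trans h'.2.symm)

end Spectrum

/-! ### Exceptional eigenvalues from quotient matrices -/

/-- The number of neighbours that a vertex has in a block of size `n` to which its block is related
by `r`. -/
def BlockRel.count : BlockRel → ℕ → ℝ
  | .none, _ => 0
  | .all, n => n
  | .eq, _ => 1
  | .ne, n => n - 1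

section PatternSpectrum
open scoped Classical
variable {V : Type*} [Fintype V] {G : SimpleGraph V} {t : ℕ} {n : Fin t → ℕ}
  {κ : Fin t → Fin t → BlockRel}

lemma BlockRel.sum_holds (r : BlockRel) {n a : ℕ} (h : r = .eq ∨ r = .ne → a < n) :
    ∑ b : Fin n, (if r.Holds a b then 1 else 0 : ℝ) = r.count n := by
  have one : a < n → ∑ b : Fin n, (if a = (b : ℕ) then 1 else 0 : ℝ) = 1 := by
    intro ha
    rw [sum_eq_single (⟨a, ha⟩ : Fin n)]
    · simp
    · intro b _ hb
      rw [if_neg]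
      rintro rfl
      exact hb rfl
    · simp
  cases r with
  | none => simp [BlockRel.Holds, BlockRel.count]
  | all => simp [BlockRel.Holds, BlockRel.count]
  | eq =>
    refine Eq.trans (sum_congr rfl fun b _ => ?_) (one (h (Or.inl rfl)))
    by_cases hb : a = b <;> simp [BlockRel.Holds, hb]
  | ne =>
    have e : ∀ b : Fin n, (if BlockRel.ne.Holds a b then 1 else 0 : ℝ)
        = 1 - if a = (b : ℕ) then 1 else 0 := by
      intro b; by_cases hb : a = b <;> simp [BlockRel.Holds, hb]
    simp_rw [e]
    rw [sum_sub_distrib, one (h (Or.inr rfl))]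
    simp [BlockRel.count]

/-- Functions on the blocks lift to functions on the vertices, and eigenvectors of the quotient
lift to eigenvectors. -/
lemma HasPattern.exists_lift (h : HasPattern G n κ)
    (hn : ∀ i j, (κ i j = .eq ∨ κ i j = .ne) → n i = n j) :
    ∃ φ : (Fin t → ℝ) → V → ℝ,
      (∀ c θ, (∀ i, ∑ j, (κ i j).count (n j) * c j = θ * c i) →
        ∀ v, ∑ w, adjInd G v w * φ c w = θ * φ c v) ∧
      (∀ i, 0 < n i → ∃ v, ∀ c, φ c v = c i) ∧
      ∑ v, ∑ w, adjInd G v w = ∑ i, n i * ∑ j, (κ i j).count (n j) := by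
  obtain ⟨e, he⟩ := h.exists_equiv
  have key : ∀ (c : Fin t → ℝ) (p : Σ i, Fin (n i)),
      ∑ w, adjInd G (e p) w * c (e.symm w).1 = ∑ j, (κ p.1 j).count (n j) * c j := by
    intro c p
    rw [← e.sum_comp, Fintype.sum_sigma]
    refine sum_congr rfl fun j _ => ?_
    rw [← BlockRel.sum_holds (κ p.1 j) (a := p.2) (fun hh => hn p.1 j hh ▸ p.2.2), sum_mul]
    refine sum_congr rfl fun b _ => ?_
    rw [e.symm_apply_apply]
    congr 1
    unfold adjInd
    simp only [he]
  refine ⟨fun c v => c (e.symm v).1, ?_, ?_, ?_⟩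
  · intro c θ hc v
    obtain ⟨p, rfl⟩ := e.surjective v
    rw [key, hc]
    simp only [e.symm_apply_apply]
  · intro i hi
    exact ⟨e ⟨i, ⟨0, hi⟩⟩, fun c => by simp only [e.symm_apply_apply]⟩
  · rw [← e.sum_comp, Fintype.sum_sigma]
    refine sum_congr rfl fun i _ => ?_
    have := fun a : Fin (n i) => key (fun _ => 1) ⟨i, a⟩
    simp only [mul_one] at this
    simp_rw [this]
    simp

variable [DecidableEq V] [DecidableRel G.Adj]

lemma HasPattern.hasExc_pair (h : HasPattern G n κ) (hG : IsInH G)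
    (hn : ∀ i j, (κ i j = .eq ∨ κ i j = .ne) → n i = n j) {θ θ' : ℝ} (c c' : Fin t → ℝ)
    (hc : ∀ i, ∑ j, (κ i j).count (n j) * c j = θ * c i)
    (hc' : ∀ i, ∑ j, (κ i j).count (n j) * c' j = θ' * c' i) (i i' : Fin t) (hi : 0 < n i)
    (hi' : 0 < n i') (ci : c i ≠ 0) (ci' : c' i' ≠ 0) (hne : θ ≠ θ' ∨ c' i = 0)
    (h1 : θ ≠ -2 ∧ θ ≠ 0) (h2 : θ' ≠ -2 ∧ θ' ≠ 0) : HasExc G (θ + θ') (θ * θ') := by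
  obtain ⟨φ, h3, h4, -⟩ := h.exists_lift hn
  obtain ⟨v, hv⟩ := h4 i hi
  obtain ⟨w, hw⟩ := h4 i' hi'
  exact HasExc.of_pair hG (h3 c θ hc) (h3 c' θ' hc') (v := v) (w := w) (by rwa [hv])
    (by rwa [hw]) (by rwa [hv]) h1 h2

lemma HasPattern.hasExc_single (h : HasPattern G n κ) (hG : IsInH G)
    (hn : ∀ i j, (κ i j = .eq ∨ κ i j = .ne) → n i = n j) {θ : ℝ} (c : Fin t → ℝ)
    (hc : ∀ i, ∑ j, (κ i j).count (n j) * c j = θ * c i) (i : Fin t) (hi : 0 < n i)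
    (ci : c i ≠ 0) (h1 : θ ≠ -2 ∧ θ ≠ 0)
    (he : ∑ i, n i * ∑ j, (κ i j).count (n j) = θ * (θ + 2)) : HasExc G θ 0 := by
  obtain ⟨φ, h3, h4, h5⟩ := h.exists_lift hn
  obtain ⟨v, hv⟩ := h4 i hi
  exact HasExc.of_single hG (h3 c θ hc) (v := v) (by rwa [hv]) h1 (h5.trans he)

/-- Exceptional eigenvalues that are the roots of a quadratic polynomial. -/
lemma HasPattern.hasExc_roots (h : HasPattern G n κ) (hG : IsInH G)
    (hn : ∀ i j, (κ i j = .eq ∨ κ i j = .ne) → n i = n j) {S P : ℝ} (hd : 0 < S ^ 2 - 4 * P)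
    (hP : P ≠ 0) (h2 : 4 + 2 * S + P ≠ 0) (c : ℝ → Fin t → ℝ)
    (hc : ∀ θ, θ ^ 2 = S * θ - P → (∀ i, ∑ j, (κ i j).count (n j) * c θ j = θ * c θ i) ∧
      ∃ i, 0 < n i ∧ c θ i ≠ 0) : HasExc G S P := by
  -- The roots are `(S ± r) / 2`. They differ since the discriminant is positive, and `hP` and `h2`
  -- say that neither `0` nor `-2` is a root.
  set r := Real.sqrt (S ^ 2 - 4 * P) with hr
  have hr0 : 0 < r := Real.sqrt_pos.2 hd
  have hr2 : r ^ 2 = S ^ 2 - 4 * P := Real.sq_sqrt hd.le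
  have root : ∀ θ, θ ^ 2 = S * θ - P → θ ≠ -2 ∧ θ ≠ 0 := by
    intro θ hθ
    refine ⟨?_, ?_⟩
    · rintro rfl; exact h2 (by linarith)
    · rintro rfl; exact hP (by linarith)
  have r1 : ((S + r) / 2) ^ 2 = S * ((S + r) / 2) - P := by nlinarith
  have r2 : ((S - r) / 2) ^ 2 = S * ((S - r) / 2) - P := by nlinarith
  obtain ⟨e1, i, hi, ci⟩ := hc _ r1
  obtain ⟨e2, j, hj, cj⟩ := hc _ r2
  have := h.hasExc_pair hG hn _ _ e1 e2 i j hi hj ci cj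
    (Or.inl (by intro e; linarith)) (root _ r1) (root _ r2)
  rwa [show (S + r) / 2 + (S - r) / 2 = S by ring,
    show (S + r) / 2 * ((S - r) / 2) = P by nlinarith] at this

lemma HasPattern.hasExc_cocktail (hG : IsInH G) {k : ℕ} (hk : 2 ≤ k)
    (h : HasPattern G ![k, k] (kappaTwo .ne .ne)) : HasExc G (2 * k - 2) 0 := by
  have hk' : (2 : ℝ) ≤ k := by exact_mod_cast hk
  refine h.hasExc_single hG ?_ ![1, 1] ?_ 0 (by simp; omega) (by simp) ?_ ?_
  · intro i j; fin_cases i <;> fin_cases j <;> simp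
  · intro i; fin_cases i <;> simp [Fin.sum_univ_succ, kappaTwo, BlockRel.count] <;> ring
  · constructor <;> intro h <;> linarith
  · simp [Fin.sum_univ_succ, kappaTwo, BlockRel.count]; ring

lemma HasPattern.hasExc_two_stars (hG : IsInH G)
    (h : HasPattern G ![1, 4, 1, 4] (kappaSum .none .all .none .all)) : HasExc G 4 4 := by
  have := h.hasExc_pair hG (θ := 2) (θ' := 2) ?_ ![2, 1, 0, 0] ![0, 0, 2, 1] ?_ ?_ 0 2 (by simp)
    (by simp) (by simp) (by simp) (by simp) (by norm_num) (by norm_num)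
  · norm_num at this; exact this
  · intro i j; fin_cases i <;> fin_cases j <;> simp [kappaSum]
  · intro i; fin_cases i <;> norm_num [Fin.sum_univ_succ, kappaSum, BlockRel.count]
  · intro i; fin_cases i <;> norm_num [Fin.sum_univ_succ, kappaSum, BlockRel.count]

lemma HasPattern.hasExc_star_cocktail (hG : IsInH G) {k : ℕ} (hk : 2 ≤ k)
    (h : HasPattern G ![1, 4, k, k] (kappaSum .none .all .ne .ne)) :
    HasExc G (2 * k) (4 * k - 4) := by
  have hk' : (2 : ℝ) ≤ k := by exact_mod_cast hk
  have := h.hasExc_pair hG (θ := 2) (θ' := 2 * k - 2) ?_ ![2, 1, 0, 0] ![0, 0, 1, 1] ?_ ?_ 0 2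
    (by simp) (by simp; omega) (by simp) (by simp) (by simp) (by norm_num)
    (by constructor <;> intro h <;> linarith)
  · ring_nf at this ⊢; exact this
  · intro i j; fin_cases i <;> fin_cases j <;> simp [kappaSum]
  · intro i; fin_cases i <;> norm_num [Fin.sum_univ_succ, kappaSum, BlockRel.count]
  · intro i
    fin_cases i <;> norm_num [Fin.sum_univ_succ, kappaSum, BlockRel.count] <;> ring

lemma HasPattern.hasExc_two_cocktails (hG : IsInH G) {k l : ℕ} (hk : 2 ≤ k) (hl : 2 ≤ l)
    (h : HasPattern G ![k, k, l, l] (kappaSum .ne .ne .ne .ne)) :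
    HasExc G (2 * k + 2 * l - 4) (4 * (k - 1) * (l - 1)) := by
  have hk' : (2 : ℝ) ≤ k := by exact_mod_cast hk
  have hl' : (2 : ℝ) ≤ l := by exact_mod_cast hl
  have := h.hasExc_pair hG (θ := 2 * k - 2) (θ' := 2 * l - 2) ?_ ![1, 1, 0, 0] ![0, 0, 1, 1] ?_ ?_
    0 2 (by simp; omega) (by simp; omega) (by simp) (by simp) (by simp)
    (by constructor <;> intro h <;> linarith) (by constructor <;> intro h <;> linarith)
  · ring_nf at this ⊢; exact this
  · intro i j; fin_cases i <;> fin_cases j <;> simp [kappaSum]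
  · intro i
    fin_cases i <;> norm_num [Fin.sum_univ_succ, kappaSum, BlockRel.count] <;> ring
  · intro i
    fin_cases i <;> norm_num [Fin.sum_univ_succ, kappaSum, BlockRel.count] <;> ring

lemma HasPattern.hasExc_kappa6 (hG : IsInH G) {k : ℕ} (hk : 3 ≤ k)
    (h : HasPattern G ![k, k] kappa6) :
    HasExc G (2 * k - 2) (k * (k - 2)) := by
  have hk' : (3 : ℝ) ≤ k := by exact_mod_cast hk
  have := h.hasExc_pair hG (θ := k) (θ' := k - 2) ?_ ![1, 1] ![1, -1] ?_ ?_
    0 0 (by simp; omega) (by simp; omega) (by simp) (by simp) (by left; intro h; linarith)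
    (by constructor <;> intro h <;> linarith) (by constructor <;> intro h <;> linarith)
  · ring_nf at this ⊢; exact this
  · intro i j; fin_cases i <;> fin_cases j <;> simp
  · intro i
    fin_cases i <;> norm_num [Fin.sum_univ_succ, kappa6, BlockRel.count]
  · intro i
    fin_cases i <;> norm_num [Fin.sum_univ_succ, kappa6, BlockRel.count] <;> ring

lemma HasPattern.hasExc_kappa8 (hG : IsInH G) {k l : ℕ} (hk : 1 ≤ k) (hl : 1 ≤ l)
    (hkl : 3 ≤ k + l) (h : HasPattern G ![k, k, l, l, 1] kappa8) :
    HasExc G (2 * (k + l - 1)) (4 * k * l - 2 * (k + l)) := by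
  have hk' : (1 : ℝ) ≤ k := by exact_mod_cast hk
  have hl' : (1 : ℝ) ≤ l := by exact_mod_cast hl
  have hkl' : (3 : ℝ) ≤ k + l := by exact_mod_cast hkl
  have hn : ∀ i j, (kappa8 i j = .eq ∨ kappa8 i j = .ne) →
      (![k, k, l, l, 1] : Fin 5 → ℕ) i = (![k, k, l, l, 1] : Fin 5 → ℕ) j := by
    intro i j; fin_cases i <;> fin_cases j <;> simp [kappa8]
  have hP : (0 : ℝ) < 4 * k * l - 2 * (k + l) := by
    have := mul_nonneg (sub_nonneg.2 hk') (sub_nonneg.2 hl')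
    nlinarith
  -- For `k = l` the family of eigenvectors used below vanishes at the root `2k - 2`, so explicit
  -- eigenvectors are given instead.
  by_cases hne : k = l
  · subst hne
    have := h.hasExc_pair hG (θ := 2 * k) (θ' := 2 * k - 2) hn ![1, 1, 1, 1, 2] ![1, 1, -1, -1, 0]
      ?_ ?_ 0 0 (by simp; omega) (by simp; omega) (by simp) (by simp) (by left; intro h; linarith)
      (by constructor <;> intro h <;> linarith) (by constructor <;> intro h <;> linarith)
    · ring_nf at this ⊢; exact this
    · intro i
      fin_cases i <;> norm_num [Fin.sum_univ_succ, kappa8, BlockRel.count] <;> ring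
    · intro i
      fin_cases i <;> norm_num [Fin.sum_univ_succ, kappa8, BlockRel.count] <;> ring
  · have hne' : (k : ℝ) ≠ l := by exact_mod_cast hne
    refine h.hasExc_roots hG hn ?_ hP.ne' (by nlinarith) (fun θ => ![θ - 2 * l + 2, θ - 2 * l + 2,
      θ - 2 * k + 2, θ - 2 * k + 2, (θ - 2 * l + 2) * (θ - 2 * k + 2)]) ?_
    · nlinarith [sq_nonneg ((k : ℝ) - l)]
    · intro θ hθ
      refine ⟨?_, ?_⟩
      · intro i
        fin_cases i <;> norm_num [Fin.sum_univ_succ, kappa8, BlockRel.count]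
        · ring
        · ring
        · ring
        · ring
        · linear_combination (-(θ + 2)) * hθ
      · by_cases h0 : θ - 2 * l + 2 = 0
        · refine ⟨2, by simp; omega, ?_⟩
          simp
          intro e
          exact hne' (by linarith)
        · exact ⟨0, by simp; omega, by simpa using h0⟩

lemma HasPattern.hasExc_kappa9 (hG : IsInH G) {k : ℕ} (hk : 1 ≤ k)
    (h : HasPattern G ![k, k, 3, 3] kappa9) :
    HasExc G (2 * k + 4) (6 * k) := by
  refine h.hasExc_roots hG ?_ (by nlinarith [sq_nonneg ((k : ℝ) - 1)]) (by positivity)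
    (by positivity) (fun θ => ![θ * (θ - 4), θ * (θ - 4), 2 * k * (θ - 2), 4 * k]) ?_
  · intro i j; fin_cases i <;> fin_cases j <;> simp [kappa9]
  · intro θ hθ
    refine ⟨?_, 3, by simp, by simp; omega⟩
    intro i
    fin_cases i <;> norm_num [Fin.sum_univ_succ, kappa9, BlockRel.count]
    · linear_combination (-(θ + 2)) * hθ
    · linear_combination (-(θ + 2)) * hθ
    · ring
    · ring

/-- The eigenvalue equations at all blocks but the second determine the eigenvector up to scale;
`hS` is the equation at the remaining one, a cubic in `θ` that the quadratic must divide. -/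
lemma HasPattern.hasExc_tail (hG : IsInH G) {a m : ℕ} {S P : ℝ} (hm : 2 ≤ m)
    (h : HasPattern G ![a, 1, m, m] kappaTail) (hd : 0 < S ^ 2 - 4 * P) (hP : P ≠ 0)
    (h2 : 4 + 2 * S + P ≠ 0) (hS : ∀ θ : ℝ, θ ^ 2 = S * θ - P →
      a * (θ - 2 * m + 2) + m * (θ - m + 1) = θ ^ 2 * (θ - 2 * m + 2)) : HasExc G S P := by
  refine h.hasExc_roots hG ?_ hd hP h2
    (fun θ => ![θ - 2 * m + 2, θ * (θ - 2 * m + 2), θ - m + 1, m - 1]) ?_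
  · intro i j; fin_cases i <;> fin_cases j <;> simp [kappaTail]
  · intro θ hθ
    have hm' : (2 : ℝ) ≤ m := by exact_mod_cast hm
    refine ⟨?_, 3, by simp; omega, by simp; intro e; linarith⟩
    intro i
    fin_cases i <;> norm_num [Fin.sum_univ_succ, kappaTail, BlockRel.count]
    · linear_combination hS θ hθ
    · ring
    · ring

lemma HasPattern.hasExc_twelve (hG : IsInH G)
    (h : HasPattern G ![2, 2, 2, 1, 1] (kappaOpp .none .all .none)) : HasExc G 4 3 := by
  have := h.hasExc_pair hG (θ := 3) (θ' := 1) ?_ ![1, 1, 2, 3, 3] ![1, -1, 0, 1, -1] ?_ ?_ 0 0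
    (by simp) (by simp) (by simp) (by simp) (by norm_num) (by norm_num) (by norm_num)
  · norm_num at this; exact this
  · intro i j; fin_cases i <;> fin_cases j <;> simp [kappaOpp]
  · intro i; fin_cases i <;> norm_num [Fin.sum_univ_succ, kappaOpp, BlockRel.count]
  · intro i; fin_cases i <;> norm_num [Fin.sum_univ_succ, kappaOpp, BlockRel.count]

lemma HasPattern.hasExc_eleven (hG : IsInH G)
    (h : HasPattern G ![2, 2, 1, 2, 2] (kappaOpp .ne .eq .ne)) : HasExc G 6 8 := by
  have := h.hasExc_pair hG (θ := 4) (θ' := 2) ?_ ![1, 1, 2, 2, 2] ![1, -1, 0, 1, -1] ?_ ?_ 0 0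
    (by simp) (by simp) (by simp) (by simp) (by norm_num) (by norm_num) (by norm_num)
  · norm_num at this; exact this
  · intro i j; fin_cases i <;> fin_cases j <;> simp [kappaOpp]
  · intro i; fin_cases i <;> norm_num [Fin.sum_univ_succ, kappaOpp, BlockRel.count]
  · intro i; fin_cases i <;> norm_num [Fin.sum_univ_succ, kappaOpp, BlockRel.count]

end PatternSpectrum

/-! ### One positive eigenvalue: complete multipartite graphs -/

/-- The relations between the blocks of a complete multipartite graph with one arbitrary part and
further parts of size two. -/
def kappaMulti : Fin 3 → Fin 3 → BlockRel :=
  ![![.none, .all, .all], ![.all, .ne, .ne], ![.all, .ne, .ne]]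

/-- The relations between the blocks of a complete tripartite graph. -/
def kappaTri : Fin 3 → Fin 3 → BlockRel :=
  ![![.none, .all, .all], ![.all, .none, .all], ![.all, .all, .none]]

section Multipartite
open scoped Classical
variable {V : Type*} [Fintype V] {G : SimpleGraph V}

/-- A graph without isolated vertices whose adjacency matrix has only one positive eigenvalue is
complete multipartite. -/
lemma adj_or_of_bound (hiso : ∀ v, ¬ G.IsIsolated v) {g : V → ℝ}
    (hg : ∀ f : V → ℝ, ∑ v, f v * ∑ w, adjInd G v w * f w ≤ (∑ v, g v * f v) ^ 2) {v u : V}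
    (hvu : G.Adj v u) (w : V) : G.Adj w v ∨ G.Adj w u := by
  by_contra hcon
  push Not at hcon
  obtain ⟨hwv, hwu⟩ := hcon
  obtain ⟨t, ht⟩ := IsGram.exists_adj hiso w
  -- The weights are chosen so that the test vector below is orthogonal to `g`, whence the quadratic
  -- form is at most `0` on it. With `c`, `d` the adjacencies of `t` to `v` and `u`, the form is
  -- `4α² + 2(c + d)αβ + 2β²`. The weight `2` on `w` makes it positive definite even for `c = d =
  -- 1`.
  obtain ⟨α, β, hne, h0⟩ : ∃ α β : ℝ, 0 < α ^ 2 + β ^ 2 ∧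
      α * (2 * g w + g t) + β * (g v + g u) = 0 := by
    by_cases hz : 2 * g w + g t = 0
    · exact ⟨1, 0, by norm_num, by rw [hz]; ring⟩
    · refine ⟨-(g v + g u), 2 * g w + g t, ?_, by ring⟩
      have : 0 < (2 * g w + g t) ^ 2 := by positivity
      positivity
  set f : V → ℝ := fun z => (if z = w then 2 * α else 0) + (if z = t then α else 0)
    + (if z = v then β else 0) + (if z = u then β else 0) with hf
  have e1 : ∀ F : V → ℝ, ∑ z, F z * f z = 2 * α * F w + α * F t + β * F v + β * F u := by
    intro F
    simp only [hf, mul_add, sum_add_distrib, mul_ite, mul_zero, sum_ite_eq', mem_univ, if_true]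
    ring
  have key := hg f
  rw [e1 g] at key
  have e2 : ∀ z, f z * ∑ x, adjInd G z x * f x = (∑ x, adjInd G z x * f x) * f z :=
    fun z => mul_comm _ _
  simp_rw [e2] at key
  rw [e1 fun z => ∑ x, adjInd G z x * f x] at key
  simp only [e1] at key
  have a0 : ∀ z, adjInd G z z = 0 := fun z => by simp [adjInd]
  have a1 : ∀ {a b}, G.Adj a b → adjInd G a b = 1 := fun h => by simp [adjInd, h]
  have a2 : ∀ {a b}, ¬ G.Adj a b → adjInd G a b = 0 := fun h => by simp [adjInd, h]
  have bd : ∀ a b, 0 ≤ adjInd G a b ∧ adjInd G a b ≤ 1 := fun a b => by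
    unfold adjInd; split_ifs <;> norm_num
  rw [a0, a0, a0, a0, a1 ht, a1 ht.symm, a1 hvu, a1 hvu.symm, a2 hwv, a2 hwu,
    a2 (fun e => hwv e.symm), a2 (fun e => hwu e.symm), adjInd_comm v t, adjInd_comm u t] at key
  set c := adjInd G t v
  set d := adjInd G t u
  obtain ⟨c0, c1⟩ : 0 ≤ c ∧ c ≤ 1 := bd t v
  obtain ⟨d0, d1⟩ : 0 ≤ d ∧ d ≤ 1 := bd t u
  have h3 : (2 * α * g w + α * g t + β * g v + β * g u) ^ 2 = 0 := by
    rw [show 2 * α * g w + α * g t + β * g v + β * g u = 0 by linarith]; norm_num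
  rw [h3] at key
  have h4 : 4 * α ^ 2 + 2 * (c + d) * (α * β) + 2 * β ^ 2 ≤ 0 := by linarith
  have h5 : (c + d) ^ 2 ≤ 4 := by nlinarith
  have h6 : 0 ≤ ((c + d) * α + 2 * β) ^ 2 := sq_nonneg _
  have h7 : α ^ 2 * (8 - (c + d) ^ 2) ≤ 0 := by nlinarith
  have hα : α ^ 2 = 0 := by nlinarith [sq_nonneg α]
  have hα' : α = 0 := by simpa using hα
  rw [hα'] at h4 hne
  nlinarith

/-- Nonadjacency is transitive. -/
def IsMultipartite (G : SimpleGraph V) : Prop := ∀ v u, G.Adj v u → ∀ w, G.Adj w v ∨ G.Adj w u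

/-- The part of a vertex in a complete multipartite graph. -/
noncomputable def part (G : SimpleGraph V) (v : V) : Finset V := univ.filter fun w => ¬ G.Adj v w

lemma mem_part {v w : V} : w ∈ part G v ↔ ¬ G.Adj v w := by simp [part]

lemma self_mem_part (v : V) : v ∈ part G v := mem_part.2 (G.loopless.irrefl v)

namespace IsMultipartite

lemma adj_of_part (h : IsMultipartite G) {v w a b : V} (hvw : G.Adj v w) (ha : a ∈ part G v)
    (hb : b ∈ part G w) : G.Adj a b := by
  rw [mem_part] at ha hb
  have h1 : G.Adj a w := (h v w hvw a).resolve_left fun e => ha e.symm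
  exact ((h a w h1 b).resolve_right fun e => hb e.symm).symm

lemma not_adj_of_part (h : IsMultipartite G) {v a b : V} (ha : a ∈ part G v)
    (hb : b ∈ part G v) : ¬ G.Adj a b := by
  rw [mem_part] at ha hb
  exact fun e => (h a b e v).elim ha hb

lemma part_eq (h : IsMultipartite G) {v w : V} (hvw : ¬ G.Adj v w) : part G v = part G w := by
  ext z
  rw [mem_part, mem_part, not_iff_not]
  refine ⟨fun e => ?_, fun e => ?_⟩
  · exact ((h v z e w).resolve_left fun e => hvw e.symm)
  · exact (h w z e v).resolve_left hvw

lemma disjoint (h : IsMultipartite G) {v w : V} (hvw : G.Adj v w) :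
    Disjoint (part G v) (part G w) := by
  rw [disjoint_left]
  intro z hz hz'
  exact G.loopless.irrefl z (h.adj_of_part hvw hz hz')

lemma card_closed (v : V) :
    ((closedNbhd G v).card : ℝ) = Fintype.card V - (part G v).card + 1 := by
  have : closedNbhd G v = univ \ (part G v).erase v := by
    ext z
    simp only [mem_closedNbhd, mem_sdiff, mem_univ, mem_erase, mem_part, true_and]
    tauto
  have h1 := card_sdiff_add_card_eq_card (subset_univ ((part G v).erase v))
  have h2 := card_erase_add_one (self_mem_part (G := G) v)
  rw [← this, card_univ] at h1
  have : ((closedNbhd G v).card : ℝ) + ((part G v).erase v).card = Fintype.card V := by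
    exact_mod_cast h1
  have : (((part G v).erase v).card : ℝ) + 1 = (part G v).card := by exact_mod_cast h2
  linarith

lemma card_inter (h : IsMultipartite G) {v w : V} (hvw : G.Adj v w) :
    ((closedNbhd G v ∩ closedNbhd G w).card : ℝ)
      = Fintype.card V - (part G v).card - (part G w).card + 2 := by
  have h1 := card_union_add_card_inter (closedNbhd G v) (closedNbhd G w)
  have hu : closedNbhd G v ∪ closedNbhd G w = univ := by
    ext z
    simp only [mem_union, mem_closedNbhd, mem_univ, iff_true]
    rcases h v w hvw z with e | e
    · exact Or.inl (Or.inr e.symm)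
    · exact Or.inr (Or.inr e.symm)
  rw [hu, card_univ] at h1
  have h2 : (Fintype.card V : ℝ) + (closedNbhd G v ∩ closedNbhd G w).card
      = (closedNbhd G v).card + (closedNbhd G w).card := by exact_mod_cast h1
  rw [card_closed, card_closed] at h2
  linarith

/-- Three parts, when `A² + 2A` has rank at most two. -/
lemma triple (h : IsMultipartite G) {p q : ℝ} {a b : V → ℝ}
    (hr : ∀ v w, ∑ z, adjInd G v z * adjInd G z w + 2 * adjInd G v w
      = p * a v * a w + q * b v * b w) {v w z : V} (hvw : G.Adj v w) (hwz : G.Adj w z)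
    (hvz : G.Adj v z) :
    (Fintype.card V - (part G v).card - (part G w).card - (part G z).card + 4 : ℤ)
      * (((part G v).card - 2) * ((part G w).card - 2) + ((part G w).card - 2)
        * ((part G z).card - 2) + ((part G z).card - 2) * ((part G v).card - 2))
      + 4 * ((part G v).card - 2) * ((part G w).card - 2) * ((part G z).card - 2) = 0 := by
  have d : ∀ v, p * a v * a v + q * b v * b v = Fintype.card V - (part G v).card := by
    intro v
    have := IsDiag.inter_eq (G := G) v v
    rw [hr, inter_self, card_closed, if_pos rfl] at this
    linarith
  have o : ∀ v w, G.Adj v w → p * a v * a w + q * b v * b w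
      = Fintype.card V - (part G v).card - (part G w).card + 2 := by
    intro v w hvw
    have := IsDiag.inter_eq (G := G) v w
    rw [hr, h.card_inter hvw, if_neg hvw.ne] at this
    linarith
  have e : ((Fintype.card V - (part G v).card - (part G w).card - (part G z).card + 4 : ℝ)
      * (((part G v).card - 2) * ((part G w).card - 2) + ((part G w).card - 2)
        * ((part G z).card - 2) + ((part G z).card - 2) * ((part G v).card - 2))
      + 4 * ((part G v).card - 2) * ((part G w).card - 2) * ((part G z).card - 2)) = 0 := by
    -- A 3×3 minor of a sum of two rank-one matrices vanishes identically.
    have det : (p * a v * a v + q * b v * b v) * ((p * a w * a w + q * b w * b w)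
          * (p * a z * a z + q * b z * b z) - (p * a w * a z + q * b w * b z) ^ 2)
        - (p * a v * a w + q * b v * b w) * ((p * a v * a w + q * b v * b w)
          * (p * a z * a z + q * b z * b z) - (p * a w * a z + q * b w * b z)
          * (p * a v * a z + q * b v * b z))
        + (p * a v * a z + q * b v * b z) * ((p * a v * a w + q * b v * b w)
          * (p * a w * a z + q * b w * b z) - (p * a w * a w + q * b w * b w)
          * (p * a v * a z + q * b v * b z)) = 0 := by ring
    rw [d, d, d, o v w hvw, o w z hwz, o v z hvz] at det
    linear_combination det
  exact_mod_cast e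

lemma card_parts (h : IsMultipartite G) {v w z : V} (hvw : G.Adj v w) (hwz : G.Adj w z)
    (hvz : G.Adj v z) :
    (part G v).card + (part G w).card + (part G z).card ≤ Fintype.card V ∧
      ((∀ t, t ∈ part G v ∨ t ∈ part G w ∨ t ∈ part G z) ∨
        (part G v).card + (part G w).card + (part G z).card < Fintype.card V) := by
  have d : Disjoint (part G v ∪ part G w) (part G z) :=
    disjoint_union_left.2 ⟨h.disjoint hvz, h.disjoint hwz⟩
  rw [← card_union_of_disjoint (h.disjoint hvw), ← card_union_of_disjoint d]
  refine ⟨card_le_univ _, ?_⟩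
  by_cases hc : ∀ t, t ∈ part G v ∨ t ∈ part G w ∨ t ∈ part G z
  · exact Or.inl hc
  · push Not at hc
    obtain ⟨t, h1, h2, h3⟩ := hc
    refine Or.inr (card_lt_univ_of_notMem (x := t) ?_)
    simp [h1, h2, h3]

lemma part_pos (v : V) : 1 ≤ (part G v).card := card_pos.2 ⟨v, self_mem_part v⟩

lemma bipartite (h : IsMultipartite G) {v w : V} (hvw : G.Adj v w)
    (hno : ∀ z, ¬ (G.Adj v z ∧ G.Adj w z)) :
    HasPattern G ![(part G v).card, (part G w).card] (kappaTwo .none .all) := by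
  have : Nonempty V := ⟨v⟩
  obtain ⟨f, hf⟩ := IsEnum.exists (part G v) rfl
  obtain ⟨g, hg⟩ := IsEnum.exists (part G w) rfl
  refine IsPart.hasPattern (S := univ) ⟨f, g, _, _, hf, hg, ?_, ?_, ?_, ?_, ?_⟩ mem_univ
  · exact fun z hz hz' => disjoint_left.1 (h.disjoint hvw) hz hz'
  · intro z
    simp only [mem_univ, true_iff, mem_part]
    have := hno z
    tauto
  · exact fun a b ha hb => iff_of_false (h.not_adj_of_part (hf.mem a ha) (hf.mem b hb)) id
  · exact fun a b ha hb => iff_of_false (h.not_adj_of_part (hg.mem a ha) (hg.mem b hb)) id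
  · exact fun a b ha hb => iff_of_true (h.adj_of_part hvw (hf.mem a ha) (hg.mem b hb)) trivial

lemma tripartite (h : IsMultipartite G) {v w z : V} (hvw : G.Adj v w) (hwz : G.Adj w z)
    (hvz : G.Adj v z) (hc : ∀ t, t ∈ part G v ∨ t ∈ part G w ∨ t ∈ part G z) :
    HasPattern G ![(part G v).card, (part G w).card, (part G z).card] kappaTri := by
  have : Nonempty V := ⟨v⟩
  obtain ⟨f, hf⟩ := IsEnum.exists (part G v) rfl
  obtain ⟨g, hg⟩ := IsEnum.exists (part G w) rfl
  obtain ⟨k, hk⟩ := IsEnum.exists (part G z) rfl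
  refine HasPattern.of_enum ![f, g, k] ![part G v, part G w, part G z] ?_ (by decide) ?_ ?_ ?_
  · intro i; fin_cases i
    exacts [hf, hg, hk]
  · intro i j hij t ht
    fin_cases i <;> fin_cases j <;> first | exact absurd hij (by decide) | skip
    · exact disjoint_left.1 (h.disjoint hvw) ht
    · exact disjoint_left.1 (h.disjoint hvz) ht
    · exact disjoint_left.1 (h.disjoint hwz) ht
  · intro t
    rcases hc t with ht | ht | ht
    exacts [⟨0, ht⟩, ⟨1, ht⟩, ⟨2, ht⟩]
  · intro i j hij a b ha hb m1 m2
    fin_cases i <;> fin_cases j <;> first | exact absurd hij (by decide) | skip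
    · exact iff_of_false (h.not_adj_of_part m1 m2) id
    · exact iff_of_true (h.adj_of_part hvw m1 m2) trivial
    · exact iff_of_true (h.adj_of_part hvz m1 m2) trivial
    · exact iff_of_false (h.not_adj_of_part m1 m2) id
    · exact iff_of_true (h.adj_of_part hwz m1 m2) trivial
    · exact iff_of_false (h.not_adj_of_part m1 m2) id

/-- Parts of size two form a cocktail party graph, and the part of `p`, of arbitrary size, is joined
to all of it. -/
lemma one_part (h : IsMultipartite G) {p v w : V} (hpv : G.Adj p v) (hpw : G.Adj p w)
    (hvw : G.Adj v w) (htwo : ∀ z, G.Adj p z → (part G z).card = 2) :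
    ∃ k, 2 ≤ k ∧ HasPattern G ![(part G p).card, k, k] kappaMulti := by
  set S : Finset V := univ.filter (G.Adj p) with hS
  have memS : ∀ z, z ∈ S ↔ G.Adj p z := fun z => by simp [hS]
  obtain ⟨k, hk, f, g, M, N, hf, hg, hd, hc, h1, h2, h3⟩ :=
    isPart_cocktail (G := G) (S := S) ((memS v).2 hpv) ((memS w).2 hpw) hvw (by
      intro z hz
      have hpz := (memS z).1 hz
      obtain ⟨z', hz', hne⟩ := exists_mem_ne (s := part G z) (by rw [htwo z hpz]; omega) z
      have heq : part G z = {z, z'} := by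
        refine (eq_of_subset_of_card_le ?_ ?_).symm
        · intro t; rw [mem_insert, mem_singleton]
          rintro (rfl | rfl)
          exacts [self_mem_part _, hz']
        · rw [htwo z hpz, card_pair hne.symm]
      refine ⟨z', (memS z').2 (h.adj_of_part hpz (self_mem_part p) hz'), hne, fun t _ ht => ?_⟩
      have : t ∈ part G z ↔ t = z' := by rw [heq, mem_insert, mem_singleton]; tauto
      rw [mem_part] at this
      tauto)
  have : Nonempty V := ⟨v⟩
  obtain ⟨e, he⟩ := IsEnum.exists (part G p) rfl
  have MS : ∀ z, z ∈ M ∨ z ∈ N → G.Adj p z := fun z hz => (memS z).1 ((hc z).2 hz)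
  have PS : ∀ a z, a ∈ part G p → z ∈ M ∨ z ∈ N → G.Adj a z := fun a z ha hz =>
    h.adj_of_part (MS z hz) ha (self_mem_part z)
  refine ⟨k, hk, HasPattern.of_enum ![e, f, g] ![part G p, M, N] ?_ (by decide) ?_ ?_ ?_⟩
  · intro i; fin_cases i
    exacts [he, hf, hg]
  · intro i j hij t ht
    fin_cases i <;> fin_cases j <;> first | exact absurd hij (by decide) | skip
    · exact fun e => mem_part.1 ht (MS t (Or.inl e))
    · exact fun e => mem_part.1 ht (MS t (Or.inr e))
    · exact hd t ht
  · intro t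
    by_cases ht : G.Adj p t
    · rcases (hc t).1 ((memS t).2 ht) with ht | ht
      exacts [⟨1, ht⟩, ⟨2, ht⟩]
    · exact ⟨0, mem_part.2 ht⟩
  · intro i j hij a b ha hb m1 m2
    fin_cases i <;> fin_cases j <;> first | exact absurd hij (by decide) | skip
    · exact iff_of_false (h.not_adj_of_part m1 m2) id
    · exact iff_of_true (PS _ _ m1 (Or.inl m2)) trivial
    · exact iff_of_true (PS _ _ m1 (Or.inr m2)) trivial
    · exact h1 a b ha hb
    · exact h3 a b ha hb
    · exact h2 a b ha hb

/-- The complete multipartite graphs for which `A² + 2A` has rank at most two. -/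
theorem classification (h : IsMultipartite G) (hiso : ∀ v, ¬ G.IsIsolated v) [Nonempty V]
    {p q : ℝ} {a b : V → ℝ} (hr : ∀ v w, ∑ z, adjInd G v z * adjInd G z w + 2 * adjInd G v w
      = p * a v * a w + q * b v * b w) :
    (∃ l m, 1 ≤ l ∧ 1 ≤ m ∧ HasPattern G ![l, m] (kappaTwo .none .all)) ∨
    (∃ l k, 1 ≤ l ∧ 2 ≤ k ∧ HasPattern G ![l, k, k] kappaMulti) ∨
    HasPattern G ![1, 1, 3] kappaTri := by
  have pos := part_pos (G := G)
  by_cases htri : ∃ v w z, G.Adj v w ∧ G.Adj w z ∧ G.Adj v z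
  swap
  · push Not at htri
    obtain ⟨v⟩ := ‹Nonempty V›
    obtain ⟨w, hw⟩ := IsGram.exists_adj hiso v
    exact Or.inl ⟨_, _, pos v, pos w, h.bipartite hw fun z hz => htri v w z hw hz.2 hz.1⟩
  obtain ⟨v, w, z, hvw, hwz, hvz⟩ := htri
  have tr := fun {v w z : V} (hvw : G.Adj v w) (hwz : G.Adj w z) (hvz : G.Adj v z) =>
    h.triple hr hvw hwz hvz
  by_cases h2 : ∃ t, (part G t).card = 2
  · right; left
    obtain ⟨t, ht⟩ := h2
    have third : ∀ p, ∃ v w, G.Adj p v ∧ G.Adj p w ∧ G.Adj v w := by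
      intro p
      by_cases hpv : G.Adj p v
      · by_cases hpw : G.Adj p w
        · exact ⟨v, w, hpv, hpw, hvw⟩
        · have hpz := (h w z hwz p).resolve_left hpw
          exact ⟨v, z, hpv, hpz, hvz⟩
      · exact ⟨w, z, (h v w hvw p).resolve_left hpv, (h v z hvz p).resolve_left hpv, hwz⟩
    by_cases hp : ∃ p, (part G p).card ≠ 2
    · obtain ⟨p, hp⟩ := hp
      obtain ⟨c, d, h3, h4, h5⟩ := third p
      obtain ⟨k, hk, h6⟩ := h.one_part h3 h4 h5 (by
        intro u hu
        by_contra hu2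
        have a1 : G.Adj p t := by
          by_contra hn; rw [h.part_eq hn] at hp; exact hp ht
        have a2 : G.Adj u t := by
          by_contra hn; rw [h.part_eq hn] at hu2; exact hu2 ht
        have e := tr hu a2 a1
        rw [ht] at e
        have hle := (h.card_parts hu a2 a1).1
        rw [ht] at hle
        -- With a third part of size `2`, the minor reduces to a positive number times the product
        -- of the two other sizes diminished by `2`. So at most one part has a size other than `2`.
        have e' : (Fintype.card V - (part G p).card - (part G u).card - 2 + 4 : ℤ)
            * (((part G p).card - 2) * ((part G u).card - 2)) = 0 := by
          push_cast at e; linear_combination e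
        rcases mul_eq_zero.1 e' with h0 | h0
        · omega
        · rcases mul_eq_zero.1 h0 with h0 | h0 <;> omega)
      exact ⟨_, k, pos p, hk, h6⟩
    · push Not at hp
      obtain ⟨c, d, h3, h4, h5⟩ := third v
      obtain ⟨k, hk, h6⟩ := h.one_part h3 h4 h5 fun u _ => hp u
      exact ⟨_, k, pos v, hk, h6⟩
  · right; right
    push Not at h2
    have dich : ∀ t, (part G t).card = 1 ∨ 3 ≤ (part G t).card := by
      intro t
      have := pos t
      have := h2 t
      omega
    -- With all three sizes at least `3`, every term of the minor is positive.
    have three : ∀ {v w z : V}, G.Adj v w → G.Adj w z → G.Adj v z → 3 ≤ (part G v).card →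
        3 ≤ (part G w).card → 3 ≤ (part G z).card → False := by
      intro v w z hvw hwz hvz h3 h4 h5
      have e := tr hvw hwz hvz
      have hle := (h.card_parts hvw hwz hvz).1
      obtain ⟨a, ha⟩ : ∃ a : ℕ, (part G v).card = a + 3 := ⟨_, (Nat.sub_add_cancel h3).symm⟩
      obtain ⟨b, hb⟩ : ∃ b : ℕ, (part G w).card = b + 3 := ⟨_, (Nat.sub_add_cancel h4).symm⟩
      obtain ⟨c, hc⟩ : ∃ c : ℕ, (part G z).card = c + 3 := ⟨_, (Nat.sub_add_cancel h5).symm⟩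
      rw [ha, hb, hc] at e hle
      obtain ⟨r, hr⟩ := Nat.exists_eq_add_of_le hle
      rw [hr] at e
      push_cast at e
      have : (0 : ℤ) < (r + 4) * ((a + 1) * (b + 1) + (b + 1) * (c + 1) + (c + 1) * (a + 1))
        + 4 * (a + 1) * (b + 1) * (c + 1) := by positivity
      linarith
    -- Two parts of size `1` and a third of size `c + 3` reduce the minor to `r (2c + 1) + 4c = 0`,
    -- where `r` counts the vertices outside the three parts; so `c = r = 0`.
    have ones : ∀ {v w z : V}, G.Adj v w → G.Adj w z → G.Adj v z → (part G v).card = 1 →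
        (part G w).card = 1 → (part G z).card = 3 ∧ Fintype.card V = 5 := by
      intro v w z hvw hwz hvz h3 h4
      have e := tr hvw hwz hvz
      have hle := (h.card_parts hvw hwz hvz).1
      rw [h3, h4] at e hle
      obtain ⟨r, hr⟩ := Nat.exists_eq_add_of_le hle
      rw [hr] at e
      rcases dich z with h5 | h5
      · rw [h5] at e; push_cast at e; omega
      · obtain ⟨c, hc⟩ : ∃ c : ℕ, (part G z).card = c + 3 := ⟨_, (Nat.sub_add_cancel h5).symm⟩
        rw [hc] at e hr ⊢
        push_cast at e
        have e' : (r : ℤ) * (2 * c + 1) + 4 * c = 0 := by linear_combination -e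
        have : (c : ℤ) = 0 := by nlinarith
        have hr0 : (r : ℤ) = 0 := by rw [this] at e'; linarith
        omega
    have fin : ∀ {v w z : V}, G.Adj v w → G.Adj w z → G.Adj v z → (part G v).card = 1 →
        (part G w).card = 1 → HasPattern G ![1, 1, 3] kappaTri := by
      intro v w z hvw hwz hvz h3 h4
      obtain ⟨h5, h6⟩ := ones hvw hwz hvz h3 h4
      have hc := (h.card_parts hvw hwz hvz).2.resolve_right (by omega)
      have := h.tripartite hvw hwz hvz hc
      rwa [h3, h4, h5] at this
    -- If there are only three parts, of sizes `1`, `b`, `c`, the minor is `4 (b + c - 4)` up to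
    -- sign, which is nonzero for `b, c ≥ 3`. A fourth part gives either two parts of size `1` or
    -- three parts of size at least `3`.
    have one : ∀ {v w z : V}, G.Adj v w → G.Adj w z → G.Adj v z → (part G v).card = 1 →
        HasPattern G ![1, 1, 3] kappaTri := by
      intro v w z hvw hwz hvz h3
      rcases dich w with h4 | h4
      · exact fin hvw hwz hvz h3 h4
      rcases dich z with h5 | h5
      · exact fin hvz hwz.symm hvw h3 h5
      exfalso
      rcases h.card_parts hvw hwz hvz with ⟨hle, hc | hlt⟩
      · have e := tr hvw hwz hvz
        have hN : Fintype.card V = (part G v).card + (part G w).card + (part G z).card := by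
          rw [← card_union_of_disjoint (h.disjoint hvw), ← card_union_of_disjoint
            (disjoint_union_left.2 ⟨h.disjoint hvz, h.disjoint hwz⟩), ← card_univ]
          congr 1
          ext t
          have := hc t
          simp only [mem_univ, mem_union, true_iff]
          tauto
        rw [hN, h3] at e
        push_cast at e
        have : (4 : ℤ) * ((part G w).card + (part G z).card - 4) = 0 := by linear_combination -e
        omega
      · obtain ⟨t, ht⟩ : ∃ t, ¬ (t ∈ part G v ∨ t ∈ part G w ∨ t ∈ part G z) := by
          by_contra hcon
          push Not at hcon
          have hsub : (univ : Finset V) ⊆ part G v ∪ part G w ∪ part G z := by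
            intro t _
            have := hcon t
            simp only [mem_union]
            tauto
          have c1 := card_le_card hsub
          have c2 := card_union_le (part G v ∪ part G w) (part G z)
          have c3 := card_union_le (part G v) (part G w)
          rw [card_univ] at c1
          omega
        simp only [mem_part, not_or, not_not] at ht
        obtain ⟨t1, t2, t3⟩ := ht
        rcases dich t with h6 | h6
        · have := ones t1 t2.symm hvw h3 h6
          omega
        · exact three hwz t3 t2 h4 h5 h6
    rcases dich v with h3 | h3
    · exact one hvw hwz hvz h3
    rcases dich w with h4 | h4
    · exact one hvw.symm hvz hwz h4
    rcases dich z with h5 | h5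
    · exact one hvz.symm hvw hwz.symm h5
    · exact (three hvw hwz hvz h3 h4 h5).elim

end IsMultipartite
end Multipartite

/-! ### Patterns of the named graphs -/

instance (r : BlockRel) (a b : ℕ) : Decidable (r.Holds a b) :=
  match r with
  | .none => inferInstanceAs (Decidable False)
  | .all => inferInstanceAs (Decidable True)
  | .eq => inferInstanceAs (Decidable (a = b))
  | .ne => inferInstanceAs (Decidable (a ≠ b))

section Explicit

variable {V : Type*} {G : SimpleGraph V} {t : ℕ} {n : Fin t → ℕ} {κ : Fin t → Fin t → BlockRel}

/-- A pattern given by the block and the index of each vertex. -/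
lemma HasPattern.of_code [Nonempty V] (c : V → Fin t × ℕ)
    (hsurj : ∀ i a, a < n i ↔ ∃ v, c v = (i, a))
    (hinj : Function.Injective c)
    (hadj : ∀ v w, G.Adj v w ↔ (κ (c v).1 (c w).1).Holds (c v).2 (c w).2) :
    HasPattern G n κ := by
  classical
  have ex : ∀ i a, ∃ v, a < n i → c v = (i, a) := by
    intro i a
    by_cases h : a < n i
    · obtain ⟨v, hv⟩ := (hsurj i a).1 h
      exact ⟨v, fun _ => hv⟩
    · exact ⟨Classical.arbitrary V, fun h' => absurd h' h⟩
  choose f hf using ex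
  refine ⟨f, ?_, ?_, ?_⟩
  · intro i j a b ha hb hab
    have := hf i a ha
    rw [hab, hf j b hb, Prod.mk.injEq] at this
    exact ⟨this.1.symm, this.2.symm⟩
  · intro v
    refine ⟨(c v).1, (c v).2, (hsurj _ _).2 ⟨v, rfl⟩, hinj ?_⟩
    rw [hf _ _ ((hsurj _ _).2 ⟨v, rfl⟩)]
  · intro i j a b ha hb
    rw [hadj, hf i a ha, hf j b hb]

lemma HasPattern.reindex {n' : Fin t → ℕ} {κ' : Fin t → Fin t → BlockRel} (h : HasPattern G n κ)
    (σ : Fin t → Fin t) (hσ : ∀ i, σ (σ i) = i) (hn : ∀ i, n' i = n (σ i))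
    (hκ : ∀ i j, κ' i j = κ (σ i) (σ j)) : HasPattern G n' κ' := by
  obtain ⟨f, h1, h2, h3⟩ := h
  refine ⟨fun i => f (σ i), ?_, ?_, ?_⟩
  · intro i j a b ha hb hab
    rw [hn] at ha hb
    obtain ⟨h4, h5⟩ := h1 _ _ a b ha hb hab
    exact ⟨by rw [← hσ i, h4, hσ], h5⟩
  · intro v
    obtain ⟨i, a, ha, e⟩ := h2 v
    exact ⟨σ i, a, by rw [hn, hσ]; exact ha, by simpa only [hσ] using e⟩
  · intro i j a b ha hb
    rw [hn] at ha hb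
    rw [hκ]
    exact h3 _ _ a b ha hb

lemma graph0_hasPattern {l m : ℕ} (hl : 1 ≤ l) :
    HasPattern (graph0 l m) ![l, m] (kappaTwo .none .all) := by
  have : Nonempty (Fin l) := ⟨⟨0, hl⟩⟩
  refine HasPattern.of_code (fun v : Fin l ⊕ Fin m =>
    v.elim (fun a : Fin l => ((0 : Fin 2), (a : ℕ))) fun a : Fin m => (1, (a : ℕ))) ?_ ?_ ?_
  · intro i a
    fin_cases i <;> simp [Fin.exists_iff]
  · rintro (a | a) (b | b) h <;> simp_all [Fin.ext_iff]
  · rintro (a | a) (b | b) <;> simp [graph0, kappaTwo, BlockRel.Holds]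

lemma cocktailParty_adj {k : ℕ} (v w : Fin k × Fin 2) :
    (cocktailParty k).Adj v w ↔ (v.1 : ℕ) ≠ w.1 := by
  simp [cocktailParty, Fin.ext_iff]

lemma cocktailParty_hasPattern {k : ℕ} (hk : 1 ≤ k) :
    HasPattern (cocktailParty k) ![k, k] (kappaTwo .ne .ne) := by
  have : Nonempty (Fin k) := ⟨⟨0, hk⟩⟩
  refine HasPattern.of_code (fun v => (v.2, (v.1 : ℕ))) ?_ ?_ ?_
  · intro i a
    fin_cases i <;> simp [Fin.exists_iff]
  · rintro ⟨a, i⟩ ⟨b, j⟩ h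
    simp only [Prod.mk.injEq, Fin.ext_iff] at h ⊢
    tauto
  · rintro ⟨a, i⟩ ⟨b, j⟩
    rw [cocktailParty_adj]
    fin_cases i <;> fin_cases j <;> rfl

/-- The pattern of a disjoint union of two graphs with two blocks. -/
lemma HasPattern.sum {W : Type*} {H : SimpleGraph W} {m n m' n' : ℕ} {s r s' r' : BlockRel}
    (h : HasPattern G ![m, n] (kappaTwo s r)) (h' : HasPattern H ![m', n'] (kappaTwo s' r')) :
    HasPattern (SimpleGraph.sum G H) ![m, n, m', n'] (kappaSum s r s' r') := by
  obtain ⟨f, h1, h2, h3⟩ := h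
  obtain ⟨f', h1', h2', h3'⟩ := h'
  refine HasPattern.of_lt ![fun a => Sum.inl (f 0 a), fun a => Sum.inl (f 1 a),
    fun a => Sum.inr (f' 0 a), fun a => Sum.inr (f' 1 a)] ?_ ?_ ?_ ?_ ?_
  · intro i j; fin_cases i <;> fin_cases j <;> rfl
  · intro i a b ha hb hab
    fin_cases i
    · exact (h1 0 0 a b ha hb (Sum.inl_injective hab)).2
    · exact (h1 1 1 a b ha hb (Sum.inl_injective hab)).2
    · exact (h1' 0 0 a b ha hb (Sum.inr_injective hab)).2
    · exact (h1' 1 1 a b ha hb (Sum.inr_injective hab)).2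
  · intro i j hij a b ha hb hab
    fin_cases i <;> fin_cases j <;> first | exact absurd hij (by decide) | skip
    · exact absurd (h1 0 1 a b ha hb (Sum.inl_injective hab)).1 (by decide)
    · exact Sum.inl_ne_inr hab
    · exact Sum.inl_ne_inr hab
    · exact Sum.inl_ne_inr hab
    · exact Sum.inl_ne_inr hab
    · exact absurd (h1' 0 1 a b ha hb (Sum.inr_injective hab)).1 (by decide)
  · rintro (v | v)
    · obtain ⟨i, a, ha, e⟩ := h2 v
      fin_cases i
      · exact ⟨0, a, ha, congrArg Sum.inl e⟩
      · exact ⟨1, a, ha, congrArg Sum.inl e⟩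
    · obtain ⟨i, a, ha, e⟩ := h2' v
      fin_cases i
      · exact ⟨2, a, ha, congrArg Sum.inr e⟩
      · exact ⟨3, a, ha, congrArg Sum.inr e⟩
  · intro i j hij a b ha hb
    fin_cases i <;> fin_cases j <;> first | exact absurd hij (by decide) | skip
    · exact h3 0 0 a b ha hb
    · exact h3 0 1 a b ha hb
    · exact iff_of_false (by simp) id
    · exact iff_of_false (by simp) id
    · exact h3 1 1 a b ha hb
    · exact iff_of_false (by simp) id
    · exact iff_of_false (by simp) id
    · exact h3' 0 0 a b ha hb
    · exact h3' 0 1 a b ha hb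
    · exact h3' 1 1 a b ha hb

lemma graph6_hasPattern {m : ℕ} (hm : 1 ≤ m) : HasPattern (graph6 m) ![m, m] kappa6 := by
  have : Nonempty (Fin m) := ⟨⟨0, hm⟩⟩
  refine HasPattern.of_code (fun v => (v.1, (v.2 : ℕ))) ?_ ?_ ?_
  · intro i a
    fin_cases i <;> simp [Fin.exists_iff]
  · rintro ⟨a, i⟩ ⟨b, j⟩ h
    simp only [Prod.mk.injEq, Fin.ext_iff] at h ⊢
    tauto
  · rintro ⟨i, a⟩ ⟨j, b⟩
    fin_cases i <;> fin_cases j <;> simp [graph6, kappa6, BlockRel.Holds, Fin.ext_iff]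

lemma graph8_hasPattern {k l : ℕ} : HasPattern (graph8 k l) ![k, k, l, l, 1] kappa8 := by
  have : Nonempty (Fin 1) := ⟨0⟩
  refine HasPattern.of_code (fun v => v.elim (fun u => u.elim
    (fun p => (![0, 1] p.2, (p.1 : ℕ))) fun p => (![2, 3] p.2, (p.1 : ℕ))) fun _ => (4, 0)) ?_ ?_ ?_
  · intro i a
    constructor
    · intro h
      fin_cases i
      · exact ⟨.inl (.inl (⟨a, h⟩, 0)), rfl⟩
      · exact ⟨.inl (.inl (⟨a, h⟩, 1)), rfl⟩
      · exact ⟨.inl (.inr (⟨a, h⟩, 0)), rfl⟩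
      · exact ⟨.inl (.inr (⟨a, h⟩, 1)), rfl⟩
      · obtain rfl : a = 0 := Nat.lt_one_iff.1 h
        exact ⟨.inr 0, rfl⟩
    · rintro ⟨(⟨p, j⟩ | ⟨p, j⟩) | j, h⟩
      · fin_cases j <;> simp at h <;> obtain ⟨rfl, rfl⟩ := h <;> simp
      · fin_cases j <;> simp at h <;> obtain ⟨rfl, rfl⟩ := h <;> simp
      · simp at h; obtain ⟨rfl, rfl⟩ := h; simp
  · rintro ((⟨a, i⟩ | ⟨a, i⟩) | a) ((⟨b, j⟩ | ⟨b, j⟩) | b) h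
    all_goals try fin_cases i
    all_goals try fin_cases j
    all_goals simp_all [Fin.ext_iff]
  · rintro ((⟨a, i⟩ | ⟨a, i⟩) | a) ((⟨b, j⟩ | ⟨b, j⟩) | b)
    all_goals try fin_cases i
    all_goals try fin_cases j
    all_goals simp [graph8, graph5, cocktailParty_adj, kappa8, BlockRel.Holds]

/-- The two nonadjacent vertices of the first block form one further pair of the cocktail party
block and receive the index `k`; hence the block size `k + 1`. -/
lemma graph9_hasPattern {k : ℕ} : HasPattern (graph9 k) ![k + 1, k + 1, 3, 3] kappa9 := by
  have : Nonempty (Vert9 k) := ⟨.a 0⟩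
  have adj : ∀ v w, (graph9 k).Adj v w ↔ adj9 k v w := fun _ _ => Iff.rfl
  refine HasPattern.of_code (fun v => match v with
    | .a i => (![0, 1] i, k)
    | .b i => (3, i)
    | .c i => (2, i)
    | .d p => (![0, 1] p.2, p.1)) ?_ ?_ ?_
  · intro i a
    constructor
    · intro h
      fin_cases i
      · by_cases ha : a < k
        · exact ⟨.d (⟨a, ha⟩, 0), rfl⟩
        · exact ⟨.a 0, by simp at h ⊢; omega⟩
      · by_cases ha : a < k
        · exact ⟨.d (⟨a, ha⟩, 1), rfl⟩
        · exact ⟨.a 1, by simp at h ⊢; omega⟩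
      · exact ⟨.c ⟨a, h⟩, rfl⟩
      · exact ⟨.b ⟨a, h⟩, rfl⟩
    · rintro ⟨⟨j⟩ | ⟨j⟩ | ⟨j⟩ | ⟨p, j⟩, h⟩
      · fin_cases j <;> simp at h <;> obtain ⟨rfl, rfl⟩ := h <;> simp
      · simp at h; obtain ⟨rfl, rfl⟩ := h; simp
      · simp at h; obtain ⟨rfl, rfl⟩ := h; simp
      · fin_cases j <;> simp at h <;> obtain ⟨rfl, rfl⟩ := h <;> simp
  · rintro (i | i | i | ⟨a, i⟩) (j | j | j | ⟨b, j⟩) h <;> fin_cases i <;> fin_cases j <;>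
      simp_all [Fin.ext_iff] <;> omega
  · rintro (i | i | i | ⟨a, i⟩) (j | j | j | ⟨b, j⟩) <;> rw [adj] <;> fin_cases i <;>
      fin_cases j <;> simp [adj9, cocktailParty_adj, kappa9, BlockRel.Holds] <;> omega

lemma graph11_hasPattern : HasPattern graph11 ![2, 2, 1, 2, 2] (kappaOpp .ne .eq .ne) := by
  -- The last two indices are interchanged because the matching joins the sixth vertex to the ninth
  -- and the seventh to the eighth.
  let c : Fin 9 → Fin 5 × ℕ := ![(0, 0), (0, 1), (1, 0), (1, 1), (2, 0), (3, 0), (3, 1), (4, 1), (4, 0)]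
  refine HasPattern.of_code c ?_ (by decide) ?_
  · intro i a
    simp only [c]
    fin_cases i <;> simp [Fin.exists_fin_succ, eq_comm] <;> omega
  · have : ∀ v w, decide (matrix11 v w = 1) =
        decide ((kappaOpp .ne .eq .ne (c v).1 (c w).1).Holds (c v).2 (c w).2) := by decide
    exact fun v w => decide_eq_decide.1 (this v w)

lemma graph12_hasPattern : HasPattern graph12 ![2, 2, 2, 1, 1] (kappaOpp .none .all .none) := by
  let c : Fin 8 → Fin 5 × ℕ := ![(0, 0), (0, 1), (1, 0), (1, 1), (2, 0), (2, 1), (3, 0), (4, 0)]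
  refine HasPattern.of_code c ?_ (by decide) ?_
  · intro i a
    simp only [c]
    fin_cases i <;> simp [Fin.exists_fin_succ, eq_comm] <;> omega
  · have : ∀ v w, decide (matrix12 v w = 1) =
        decide ((kappaOpp .none .all .none (c v).1 (c w).1).Holds (c v).2 (c w).2) := by decide
    exact fun v w => decide_eq_decide.1 (this v w)

end Explicit

/-! ### Two positive exceptional eigenvalues: the parameters `M`, `d`, `r` -/

lemma IsIsoTo.of_common {V W U : Type*} {G : SimpleGraph V} {H : SimpleGraph W}
    {K : SimpleGraph U} (h : IsIsoTo G K) (h' : IsIsoTo H K) : IsIsoTo G H :=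
  h.elim fun e => h'.elim fun e' => ⟨e.trans e'.symm⟩

/-- Graphs with two positive exceptional eigenvalues, of sum `2 * M` and product
`M ^ 2 - d ^ 2 - r`. -/
inductive Entry {V : Type*} (G : SimpleGraph V) : ℕ → ℕ → ℕ → Prop
  | three : IsIsoTo G graph3 → Entry G 2 0 0
  | four {k d} : k = d + 2 → IsIsoTo G (graph4 k) → Entry G k d 0
  | five {k l M d} : 2 ≤ l → k = l + d → M + 2 = k + l → IsIsoTo G (graph5 k l) → Entry G M d 0
  | six {k M} : 3 ≤ k → M + 1 = k → IsIsoTo G (graph6 k) → Entry G M 1 0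
  | eight {k l M d} : 1 ≤ l → 2 ≤ k → k = l + d → M + 1 = k + l → IsIsoTo G (graph8 k l) →
      Entry G M d 1
  | nine {k M} : M = k + 3 → IsIsoTo G (graph9 k) → Entry G M k 3
  | eleven : IsIsoTo G graph11 → Entry G 3 1 0
  | twelve : IsIsoTo G graph12 → Entry G 2 1 0
  | tail_three : HasPattern G ![2, 1, 3, 3] kappaTail → Entry G 3 1 1
  | tail_five : HasPattern G ![1, 1, 5, 5] kappaTail → Entry G 5 3 2
  | tail_seven : HasPattern G ![0, 1, 7, 7] kappaTail → Entry G 7 5 3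

section Entry

variable {V : Type*} {G : SimpleGraph V} {M d r N : ℕ}

lemma graph3_hasPattern : HasPattern graph3 ![1, 4, 1, 4] (kappaSum .none .all .none .all) :=
  (graph0_hasPattern le_rfl).sum (graph0_hasPattern le_rfl)

lemma graph4_hasPattern {k : ℕ} (hk : 1 ≤ k) :
    HasPattern (graph4 k) ![1, 4, k, k] (kappaSum .none .all .ne .ne) :=
  (graph0_hasPattern le_rfl).sum (cocktailParty_hasPattern hk)

lemma graph5_hasPattern {k l : ℕ} (hk : 1 ≤ k) (hl : 1 ≤ l) :
    HasPattern (graph5 k l) ![k, k, l, l] (kappaSum .ne .ne .ne .ne) :=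
  (cocktailParty_hasPattern hk).sum (cocktailParty_hasPattern hl)

/-- The graph `K_{2,2}` is also the cocktail party graph with two classes: the classes are the two
sides, and each block takes one vertex from each side. -/
lemma graph0_two_two_hasPattern : HasPattern (graph0 2 2) ![2, 2] (kappaTwo .ne .ne) := by
  refine HasPattern.of_code (fun v : Fin 2 ⊕ Fin 2 =>
    v.elim (fun a => ((a : Fin 2), 0)) fun a => (a, 1)) ?_ ?_ ?_
  · intro i a
    constructor
    · intro h
      replace h : a < 2 := by fin_cases i <;> exact h
      interval_cases a
      · exact ⟨.inl i, rfl⟩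
      · exact ⟨.inr i, rfl⟩
    · rintro ⟨j | j, h⟩ <;> simp only [Sum.elim_inl, Sum.elim_inr, Prod.mk.injEq] at h <;>
        obtain ⟨rfl, rfl⟩ := h <;> fin_cases j <;> simp
  · rintro (a | a) (b | b) h <;> simp_all
  · rintro (a | a) (b | b) <;> fin_cases a <;> fin_cases b <;>
      simp [graph0, kappaTwo, BlockRel.Holds]

lemma HasPattern.isIsoTo_graph0 {l m : ℕ} (hl : 1 ≤ l) (hm : 1 ≤ m)
    (h : HasPattern G ![l, m] (kappaTwo .none .all)) :
    ∃ l' m', 1 ≤ m' ∧ m' ≤ l' ∧ l * m = l' * m' ∧ IsIsoTo G (graph0 l' m') := by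
  rcases le_total m l with h1 | h1
  · exact ⟨l, m, hm, h1, rfl, h.isIsoTo (graph0_hasPattern hl)⟩
  · refine ⟨m, l, hl, h1, mul_comm _ _, HasPattern.isIsoTo (h.reindex ![1, 0] (by decide) ?_
      (by decide)) (graph0_hasPattern hm)⟩
    intro i; fin_cases i <;> rfl

lemma HasPattern.entry_five {k l : ℕ} (hk : 2 ≤ k) (hl : 2 ≤ l)
    (h : HasPattern G ![k, k, l, l] (kappaSum .ne .ne .ne .ne)) : ∃ M d r, Entry G M d r := by
  rcases le_total l k with h1 | h1
  · exact ⟨k + l - 2, k - l, 0, .five (k := k) (l := l) hl (by omega) (by omega)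
      (h.isIsoTo (graph5_hasPattern (by omega) (by omega)))⟩
  · refine ⟨k + l - 2, l - k, 0, .five (k := l) (l := k) hk (by omega) (by omega)
      (HasPattern.isIsoTo (h.reindex ![2, 3, 0, 1] (by decide) ?_ (by decide))
        (graph5_hasPattern (by omega) (by omega)))⟩
    intro i; fin_cases i <;> rfl

lemma HasPattern.entry_eight {k l : ℕ} (hk : 1 ≤ k) (hl : 1 ≤ l) (hkl : 3 ≤ k + l)
    (h : HasPattern G ![k, k, l, l, 1] kappa8) : ∃ M d r, Entry G M d r := by
  rcases le_total l k with h1 | h1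
  · exact ⟨k + l - 1, k - l, 1, .eight (k := k) (l := l) hl (by omega) (by omega) (by omega)
      (h.isIsoTo graph8_hasPattern)⟩
  · refine ⟨k + l - 1, l - k, 1, .eight (k := l) (l := k) hk (by omega) (by omega) (by omega)
      (HasPattern.isIsoTo (h.reindex ![2, 3, 0, 1, 4] (by decide) ?_ (by decide))
        graph8_hasPattern)⟩
    intro i; fin_cases i <;> rfl

/-- The product of the exceptional eigenvalues is positive; this separates these graphs from all
other kinds. -/
lemma Entry.lt (h : Entry G M d r) : d * d + r < M * M := by
  cases h with
  | four h1 => subst h1; nlinarith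
  | @five k l _ _ h1 h2 h3 => obtain rfl : M = d + (2 * l - 2) := by omega
                              obtain ⟨c, rfl⟩ := Nat.exists_eq_add_of_le h1
                              rw [show d + (2 * (2 + c) - 2) = d + 2 * c + 2 by omega]; nlinarith
  | @six k _ h1 h2 => nlinarith [show 2 ≤ M by omega]
  | @eight k l _ _ h1 h2 h3 h4 =>
    obtain ⟨c, rfl⟩ := Nat.exists_eq_add_of_le h1
    obtain rfl : M = d + 2 * c + 1 := by omega
    nlinarith [show 1 ≤ d + c by omega]
  | nine h1 => subst h1; nlinarith
  | _ => norm_num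

lemma Entry.hasExc [Fintype V] [DecidableEq V] [DecidableRel G.Adj] (hG : IsInH G)
    (h : Entry G M d r) : HasExc G (2 * M) (M ^ 2 - d ^ 2 - r) := by
  cases h with
  | three h =>
    have := HasPattern.hasExc_two_stars hG (h.hasPattern graph3_hasPattern)
    norm_num
    exact this
  | four h1 h =>
    have := HasPattern.hasExc_star_cocktail hG (by omega) (h.hasPattern (graph4_hasPattern (by omega)))
    subst h1
    push_cast at this ⊢
    convert this using 1; ring
  | @five k l _ _ h1 h2 h3 h =>
    have := HasPattern.hasExc_two_cocktails hG (by omega) (by omega)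
      (h.hasPattern (graph5_hasPattern (by omega) (by omega)))
    obtain ⟨c, rfl⟩ := Nat.exists_eq_add_of_le h1
    obtain rfl : M = d + 2 * c + 2 := by omega
    subst h2
    push_cast at this ⊢
    convert this using 1 <;> ring
  | @six k _ h1 h2 h =>
    have := HasPattern.hasExc_kappa6 hG h1 (h.hasPattern (graph6_hasPattern (by omega)))
    subst h2
    push_cast at this ⊢
    convert this using 1 <;> ring
  | @eight k l _ _ h1 h2 h3 h4 h =>
    have := HasPattern.hasExc_kappa8 hG (by omega) (by omega) (by omega)
      (h.hasPattern graph8_hasPattern)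
    obtain ⟨c, rfl⟩ := Nat.exists_eq_add_of_le h1
    obtain rfl : M = d + 2 * c + 1 := by omega
    subst h3
    push_cast at this ⊢
    convert this using 1 <;> ring
  | nine h1 h =>
    have := HasPattern.hasExc_kappa9 hG (by omega) (h.hasPattern graph9_hasPattern)
    subst h1
    push_cast at this ⊢
    convert this using 1 <;> ring
  | eleven h =>
    have := HasPattern.hasExc_eleven hG (h.hasPattern graph11_hasPattern)
    norm_num
    exact this
  | twelve h =>
    have := HasPattern.hasExc_twelve hG (h.hasPattern graph12_hasPattern)
    norm_num
    exact this
  | tail_three h =>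
    have := HasPattern.hasExc_tail hG (S := 6) (P := 7) (by norm_num) h (by norm_num)
      (by norm_num) (by norm_num)
      fun θ hθ => by push_cast; linear_combination (-θ - 2) * hθ
    norm_num
    exact this
  | tail_five h =>
    have := HasPattern.hasExc_tail hG (S := 10) (P := 14) (by norm_num) h (by norm_num)
      (by norm_num) (by norm_num)
      fun θ hθ => by push_cast; linear_combination (-θ - 2) * hθ
    norm_num
    exact this
  | tail_seven h =>
    have := HasPattern.hasExc_tail hG (S := 14) (P := 21) (by norm_num) h (by norm_num)
      (by norm_num) (by norm_num)
      fun θ hθ => by push_cast; linear_combination (-θ - 2) * hθ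
    norm_num
    exact this

/-- The graphs with exceptional eigenvalues `M ± √N`, both positive. -/
def HasEntry (G : SimpleGraph V) (M N : ℕ) : Prop := ∃ d r, Entry G M d r ∧ d * d + r = N

lemma HasEntry.lt (h : HasEntry G M N) : N < M * M := by
  obtain ⟨d, r, h, rfl⟩ := h
  exact h.lt

lemma HasEntry.hasExc [Fintype V] [DecidableEq V] [DecidableRel G.Adj] (hG : IsInH G)
    (h : HasEntry G M N) : HasExc G (2 * M) (M ^ 2 - N) := by
  obtain ⟨d, r, h, rfl⟩ := h
  have := h.hasExc hG
  push_cast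
  ring_nf at this ⊢
  exact this

lemma Entry.le_three (h : Entry G M d r) : r ≤ 3 ∧ (r = 2 → d = 3) := by
  cases h <;> norm_num

/-- Equal values of `d * d + r`. -/
lemma Entry.index_eq {W : Type*} {H : SimpleGraph W} {M' d' r' : ℕ} (h : Entry G M d r)
    (h' : Entry H M' d' r') (he : d * d + r = d' * d' + r') :
    (d = d' ∧ r = r') ∨ (d = 1 ∧ r = 0 ∧ d' = 0 ∧ r' = 1) ∨ (d = 0 ∧ r = 1 ∧ d' = 1 ∧ r' = 0) ∨
      (d = 2 ∧ r = 0 ∧ d' = 1 ∧ r' = 3) ∨ (d = 1 ∧ r = 3 ∧ d' = 2 ∧ r' = 0) := by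
  obtain ⟨h1, h2⟩ := h.le_three
  obtain ⟨h3, h4⟩ := h'.le_three
  -- Since `r ≤ 3`, the squares of two different values of `d` differ by at most `3`, so only `0`,
  -- `1`, `4` are involved.
  have small : ∀ a b s t : ℕ, a * a + s = b * b + t → s ≤ 3 → a < b → a ≤ 1 := by
    intro a b s t h1 h2 h3
    nlinarith
  rcases lt_trichotomy d d' with h5 | h5 | h5
  · have := small _ _ _ _ he h1 h5
    have h6 : d' ≤ 2 := by nlinarith
    interval_cases d <;> interval_cases d' <;> omega
  · subst h5; omega
  · have := small _ _ _ _ he.symm h3 h5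
    have h6 : d ≤ 2 := by nlinarith
    interval_cases d' <;> interval_cases d <;> omega

/-- The parameters for which several graphs have the same exceptional eigenvalues. -/
def IsShared (M N : ℕ) : Prop :=
  (M = 2 ∧ (N = 0 ∨ N = 1)) ∨ (M = 3 ∧ N = 1) ∨ (M = 4 ∧ N = 4) ∨
    (5 ≤ M ∧ M % 2 = 1 ∧ N = 1) ∨ 5 ≤ M ∧ N = (M - 2) * (M - 2)

/-- The value of `N` almost determines `d` and `r`, and within each family `M` and `d` determine the
graph. Coincidences between families are linear conditions on `M` and `d`, collected in `IsShared`.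
-/
lemma HasEntry.isIsoTo_or {W : Type*} {H : SimpleGraph W} (h : HasEntry G M N)
    (h' : HasEntry H M N) : IsIsoTo G H ∨ IsShared M N := by
  obtain ⟨d, r, h, rfl⟩ := h
  obtain ⟨d', r', h', he⟩ := h'
  unfold IsShared
  rcases h.index_eq h' he.symm with ⟨rfl, rfl⟩ | ⟨rfl, rfl, rfl, rfl⟩ | ⟨rfl, rfl, rfl, rfl⟩ |
    ⟨rfl, rfl, rfl, rfl⟩ | ⟨rfl, rfl, rfl, rfl⟩
  -- The values of the squares are provided for the relevant `d`, since linear arithmetic treats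
  -- products as unknowns.
  · have key : M = d + 2 → (M - 2) * (M - 2) = d * d ∧ (d = 0 → d * d = 0) ∧
        (d = 1 → d * d = 1) ∧ (d = 2 → d * d = 4) := by
      rintro rfl
      exact ⟨rfl, by rintro rfl; rfl, by rintro rfl; rfl, by rintro rfl; rfl⟩
    cases h <;> cases h' <;> first
      | exact Or.inl (IsIsoTo.of_common ‹_› ‹_›)
      | exact Or.inl (HasPattern.isIsoTo ‹_› ‹_›)
      | (right; omega)
      | skip
    case five.five =>
      rename_i k l _ i _ _ k' l' _ i' _ _
      obtain ⟨rfl, rfl⟩ : k = k' ∧ l = l' := by omega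
      exact Or.inl (i.of_common i')
    case six.six =>
      subst_vars
      exact Or.inl (IsIsoTo.of_common ‹_› ‹_›)
    case eight.eight =>
      rename_i k l _ _ i _ _ k' l' _ _ i' _ _
      obtain ⟨rfl, rfl⟩ : k = k' ∧ l = l' := by omega
      exact Or.inl (i.of_common i')
  all_goals cases h <;> cases h' <;> omega

lemma hasEntry_two_zero :
    IsIsoTo G graph3 ∨ IsIsoTo G (graph4 2) ∨ IsIsoTo G (graph5 2 2) ↔ HasEntry G 2 0 := by
  constructor
  · rintro (h | h | h)
    · exact ⟨_, _, .three h, rfl⟩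
    · exact ⟨0, _, .four rfl h, rfl⟩
    · exact ⟨0, _, .five le_rfl rfl rfl h, rfl⟩
  · rintro ⟨d, r, h, he⟩
    obtain ⟨rfl, rfl⟩ : d = 0 ∧ r = 0 := ⟨by nlinarith, by nlinarith⟩
    cases h with
    | three h => exact .inl h
    | four _ h => exact .inr (.inl h)
    | @five k l _ _ h1 h2 h3 h =>
      obtain ⟨rfl, rfl⟩ : k = 2 ∧ l = 2 := by omega
      exact .inr (.inr h)

lemma Entry.cases_one (h : Entry G M d r) (he : d * d + r = 1) :
    (d = 1 ∧ r = 0) ∨ (d = 0 ∧ r = 1) := by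
  have : d ≤ 1 := by nlinarith
  interval_cases d <;> omega

lemma hasEntry_two_one : IsIsoTo G (graph6 3) ∨ IsIsoTo G graph12 ↔ HasEntry G 2 1 := by
  constructor
  · rintro (h | h)
    · exact ⟨_, _, .six le_rfl rfl h, rfl⟩
    · exact ⟨_, _, .twelve h, rfl⟩
  · rintro ⟨d, r, h, he⟩
    rcases h.cases_one he with ⟨rfl, rfl⟩ | ⟨rfl, rfl⟩
    · cases h with
      | six _ h2 h => subst h2; exact .inl h
      | twelve h => exact .inr h
      | _ => omega
    · cases h; omega

lemma hasEntry_three_one :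
    IsIsoTo G (graph4 3) ∨ IsIsoTo G (graph5 3 2) ∨ IsIsoTo G (graph6 4) ∨
      IsIsoTo G (graph8 2 2) ∨ IsIsoTo G graph11 ↔ HasEntry G 3 1 := by
  constructor
  · rintro (h | h | h | h | h)
    · exact ⟨1, _, .four rfl h, rfl⟩
    · exact ⟨1, _, .five le_rfl rfl rfl h, rfl⟩
    · exact ⟨_, _, .six (by norm_num) rfl h, rfl⟩
    · exact ⟨0, _, .eight (by norm_num) le_rfl rfl rfl h, rfl⟩
    · exact ⟨_, _, .eleven h, rfl⟩
  · rintro ⟨d, r, h, he⟩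
    rcases h.cases_one he with ⟨rfl, rfl⟩ | ⟨rfl, rfl⟩
    · cases h with
      | four _ h => exact .inl h
      | @five k l _ _ h1 h2 h3 h =>
        obtain ⟨rfl, rfl⟩ : k = 3 ∧ l = 2 := by omega
        exact .inr (.inl h)
      | six _ h2 h => subst h2; exact .inr (.inr (.inl h))
      | eleven h => exact .inr (.inr (.inr (.inr h)))
    · cases h with
      | @eight k l _ _ h1 h2 h3 h4 h =>
        obtain ⟨rfl, rfl⟩ : k = 2 ∧ l = 2 := by omega
        exact .inr (.inr (.inr (.inl h)))

lemma hasEntry_four_four :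
    IsIsoTo G (graph4 4) ∨ IsIsoTo G (graph5 4 2) ∨ IsIsoTo G (graph9 1) ↔ HasEntry G 4 4 := by
  constructor
  · rintro (h | h | h)
    · exact ⟨2, _, .four rfl h, rfl⟩
    · exact ⟨2, _, .five le_rfl rfl rfl h, rfl⟩
    · exact ⟨_, _, .nine rfl h, rfl⟩
  · rintro ⟨d, r, h, he⟩
    have : d ≤ 2 := by nlinarith
    obtain ⟨h1, -⟩ := h.le_three
    interval_cases d
    · omega
    · obtain rfl : r = 3 := by omega
      cases h with
      | nine h1 h => exact .inr (.inr h)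
    · obtain rfl : r = 0 := by omega
      cases h with
      | four _ h => exact .inl h
      | @five k l _ _ h1 h2 h3 h =>
        obtain ⟨rfl, rfl⟩ : k = 4 ∧ l = 2 := by omega
        exact .inr (.inl h)

lemma hasEntry_odd_one_of {k : ℕ} (hk : 2 ≤ k) (h : IsIsoTo G (graph5 (k + 1) k) ∨
    IsIsoTo G (graph6 (2 * k)) ∨ IsIsoTo G (graph8 k k)) : HasEntry G (2 * k - 1) 1 := by
  rcases h with h | h | h
  · exact ⟨1, _, .five hk rfl (by omega) h, rfl⟩
  · exact ⟨_, _, .six (by omega) (by omega) h, rfl⟩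
  · exact ⟨0, _, .eight (by omega) hk rfl (by omega) h, rfl⟩

/-- The bound on `k` excludes `M = 3`, where further graphs share the spectrum. -/
lemma HasEntry.odd_one {k : ℕ} (hk : 3 ≤ k) (h : HasEntry G (2 * k - 1) 1) :
    IsIsoTo G (graph5 (k + 1) k) ∨ IsIsoTo G (graph6 (2 * k)) ∨ IsIsoTo G (graph8 k k) := by
  obtain ⟨d, r, h, he⟩ := h
  obtain ⟨M, hM⟩ : ∃ M, M = 2 * k - 1 := ⟨_, rfl⟩
  rw [← hM] at h
  rcases h.cases_one he with ⟨rfl, rfl⟩ | ⟨rfl, rfl⟩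
  · cases h with
    | @five k' l _ _ h1 h2 h3 h =>
      obtain ⟨rfl, rfl⟩ : k' = k + 1 ∧ l = k := by omega
      exact .inl h
    | @six k' _ h1 h2 h =>
      obtain rfl : k' = 2 * k := by omega
      exact .inr (.inl h)
    | _ => omega
  · cases h with
    | @eight k' l _ _ h1 h2 h3 h4 h =>
      obtain ⟨rfl, rfl⟩ : k' = k ∧ l = k := by omega
      exact .inr (.inr h)

lemma hasEntry_square_of {k : ℕ} (hk : 2 ≤ k) (h : IsIsoTo G (graph4 k) ∨ IsIsoTo G (graph5 k 2)) :
    HasEntry G k ((k - 2) * (k - 2)) := by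
  rcases h with h | h
  · exact ⟨k - 2, _, .four (by omega) h, rfl⟩
  · exact ⟨k - 2, _, .five le_rfl (by omega) rfl h, rfl⟩

/-- For `k` at most `4`, sporadic graphs and members of other families have the same parameters;
from `5` on only these two remain. -/
lemma HasEntry.square {k : ℕ} (hk : 5 ≤ k) (h : HasEntry G k ((k - 2) * (k - 2))) :
    IsIsoTo G (graph4 k) ∨ IsIsoTo G (graph5 k 2) := by
  obtain ⟨d, r, h, he⟩ := h
  obtain ⟨c, rfl⟩ := Nat.exists_eq_add_of_le hk
  obtain ⟨h1, -⟩ := h.le_three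
  have h2 : d = c + 3 := by
    rw [show 5 + c - 2 = c + 3 by omega] at he
    by_contra hne
    rcases Nat.lt_or_gt_of_ne hne with h2 | h2 <;> nlinarith
  subst h2
  obtain rfl : r = 0 := by
    rw [show 5 + c - 2 = c + 3 by omega] at he
    omega
  obtain ⟨M, hM⟩ : ∃ M, M = 5 + c := ⟨_, rfl⟩
  rw [← hM] at h ⊢
  cases h with
  | four _ h => exact .inl h
  | @five k l _ _ h1 h2 h3 h =>
    obtain ⟨rfl, rfl⟩ : k = M ∧ l = 2 := by omega
    exact .inr h

end Entry

/-! ### The complete list of graphs and the separation of its kinds -/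

/-- Graphs with at most two exceptional eigenvalues, of sum `S` and product `P`. -/
inductive Kind {V : Type*} (G : SimpleGraph V) : ℤ → ℤ → Prop
  | empty : IsEmpty V → Kind G 0 0
  -- The eigenvalues are `±√(lm)`; for `lm = 4` the negative one is `-2` and not exceptional, so
  -- that case is listed separately.
  | bip {l m : ℕ} : 1 ≤ m → m ≤ l → l * m ≠ 4 → IsIsoTo G (graph0 l m) → Kind G 0 (-(l * m : ℕ))
  | multi {l k : ℕ} : 1 ≤ l → 2 ≤ k → l ≠ 2 → HasPattern G ![l, k, k] kappaMulti →
      Kind G (2 * k - 2) (-(2 * (k * l : ℕ)))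
  | tri : HasPattern G ![1, 1, 3] kappaTri → Kind G 2 (-3)
  | four {l m : ℕ} : 1 ≤ m → m ≤ l → l * m = 4 → IsIsoTo G (graph0 l m) → Kind G 2 0
  -- For two classes the graph is `K_{2,2}`, which is already covered by the complete bipartite
  -- graphs.
  | cocktail {k : ℕ} : 3 ≤ k → HasPattern G ![k, k] (kappaTwo .ne .ne) → Kind G (2 * k - 2) 0
  | entry {M N : ℕ} : HasEntry G M N → Kind G (2 * M) (M * M - N : ℤ)

section Kind

variable {V : Type*} [Fintype V] {G : SimpleGraph V}

section Instances

variable [DecidableEq V] [DecidableRel G.Adj]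

lemma HasExc.of_isEmpty (h : IsEmpty V) : HasExc G 0 0 := by
  obtain ⟨lam, u, -, hs⟩ := exists_isDiag G
  have : exceptional G = 0 := by rw [exceptional, hs, univ_eq_empty]; rfl
  rw [HasExc, this]
  simp

/-- With a negative exceptional eigenvalue, the product of the exceptional eigenvalues does not
vanish when their sum is positive. -/
lemma HasExc.not_neg {lam : V → ℝ} {S : ℝ} (hG : IsInH G) (hs : adjSpectrum G = univ.val.map lam)
    (h : HasExc G S 0) (hS : 0 < S) : ¬ ∃ i ∈ IsDiag.excIdx lam, lam i < 0 := by
  rintro ⟨i, hi, hneg⟩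
  have hc := hG.card_le hs
  have e : ∀ f : ℝ → ℝ, ((exceptional G).map f).sum = ∑ i ∈ IsDiag.excIdx lam, f (lam i) := by
    intro f
    rw [exceptional_eq hs, Multiset.map_map]
    rfl
  have e1 := e id
  have e2 := e (· ^ 2)
  rw [Multiset.map_id, h.1, ← add_sum_erase _ _ hi] at e1
  rw [h.2, ← add_sum_erase _ _ hi] at e2
  have h3 := card_erase_of_mem hi
  rcases Nat.lt_or_ge ((IsDiag.excIdx lam).erase i).card 1 with h4 | h4
  · rw [card_eq_zero.1 (show ((IsDiag.excIdx lam).erase i).card = 0 by omega)] at e1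
    simp at e1
    linarith
  · obtain ⟨j, hj⟩ := card_eq_one.1 (show ((IsDiag.excIdx lam).erase i).card = 1 by omega)
    rw [hj, sum_singleton] at e1 e2
    have hje := IsDiag.mem_excIdx.1 (mem_of_mem_erase (hj ▸ mem_singleton_self j :
      j ∈ (IsDiag.excIdx lam).erase i))
    simp only [id] at e1
    -- The sum of squares equals the square of the sum, so the product of the two eigenvalues
    -- vanishes.
    have : lam i * lam j = 0 := by subst e1; nlinarith
    rcases mul_eq_zero.1 this with h5 | h5
    · linarith
    · exact hje.2 h5

lemma HasPattern.hasExc_bip (hG : IsInH G) {l m : ℕ} (hl : 1 ≤ l) (hm : 1 ≤ m) (h4 : l * m ≠ 4)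
    (h : HasPattern G ![l, m] (kappaTwo .none .all)) : HasExc G 0 (-(l * m)) := by
  have hl' : (1 : ℝ) ≤ l := by exact_mod_cast hl
  have hm' : (1 : ℝ) ≤ m := by exact_mod_cast hm
  have h4' : (l : ℝ) * m ≠ 4 := by exact_mod_cast h4
  refine h.hasExc_roots hG ?_ (by nlinarith) (by nlinarith) (by intro h; apply h4'; linarith)
    (fun θ => ![m, θ]) ?_
  · intro i j; fin_cases i <;> fin_cases j <;> simp [kappaTwo]
  · intro θ hθ
    refine ⟨?_, 0, by simp; omega, by simp; omega⟩
    intro i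
    fin_cases i <;> norm_num [Fin.sum_univ_succ, kappaTwo, BlockRel.count]
    · ring
    · linear_combination -hθ

lemma HasPattern.hasExc_four (hG : IsInH G) {l m : ℕ} (h4 : l * m = 4)
    (h : HasPattern G ![l, m] (kappaTwo .none .all)) : HasExc G 2 0 := by
  have h4' : (l : ℝ) * m = 4 := by exact_mod_cast h4
  have hm : m ≠ 0 := by rintro rfl; omega
  have hl : l ≠ 0 := by rintro rfl; omega
  refine h.hasExc_single hG ?_ ![m, 2] ?_ 0 (by simp; omega) (by simpa using hm) (by norm_num) ?_
  · intro i j; fin_cases i <;> fin_cases j <;> simp [kappaTwo]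
  · intro i
    fin_cases i <;> norm_num [Fin.sum_univ_succ, kappaTwo, BlockRel.count]
    · ring
    · exact h4'
  · norm_num [Fin.sum_univ_succ, kappaTwo, BlockRel.count]
    linarith

lemma HasPattern.hasExc_multi (hG : IsInH G) {l k : ℕ} (hl : 1 ≤ l) (hk : 2 ≤ k) (h2 : l ≠ 2)
    (h : HasPattern G ![l, k, k] kappaMulti) : HasExc G (2 * k - 2) (-(2 * (k * l))) := by
  have hl' : (1 : ℝ) ≤ l := by exact_mod_cast hl
  have hk' : (2 : ℝ) ≤ k := by exact_mod_cast hk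
  have h2' : (l : ℝ) - 2 ≠ 0 := sub_ne_zero.2 (by exact_mod_cast h2)
  refine h.hasExc_roots hG ?_ (by nlinarith) (by nlinarith) ?_ (fun θ => ![2 * k, θ, θ]) ?_
  · intro i j; fin_cases i <;> fin_cases j <;> simp [kappaMulti]
  · have : (4 + 2 * (2 * k - 2) + -(2 * (k * l)) : ℝ) = -2 * (k * (l - 2)) := by ring
    rw [this]
    exact mul_ne_zero (by norm_num) (mul_ne_zero (by linarith) h2')
  · intro θ hθ
    refine ⟨?_, 0, by simp; omega, by simp; omega⟩
    intro i
    fin_cases i <;> norm_num [Fin.sum_univ_succ, kappaMulti, BlockRel.count]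
    · ring
    · linear_combination -hθ
    · linear_combination -hθ

lemma HasPattern.hasExc_multi_two (hG : IsInH G) {k : ℕ} (hk : 2 ≤ k)
    (h : HasPattern G ![2, k, k] kappaMulti) : HasExc G (2 * k) 0 := by
  have hk' : (2 : ℝ) ≤ k := by exact_mod_cast hk
  refine h.hasExc_single hG ?_ ![1, 1, 1] ?_ 0 (by simp) (by simp) ?_ ?_
  · intro i j; fin_cases i <;> fin_cases j <;> simp [kappaMulti]
  · intro i; fin_cases i <;> norm_num [Fin.sum_univ_succ, kappaMulti, BlockRel.count] <;> ring
  · constructor <;> intro h <;> linarith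
  · norm_num [Fin.sum_univ_succ, kappaMulti, BlockRel.count]
    ring

lemma HasPattern.hasExc_tri (hG : IsInH G) (h : HasPattern G ![1, 1, 3] kappaTri) :
    HasExc G 2 (-3) := by
  have := h.hasExc_pair hG (θ := 3) (θ' := -1) ?_ ![3, 3, 2] ![1, -1, 0] ?_ ?_ 0 0
    (by simp) (by simp) (by simp) (by simp) (by norm_num) (by norm_num) (by norm_num)
  · norm_num at this; exact this
  · intro i j; fin_cases i <;> fin_cases j <;> simp [kappaTri]
  · intro i; fin_cases i <;> norm_num [Fin.sum_univ_succ, kappaTri, BlockRel.count]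
  · intro i; fin_cases i <;> norm_num [Fin.sum_univ_succ, kappaTri, BlockRel.count]

lemma Kind.hasExc (hG : IsInH G) {S P : ℤ} (h : Kind G S P) : HasExc G S P := by
  cases h with
  | empty h => simpa using HasExc.of_isEmpty h
  | bip h1 h2 h3 h =>
    exact_mod_cast HasPattern.hasExc_bip hG (h1.trans h2) h1 h3
      (h.hasPattern (graph0_hasPattern (h1.trans h2)))
  | multi h1 h2 h3 h =>
    exact_mod_cast HasPattern.hasExc_multi hG h1 h2 h3 h
  | tri h =>
    exact_mod_cast HasPattern.hasExc_tri hG h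
  | four h1 h2 h3 h =>
    exact_mod_cast HasPattern.hasExc_four hG h3 (h.hasPattern (graph0_hasPattern (h1.trans h2)))
  | cocktail h1 h =>
    exact_mod_cast HasPattern.hasExc_cocktail hG (by omega) h
  | entry h =>
    have := h.hasExc hG
    push_cast
    ring_nf at this ⊢
    exact this

lemma Kind.of_entry {M d r : ℕ} (h : Entry G M d r) : ∃ S P, Kind G S P :=
  ⟨_, _, .entry ⟨d, r, h, rfl⟩⟩

lemma Kind.of_bip {l m : ℕ} (hl : 1 ≤ l) (hm : 1 ≤ m)
    (h : HasPattern G ![l, m] (kappaTwo .none .all)) : ∃ S P, Kind G S P := by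
  obtain ⟨l', m', h1, h2, -, h3⟩ := h.isIsoTo_graph0 hl hm
  by_cases h4 : l' * m' = 4
  · exact ⟨_, _, .four h1 h2 h4 h3⟩
  · exact ⟨_, _, .bip h1 h2 h4 h3⟩

theorem IsInH'.exists_kind (hG : IsInH' G) : ∃ S P, Kind G S P := by
  rcases isEmpty_or_nonempty V with hV | hV
  · exact ⟨_, _, .empty hV⟩
  obtain ⟨hG, hiso⟩ := hG
  obtain ⟨lam, u, hd, hs⟩ := exists_isDiag G
  have hc := hG.card_le hs
  by_cases hneg : ∃ i ∈ IsDiag.excIdx lam, lam i < 0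
  · obtain ⟨g, hg⟩ := hd.exists_bound hc hneg
    obtain ⟨p, q, a, b, hab, -⟩ := IsDiag.exists_two hc (fun i => lam i * (lam i + 2)) u
    have hm : IsMultipartite G := fun v u hvu w => adj_or_of_bound hiso hg hvu w
    rcases hm.classification hiso (fun v w => (hd.gram v w).trans (hab v w)) with
      ⟨l, m, hl, hm, h⟩ | ⟨l, k, hl, hk, h⟩ | h
    · exact Kind.of_bip hl hm h
    -- A coclique of size two only adds a class to the cocktail party graph, whose single
    -- exceptional eigenvalue is positive.
    · by_cases h2 : l = 2
      · subst h2
        exact absurd hneg ((HasPattern.hasExc_multi_two hG hk h).not_neg hG hs (by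
          have : (2 : ℝ) ≤ k := by exact_mod_cast hk
          linarith))
      · exact ⟨_, _, .multi hl hk h2 h⟩
    · exact ⟨_, _, .tri h⟩
  · obtain ⟨x, y, hg⟩ := hd.exists_isGram hc fun i hi =>
      lt_of_le_of_ne (not_lt.1 fun h => hneg ⟨i, hi, h⟩) (Ne.symm (IsDiag.mem_excIdx.1 hi).2)
    rcases hg.classification hiso with h | ⟨k, hk, h⟩ | h | ⟨k, hk, h⟩ | ⟨k, l, hk, hl, h⟩ | h | h |
      h | h | h | ⟨k, hk, h⟩ | ⟨k, l, hk, hl, hkl, h⟩ | ⟨l, hl, h⟩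
    · exact Kind.of_bip le_rfl (by norm_num) h
    · rcases hk.eq_or_lt with rfl | hk
      · exact ⟨_, _, .four (l := 2) (m := 2) (by norm_num) le_rfl rfl
          (h.isIsoTo graph0_two_two_hasPattern)⟩
      · exact ⟨_, _, .cocktail hk h⟩
    · exact Kind.of_entry (.three (h.isIsoTo graph3_hasPattern))
    · exact Kind.of_entry (.four (d := k - 2) (by omega)
        (h.isIsoTo (graph4_hasPattern (by omega))))
    · obtain ⟨_, _, _, h⟩ := HasPattern.entry_five hk hl h
      exact Kind.of_entry h
    · exact Kind.of_entry (.twelve (h.isIsoTo graph12_hasPattern))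
    · exact Kind.of_entry (.eleven (h.isIsoTo graph11_hasPattern))
    · exact Kind.of_entry (.tail_five h)
    · exact Kind.of_entry (.tail_three h)
    · exact Kind.of_entry (.tail_seven h)
    · exact Kind.of_entry (.six (M := k - 1) hk (by omega)
        (h.isIsoTo (graph6_hasPattern (by omega))))
    · obtain ⟨_, _, _, h⟩ := HasPattern.entry_eight hk hl hkl h
      exact Kind.of_entry h
    · obtain ⟨k, rfl⟩ := Nat.exists_eq_add_of_le' hl
      exact Kind.of_entry (.nine rfl (h.isIsoTo graph9_hasPattern))

end Instances

lemma nonzeroSpectrum_eq_of_hasEntry {W : Type*} [Fintype W] {H : SimpleGraph W} [DecidableEq V]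
    [DecidableRel G.Adj] [DecidableEq W] [DecidableRel H.Adj] (hG : IsInH G) (hH : IsInH H)
    {M N : ℕ} (h : HasEntry G M N) (h' : HasEntry H M N) :
    nonzeroSpectrum G = nonzeroSpectrum H :=
  (hG.exceptional_eq_iff hH (h.hasExc hG) (h'.hasExc hH)).2 ⟨rfl, rfl⟩

/-- Two nonisomorphic graphs with the same exceptional eigenvalues are both complete bipartite, or
both have two positive exceptional eigenvalues. -/
lemma Kind.bip_or_hasEntry {W : Type*} {H : SimpleGraph W} {S P S' P' : ℤ} (h : Kind G S P)
    (h' : Kind H S' P') (hS : S = S') (hP : P = P') (hne : ¬ IsIsoTo G H) :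
    (∃ l m l' m' : ℕ, 1 ≤ m ∧ m ≤ l ∧ 1 ≤ m' ∧ m' ≤ l' ∧ l * m = l' * m' ∧
      IsIsoTo G (graph0 l m) ∧ IsIsoTo H (graph0 l' m')) ∨
    ∃ M N, HasEntry G M N ∧ HasEntry H M N := by
  -- The product `P` is negative for complete multipartite graphs with a negative exceptional
  -- eigenvalue, zero when there is at most one exceptional eigenvalue, and positive otherwise.
  -- Within each sign, `S` and the parity of `P` separate the kinds.
  have pos : ∀ a b : ℕ, 1 ≤ b → 1 ≤ a → 1 ≤ a * b := fun a b h1 h2 => Nat.mul_pos h2 h1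
  rcases h with h1 | @⟨l, m, h1, h2, h3, h4⟩ | @⟨l, k, h1, h2, h3, h4⟩ | h1 |
    @⟨l, m, h1, h2, h3, h4⟩ | @⟨k, h1, h2⟩ | @⟨M, N, h1⟩ <;>
  rcases h' with h1' | @⟨l', m', h1', h2', h3', h4'⟩ | @⟨l', k', h1', h2', h3', h4'⟩ | h1' |
    @⟨l', m', h1', h2', h3', h4'⟩ | @⟨k', h1', h2'⟩ | @⟨M', N', h1'⟩
  all_goals try have e1 := pos l m (by omega) (by omega)
  all_goals try have e2 := pos k l (by omega) (by omega)
  all_goals try have e3 := h1.lt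
  all_goals try have e1' := pos l' m' (by omega) (by omega)
  all_goals try have e2' := pos k' l' (by omega) (by omega)
  all_goals try have e3' := h1'.lt
  all_goals try (exfalso; omega)
  · exact absurd ⟨⟨Equiv.equivOfIsEmpty V W, fun {a} => isEmptyElim a⟩⟩ hne
  · exact Or.inl ⟨l, m, l', m', h1, h2, h1', h2', by omega, h4, h4'⟩
  · obtain rfl : k = k' := by omega
    obtain rfl : l = l' := Nat.eq_of_mul_eq_mul_left (show 0 < k by omega) (by omega)
    exact absurd (h4.isIsoTo h4') hne
  · exact absurd (h1.isIsoTo h1') hne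
  · exact Or.inl ⟨l, m, l', m', h1, h2, h1', h2', by omega, h4, h4'⟩
  · obtain rfl : k = k' := by omega
    exact absurd (h2.isIsoTo h2') hne
  · obtain rfl : M = M' := by omega
    obtain rfl : N = N' := by omega
    exact Or.inr ⟨M, N, h1, h1'⟩

end Kind

/-! ### Comparison of the spectra -/

theorem mainTheorem4 {V V' : Type*} [Fintype V] [DecidableEq V] [Fintype V'] [DecidableEq V']
    (G : SimpleGraph V) [DecidableRel G.Adj] (G' : SimpleGraph V') [DecidableRel G'.Adj]
    (hG : IsInH' G) (hG' : IsInH' G') (hne : ¬ IsIsoTo G G') :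
    nonzeroSpectrum G = nonzeroSpectrum G' ↔
      (∃ l m l' m' : ℕ, 1 ≤ m ∧ m ≤ l ∧ 1 ≤ m' ∧ m' ≤ l' ∧ l * m = l' * m' ∧
        IsIsoTo G (graph0 l m) ∧ IsIsoTo G' (graph0 l' m')) ∨
      (∃ k : ℕ, 2 ≤ k ∧
        (IsIsoTo G (graph4 k) ∨ IsIsoTo G (graph5 k 2)) ∧
        (IsIsoTo G' (graph4 k) ∨ IsIsoTo G' (graph5 k 2))) ∨
      (∃ k : ℕ, 2 ≤ k ∧
        (IsIsoTo G (graph5 (k + 1) k) ∨ IsIsoTo G (graph6 (2 * k)) ∨ IsIsoTo G (graph8 k k)) ∧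
        (IsIsoTo G' (graph5 (k + 1) k) ∨ IsIsoTo G' (graph6 (2 * k)) ∨ IsIsoTo G' (graph8 k k))) ∨
      ((IsIsoTo G (graph6 3) ∨ IsIsoTo G graph12) ∧
        (IsIsoTo G' (graph6 3) ∨ IsIsoTo G' graph12)) ∨
      ((IsIsoTo G (graph4 4) ∨ IsIsoTo G (graph5 4 2) ∨ IsIsoTo G (graph9 1)) ∧
        (IsIsoTo G' (graph4 4) ∨ IsIsoTo G' (graph5 4 2) ∨ IsIsoTo G' (graph9 1))) ∨
      ((IsIsoTo G (graph4 3) ∨ IsIsoTo G (graph5 3 2) ∨ IsIsoTo G (graph6 4) ∨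
          IsIsoTo G (graph8 2 2) ∨ IsIsoTo G graph11) ∧
        (IsIsoTo G' (graph4 3) ∨ IsIsoTo G' (graph5 3 2) ∨ IsIsoTo G' (graph6 4) ∨
          IsIsoTo G' (graph8 2 2) ∨ IsIsoTo G' graph11)) ∨
      ((IsIsoTo G graph3 ∨ IsIsoTo G (graph4 2) ∨ IsIsoTo G (graph5 2 2)) ∧
        (IsIsoTo G' graph3 ∨ IsIsoTo G' (graph4 2) ∨ IsIsoTo G' (graph5 2 2))) := by
  obtain ⟨S, P, hk⟩ := hG.exists_kind
  obtain ⟨S', P', hk'⟩ := hG'.exists_kind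
  constructor
  · intro he
    obtain ⟨hS, hP⟩ := (hG.1.exceptional_eq_iff hG'.1 (hk.hasExc hG.1) (hk'.hasExc hG'.1)).1 he
    rcases hk.bip_or_hasEntry hk' (by exact_mod_cast hS) (by exact_mod_cast hP) hne with
      h | ⟨M, N, h, h'⟩
    · exact .inl h
    refine .inr ?_
    -- Nonisomorphic graphs with the same parameters must have shared ones. The small values of `M`
    -- give the sporadic groups; for `M ≥ 5` only the two infinite families remain.
    rcases (h.isIsoTo_or h').resolve_left hne with ⟨rfl, rfl | rfl⟩ | ⟨rfl, rfl⟩ | ⟨rfl, rfl⟩ |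
      ⟨h5, h2, rfl⟩ | ⟨h5, rfl⟩
    · exact .inr <| .inr <| .inr <| .inr <| .inr ⟨hasEntry_two_zero.2 h, hasEntry_two_zero.2 h'⟩
    · exact .inr <| .inr <| .inl ⟨hasEntry_two_one.2 h, hasEntry_two_one.2 h'⟩
    · exact .inr <| .inr <| .inr <| .inr <| .inl
        ⟨hasEntry_three_one.2 h, hasEntry_three_one.2 h'⟩
    · exact .inr <| .inr <| .inr <| .inl ⟨hasEntry_four_four.2 h, hasEntry_four_four.2 h'⟩
    · obtain ⟨k, rfl⟩ : ∃ k, M = 2 * k - 1 := ⟨(M + 1) / 2, by omega⟩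
      exact .inr <| .inl ⟨k, by omega, h.odd_one (by omega), h'.odd_one (by omega)⟩
    · exact .inl ⟨M, by omega, h.square h5, h'.square h5⟩
  · rintro (⟨l, m, l', m', h1, h2, h1', h2', he, h, h'⟩ | ⟨k, hk, h, h'⟩ | ⟨k, hk, h, h'⟩ |
      ⟨h, h'⟩ | ⟨h, h'⟩ | ⟨h, h'⟩ | ⟨h, h'⟩)
    · by_cases h4 : l * m = 4
      · exact (hG.1.exceptional_eq_iff hG'.1 (Kind.hasExc hG.1 (.four h1 h2 h4 h))
          (Kind.hasExc hG'.1 (.four h1' h2' (he ▸ h4) h'))).2 ⟨rfl, rfl⟩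
      · exact (hG.1.exceptional_eq_iff hG'.1 (Kind.hasExc hG.1 (.bip h1 h2 h4 h))
          (Kind.hasExc hG'.1 (.bip h1' h2' (he ▸ h4) h'))).2 ⟨rfl, by rw [he]⟩
    · exact nonzeroSpectrum_eq_of_hasEntry hG.1 hG'.1 (hasEntry_square_of hk h)
        (hasEntry_square_of hk h')
    · exact nonzeroSpectrum_eq_of_hasEntry hG.1 hG'.1 (hasEntry_odd_one_of hk h)
        (hasEntry_odd_one_of hk h')
    · exact nonzeroSpectrum_eq_of_hasEntry hG.1 hG'.1 (hasEntry_two_one.1 h)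
        (hasEntry_two_one.1 h')
    · exact nonzeroSpectrum_eq_of_hasEntry hG.1 hG'.1 (hasEntry_four_four.1 h)
        (hasEntry_four_four.1 h')
    · exact nonzeroSpectrum_eq_of_hasEntry hG.1 hG'.1 (hasEntry_three_one.1 h)
        (hasEntry_three_one.1 h')
    · exact nonzeroSpectrum_eq_of_hasEntry hG.1 hG'.1 (hasEntry_two_zero.1 h)
        (hasEntry_two_zero.1 h')
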